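/- Theorem (Iterated moments for semiflows). For $\eta\in(0,1]$ and a function $f$ on a metric space put $\|f\|_\eta=\sup|f|+\sup_{x\ne x'}|f(x)-f(x')|/d(x,x')^\eta$. Setting. Let $(\Lambda,d_\Lambda)$ be a bounded metric space with finite Borel measure $\rho$, let $T:\Lambda\to\Lambda$ be measurable and nonsingular, let $Y\subset\Lambda$ be measurable with $\rho(Y)>0$, $\alpha$ an at most countable measurable partition of $Y$, and $\tau:Y\to\{1,2,\dots\}$ a $\rho$-integrable function which is constant on each $a\in\alpha$. Suppose that $T$ is nonuniformly expanding: there are constants $\beta>1$, $\eta\in(0,1]$, $C_1\ge1$ such that, with $F=T^\tau$, for each $a\in\alpha$ and all $x,y\in a$: (1) $F$ restricts to a bijection (mod null sets) from $a$ onto $Y$; (2) $d_\Lambda(Fx,Fy)\ge\beta d_\Lambda(x,y)$; (3) $d_\Lambda(T^\ell x,T^\ell y)\le C_1d_\Lambda(Fx,Fy)$ for $0\le\ell<\tau(a)$; (4) $\zeta_0=d\rho|_Y/d(\rho|_Y\circ F)$ satisfies $|\log\zeta_0(x)-\log\zeta_0(y)|\le C_1d_\Lambda(Fx,Fy)^\eta$.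 Let $\mu_Y$ be the absolutely continuous $F$-invariant probability measure on $Y$, and assume that $\tau\in L^p(Y,\mu_Y)$ for some $p\ge2$; write $|\tau|_p$ for its norm. Let $\mu_\Delta=(\mu_Y\times\text{counting})/\int_Y\tau\,d\mu_Y$ on the tower $\Delta=\{(y,\ell):y\in Y,\ 0\le\ell<\tau(y)\}$ and let $\mu_\Lambda$ be the image of $\mu_\Delta$ under $(y,\ell)\mapsto T^\ell y$. Let $h:\Lambda\to(0,\infty)$ satisfy $\|h\|_\eta<\infty$ and $\inf h>0$. Let $\Omega=\{(x,u):x\in\Lambda,\ 0\le u\le h(x)\}/\!\sim$, $(x,h(x))\sim(Tx,0)$, be the suspension (each class is represented by its unique point with $0\le u<h(x)$), let $g_t(x,u)=(x,u+t)$, computed modulo identifications, be the suspension semiflow, and let $\mu=(\mu_\Lambda\times\text{Lebesgue})/\int_\Lambda h\,d\mu_\Lambda$. For measurable $v:\Omega\to\mathbb R^d$ put $$\|v\|_\eta=\sup_{\Omega}|v|+\sup_{(x,u)\ne(x',u)\in\Omega}\frac{|v(x,u)-v(x',u)|}{d_\Lambda(x,x')^\eta},$$ $$S_t=\int_0^tv\circ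 g_s\,ds,\qquad \mathbb S_t=\int_0^t\!\int_0^s(v\circ g_r)\otimes(v\circ g_s)\,dr\,ds,$$ where $a\otimes b=ab^T$, with the norm $|J|=(\sum_{i,j}J_{ij}^2)^{1/2}$ on matrices. Conclusion. There is a constant $C$, depending only and continuously on $\operatorname{diam}\Lambda$, $C_1$, $\beta$, $\eta$, $p$, $|\tau|_p$, $\|h\|_\eta$ and $\inf h$, such that for every $d$, every $v:\Omega\to\mathbb R^d$ with $\|v\|_\eta<\infty$ and $\int_\Omega v\,d\mu=0$, and every $t_1\ge0$, $$\Big|\sup_{t\in[0,t_1]}|S_t|\Big|_{L^{2(p-1)}(\Omega,\mu)}\le C\,t_1^{1/2}\|v\|_\eta,\qquad \Big|\sup_{t\in[0,t_1]}|\mathbb S_t|\Big|_{L^{p-1}(\Omega,\mu)}\le C\,t_1\|v\|_\eta^2 .$$ -/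

import Mathlib

open MeasureTheory Set
open scoped ENNReal

noncomputable section

namespace ExpandingSemiflow

/-! ### Nonuniformly expanding maps -/

section Maps

variable {Λ : Type*}

/-- The induced map `F = T^τ`, i.e. `F x = T^{τ(x)} x`. -/
def inducedMap (T : Λ → Λ) (τ : Λ → ℕ) (x : Λ) : Λ := T^[τ x] x

/-- `T : Λ → Λ` is nonuniformly expanding on the bounded metric space `Λ` with finite Borel
measure `ρ`, with inducing set `Y`, countable partition `α` of `Y`, return time `τ` (only its values
on `Y` matter) and constants `C₁ ≥ 1`, `β > 1`, `η ∈ (0,1]`. -/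
structure IsNonuniformlyExpanding [MetricSpace Λ] [MeasurableSpace Λ]
    (T : Λ → Λ) (ρ : Measure Λ) (Y : Set Λ) (α : Set (Set Λ)) (τ : Λ → ℕ)
    (C₁ β η : ℝ) : Prop where
  bounded : Bornology.IsBounded (univ : Set Λ)
  finite : IsFiniteMeasure ρ
  nonsingular : Measure.QuasiMeasurePreserving T ρ ρ
  measurableSet_Y : MeasurableSet Y
  measure_Y_pos : 0 < ρ Y
  one_le_C₁ : 1 ≤ C₁
  one_lt_β : 1 < β
  η_pos : 0 < η
  η_le_one : η ≤ 1
  -- `α` is an at most countable measurable partition of `Y`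
  countable : α.Countable
  measurableSet : ∀ a ∈ α, MeasurableSet a
  pairwiseDisjoint : α.PairwiseDisjoint id
  sUnion_eq : ⋃₀ α = Y
  -- `τ : Y → {1, 2, ...}` is integrable and constant on partition elements
  one_le_τ : ∀ x ∈ Y, 1 ≤ τ x
  τ_const : ∀ a ∈ α, ∀ x ∈ a, ∀ y ∈ a, τ x = τ y
  τ_integrable : IntegrableOn (fun x => (τ x : ℝ)) Y ρ
  -- (1) `F` is a bijection from `a` onto `Y` modulo null sets
  injOn : ∀ a ∈ α, InjOn (inducedMap T τ) a
  image_ae_eq : ∀ a ∈ α, (inducedMap T τ '' a : Set Λ) =ᵐ[ρ] Y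
  -- (2) expansion
  expansion : ∀ a ∈ α, ∀ x ∈ a, ∀ y ∈ a,
    β * dist x y ≤ dist (inducedMap T τ x) (inducedMap T τ y)
  -- (3) control of intermediate iterates
  intermediate : ∀ a ∈ α, ∀ x ∈ a, ∀ y ∈ a, ∀ l < τ x,
    dist (T^[l] x) (T^[l] y) ≤ C₁ * dist (inducedMap T τ x) (inducedMap T τ y)
  -- (4) bounded distortion. `ζ` is (a version of) the density of `ρ|_Y` with respect to the
  -- measure `ρ|_Y ∘ F`, which on a subset `B` of a partition element is `B ↦ ρ (F(B))`;
  -- that is, `d(ρ ∘ F) = ζ⁻¹ dρ` on each partition element.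
  distortion : ∃ ζ : Λ → ℝ, Measurable ζ ∧ (∀ x ∈ Y, 0 < ζ x) ∧
    (∀ a ∈ α, ∀ B ⊆ a, MeasurableSet B →
      ρ (inducedMap T τ '' B) = ∫⁻ x in B, ENNReal.ofReal (ζ x)⁻¹ ∂ρ) ∧
    ∀ a ∈ α, ∀ x ∈ a, ∀ y ∈ a,
      |Real.log (ζ x) - Real.log (ζ y)| ≤
        C₁ * dist (inducedMap T τ x) (inducedMap T τ y) ^ η

/-- `μY` is an absolutely continuous `F`-invariant probability measure on `Y`
(seen as a measure on `Λ` carried by `Y`). -/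
structure IsInducedMeasure [MeasurableSpace Λ]
    (T : Λ → Λ) (ρ : Measure Λ) (Y : Set Λ) (τ : Λ → ℕ) (μY : Measure Λ) : Prop where
  isProbabilityMeasure : IsProbabilityMeasure μY
  absolutelyContinuous : μY ≪ ρ.restrict Y
  invariant : μY.map (inducedMap T τ) = μY

/-- The Young tower `Δ = {(y, ℓ) : y ∈ Y, 0 ≤ ℓ ≤ τ(y) - 1}`. -/
def tower (Y : Set Λ) (τ : Λ → ℕ) : Set (Λ × ℕ) := {q | q.1 ∈ Y ∧ q.2 < τ q.1}

/-- The measure `μ_Δ = (μ_Y × counting) / ∫_Y τ dμ_Y` on the tower. -/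
def towerMeasure [MeasurableSpace Λ] (Y : Set Λ) (τ : Λ → ℕ) (μY : Measure Λ) :
    Measure (Λ × ℕ) :=
  (∫⁻ y in Y, (τ y : ℝ≥0∞) ∂μY)⁻¹ • (μY.prod Measure.count).restrict (tower Y τ)

/-- The projection `π_Δ (y, ℓ) = T^ℓ y`. -/
def towerProj (T : Λ → Λ) (q : Λ × ℕ) : Λ := T^[q.2] q.1

/-- The `T`-invariant probability measure `(π_Δ)_* μ_Δ` on `Λ`. -/
def baseMeasure [MeasurableSpace Λ] (T : Λ → Λ) (Y : Set Λ) (τ : Λ → ℕ) (μY : Measure Λ) :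
    Measure Λ :=
  (towerMeasure Y τ μY).map (towerProj T)

/-- The Hölder norm `‖f‖_η = |f|_∞ + |f|_η` of a function on `Λ`, with values in `[0, ∞]`. -/
def holderNorm [MetricSpace Λ] (η : ℝ) (f : Λ → ℝ) : ℝ≥0∞ :=
  (⨆ x, ‖f x‖ₑ) + ⨆ (x) (x') (_ : x ≠ x'), ‖f x - f x'‖ₑ / edist x x' ^ η

end Maps

/-! ### The suspension semiflow -/

section Suspension

variable {Λ : Type*}

/-- The suspension `Ω = {(x, u) : 0 ≤ u ≤ h(x)} / (x, h(x)) ∼ (T x, 0)`, represented by the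
fundamental domain `{(x, u) : 0 ≤ u < h(x)}`, which contains exactly one point of each class. -/
def suspension (h : Λ → ℝ) : Set (Λ × ℝ) := {q | 0 ≤ q.2 ∧ q.2 < h q.1}

/-- The lap number `N(t)(x, u) = max {n ≥ 0 : ∑_{j < n} h(T^j x) ≤ u + t}`. -/
def lapNumber (T : Λ → Λ) (h : Λ → ℝ) (t : ℝ) (q : Λ × ℝ) : ℕ :=
  sSup {n : ℕ | ∑ j ∈ Finset.range n, h (T^[j] q.1) ≤ q.2 + t}

/-- The suspension semiflow `g_t (x, u) = (x, u + t)` computed modulo identifications: the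
representative of `(x, u + t)` in the fundamental domain is
`(T^N x, u + t - ∑_{j < N} h(T^j x))` with `N` the lap number. -/
def semiflow (T : Λ → Λ) (h : Λ → ℝ) (t : ℝ) (q : Λ × ℝ) : Λ × ℝ :=
  (T^[lapNumber T h t q] q.1,
    q.2 + t - ∑ j ∈ Finset.range (lapNumber T h t q), h (T^[j] q.1))

/-- The probability measure `(μ × Lebesgue) / h̄` on the suspension, where `h̄ = ∫ h dμ`. -/
def suspensionMeasure [MeasurableSpace Λ] (μ : Measure Λ) (h : Λ → ℝ) : Measure (Λ × ℝ) :=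
  (ENNReal.ofReal (∫ x, h x ∂μ))⁻¹ • (μ.prod volume).restrict (suspension h)

/-- The norm `‖v‖_η = |v|_∞ + |v|_η` of an observable on the suspension, where
`|v|_η = sup |v(x,u) - v(x',u)| / d(x,x')^η` over distinct points `(x,u), (x',u)` of the
suspension. Only the values of `v` on the suspension matter. -/
def flowHolderNorm [MetricSpace Λ] {d : ℕ} (h : Λ → ℝ) (η : ℝ)
    (v : Λ × ℝ → EuclideanSpace ℝ (Fin d)) : ℝ≥0∞ :=
  (⨆ q ∈ suspension h, ‖v q‖ₑ) +
    ⨆ (x : Λ) (x' : Λ) (u : ℝ) (_ : (x, u) ∈ suspension h) (_ : (x', u) ∈ suspension h)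
      (_ : x ≠ x'), ‖v (x, u) - v (x', u)‖ₑ / edist x x' ^ η

/-- `S_t = ∫_0^t v ∘ g_s ds`. -/
def singleIntegral {d : ℕ} (T : Λ → Λ) (h : Λ → ℝ) (v : Λ × ℝ → EuclideanSpace ℝ (Fin d))
    (t : ℝ) (q : Λ × ℝ) : EuclideanSpace ℝ (Fin d) :=
  ∫ s in (0 : ℝ)..t, v (semiflow T h s q)

/-- `𝕊_t = ∫_0^t ∫_0^s (v ∘ g_r) ⊗ (v ∘ g_s) dr ds`, with `a ⊗ b = a bᵀ`. -/
def doubleIntegral {d : ℕ} (T : Λ → Λ) (h : Λ → ℝ) (v : Λ × ℝ → EuclideanSpace ℝ (Fin d))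
    (t : ℝ) (q : Λ × ℝ) : Matrix (Fin d) (Fin d) ℝ :=
  Matrix.of fun i j =>
    ∫ s in (0 : ℝ)..t, ∫ r in (0 : ℝ)..s, v (semiflow T h r q) i * v (semiflow T h s q) j

/-- The matrix norm `|J| = (∑_{i,j} J_{ij}²)^{1/2}`. -/
def matrixNorm {d : ℕ} (J : Matrix (Fin d) (Fin d) ℝ) : ℝ :=
  Real.sqrt (∑ i, ∑ j, J i j ^ 2)

end Suspension

/-- The range of the data `(diam Λ, C₁, β, η, p, |τ|_p, ‖h‖_η, inf h)`. -/
def dataDomain : Set (ℝ × ℝ × ℝ × ℝ × ℝ × ℝ × ℝ × ℝ) :=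
  {(D, C₁, β, η, p, M, K, c) |
    0 ≤ D ∧ 1 ≤ C₁ ∧ 1 < β ∧ 0 < η ∧ η ≤ 1 ∧ 2 ≤ p ∧ 1 ≤ M ∧ 0 < K ∧ 0 < c}

end ExpandingSemiflow

end

open ExpandingSemiflow

/-! Write q = p - 1. The integrals of v over the fibres of the suspension form a mean zero Hölder
observable on Λ. Up to time t₁ the integrals S_t and 𝕊_t follow its Birkhoff sums and iterated
Birkhoff sums over at most N ≍ t₁ steps; the errors are of lower order for S_t and O(N), or a
bounded multiple of a Birkhoff sum, for 𝕊_t. It therefore suffices to bound the maximum over n ≤ N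
of these sums by √N in L^{2q} and by N in L^q, with constants that do not see the dimension d. For
t₁ ≤ 1 sup bounds are enough.

On the tower an orbit is cut into excursions. Excursions longer than N are replaced by zero: the
probability of meeting one before time N is O(N^{-q}), and there the trivial bounds O(N) and O(N²)
already have the right norms (`MartingaleCoboundary.exists_majorants`). After truncation the
inequality min(τ,N)^{2q} ≤ N^{q-1} τ^{q+1} shows why p = q + 1 moments of τ give moments of order
2q.

For the induced map F, a coupling argument for positive log-Hölder functions gives exponential
convergence of the transfer operator with explicit constants (`FullBranchSystem.iterate_le_add`).
Summing the resulting series gives a bounded χ' such that the centred excursion sum plus χ' - χ' ∘ F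
is orthogonal to every function of F (`FullBranchSystem.exists_orthogonal_coboundary`). Lifted to
the tower map f this becomes v = m + χ ∘ f - χ + c, with m supported on the top floor and c a drift
of size O(1/N) which repairs the mean lost in the truncation. Decorrelation of τ from functions of F
controls m conditionally on f.

Since m is orthogonal to functions of f, its Birkhoff sums form a martingale in reversed time, that
is, a recursion U_{j+1} = U_j ∘ f + ξ_j with ξ_j orthogonal to functions of f. A second order
expansion of ‖a + b‖^r gives a Rosenthal type bound for such recursions, and a stationary Doob
inequality gives the maximum (`exists_majorant_of_orthogonal`). The sums ∑_{i<j} m(f^i) ⊗ v(f^j) are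
again of this kind, because the earlier index is the last to enter the recursion. Replacing v by m
in the first slot costs, after summation by parts, essentially ∑ χ ⊗ v along the orbit. This is O(N)
in L^q because χ is bounded in L^q, although the maximum of χ along N steps is only O(√N) in L^{2q}.
All these sums end at the common time N; Chen's relation turns them into sums that start at time 0.

For continuity of the constant, every hypothesis can be weakened to hold on a whole neighbourhood of
the data, so one constant is valid locally. The valid constants for given data form an upper set,
hence a convex set, and a partition of unity selects them continuously. -/

/-! ### A second order inequality for powers of the norm in an inner product space -/

section PowerInequality

/-- The tangent line inequality for `x ↦ x ^ r`. -/
theorem Real.rpow_tangent_le {r x y : ℝ} (hr : 1 ≤ r) (hx : 0 ≤ x) (hy : 0 ≤ y) :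
    y ^ r + r * y ^ (r - 1) * (x - y) ≤ x ^ r := by
  rcases hy.eq_or_lt with rfl | hy
  · rw [Real.zero_rpow (by linarith)]
    rcases hr.eq_or_lt with rfl | hr
    · simp
    · rw [Real.zero_rpow (by linarith)]; simpa using Real.rpow_nonneg hx r
  · have h := one_add_mul_self_le_rpow_one_add (s := x / y - 1)
      (by have := div_nonneg hx hy.le; linarith) hr
    rw [add_sub_cancel, Real.div_rpow hx hy.le, le_div_iff₀ (Real.rpow_pos_of_pos hy r)] at h
    refine le_trans (le_of_eq ?_) h
    rw [Real.rpow_sub hy, Real.rpow_one]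
    field_simp

/-- For s < 1 the power t^s is not Lipschitz at 0; the factor x repairs this. If x ≤ b both powers
are at most (2b)^s. If b ≤ x then y ≤ 2x, and the tangent inequality for the exponent s + 1 applies.
-/
theorem abs_rpow_sub_rpow_mul_le {s x y b : ℝ} (hs : 0 ≤ s) (hx : 0 ≤ x) (hy : 0 ≤ y)
    (hb : |x - y| ≤ b) :
    |y ^ s - x ^ s| * x ≤ (s + 1) * 2 ^ s * ((x ^ s + b ^ s) * b) := by
  have hb0 : 0 ≤ b := (abs_nonneg _).trans hb
  obtain ⟨hb1, hb2⟩ := abs_le.1 hb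
  have hxs := Real.rpow_nonneg hx s
  have hys := Real.rpow_nonneg hy s
  have hbs := Real.rpow_nonneg hb0 s
  have h2s : 1 ≤ (2 : ℝ) ^ s := Real.one_le_rpow (by norm_num) hs
  have hc : 1 ≤ (s + 1) * 2 ^ s := by nlinarith
  rcases le_total x b with hxb | hxb
  · have h1 : |y ^ s - x ^ s| ≤ 2 ^ s * b ^ s := by
      rw [← Real.mul_rpow (by norm_num) hb0, abs_le]
      have e1 : x ^ s ≤ (2 * b) ^ s := Real.rpow_le_rpow hx (by linarith) hs
      have e2 : y ^ s ≤ (2 * b) ^ s := Real.rpow_le_rpow hy (by linarith) hs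
      constructor <;> linarith
    calc |y ^ s - x ^ s| * x ≤ (2 ^ s * b ^ s) * b := by gcongr
      _ ≤ (s + 1) * 2 ^ s * (b ^ s * b) := by
        have : 0 ≤ s * (2 ^ s * (b ^ s * b)) := by positivity
        nlinarith
      _ ≤ _ := by gcongr; linarith
  · suffices h : |y ^ s - x ^ s| * x ≤ (s + 1) * 2 ^ s * (x ^ s * b) by
      refine h.trans ?_
      gcongr
      linarith
    have hpow : ∀ z : ℝ, 0 ≤ z → z ^ (s + 1) = z ^ s * z := fun z hz => by
      rw [Real.rpow_add_one' hz (by linarith)]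
    rcases le_total x y with hxy | hxy
    · have e1 : x ^ s ≤ y ^ s := Real.rpow_le_rpow hx hxy hs
      rw [abs_of_nonneg (by linarith)]
      have t := Real.rpow_tangent_le (r := s + 1) (by linarith) hx hy
      rw [hpow x hx, hpow y hy, add_sub_cancel_right] at t
      have e2 : y ^ s ≤ 2 ^ s * x ^ s := by
        rw [← Real.mul_rpow (by norm_num) hx]
        exact Real.rpow_le_rpow hy (by linarith) hs
      calc (y ^ s - x ^ s) * x ≤ (s + 1) * y ^ s * (y - x) := by nlinarith
        _ ≤ (s + 1) * (2 ^ s * x ^ s) * b := by gcongr; linarith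
        _ = _ := by ring
    · have e1 : y ^ s ≤ x ^ s := Real.rpow_le_rpow hy hxy hs
      rw [abs_of_nonpos (by linarith)]
      have t := Real.rpow_tangent_le (r := s + 1) (by linarith) hy hx
      rw [hpow x hx, hpow y hy, add_sub_cancel_right] at t
      have h3 : y ^ s * y ≤ y ^ s * x := by gcongr
      calc -(y ^ s - x ^ s) * x ≤ (s + 1) * x ^ s * (x - y) := by nlinarith
        _ ≤ (s + 1) * x ^ s * b := by gcongr
        _ ≤ (s + 1) * 2 ^ s * (x ^ s * b) := by
          have : 0 ≤ (s + 1) * (x ^ s * b) := by positivity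
          nlinarith

variable {E : Type*} [NormedAddCommGroup E] [InnerProductSpace ℝ E]

/-- The constant in `norm_add_rpow_le`. -/
noncomputable def taylorConst (r : ℝ) : ℝ := r * (2 ^ r + r * 2 ^ r)

theorem one_le_taylorConst {r : ℝ} (hr : 2 ≤ r) : 1 ≤ taylorConst r := by
  have : (1 : ℝ) ≤ 2 ^ r := Real.one_le_rpow (by norm_num) (by linarith)
  have : 1 ≤ 2 ^ r + r * 2 ^ r := by nlinarith
  unfold taylorConst
  nlinarith

theorem taylorConst_mono {r s : ℝ} (hr : 0 ≤ r) (hrs : r ≤ s) :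
    taylorConst r ≤ taylorConst s := by
  have : (2 : ℝ) ^ r ≤ 2 ^ s := Real.rpow_le_rpow_of_exponent_le (by norm_num) hrs
  have : 0 < (2 : ℝ) ^ r := by positivity
  have : 0 ≤ s := hr.trans hrs
  unfold taylorConst
  gcongr

/-- No differentiation is needed. With c = a + b and s = r - 2, the tangent inequality at ‖c‖
together with ‖c‖(‖c‖ - ‖a‖) ≤ ⟨c, b⟩ gives ‖c‖^r ≤ ‖a‖^r + r‖c‖^s⟨c, b⟩. Then ⟨c, b⟩ = ⟨a, b⟩ +
‖b‖², and exchanging ‖c‖^s for ‖a‖^s is controlled by `abs_rpow_sub_rpow_mul_le`. -/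
theorem norm_add_rpow_le {r : ℝ} (hr : 2 ≤ r) (a b : E) :
    ‖a + b‖ ^ r ≤ ‖a‖ ^ r + r * (‖a‖ ^ (r - 2) * inner ℝ a b) +
      taylorConst r * (‖a‖ ^ (r - 2) * ‖b‖ ^ 2 + ‖b‖ ^ r) := by
  set s := r - 2 with hs
  have hs0 : 0 ≤ s := by linarith
  set c := a + b with hc
  have hcs := Real.rpow_nonneg (norm_nonneg c) s
  have has := Real.rpow_nonneg (norm_nonneg a) s
  have hbs := Real.rpow_nonneg (norm_nonneg b) s
  have hpow : ∀ z : ℝ, 0 ≤ z → z ^ r = z ^ s * z ^ 2 := fun z hz => by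
    rw [show r = s + 2 by rw [hs]; ring, Real.rpow_add_of_nonneg hz hs0 (by norm_num)]
    norm_num
  have hpow1 : ∀ z : ℝ, 0 ≤ z → z ^ (r - 1) = z ^ s * z := fun z hz => by
    rw [show r - 1 = s + 1 by rw [hs]; ring, Real.rpow_add_one' hz (by linarith)]
  have t := Real.rpow_tangent_le (r := r) (by linarith) (norm_nonneg a) (norm_nonneg c)
  rw [hpow1 _ (norm_nonneg c)] at t
  have hcb : ‖c‖ * (‖c‖ - ‖a‖) ≤ inner ℝ c b := by
    have h1 : inner ℝ c b = ‖c‖ ^ 2 - inner ℝ c a := by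
      rw [← real_inner_self_eq_norm_sq, ← inner_sub_right, hc, add_sub_cancel_left]
    have h2 := real_inner_le_norm c a
    rw [h1]; nlinarith
  have h3 : ‖c‖ ^ r ≤ ‖a‖ ^ r + r * (‖c‖ ^ s * inner ℝ c b) := by
    have : r * (‖c‖ ^ s * (‖c‖ * (‖c‖ - ‖a‖))) ≤ r * (‖c‖ ^ s * inner ℝ c b) := by gcongr
    linarith
  have hcbs : inner ℝ c b = inner ℝ a b + ‖b‖ ^ 2 := by
    rw [hc, inner_add_left, real_inner_self_eq_norm_sq]
  have hdiff : |‖a‖ - ‖c‖| ≤ ‖b‖ := by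
    have := abs_norm_sub_norm_le a c
    rwa [hc, sub_add_cancel_left, norm_neg] at this
  have h4 := abs_rpow_sub_rpow_mul_le hs0 (norm_nonneg a) (norm_nonneg c) hdiff
  have h5 : (‖c‖ ^ s - ‖a‖ ^ s) * inner ℝ a b ≤ |‖c‖ ^ s - ‖a‖ ^ s| * ‖a‖ * ‖b‖ := by
    rw [mul_assoc]
    refine (le_abs_self _).trans ?_
    rw [abs_mul]
    gcongr
    exact abs_real_inner_le_norm a b
  have h2s : 1 ≤ (2 : ℝ) ^ s := Real.one_le_rpow (by norm_num) hs0
  have h2r : (2 : ℝ) ^ s ≤ 2 ^ r := Real.rpow_le_rpow_of_exponent_le (by norm_num) (by linarith)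
  have h6 : ‖c‖ ^ s ≤ 2 ^ s * (‖a‖ ^ s + ‖b‖ ^ s) := by
    have hcn : ‖c‖ ≤ 2 * max ‖a‖ ‖b‖ := by
      have := norm_add_le a b
      have := le_max_left ‖a‖ ‖b‖
      have := le_max_right ‖a‖ ‖b‖
      linarith
    calc ‖c‖ ^ s ≤ (2 * max ‖a‖ ‖b‖) ^ s := Real.rpow_le_rpow (norm_nonneg c) hcn hs0
      _ = 2 ^ s * (max ‖a‖ ‖b‖) ^ s :=
        Real.mul_rpow (by norm_num) ((norm_nonneg a).trans (le_max_left _ _))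
      _ ≤ _ := by
        gcongr
        rcases max_cases ‖a‖ ‖b‖ with ⟨h, _⟩ | ⟨h, _⟩ <;> rw [h] <;> linarith
  have h7 : ‖c‖ ^ s * inner ℝ c b ≤ ‖a‖ ^ s * inner ℝ a b +
      (2 ^ r + r * 2 ^ r) * ((‖a‖ ^ s + ‖b‖ ^ s) * ‖b‖ ^ 2) := by
    have e1 : ‖c‖ ^ s * inner ℝ c b = ‖a‖ ^ s * inner ℝ a b +
        (‖c‖ ^ s - ‖a‖ ^ s) * inner ℝ a b + ‖c‖ ^ s * ‖b‖ ^ 2 := by rw [hcbs]; ring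
    have e2 : ‖c‖ ^ s * ‖b‖ ^ 2 ≤ 2 ^ r * ((‖a‖ ^ s + ‖b‖ ^ s) * ‖b‖ ^ 2) := by
      rw [← mul_assoc]
      gcongr
      exact h6.trans (by gcongr)
    have e3 : |‖c‖ ^ s - ‖a‖ ^ s| * ‖a‖ * ‖b‖ ≤
        r * 2 ^ r * ((‖a‖ ^ s + ‖b‖ ^ s) * ‖b‖ ^ 2) := by
      calc |‖c‖ ^ s - ‖a‖ ^ s| * ‖a‖ * ‖b‖
          ≤ (s + 1) * 2 ^ s * ((‖a‖ ^ s + ‖b‖ ^ s) * ‖b‖) * ‖b‖ := by gcongr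
        _ = (s + 1) * 2 ^ s * ((‖a‖ ^ s + ‖b‖ ^ s) * ‖b‖ ^ 2) := by ring
        _ ≤ _ := by
          gcongr
          linarith
    rw [e1, add_mul]
    linarith
  have hbr := hpow _ (norm_nonneg b)
  have h8 := mul_le_mul_of_nonneg_left h7 (show 0 ≤ r by linarith)
  unfold taylorConst
  rw [hbr]
  linarith

end PowerInequality

set_option linter.unusedSectionVars false

/-! ### Bounded measurable functions -/

section BoundedMeasurable

variable {X : Type*} [MeasurableSpace X]

/-- Bounded measurable functions. -/
def BddMeas {F : Type*} [NormedAddCommGroup F] [MeasurableSpace F] (f : X → F) : Prop :=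
  Measurable f ∧ ∃ C, ∀ x, ‖f x‖ ≤ C

namespace BddMeas

variable {F : Type*} [NormedAddCommGroup F] [MeasurableSpace F] [BorelSpace F]
  [SecondCountableTopology F]

theorem integrable {f : X → F} (hf : BddMeas f) (μ : Measure X) [IsFiniteMeasure μ] :
    Integrable f μ :=
  let ⟨h1, C, hC⟩ := hf
  Integrable.of_bound h1.aestronglyMeasurable C (Filter.Eventually.of_forall hC)

theorem const (c : F) : BddMeas (fun _ : X => c) := ⟨measurable_const, ‖c‖, fun _ => le_rfl⟩

theorem comp {X' : Type*} [MeasurableSpace X'] {f : X → F} (hf : BddMeas f) {g : X' → X}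
    (hg : Measurable g) : BddMeas (fun x => f (g x)) :=
  let ⟨h1, C, hC⟩ := hf
  ⟨h1.comp hg, C, fun _ => hC _⟩

theorem add {f g : X → F} (hf : BddMeas f) (hg : BddMeas g) : BddMeas (fun x => f x + g x) :=
  let ⟨h1, C, hC⟩ := hf
  let ⟨h2, D, hD⟩ := hg
  ⟨h1.add h2, C + D, fun x => (norm_add_le _ _).trans (add_le_add (hC x) (hD x))⟩

theorem sub {f g : X → F} (hf : BddMeas f) (hg : BddMeas g) : BddMeas (fun x => f x - g x) :=
  let ⟨h1, C, hC⟩ := hf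
  let ⟨h2, D, hD⟩ := hg
  ⟨h1.sub h2, C + D, fun x => (norm_sub_le _ _).trans (add_le_add (hC x) (hD x))⟩

theorem norm {f : X → F} (hf : BddMeas f) : BddMeas (fun x => ‖f x‖) :=
  let ⟨h1, C, hC⟩ := hf
  ⟨h1.norm, C, fun x => by rw [norm_norm]; exact hC x⟩

theorem smul [NormedSpace ℝ F] {a : X → ℝ} {f : X → F} (ha : BddMeas a) (hf : BddMeas f) :
    BddMeas (fun x => a x • f x) :=
  let ⟨h1, C, hC⟩ := ha
  let ⟨h2, D, hD⟩ := hf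
  ⟨h1.smul h2, C * D, fun x => by
    rw [norm_smul]
    exact mul_le_mul (hC x) (hD x) (norm_nonneg _) ((norm_nonneg _).trans (hC x))⟩

theorem mul {f g : X → ℝ} (hf : BddMeas f) (hg : BddMeas g) : BddMeas (fun x => f x * g x) :=
  hf.smul hg

theorem inner [InnerProductSpace ℝ F] {f g : X → F} (hf : BddMeas f) (hg : BddMeas g) :
    BddMeas (fun x => inner ℝ (f x) (g x)) :=
  let ⟨h1, C, hC⟩ := hf
  let ⟨h2, D, hD⟩ := hg
  ⟨h1.inner h2, C * D, fun x => (norm_inner_le_norm _ _).trans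
    (mul_le_mul (hC x) (hD x) (norm_nonneg _) ((norm_nonneg _).trans (hC x)))⟩

theorem rpow {f : X → ℝ} (hf : BddMeas f) (h0 : ∀ x, 0 ≤ f x) {r : ℝ} (hr : 0 ≤ r) :
    BddMeas (fun x => f x ^ r) :=
  let ⟨h1, C, hC⟩ := hf
  ⟨h1.pow_const r, C ^ r, fun x => by
    rw [Real.norm_of_nonneg (Real.rpow_nonneg (h0 x) r)]
    exact Real.rpow_le_rpow (h0 x) ((Real.le_norm_self _).trans (hC x)) hr⟩

theorem pow {f : X → ℝ} (hf : BddMeas f) (n : ℕ) : BddMeas (fun x => f x ^ n) :=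
  let ⟨h1, C, hC⟩ := hf
  ⟨h1.pow_const n, C ^ n, fun x => by
    rw [norm_pow]; exact pow_le_pow_left₀ (norm_nonneg _) (hC x) n⟩

theorem max {f g : X → ℝ} (hf : BddMeas f) (hg : BddMeas g) :
    BddMeas (fun x => Max.max (f x) (g x)) :=
  let ⟨h1, C, hC⟩ := hf
  let ⟨h2, D, hD⟩ := hg
  ⟨h1.max h2, C + D, fun x => by
    have := (norm_nonneg _).trans (hC x)
    have := (norm_nonneg _).trans (hD x)
    have := hC x
    have := hD x
    change ‖Max.max (f x) (g x)‖ ≤ C + D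
    rcases max_choice (f x) (g x) with h | h <;> rw [h] <;> linarith⟩

theorem sum {ι : Type*} (s : Finset ι) {f : ι → X → F} (hf : ∀ i ∈ s, BddMeas (f i)) :
    BddMeas (fun x => ∑ i ∈ s, f i x) := by
  classical
  induction s using Finset.induction_on with
  | empty => simpa using const (X := X) (0 : F)
  | insert a s ha ih =>
    simp_rw [Finset.sum_insert ha]
    exact (hf a (by simp)).add (ih fun i hi => hf i (by simp [hi]))

theorem bilin {E G : Type*} [NormedAddCommGroup E] [NormedSpace ℝ E] [MeasurableSpace E]
    [BorelSpace E] [SecondCountableTopology E] [NormedSpace ℝ F] [NormedAddCommGroup G]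
    [NormedSpace ℝ G] [MeasurableSpace G] [BorelSpace G] (T : E →L[ℝ] F →L[ℝ] G)
    {f : X → E} {g : X → F} (hf : BddMeas f) (hg : BddMeas g) :
    BddMeas (fun x => T (f x) (g x)) :=
  let ⟨h1, C, hC⟩ := hf
  let ⟨h2, D, hD⟩ := hg
  ⟨(T.continuous₂.measurable).comp (h1.prodMk h2), ‖T‖ * C * D, fun x => by
    have := (norm_nonneg _).trans (hC x)
    refine (T.le_opNorm₂ _ _).trans ?_
    gcongr
    · exact hC x
    · exact hD x⟩

end BddMeas

end BoundedMeasurable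

/-! ### Moments of stationary sums of orthogonal increments -/

section Stationary

theorem rpow_mul_rpow_le_weighted {r s x y : ℝ} (hr : 0 < r) (hs : 0 ≤ s) (hsr : s ≤ r)
    (hx : 0 ≤ x) (hy : 0 ≤ y) :
    x ^ (r - s) * y ^ s ≤ (1 - s / r) * x ^ r + s / r * y ^ r := by
  have h := Real.geom_mean_le_arith_mean2_weighted (w₁ := 1 - s / r) (w₂ := s / r)
    (p₁ := x ^ r) (p₂ := y ^ r) (by rw [sub_nonneg, div_le_one hr]; exact hsr)
    (by positivity) (by positivity) (by positivity) (by ring)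
  rwa [← Real.rpow_mul hx, ← Real.rpow_mul hy, mul_sub, mul_one, mul_div_cancel₀ _ hr.ne'] at h

variable {X : Type*} [MeasurableSpace X] {μ : Measure X} [IsProbabilityMeasure μ]

/-- Hölder's inequality, obtained by integrating the weighted arithmetic-geometric mean inequality
for a / A and b / B. -/
theorem integral_rpow_mul_rpow_le {a b : X → ℝ} (ha : BddMeas a) (hb : BddMeas b)
    (ha0 : ∀ x, 0 ≤ a x) (hb0 : ∀ x, 0 ≤ b x) {r s A B : ℝ} (hr : 0 < r) (hs : 0 ≤ s)
    (hsr : s ≤ r) (hA : 0 < A) (hB : 0 < B) (haA : ∫ x, a x ^ r ∂μ ≤ A ^ r)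
    (hbB : ∫ x, b x ^ r ∂μ ≤ B ^ r) :
    ∫ x, a x ^ (r - s) * b x ^ s ∂μ ≤ A ^ (r - s) * B ^ s := by
  have hpt : ∀ x, a x ^ (r - s) * b x ^ s ≤ A ^ (r - s) * B ^ s *
      ((1 - s / r) * (A ^ r)⁻¹ * a x ^ r + s / r * (B ^ r)⁻¹ * b x ^ r) := by
    intro x
    have h := rpow_mul_rpow_le_weighted hr hs hsr (div_nonneg (ha0 x) hA.le)
      (div_nonneg (hb0 x) hB.le)
    rw [Real.div_rpow (ha0 x) hA.le, Real.div_rpow (hb0 x) hB.le, Real.div_rpow (ha0 x) hA.le,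
      Real.div_rpow (hb0 x) hB.le] at h
    have h1 : 0 < A ^ (r - s) := by positivity
    have h2 : 0 < B ^ s := by positivity
    calc a x ^ (r - s) * b x ^ s
        = A ^ (r - s) * B ^ s * (a x ^ (r - s) / A ^ (r - s) * (b x ^ s / B ^ s)) := by
          field_simp
      _ ≤ A ^ (r - s) * B ^ s * _ := mul_le_mul_of_nonneg_left h (by positivity)
      _ = _ := by ring
  have ia := (ha.rpow ha0 hr.le).integrable μ
  have ib := (hb.rpow hb0 hr.le).integrable μ
  have hsr' : 0 ≤ 1 - s / r := by rw [sub_nonneg, div_le_one hr]; exact hsr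
  calc ∫ x, a x ^ (r - s) * b x ^ s ∂μ
      ≤ ∫ x, A ^ (r - s) * B ^ s *
        ((1 - s / r) * (A ^ r)⁻¹ * a x ^ r + s / r * (B ^ r)⁻¹ * b x ^ r) ∂μ := by
        refine integral_mono (((ha.rpow ha0 (by linarith)).mul (hb.rpow hb0 hs)).integrable μ) ?_
          hpt
        exact ((ia.const_mul _).add (ib.const_mul _)).const_mul _
    _ = A ^ (r - s) * B ^ s * ((1 - s / r) * (A ^ r)⁻¹ * (∫ x, a x ^ r ∂μ) +
        s / r * (B ^ r)⁻¹ * ∫ x, b x ^ r ∂μ) := by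
        rw [integral_const_mul, integral_add (ia.const_mul _) (ib.const_mul _),
          integral_const_mul, integral_const_mul]
    _ ≤ A ^ (r - s) * B ^ s * ((1 - s / r) * (A ^ r)⁻¹ * A ^ r + s / r * (B ^ r)⁻¹ * B ^ r) := by
        gcongr
    _ = A ^ (r - s) * B ^ s := by
        have h1 : A ^ r ≠ 0 := by positivity
        have h2 : B ^ r ≠ 0 := by positivity
        field_simp
        ring

variable {E : Type*} [NormedAddCommGroup E] [InnerProductSpace ℝ E] [MeasurableSpace E]
  [BorelSpace E] [SecondCountableTopology E] {f : X → X}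

/-- The constant in the moment inequality for stationary sums of orthogonal increments. -/
noncomputable def rosenthalConst (r : ℝ) : ℝ := Real.sqrt (2 * taylorConst r)

theorem bddMeas_of_recursion (hf : Measurable f) {U ξ : ℕ → X → E} (hU0 : ∀ x, U 0 x = 0)
    (hU : ∀ j x, U (j + 1) x = U j (f x) + ξ j x) (hξ : ∀ j, BddMeas (ξ j)) (j : ℕ) :
    BddMeas (U j) := by
  induction j with
  | zero => rw [show U 0 = fun _ => 0 from funext hU0]; exact BddMeas.const _
  | succ j ih =>
    rw [show U (j + 1) = fun x => U j (f x) + ξ j x from funext (hU j)]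
    exact (ih.comp hf).add (hξ j)

/-- A Rosenthal type inequality in reversed time. In the expansion of ‖U_j ∘ f + ξ_j‖^r the linear
term integrates to zero by orthogonality, the quadratic term is handled by the conditional variance
bound ρ_j and Hölder, and the last term by the r-th moment of ξ_j. Invariance of μ removes the
composition with f. -/
theorem integral_norm_rpow_le_of_orthogonal (hf : MeasurePreserving f μ μ) {r b : ℝ} {n : ℕ}
    (hr : 2 ≤ r) (hb : 0 < b) {U ξ : ℕ → X → E} {ρ : ℕ → X → ℝ} (hU0 : ∀ x, U 0 x = 0)
    (hU : ∀ j x, U (j + 1) x = U j (f x) + ξ j x) (hξ : ∀ j, BddMeas (ξ j))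
    (hρ : ∀ j, BddMeas (ρ j)) (hρ0 : ∀ j x, 0 ≤ ρ j x)
    (horth : ∀ j, ∀ Φ : X → E, BddMeas Φ → ∫ x, inner ℝ (Φ (f x)) (ξ j x) ∂μ = 0)
    (hvar : ∀ j, ∀ g : X → ℝ, BddMeas g → (∀ x, 0 ≤ g x) →
      ∫ x, g (f x) * ‖ξ j x‖ ^ 2 ∂μ ≤ ∫ x, g x * ρ j x ^ 2 ∂μ)
    (hρb : ∀ j < n, ∫ x, ρ j x ^ r ∂μ ≤ b ^ r)
    (hξb : ∀ j < n, ∫ x, ‖ξ j x‖ ^ r ∂μ ≤ b ^ r * (n : ℝ) ^ (r / 2 - 1)) :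
    ∀ j ≤ n, ∫ x, ‖U j x‖ ^ r ∂μ ≤ (b * rosenthalConst r * Real.sqrt n) ^ r := by
  have hC1 := one_le_taylorConst hr
  rcases Nat.eq_zero_or_pos n with rfl | hn
  · intro j hj
    obtain rfl : j = 0 := by omega
    simp only [hU0, norm_zero, Real.zero_rpow (show r ≠ 0 by linarith), integral_zero]
    exact Real.rpow_nonneg (by unfold rosenthalConst; positivity) r
  have hn' : (0 : ℝ) < n := by exact_mod_cast hn
  have hUb := bddMeas_of_recursion hf.measurable hU0 hU hξ
  -- Here α² = 2 · `taylorConst r` · b² · n, so each of the two error terms of one step is at most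
  -- α^r / (2n); this gives the linear growth j/n · α^r in the induction.
  set α := b * rosenthalConst r * Real.sqrt n with hα
  have hα0 : 0 < α := by unfold rosenthalConst at hα; rw [hα]; positivity
  have hα2 : α ^ 2 = b ^ 2 * (2 * taylorConst r) * n := by
    rw [hα, mul_pow, mul_pow, Real.sq_sqrt hn'.le, rosenthalConst, Real.sq_sqrt (by positivity)]
  have hαr : 0 < α ^ r := by positivity
  have e1 : taylorConst r * (α ^ (r - 2) * b ^ 2) = α ^ r / (2 * n) := by
    rw [Real.rpow_sub hα0, Real.rpow_two, hα2]
    field_simp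
  have e2 : taylorConst r * (b ^ r * (n : ℝ) ^ (r / 2 - 1)) ≤ α ^ r / (2 * n) := by
    have h1 : α ^ r = b ^ r * (2 * taylorConst r) ^ (r / 2) * (n : ℝ) ^ (r / 2) := by
      have : α ^ r = (α ^ 2) ^ (r / 2) := by
        rw [← Real.rpow_natCast_mul hα0.le]; congr 1; push_cast; ring
      rw [this, hα2, Real.mul_rpow (by positivity) hn'.le, Real.mul_rpow (by positivity)
        (by positivity), ← Real.rpow_natCast_mul hb.le]
      congr 3; push_cast; ring
    have h2 : 2 * taylorConst r ≤ (2 * taylorConst r) ^ (r / 2) :=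
      Real.self_le_rpow_of_one_le (by linarith) (by linarith)
    rw [h1, Real.rpow_sub hn', Real.rpow_one, le_div_iff₀ (by positivity)]
    have h3 : 0 < b ^ r * (n : ℝ) ^ (r / 2) := by positivity
    calc taylorConst r * (b ^ r * ((n : ℝ) ^ (r / 2) / n)) * (2 * n)
        = (b ^ r * (n : ℝ) ^ (r / 2)) * (2 * taylorConst r) := by field_simp
      _ ≤ (b ^ r * (n : ℝ) ^ (r / 2)) * (2 * taylorConst r) ^ (r / 2) := by gcongr
      _ = _ := by ring
  suffices h : ∀ j ≤ n, ∫ x, ‖U j x‖ ^ r ∂μ ≤ j / n * α ^ r by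
    intro j hj
    refine (h j hj).trans ?_
    have : (j : ℝ) / n ≤ 1 := by rw [div_le_one hn']; exact_mod_cast hj
    nlinarith
  intro j
  induction j with
  | zero =>
    intro _
    simp [hU0, Real.zero_rpow (show r ≠ 0 by linarith)]
  | succ j ih =>
    intro hj
    have ihj := ih (by omega)
    have hle : ∫ x, ‖U j x‖ ^ r ∂μ ≤ α ^ r := by
      refine ihj.trans ?_
      have : (j : ℝ) / n ≤ 1 := by rw [div_le_one hn']; exact_mod_cast (by omega)
      nlinarith
    have hr2 : 0 ≤ r - 2 := by linarith
    have hUr := ((hUb j).norm.rpow (fun x => norm_nonneg _) (show 0 ≤ r by linarith))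
    have hUr2 := ((hUb j).norm.rpow (fun x => norm_nonneg _) hr2)
    have hξr := ((hξ j).norm.rpow (fun x => norm_nonneg _) (show 0 ≤ r by linarith))
    have hin := (hUr2.comp hf.measurable).mul (((hUb j).comp hf.measurable).inner (hξ j))
    have hsq := (hUr2.comp hf.measurable).mul ((hξ j).norm.pow 2)
    have hUrf := hUr.comp hf.measurable
    have hin0 : ∫ x, ‖U j (f x)‖ ^ (r - 2) * inner ℝ (U j (f x)) (ξ j x) ∂μ = 0 := by
      rw [← horth j _ (hUr2.smul (hUb j))]
      simp_rw [real_inner_smul_left]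
    have hsq0 : ∫ x, ‖U j (f x)‖ ^ (r - 2) * ‖ξ j x‖ ^ 2 ∂μ ≤ α ^ (r - 2) * b ^ 2 := by
      refine (hvar j _ hUr2 fun x => by positivity).trans ?_
      have := integral_rpow_mul_rpow_le (μ := μ) (hUb j).norm (hρ j) (fun x => norm_nonneg _)
        (hρ0 j) (s := 2) (by linarith) (by norm_num) hr hα0 hb hle (hρb j (by omega))
      simpa using this
    have hst : ∫ x, ‖U j (f x)‖ ^ r ∂μ = ∫ x, ‖U j x‖ ^ r ∂μ := by
      conv_rhs => rw [← hf.map_eq]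
      rw [integral_map hf.measurable.aemeasurable]
      exact hUr.1.aestronglyMeasurable
    calc ∫ x, ‖U (j + 1) x‖ ^ r ∂μ
        ≤ ∫ x, (‖U j (f x)‖ ^ r + r * (‖U j (f x)‖ ^ (r - 2) * inner ℝ (U j (f x)) (ξ j x))) +
          taylorConst r * (‖U j (f x)‖ ^ (r - 2) * ‖ξ j x‖ ^ 2 + ‖ξ j x‖ ^ r) ∂μ := by
          refine integral_mono (((hUb (j + 1)).norm.rpow (fun x => norm_nonneg _)
            (show 0 ≤ r by linarith)).integrable μ) ?_ fun x => ?_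
          · exact ((hUrf.integrable μ).add ((hin.integrable μ).const_mul _)).add
              (((hsq.integrable μ).add (hξr.integrable μ)).const_mul _)
          · simp only [hU j x]
            exact norm_add_rpow_le hr _ _
      _ = ∫ x, ‖U j x‖ ^ r ∂μ + taylorConst r *
          (∫ x, ‖U j (f x)‖ ^ (r - 2) * ‖ξ j x‖ ^ 2 ∂μ + ∫ x, ‖ξ j x‖ ^ r ∂μ) := by
          rw [integral_add ((hUrf.add ((BddMeas.const r).mul hin)).integrable μ)
            (((BddMeas.const (taylorConst r)).mul (hsq.add hξr)).integrable μ),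
            integral_add (hUrf.integrable μ) (((BddMeas.const r).mul hin).integrable μ),
            integral_const_mul, integral_const_mul, integral_add (hsq.integrable μ)
            (hξr.integrable μ), hin0, hst]
          ring
      _ ≤ j / n * α ^ r + taylorConst r * (α ^ (r - 2) * b ^ 2 +
          b ^ r * (n : ℝ) ^ (r / 2 - 1)) := by
          have := hξb j (by omega)
          gcongr
      _ ≤ j / n * α ^ r + (α ^ r / (2 * n) + α ^ r / (2 * n)) := by
          rw [mul_add]
          linarith
      _ = _ := by
          push_cast
          field_simp
          ring

/-- A stationary form of Doob's maximal inequality. -/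
theorem integral_max_rpow_le_of_orthogonal (hf : MeasurePreserving f μ μ) {r : ℝ} (hr : 2 ≤ r)
    {U ξ : ℕ → X → E} {D : ℕ → X → ℝ} (hU0 : ∀ x, U 0 x = 0)
    (hU : ∀ j x, U (j + 1) x = U j (f x) + ξ j x) (hξ : ∀ j, BddMeas (ξ j))
    (hD0 : ∀ x, D 0 x = 0) (hD : ∀ j x, D (j + 1) x = max (D j (f x)) ‖U (j + 1) x‖)
    (horth : ∀ j, ∀ Φ : X → E, BddMeas Φ → ∫ x, inner ℝ (Φ (f x)) (ξ j x) ∂μ = 0) (n : ℕ) :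
    BddMeas (D n) ∧ (∀ x, 0 ≤ D n x) ∧ ∫ x, D n x ^ r ∂μ ≤ 4 ^ r * ∫ x, ‖U n x‖ ^ r ∂μ := by
  have hUb := bddMeas_of_recursion hf.measurable hU0 hU hξ
  have hDb : ∀ j, BddMeas (D j) := by
    intro j
    induction j with
    | zero => rw [show D 0 = fun _ => 0 from funext hD0]; exact BddMeas.const _
    | succ j ih =>
      rw [show D (j + 1) = fun x => max (D j (f x)) ‖U (j + 1) x‖ from funext (hD j)]
      exact (ih.comp hf.measurable).max (hUb (j + 1)).norm
  have hDn : ∀ j x, 0 ≤ D j x := by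
    intro j x
    cases j with
    | zero => rw [hD0]
    | succ j => rw [hD]; exact (norm_nonneg _).trans (le_max_right _ _)
  refine ⟨hDb n, hDn n, ?_⟩
  have hr1 : 0 ≤ r - 1 := by linarith
  have hr0 : 0 ≤ r := by linarith
  have hDr1 := fun j => (hDb j).rpow (hDn j) hr1
  have hDr := fun j => (hDb j).rpow (hDn j) hr0
  have hst : ∀ g : X → ℝ, BddMeas g → ∫ x, g (f x) ∂μ = ∫ x, g x ∂μ := fun g hg => by
    conv_rhs => rw [← hf.map_eq]
    rw [integral_map hf.measurable.aemeasurable hg.1.aestronglyMeasurable]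
  -- Going from j to j + 1, D^{r-1}‖U‖ does not decrease in mean when D is frozen, because ‖U + ξ‖ ≥
  -- ‖U‖ + ⟨U/‖U‖, ξ⟩ and the inner product integrates to zero. D grows only where it equals the new
  -- ‖U‖, and there the gain (d'^{r-1} - d^{r-1}) d' dominates (1 - 1/r)(d'^r - d^r).
  have key : ∀ j, (1 - 1 / r) * ∫ x, D j x ^ r ∂μ ≤ ∫ x, D j x ^ (r - 1) * ‖U j x‖ ∂μ := by
    intro j
    induction j with
    | zero => simp [hD0, hU0, Real.zero_rpow (show r ≠ 0 by linarith)]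
    | succ j ih =>
      have hΦ : BddMeas (fun x => D j x ^ (r - 1) • ‖U j x‖⁻¹ • U j x) := by
        refine (hDr1 j).smul ⟨(hUb j).1.norm.inv.smul (hUb j).1, 1, fun x => ?_⟩
        rw [norm_smul, norm_inv, norm_norm]
        exact inv_mul_le_one
      have h0 := horth j _ hΦ
      have hDU := (hDr1 j).mul (hUb j).norm
      have hpt : ∀ x, (D j (f x) ^ (r - 1) * ‖U j (f x)‖ +
          inner ℝ (D j (f x) ^ (r - 1) • ‖U j (f x)‖⁻¹ • U j (f x)) (ξ j x)) +
          ((1 - 1 / r) * D (j + 1) x ^ r - (1 - 1 / r) * D j (f x) ^ r) ≤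
          D (j + 1) x ^ (r - 1) * ‖U (j + 1) x‖ := by
        intro x
        set d := D j (f x)
        set d' := D (j + 1) x with hd'
        have hd0 : 0 ≤ d := hDn _ _
        have hd'0 : 0 ≤ d' := hDn _ _
        have hdr1 : 0 ≤ d ^ (r - 1) := Real.rpow_nonneg hd0 _
        have hpow : ∀ z : ℝ, 0 ≤ z → z ^ r = z ^ (r - 1) * z := fun z hz => by
          rw [← Real.rpow_add_one' hz (by linarith), sub_add_cancel]
        have t := Real.rpow_tangent_le (r := r) (by linarith) hd'0 hd0
        have h1 : d' ^ (r - 1) * ‖U (j + 1) x‖ = d ^ (r - 1) * ‖U (j + 1) x‖ +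
            (d' ^ (r - 1) - d ^ (r - 1)) * d' := by
          rcases max_choice d ‖U (j + 1) x‖ with h | h
          · rw [show d' = d by rw [hd', hD, h]]; ring
          · rw [show d' = ‖U (j + 1) x‖ by rw [hd', hD, h]]; ring
        have h2 : ‖U j (f x)‖ + inner ℝ (‖U j (f x)‖⁻¹ • U j (f x)) (ξ j x) ≤ ‖U (j + 1) x‖ := by
          rw [hU]
          set u := U j (f x)
          by_cases hu : u = 0
          · simp [hu]
          · have hun : 0 < ‖u‖ := norm_pos_iff.2 hu
            have h3 := real_inner_le_norm (‖u‖⁻¹ • u) (u + ξ j x)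
            rw [norm_smul, norm_inv, norm_norm, inv_mul_cancel₀ hun.ne', one_mul,
              inner_add_right, real_inner_smul_left u u, real_inner_self_eq_norm_sq] at h3
            calc ‖u‖ + inner ℝ (‖u‖⁻¹ • u) (ξ j x)
                = ‖u‖⁻¹ * ‖u‖ ^ 2 + inner ℝ (‖u‖⁻¹ • u) (ξ j x) := by field_simp
              _ ≤ _ := h3
        have h4 : (1 - 1 / r) * d' ^ r - (1 - 1 / r) * d ^ r ≤
            (d' ^ (r - 1) - d ^ (r - 1)) * d' := by
          have e : d ^ (r - 1) * (d' - d) ≤ (1 / r) * (d' ^ r - d ^ r) := by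
            rw [one_div, ← div_eq_inv_mul, le_div_iff₀ (by linarith)]
            linarith
          have e1 := hpow d hd0
          have e2 := hpow d' hd'0
          linarith
        have h5 := mul_le_mul_of_nonneg_left h2 hdr1
        rw [real_inner_smul_left, h1]
        linarith
      have hint := integral_mono (μ := μ) (((((hDU.comp hf.measurable)).add
        ((hΦ.comp hf.measurable).inner (hξ j))).add
        (((BddMeas.const (1 - 1 / r)).mul (hDr (j + 1))).sub
          ((BddMeas.const (1 - 1 / r)).mul ((hDr j).comp hf.measurable)))).integrable μ)
        (((hDr1 (j + 1)).mul (hUb (j + 1)).norm).integrable μ) hpt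
      rw [integral_add, integral_add, integral_sub, integral_const_mul, integral_const_mul,
        h0, hst _ hDU, hst _ (hDr j)] at hint
      · linarith
      · exact ((BddMeas.const (1 - 1 / r)).mul (hDr (j + 1))).integrable μ
      · exact ((BddMeas.const (1 - 1 / r)).mul ((hDr j).comp hf.measurable)).integrable μ
      · exact (hDU.comp hf.measurable).integrable μ
      · exact ((hΦ.comp hf.measurable).inner (hξ j)).integrable μ
      · exact ((hDU.comp hf.measurable).add ((hΦ.comp hf.measurable).inner (hξ j))).integrable μ
      · exact (((BddMeas.const (1 - 1 / r)).mul (hDr (j + 1))).sub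
          ((BddMeas.const (1 - 1 / r)).mul ((hDr j).comp hf.measurable))).integrable μ
  have hU4 : BddMeas (fun x => ‖U n x‖ ^ r) := (hUb n).norm.rpow (fun x => norm_nonneg _) hr0
  have hY : ∀ x, D n x ^ (r - 1) * ‖U n x‖ ≤
      (1 / 4) * (D n x ^ r) + (1 / 4) * (4 ^ r * ‖U n x‖ ^ r) := by
    intro x
    -- Young's inequality is applied to 4‖U‖ so that only a quarter of the integral of D^r appears
    -- on the right; it is absorbed because 1 - 1/r ≥ 1/2.
    have h := rpow_mul_rpow_le_weighted (r := r) (s := 1) (x := D n x) (y := 4 * ‖U n x‖)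
      (by linarith) (by norm_num) (by linarith) (hDn n x) (by positivity)
    rw [Real.rpow_one, Real.mul_rpow (by norm_num) (norm_nonneg _)] at h
    have h1 : 0 ≤ D n x ^ r := Real.rpow_nonneg (hDn n x) r
    have h2 : 0 ≤ 4 ^ r * ‖U n x‖ ^ r := by positivity
    have h3 : 1 / r ≤ 1 := by rw [div_le_one (by linarith)]; linarith
    have h4 : 0 ≤ 1 / r := by positivity
    nlinarith
  have h1 := integral_mono (μ := μ) (((hDr1 n).mul (hUb n).norm).integrable μ)
    ((((BddMeas.const (1 / 4)).mul (hDr n)).add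
      ((BddMeas.const (1 / 4)).mul ((BddMeas.const (4 ^ r)).mul hU4))).integrable μ) hY
  rw [integral_add, integral_const_mul, integral_const_mul, integral_const_mul] at h1
  · have h2 := key n
    have h3 : (1 / 2 : ℝ) ≤ 1 - 1 / r := by
      have : 1 / r ≤ 1 / 2 := one_div_le_one_div_of_le (by norm_num) hr
      linarith
    have h4 : 0 ≤ ∫ x, D n x ^ r ∂μ := integral_nonneg fun x => Real.rpow_nonneg (hDn n x) r
    nlinarith
  · exact ((BddMeas.const (1 / 4)).mul (hDr n)).integrable μ
  · exact ((BddMeas.const (1 / 4)).mul ((BddMeas.const (4 ^ r)).mul hU4)).integrable μ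

end Stationary

/-! ### Norm bounds for maximal functions. -/

section Majorants

variable {X : Type*} [MeasurableSpace X] {μ : Measure X}

theorem BddMeas.eLpNorm_le_ofReal_iff [IsFiniteMeasure μ] {g : X → ℝ} (hg : BddMeas g)
    (h0 : ∀ x, 0 ≤ g x) {r A : ℝ} (hr : 0 < r) (hA : 0 ≤ A) :
    eLpNorm g (ENNReal.ofReal r) μ ≤ ENNReal.ofReal A ↔ ∫ x, g x ^ r ∂μ ≤ A ^ r := by
  have hr' : ENNReal.ofReal r ≠ 0 := by simpa using hr
  rw [eLpNorm_eq_lintegral_rpow_enorm_toReal hr' ENNReal.ofReal_ne_top,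
    ENNReal.toReal_ofReal hr.le]
  have h1 : ∫⁻ x, ‖g x‖ₑ ^ r ∂μ = ENNReal.ofReal (∫ x, g x ^ r ∂μ) := by
    rw [ofReal_integral_eq_lintegral_ofReal ((hg.rpow h0 hr.le).integrable μ)
      (Filter.Eventually.of_forall fun x => Real.rpow_nonneg (h0 x) r)]
    refine lintegral_congr fun x => ?_
    rw [Real.enorm_of_nonneg (h0 x), ENNReal.ofReal_rpow_of_nonneg (h0 x) hr.le]
  rw [h1, one_div, ENNReal.rpow_inv_le_iff hr, ENNReal.ofReal_rpow_of_nonneg hA hr.le,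
    ENNReal.ofReal_le_ofReal_iff (by positivity)]

theorem eLpNorm_sq_le [IsFiniteMeasure μ] {g : X → ℝ} (hg : BddMeas g) (h0 : ∀ x, 0 ≤ g x)
    {q A : ℝ} (hq : 0 < q) (hA : 0 ≤ A)
    (h : eLpNorm g (ENNReal.ofReal (2 * q)) μ ≤ ENNReal.ofReal A) :
    eLpNorm (fun x => g x ^ 2) (ENNReal.ofReal q) μ ≤ ENNReal.ofReal (A ^ 2) := by
  rw [hg.eLpNorm_le_ofReal_iff h0 (by positivity) hA] at h
  rw [(hg.pow 2).eLpNorm_le_ofReal_iff (fun x => by positivity) hq (by positivity)]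
  have e : ∀ z : ℝ, 0 ≤ z → (z ^ 2) ^ q = z ^ (2 * q) := fun z hz => by
    rw [← Real.rpow_natCast_mul hz]; norm_num
  simp_rw [e _ hA, e _ (h0 _)]
  exact h

theorem eLpNorm_add_le_ofReal {g g' : X → ℝ} (hg : BddMeas g) (hg' : BddMeas g') {p : ℝ≥0∞}
    (hp : 1 ≤ p) {a b : ℝ} (ha : 0 ≤ a) (hb : 0 ≤ b)
    (h : eLpNorm g p μ ≤ ENNReal.ofReal a) (h' : eLpNorm g' p μ ≤ ENNReal.ofReal b) :
    eLpNorm (fun x => g x + g' x) p μ ≤ ENNReal.ofReal (a + b) := by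
  rw [ENNReal.ofReal_add ha hb]
  exact (eLpNorm_add_le hg.1.aestronglyMeasurable hg'.1.aestronglyMeasurable hp).trans
    (add_le_add h h')

theorem eLpNorm_const_mul_le_ofReal {g : X → ℝ} {p : ℝ≥0∞} {a c : ℝ} (hc : 0 ≤ c)
    (h : eLpNorm g p μ ≤ ENNReal.ofReal a) :
    eLpNorm (fun x => c * g x) p μ ≤ ENNReal.ofReal (c * a) := by
  rw [ENNReal.ofReal_mul hc, ← Real.enorm_of_nonneg hc]
  have := eLpNorm_const_smul_le (c := c) (f := g) (p := p) (μ := μ)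
  exact this.trans (by gcongr)

theorem eLpNorm_const_le_ofReal [IsProbabilityMeasure μ] {p : ℝ≥0∞} {c : ℝ} (hc : 0 ≤ c) :
    eLpNorm (fun _ : X => c) p μ ≤ ENNReal.ofReal c := by
  refine (eLpNorm_le_of_ae_bound (C := c) (Filter.Eventually.of_forall fun x => ?_)).trans ?_
  · rw [Real.norm_of_nonneg hc]
  · simp

theorem eLpNorm_sum_le_ofReal {p : ℝ≥0∞} (hp : 1 ≤ p) {g : ℕ → X → ℝ}
    (hg : ∀ i, BddMeas (g i)) {a : ℝ} (ha : 0 ≤ a)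
    (h : ∀ i, eLpNorm (g i) p μ ≤ ENNReal.ofReal a) (n : ℕ) :
    eLpNorm (fun x => ∑ i ∈ Finset.range n, g i x) p μ ≤ ENNReal.ofReal (n * a) := by
  induction n with
  | zero => simp
  | succ n ih =>
    simp_rw [Finset.sum_range_succ]
    push_cast
    rw [add_mul, one_mul]
    exact eLpNorm_add_le_ofReal (BddMeas.sum _ fun i _ => hg i) (hg n) hp (by positivity) ha ih
      (h n)

theorem one_le_rosenthalConst {r : ℝ} (hr : 2 ≤ r) : 1 ≤ rosenthalConst r := by
  have := one_le_taylorConst hr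
  rw [rosenthalConst, Real.one_le_sqrt]
  linarith

theorem rosenthalConst_mono {r s : ℝ} (hr : 0 ≤ r) (hrs : r ≤ s) :
    rosenthalConst r ≤ rosenthalConst s := by
  have := taylorConst_mono hr hrs
  exact Real.sqrt_le_sqrt (by linarith)

variable [IsProbabilityMeasure μ] {E : Type*} [NormedAddCommGroup E] [InnerProductSpace ℝ E]
  [MeasurableSpace E] [BorelSpace E] [SecondCountableTopology E] {f : X → X}

/-- The maximal function satisfies D_{j+1} ≥ D_j ∘ f, so D_n dominates U_j at the point f^{n-j} x.
For Birkhoff sums this means all the sums that end at time n, which is the natural family for a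
martingale in reversed time. -/
theorem exists_majorant_of_orthogonal (hf : MeasurePreserving f μ μ) {r b : ℝ} {n : ℕ}
    (hr : 2 ≤ r) (hb : 0 < b) {U ξ : ℕ → X → E} {ρ : ℕ → X → ℝ} (hU0 : ∀ x, U 0 x = 0)
    (hU : ∀ j x, U (j + 1) x = U j (f x) + ξ j x) (hξ : ∀ j, BddMeas (ξ j))
    (hρ : ∀ j, BddMeas (ρ j)) (hρ0 : ∀ j x, 0 ≤ ρ j x)
    (horth : ∀ j, ∀ Φ : X → E, BddMeas Φ → ∫ x, inner ℝ (Φ (f x)) (ξ j x) ∂μ = 0)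
    (hvar : ∀ j, ∀ g : X → ℝ, BddMeas g → (∀ x, 0 ≤ g x) →
      ∫ x, g (f x) * ‖ξ j x‖ ^ 2 ∂μ ≤ ∫ x, g x * ρ j x ^ 2 ∂μ)
    (hρb : ∀ j < n, ∫ x, ρ j x ^ r ∂μ ≤ b ^ r)
    (hξb : ∀ j < n, ∫ x, ‖ξ j x‖ ^ r ∂μ ≤ b ^ r * (n : ℝ) ^ (r / 2 - 1)) :
    ∃ D : X → ℝ, BddMeas D ∧ (∀ x, 0 ≤ D x) ∧ (∀ j ≤ n, ∀ x, ‖U j (f^[n - j] x)‖ ≤ D x) ∧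
      eLpNorm D (ENNReal.ofReal r) μ ≤
        ENNReal.ofReal (4 * rosenthalConst r * b * Real.sqrt n) := by
  let D : ℕ → X → ℝ := fun n => Nat.rec (fun _ => 0)
    (fun j d x => max (d (f x)) ‖U (j + 1) x‖) n
  have hD : ∀ j x, D (j + 1) x = max (D j (f x)) ‖U (j + 1) x‖ := fun _ _ => rfl
  obtain ⟨h1, h2, h3⟩ := integral_max_rpow_le_of_orthogonal (D := D) hf hr hU0 hU hξ
    (fun _ => rfl) hD horth n
  refine ⟨D n, h1, h2, ?_, ?_⟩
  · intro j hj
    obtain ⟨k, rfl⟩ := Nat.exists_eq_add_of_le hj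
    rw [Nat.add_sub_cancel_left]
    clear h1 h2 h3 hρb hξb hj
    induction k with
    | zero =>
      intro x
      cases j with
      | zero => simp [hU0, D]
      | succ j => exact le_max_right _ _
    | succ k ih => exact fun x => (ih (f x)).trans (le_max_left _ _)
  · have hρc : 0 ≤ rosenthalConst r := zero_le_one.trans (one_le_rosenthalConst hr)
    rw [h1.eLpNorm_le_ofReal_iff h2 (by linarith) (by positivity)]
    refine h3.trans ?_
    have h4 := integral_norm_rpow_le_of_orthogonal hf hr hb hU0 hU hξ hρ hρ0 horth hvar hρb hξb n
      le_rfl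
    calc 4 ^ r * ∫ x, ‖U n x‖ ^ r ∂μ ≤ 4 ^ r * (b * rosenthalConst r * Real.sqrt n) ^ r := by
          gcongr
      _ = _ := by
        rw [← Real.mul_rpow (by norm_num) (by positivity)]
        ring_nf

end Majorants

/-! ### Iterated Birkhoff sums -/

section Iterated

variable {X E E' : Type*} [NormedAddCommGroup E] [NormedSpace ℝ E] [NormedAddCommGroup E']
  [NormedSpace ℝ E'] (T : E →L[ℝ] E →L[ℝ] E') (f : X → X) (v : X → E)

/-- The iterated Birkhoff sum `∑_{i < j < n} T (v (f^i x)) (v (f^j x))`. -/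
noncomputable def iteratedBirkhoffSum (n : ℕ) (x : X) : E' :=
  ∑ j ∈ Finset.range n, T (birkhoffSum f v j x) (v (f^[j] x))

@[simp] theorem iteratedBirkhoffSum_zero (x : X) : iteratedBirkhoffSum T f v 0 x = 0 := by
  simp [iteratedBirkhoffSum]

theorem iteratedBirkhoffSum_succ (n : ℕ) (x : X) : iteratedBirkhoffSum T f v (n + 1) x =
    iteratedBirkhoffSum T f v n x + T (birkhoffSum f v n x) (v (f^[n] x)) := by
  simp [iteratedBirkhoffSum, Finset.sum_range_succ]

/-- Discrete Chen relation: a pair i < j lies below a, or above it, or is separated by it. -/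
theorem iteratedBirkhoffSum_add (a b : ℕ) (x : X) : iteratedBirkhoffSum T f v (a + b) x =
    iteratedBirkhoffSum T f v a x + iteratedBirkhoffSum T f v b (f^[a] x) +
      T (birkhoffSum f v a x) (birkhoffSum f v b (f^[a] x)) := by
  induction b with
  | zero => simp
  | succ b ih =>
    rw [← add_assoc, iteratedBirkhoffSum_succ, ih, iteratedBirkhoffSum_succ, birkhoffSum_add,
      birkhoffSum_succ f v b]
    simp only [map_add, add_apply, ← Function.iterate_add_apply]
    rw [add_comm b a]
    abel

theorem iteratedBirkhoffSum_succ' (n : ℕ) (x : X) : iteratedBirkhoffSum T f v (n + 1) x =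
    iteratedBirkhoffSum T f v n (f x) + T (v x) (birkhoffSum f v n (f x)) := by
  rw [add_comm n 1, iteratedBirkhoffSum_add]
  simp [iteratedBirkhoffSum]

variable {f v}

theorem norm_birkhoffSum_le {c : ℝ} (hv : ∀ x, ‖v x‖ ≤ c) (n : ℕ) (x : X) :
    ‖birkhoffSum f v n x‖ ≤ n * c := by
  refine (norm_sum_le_of_le _ fun i _ => hv _).trans ?_
  simp

theorem norm_iteratedBirkhoffSum_le (hT : ‖T‖ ≤ 1) {c : ℝ} (hc : 0 ≤ c) (hv : ∀ x, ‖v x‖ ≤ c)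
    {n N : ℕ} (hn : n ≤ N) (x : X) : ‖iteratedBirkhoffSum T f v n x‖ ≤ (N * c) ^ 2 := by
  have hN : (n : ℝ) ≤ N := by exact_mod_cast hn
  have h : ∀ j ∈ Finset.range n, ‖T (birkhoffSum f v j x) (v (f^[j] x))‖ ≤ N * c * c := by
    intro j hj
    have hj' : (j : ℝ) ≤ N := by exact_mod_cast (Finset.mem_range.1 hj).le.trans hn
    refine (T.le_opNorm₂ _ _).trans ?_
    have h1 := norm_birkhoffSum_le hv j x (f := f)
    calc ‖T‖ * ‖birkhoffSum f v j x‖ * ‖v (f^[j] x)‖ ≤ 1 * (j * c) * c := by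
          gcongr
          exact hv _
      _ ≤ N * c * c := by rw [one_mul]; gcongr
  refine (norm_sum_le_of_le _ h).trans ?_
  simp only [Finset.sum_const, Finset.card_range, nsmul_eq_mul]
  calc (n : ℝ) * (N * c * c) ≤ N * (N * c * c) := by gcongr
    _ = _ := by ring

end Iterated

/-! ### Moments from a martingale-coboundary decomposition -/

section MartingaleCoboundary

variable {X : Type*} [MeasurableSpace X] {μ : Measure X} [IsProbabilityMeasure μ] {f : X → X}
  {E E' : Type*} [NormedAddCommGroup E] [InnerProductSpace ℝ E] [MeasurableSpace E]
  [BorelSpace E] [FiniteDimensional ℝ E] [NormedAddCommGroup E'] [InnerProductSpace ℝ E']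
  [MeasurableSpace E'] [BorelSpace E'] [FiniteDimensional ℝ E']

theorem BddMeas.birkhoffSum [SecondCountableTopology E] (hf : Measurable f) {v : X → E}
    (hv : BddMeas v) (n : ℕ) : BddMeas (birkhoffSum f v n) :=
  BddMeas.sum _ fun i _ => hv.comp (hf.iterate i)

/-- A decomposition `m + χ ∘ f - χ + c` of an observable on a probability space, with the
quantitative bounds that yield moment estimates up to time `N`. -/
structure MartingaleCoboundary (μ : Measure X) (f : X → X) (q K : ℝ) (N : ℕ)
    (v m χ c : X → E) (χs : X → ℝ) : Prop where
  bddMeas_m : BddMeas m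
  bddMeas_χ : BddMeas χ
  bddMeas_c : BddMeas c
  eq_add : ∀ x, v x = m x + χ (f x) - χ x + c x
  orthogonal : ∀ G : X → E, BddMeas G → ∫ x, inner ℝ (m x) (G (f x)) ∂μ = 0
  variance : ∀ g : X → ℝ, BddMeas g → (∀ x, 0 ≤ g x) →
    ∫ x, g (f x) * ‖m x‖ ^ 2 ∂μ ≤ K ^ 2 * ∫ x, g x ∂μ
  moment : ∀ g : X → ℝ, BddMeas g → (∀ x, 0 ≤ g x) →
    ∫ x, g (f x) * ‖m x‖ ^ (max 2 q) ∂μ ≤ K ^ (max 2 q) * ∫ x, g x ∂μ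
  moment_two_mul : ∫ x, ‖m x‖ ^ (2 * q) ∂μ ≤ K ^ (2 * q) * (N : ℝ) ^ (q - 1)
  bddMeas_χs : BddMeas χs
  χ_le : ∀ k ≤ N, ∀ x, ‖χ (f^[k] x)‖ ≤ χs x
  eLpNorm_χs : eLpNorm χs (ENNReal.ofReal (2 * q)) μ ≤ ENNReal.ofReal (K * Real.sqrt N)
  norm_le : ∀ x, ‖v x‖ ≤ K
  eLpNorm_χ : eLpNorm χ (ENNReal.ofReal q) μ ≤ ENNReal.ofReal K
  norm_c_le : ∀ x, ‖c x‖ ≤ K / N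

namespace MartingaleCoboundary

variable {q K Q : ℝ} {N : ℕ} {v m χ c : X → E} {χs : X → ℝ}

theorem bddMeas (h : MartingaleCoboundary μ f q K N v m χ c χs) (hf : Measurable f) :
    BddMeas v := by
  rw [show v = fun x => m x + χ (f x) - χ x + c x from funext h.eq_add]
  exact ((h.bddMeas_m.add (h.bddMeas_χ.comp hf)).sub h.bddMeas_χ).add h.bddMeas_c

theorem birkhoffSum_eq (h : MartingaleCoboundary μ f q K N v m χ c χs) (n : ℕ) (x : X) :
    birkhoffSum f v n x =
      birkhoffSum f m n x + χ (f^[n] x) - χ x + birkhoffSum f c n x := by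
  induction n with
  | zero => simp
  | succ n ih =>
    simp only [birkhoffSum_succ, ih, h.eq_add (f^[n] x), Function.iterate_succ_apply']
    abel

/-- The martingale part is treated with r = 2q, for which n^{r/2 - 1} = N^{q-1} is exactly the
growth allowed in `moment_two_mul`. The coboundary contributes at most 2χs, and the drift at most N
· K/N = K. -/
theorem exists_majorant_birkhoffSum (h : MartingaleCoboundary μ f q K N v m χ c χs)
    (hf : MeasurePreserving f μ μ) (hq : 1 ≤ q) (hqQ : q ≤ Q) (hK : 1 ≤ K) (hN : 1 ≤ N) :
    ∃ R : X → ℝ, BddMeas R ∧ (∀ x, 0 ≤ R x) ∧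
      (∀ j ≤ N, ∀ x, ‖birkhoffSum f v j (f^[N - j] x)‖ ≤ R x) ∧
      eLpNorm R (ENNReal.ofReal (2 * q)) μ ≤
        ENNReal.ofReal ((4 * rosenthalConst (2 * Q) + 3) * K * Real.sqrt N) := by
  have hN' : (1 : ℝ) ≤ N := by exact_mod_cast hN
  obtain ⟨D, hD1, hD2, hD3, hD4⟩ := exists_majorant_of_orthogonal (μ := μ) (n := N) (r := 2 * q)
    (b := K) (U := birkhoffSum f m) (ξ := fun _ => m) (ρ := fun _ _ => K) hf (by linarith)
    (by linarith) (fun x => by simp) (fun j x => by rw [birkhoffSum_succ', add_comm])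
    (fun _ => h.bddMeas_m) (fun _ => BddMeas.const K) (fun _ _ => by linarith)
    (fun _ Φ hΦ => by simp_rw [real_inner_comm]; exact h.orthogonal Φ hΦ)
    (fun _ g hg hg0 => by
      rw [integral_mul_const, mul_comm]; exact h.variance g hg hg0)
    (fun _ _ => by simp)
    (fun _ _ => by rw [mul_div_cancel_left₀ _ (by norm_num)]; exact h.moment_two_mul)
  refine ⟨fun x => (D x + 2 * χs x) + K, (hD1.add ((BddMeas.const 2).mul h.bddMeas_χs)).add
    (BddMeas.const K), fun x => ?_, fun j hj x => ?_, ?_⟩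
  · have := hD2 x
    have := (norm_nonneg _).trans (h.χ_le 0 (by omega) x)
    positivity
  · rw [h.birkhoffSum_eq, ← Function.iterate_add_apply, Nat.add_sub_cancel' hj]
    have h1 := hD3 j hj x
    have h2 := h.χ_le N le_rfl x
    have h3 := h.χ_le (N - j) (by omega) x
    have h4 := norm_birkhoffSum_le h.norm_c_le j (f^[N - j] x) (f := f)
    have h5 : (j : ℝ) * (K / N) ≤ K := by
      have : (j : ℝ) ≤ N := by exact_mod_cast hj
      rw [mul_div_assoc', div_le_iff₀ (by linarith)]
      nlinarith
    have h6 := norm_add_le (birkhoffSum f m j (f^[N - j] x) + χ (f^[N] x) - χ (f^[N - j] x))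
      (birkhoffSum f c j (f^[N - j] x))
    have h7 := norm_sub_le (birkhoffSum f m j (f^[N - j] x) + χ (f^[N] x)) (χ (f^[N - j] x))
    have h8 := norm_add_le (birkhoffSum f m j (f^[N - j] x)) (χ (f^[N] x))
    linarith
  · have hp : 1 ≤ ENNReal.ofReal (2 * q) := by rw [ENNReal.one_le_ofReal]; linarith
    have hsN : 1 ≤ Real.sqrt N := by rwa [Real.one_le_sqrt]
    have hr1 := one_le_rosenthalConst (r := 2 * q) (by linarith)
    have hr2 := rosenthalConst_mono (r := 2 * q) (s := 2 * Q) (by linarith) (by linarith)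
    refine (eLpNorm_add_le_ofReal (hD1.add ((BddMeas.const 2).mul h.bddMeas_χs))
      (BddMeas.const K) hp (by positivity) (by linarith) (eLpNorm_add_le_ofReal hD1
        ((BddMeas.const 2).mul h.bddMeas_χs) hp (by positivity) (by positivity) hD4
        (eLpNorm_const_mul_le_ofReal (by norm_num) h.eLpNorm_χs))
        (eLpNorm_const_le_ofReal (by linarith))).trans (ENNReal.ofReal_le_ofReal ?_)
    have h1 : 4 * rosenthalConst (2 * q) * K * Real.sqrt N ≤
        4 * rosenthalConst (2 * Q) * K * Real.sqrt N := by gcongr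
    have h2 : K ≤ K * Real.sqrt N := by nlinarith
    linarith

theorem norm_bilin_le {T : E →L[ℝ] E →L[ℝ] E'} (hT : ‖T‖ ≤ 1) (a b : E) :
    ‖T a b‖ ≤ ‖a‖ * ‖b‖ := by
  refine (T.le_opNorm₂ a b).trans ?_
  rw [mul_assoc]
  exact mul_le_of_le_one_left (by positivity) hT

theorem continuous_adjoint_flip (T : E →L[ℝ] E →L[ℝ] E') :
    Continuous fun z : E × E' => ContinuousLinearMap.adjoint (T.flip z.1) z.2 := by
  have h1 : Continuous fun z : E × E' => T.flip z.1 := T.flip.continuous.comp continuous_fst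
  have h2 : Continuous fun z : E × E' => ContinuousLinearMap.adjoint (T.flip z.1) :=
    (LinearIsometryEquiv.continuous _).comp h1
  exact h2.clm_apply continuous_snd
theorem measurable_adjoint_flip (T : E →L[ℝ] E →L[ℝ] E') {S : X → E} {Φ : X → E'}
    (hS : Measurable S) (hΦ : Measurable Φ) :
    Measurable fun x => ContinuousLinearMap.adjoint (T.flip (S x)) (Φ x) := by
  have h : ∀ G : E × E' → E, Continuous G → Measurable fun x => G (S x, Φ x) :=
    fun G hG => hG.measurable.comp (hS.prodMk hΦ)
  exact h _ (continuous_adjoint_flip T)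

theorem norm_adjoint_flip_le (T : E →L[ℝ] E →L[ℝ] E') (a : E) (b : E') :
    ‖ContinuousLinearMap.adjoint (T.flip a) b‖ ≤ ‖T.flip‖ * ‖a‖ * ‖b‖ := by
  refine (ContinuousLinearMap.le_opNorm _ _).trans ?_
  rw [LinearIsometryEquiv.norm_map]
  gcongr
  exact T.flip.le_opNorm _

/-- Moving a ↦ T(a, S) to the other side by its adjoint turns the integrand into the pairing of m
with a function composed with f, to which the orthogonality of m applies. -/
theorem integral_inner_bilin_eq_zero (h : MartingaleCoboundary μ f q K N v m χ c χs)
    (T : E →L[ℝ] E →L[ℝ] E') {S : X → E} (hS : BddMeas S) {Φ : X → E'} (hΦ : BddMeas Φ) :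
    ∫ x, inner ℝ (Φ (f x)) (T (m x) (S (f x))) ∂μ = 0 := by
  have hG : BddMeas (fun x => ContinuousLinearMap.adjoint (T.flip (S x)) (Φ x)) := by
    obtain ⟨h1, C, hC⟩ := hS
    obtain ⟨h2, C', hC'⟩ := hΦ
    refine ⟨?_, ‖T.flip‖ * C * C', fun x => ?_⟩
    · exact measurable_adjoint_flip T h1 h2
    · have := (norm_nonneg _).trans (hC x)
      refine (norm_adjoint_flip_le T _ _).trans ?_
      gcongr
      · exact hC x
      · exact hC' x
  rw [← h.orthogonal _ hG]
  refine integral_congr_ae (Filter.Eventually.of_forall fun x => ?_)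
  simp only
  rw [ContinuousLinearMap.adjoint_inner_right, ContinuousLinearMap.flip_apply, real_inner_comm]

theorem integral_mul_norm_bilin_sq_le (h : MartingaleCoboundary μ f q K N v m χ c χs)
    (hf : Measurable f) {T : E →L[ℝ] E →L[ℝ] E'} (hT : ‖T‖ ≤ 1) {S : X → E} (hS : BddMeas S)
    {g : X → ℝ} (hg : BddMeas g) (hg0 : ∀ x, 0 ≤ g x) :
    ∫ x, g (f x) * ‖T (m x) (S (f x))‖ ^ 2 ∂μ ≤ ∫ x, g x * (K * ‖S x‖) ^ 2 ∂μ := by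
  have hgS := hg.mul (hS.norm.pow 2)
  have hξ := BddMeas.bilin T h.bddMeas_m (hS.comp hf)
  have h1 := h.variance _ hgS fun x => mul_nonneg (hg0 x) (by positivity)
  rw [← integral_const_mul] at h1
  refine (integral_mono (((hg.comp hf).mul (hξ.norm.pow 2)).integrable μ)
    ((((hgS.comp hf).mul (h.bddMeas_m.norm.pow 2))).integrable μ)
    fun x => ?_).trans (h1.trans (le_of_eq ?_))
  · have h2 := norm_bilin_le hT (m x) (S (f x))
    have h3 := hg0 (f x)
    calc g (f x) * ‖T (m x) (S (f x))‖ ^ 2 ≤ g (f x) * (‖m x‖ * ‖S (f x)‖) ^ 2 := by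
          gcongr
      _ = _ := by ring
  · refine integral_congr_ae (Filter.Eventually.of_forall fun x => ?_)
    simp only
    ring

theorem integral_norm_bilin_rpow_le (h : MartingaleCoboundary μ f q K N v m χ c χs)
    (hf : Measurable f) {T : E →L[ℝ] E →L[ℝ] E'} (hT : ‖T‖ ≤ 1) {S : X → E} (hS : BddMeas S) :
    ∫ x, ‖T (m x) (S (f x))‖ ^ (max 2 q) ∂μ ≤ K ^ (max 2 q) * ∫ x, ‖S x‖ ^ (max 2 q) ∂μ := by
  have hr : 0 ≤ max 2 q := le_max_of_le_left (by norm_num)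
  have hSr := hS.norm.rpow (fun x => norm_nonneg _) hr
  have hmr := h.bddMeas_m.norm.rpow (fun x => norm_nonneg _) hr
  have hξ := BddMeas.bilin T h.bddMeas_m (hS.comp hf)
  refine le_trans ?_ (h.moment _ hSr fun x => by positivity)
  refine integral_mono ((hξ.norm.rpow (fun x => norm_nonneg _) hr).integrable μ)
    (((hSr.comp hf).mul hmr).integrable μ) fun x => ?_
  simp only
  rw [← Real.mul_rpow (norm_nonneg _) (norm_nonneg _)]
  refine Real.rpow_le_rpow (norm_nonneg _) ?_ hr
  rw [mul_comm]
  exact norm_bilin_le hT _ _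

theorem integral_norm_birkhoffSum_rpow_le (h : MartingaleCoboundary μ f q K N v m χ c χs)
    (hf : MeasurePreserving f μ μ) {r A : ℝ} (hr : 0 < r) (hrq : r ≤ 2 * q) (hA : 0 ≤ A)
    {R : X → ℝ} (hR : BddMeas R) (hR0 : ∀ x, 0 ≤ R x)
    (hSR : ∀ j ≤ N, ∀ x, ‖birkhoffSum f v j (f^[N - j] x)‖ ≤ R x)
    (hRA : eLpNorm R (ENNReal.ofReal (2 * q)) μ ≤ ENNReal.ofReal A) {j : ℕ} (hj : j ≤ N) :
    ∫ x, ‖birkhoffSum f v j x‖ ^ r ∂μ ≤ A ^ r := by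
  have hg := ((h.bddMeas hf.measurable).birkhoffSum hf.measurable j).norm.rpow
    (fun x => norm_nonneg _) hr.le
  have hst : ∫ x, ‖birkhoffSum f v j (f^[N - j] x)‖ ^ r ∂μ =
      ∫ x, ‖birkhoffSum f v j x‖ ^ r ∂μ := by
    conv_rhs => rw [← (hf.iterate (N - j)).map_eq]
    rw [integral_map (hf.iterate _).measurable.aemeasurable hg.1.aestronglyMeasurable]
  rw [← hst]
  refine (integral_mono ((hg.comp (hf.measurable.iterate _)).integrable μ)
    ((hR.rpow hR0 hr.le).integrable μ) fun x => ?_).trans ?_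
  · exact Real.rpow_le_rpow (norm_nonneg _) (hSR j hj x) hr.le
  · rw [← hR.eLpNorm_le_ofReal_iff hR0 hr hA]
    exact (eLpNorm_le_eLpNorm_of_exponent_le (ENNReal.ofReal_le_ofReal hrq)
      hR.1.aestronglyMeasurable).trans hRA

/-- The sums `∑_{i < j < n} T (m (f^i x)) (v (f^j x))`. -/
noncomputable def transform (T : E →L[ℝ] E →L[ℝ] E') (f : X → X) (m v : X → E) : ℕ → X → E'
  | 0, _ => 0
  | n + 1, x => transform T f m v n (f x) + T (m x) (birkhoffSum f v n (f x))

/-- The increments T(m, S_j ∘ f) are orthogonal to functions of f and have conditional variance at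
most K²‖S_j‖², so the orthogonal increment bound applies with ρ_j = K‖S_j‖ and b = K A √N. One
factor √N comes from S_j and one from the number of steps. The exponent max(2, q) is at least 2, as
that bound requires, and at most 2q, where S_j is controlled. -/
theorem exists_majorant_transform (h : MartingaleCoboundary μ f q K N v m χ c χs)
    (hf : MeasurePreserving f μ μ) (hq : 1 ≤ q) (hK : 1 ≤ K) (hN : 1 ≤ N)
    {T : E →L[ℝ] E →L[ℝ] E'} (hT : ‖T‖ ≤ 1) {A : ℝ} (hA : 1 ≤ A) {R : X → ℝ}
    (hR : BddMeas R) (hR0 : ∀ x, 0 ≤ R x)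
    (hSR : ∀ j ≤ N, ∀ x, ‖birkhoffSum f v j (f^[N - j] x)‖ ≤ R x)
    (hRA : eLpNorm R (ENNReal.ofReal (2 * q)) μ ≤ ENNReal.ofReal (A * Real.sqrt N)) :
    ∃ D : X → ℝ, BddMeas D ∧ (∀ j ≤ N, ∀ x, ‖transform T f m v j (f^[N - j] x)‖ ≤ D x) ∧
      eLpNorm D (ENNReal.ofReal (max 2 q)) μ ≤
        ENNReal.ofReal (4 * rosenthalConst (max 2 q) * K * A * N) := by
  have hN' : (1 : ℝ) ≤ N := by exact_mod_cast hN
  have hr2 : 2 ≤ max 2 q := le_max_left _ _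
  have hr2q : max 2 q ≤ 2 * q := max_le (by linarith) (by linarith)
  have hS : ∀ j, BddMeas (birkhoffSum f v j) := fun j =>
    (h.bddMeas hf.measurable).birkhoffSum hf.measurable j
  have hSr : ∀ j < N, ∫ x, ‖birkhoffSum f v j x‖ ^ (max 2 q) ∂μ ≤
      (A * Real.sqrt N) ^ (max 2 q) := fun j hj =>
    h.integral_norm_birkhoffSum_rpow_le hf (by linarith) hr2q (by positivity) hR hR0 hSR hRA hj.le
  have hKA : (K * (A * Real.sqrt N)) ^ (max 2 q) =
      K ^ (max 2 q) * (A * Real.sqrt N) ^ (max 2 q) :=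
    Real.mul_rpow (by linarith) (by positivity)
  obtain ⟨D, hD1, -, hD3, hD4⟩ := exists_majorant_of_orthogonal (μ := μ) (n := N)
    (b := K * (A * Real.sqrt N)) (U := transform T f m v)
    (ξ := fun j x => T (m x) (birkhoffSum f v j (f x)))
    (ρ := fun j x => K * ‖birkhoffSum f v j x‖) hf hr2 (by positivity)
    (fun x => rfl) (fun _ _ => rfl)
    (fun j => BddMeas.bilin T h.bddMeas_m ((hS j).comp hf.measurable))
    (fun j => (BddMeas.const K).mul (hS j).norm) (fun _ _ => by positivity)
    (fun j Φ hΦ => h.integral_inner_bilin_eq_zero T (hS j) hΦ)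
    (fun j g hg hg0 => h.integral_mul_norm_bilin_sq_le hf.measurable hT (hS j) hg hg0)
    (fun j hj => by
      simp_rw [Real.mul_rpow (show 0 ≤ K by linarith) (norm_nonneg _)]
      rw [integral_const_mul, hKA]
      have := hSr j hj
      gcongr)
    (fun j hj => by
      have h3 := hSr j hj
      refine (h.integral_norm_bilin_rpow_le hf.measurable hT (hS j)).trans ?_
      rw [hKA]
      have h4 : (1 : ℝ) ≤ (N : ℝ) ^ (max 2 q / 2 - 1) := Real.one_le_rpow hN' (by linarith)
      calc K ^ (max 2 q) * ∫ x, ‖birkhoffSum f v j x‖ ^ (max 2 q) ∂μ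
          ≤ K ^ (max 2 q) * (A * Real.sqrt N) ^ (max 2 q) * 1 := by rw [mul_one]; gcongr
        _ ≤ _ := by gcongr)
  refine ⟨D, hD1, hD3, hD4.trans (le_of_eq ?_)⟩
  congr 1
  calc 4 * rosenthalConst (max 2 q) * (K * (A * Real.sqrt N)) * Real.sqrt N
      = 4 * rosenthalConst (max 2 q) * K * A * Real.sqrt N ^ 2 := by ring
    _ = _ := by rw [Real.sq_sqrt (by linarith)]

/-- Summation by parts. Replacing v by m in the first slot leaves the coboundary χ ∘ f - χ there.
After summation only boundary terms T(χ, S), diagonal terms T(χ, v) and the small drift remain. The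
diagonal terms are kept as a sum of ‖χ‖ along the orbit because χ is uniformly controlled only in
L^q. -/
theorem norm_iteratedBirkhoffSum_sub_transform_le
    (h : MartingaleCoboundary μ f q K N v m χ c χs) (hK : 0 ≤ K)
    {T : E →L[ℝ] E →L[ℝ] E'} (hT : ‖T‖ ≤ 1) {R : X → ℝ} (hR0 : ∀ x, 0 ≤ R x)
    (hSR : ∀ j ≤ N, ∀ x, ‖birkhoffSum f v j (f^[N - j] x)‖ ≤ R x) {j : ℕ} (hj : j ≤ N) (x : X) :
    ‖iteratedBirkhoffSum T f v j (f^[N - j] x) - transform T f m v j (f^[N - j] x)‖ ≤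
      (χs x + R x) ^ 2 + (∑ i ∈ Finset.range N, K * ‖χ (f^[i] x)‖) + K * R x := by
  -- The correction T(χ, S_j) makes the coboundary telescope: e_{j+1} = e_j ∘ f + T(χ, v) + T(c, S_j
  -- ∘ f).
  let e : ℕ → X → E' := fun j x => iteratedBirkhoffSum T f v j x - transform T f m v j x +
    T (χ x) (birkhoffSum f v j x)
  have he : ∀ j x, e (j + 1) x = e j (f x) + T (χ x) (v x) +
      T (c x) (birkhoffSum f v j (f x)) := by
    intro j x
    simp only [e, transform, iteratedBirkhoffSum_succ', birkhoffSum_succ']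
    have h2 : T (v x) (birkhoffSum f v j (f x)) =
        T (m x + χ (f x) - χ x + c x) (birkhoffSum f v j (f x)) := by rw [← h.eq_add x]
    rw [h2]
    simp only [map_add, map_sub, add_apply, sub_apply]
    abel
  have heb : ∀ j ≤ N, ‖e j (f^[N - j] x)‖ ≤
      ∑ i ∈ Finset.Ico (N - j) N, (K * ‖χ (f^[i] x)‖ + K / N * R x) := by
    intro j
    induction j with
    | zero => intro _; simp [e, transform]
    | succ j ih =>
      intro hj
      have h1 := ih (by omega)
      obtain ⟨k, hk⟩ : ∃ k, N - j = k + 1 := ⟨N - j - 1, by omega⟩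
      have hk' : N - (j + 1) = k := by omega
      have hS' := hSR j (by omega) x
      rw [hk, Function.iterate_succ_apply'] at h1 hS'
      rw [hk', he, Finset.sum_eq_sum_Ico_succ_bot (by omega)]
      have h2 := norm_bilin_le hT (χ (f^[k] x)) (v (f^[k] x))
      have h3 := norm_bilin_le hT (c (f^[k] x)) (birkhoffSum f v j (f (f^[k] x)))
      have h4 : ‖χ (f^[k] x)‖ * ‖v (f^[k] x)‖ ≤ K * ‖χ (f^[k] x)‖ := by
        rw [mul_comm]; gcongr; exact h.norm_le _
      have h5 : ‖c (f^[k] x)‖ * ‖birkhoffSum f v j (f (f^[k] x))‖ ≤ K / N * R x := by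
        gcongr
        exact h.norm_c_le _
      have h6 := norm_add_le (e j (f (f^[k] x)) + T (χ (f^[k] x)) (v (f^[k] x)))
        (T (c (f^[k] x)) (birkhoffSum f v j (f (f^[k] x))))
      have h7 := norm_add_le (e j (f (f^[k] x))) (T (χ (f^[k] x)) (v (f^[k] x)))
      linarith
  have hχs0 : 0 ≤ χs x := (norm_nonneg _).trans (h.χ_le 0 (by omega) x)
  have e1 : iteratedBirkhoffSum T f v j (f^[N - j] x) - transform T f m v j (f^[N - j] x) =
      e j (f^[N - j] x) - T (χ (f^[N - j] x)) (birkhoffSum f v j (f^[N - j] x)) := by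
    simp only [e]; abel
  have h2 := norm_bilin_le hT (χ (f^[N - j] x)) (birkhoffSum f v j (f^[N - j] x))
  have h3 : ‖χ (f^[N - j] x)‖ * ‖birkhoffSum f v j (f^[N - j] x)‖ ≤ χs x * R x :=
    mul_le_mul (h.χ_le _ (by omega) x) (hSR j hj x) (norm_nonneg _) hχs0
  have h4 : χs x * R x ≤ (χs x + R x) ^ 2 := by nlinarith [hR0 x]
  have h5 : ∑ i ∈ Finset.Ico (N - j) N, (K * ‖χ (f^[i] x)‖ + K / N * R x) ≤
      (∑ i ∈ Finset.range N, K * ‖χ (f^[i] x)‖) + K * R x := by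
    have hR0x := hR0 x
    rcases Nat.eq_zero_or_pos N with rfl | hN
    · simp; positivity
    calc _ ≤ ∑ i ∈ Finset.range N, (K * ‖χ (f^[i] x)‖ + K / N * R x) := by
          refine Finset.sum_le_sum_of_subset_of_nonneg (fun i hi => ?_) fun i _ _ => by
            positivity
          simp only [Finset.mem_Ico] at hi
          simpa using hi.2
      _ = _ := by
        have : (N : ℝ) ≠ 0 := by positivity
        rw [Finset.sum_add_distrib]
        simp only [Finset.sum_const, Finset.card_range, nsmul_eq_mul]
        field_simp
  have h6 := heb j hj
  have h7 := norm_sub_le (e j (f^[N - j] x))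
    (T (χ (f^[N - j] x)) (birkhoffSum f v j (f^[N - j] x)))
  rw [e1]
  linarith

/-- Chen's relation at time j expresses the sum over [0, j) through the sums over [0, N) and [j, N),
which both end at N, and the product S_j ⊗ S_{N-j} ∘ f^j, where S_j = S_N - S_{N-j} ∘ f^j is at most
2R. -/
theorem norm_iteratedBirkhoffSum_le_of_reversed {T : E →L[ℝ] E →L[ℝ] E'} (hT : ‖T‖ ≤ 1)
    {R H : X → ℝ} (hSR : ∀ j ≤ N, ∀ x, ‖birkhoffSum f v j (f^[N - j] x)‖ ≤ R x)
    (hQ : ∀ j ≤ N, ∀ x, ‖iteratedBirkhoffSum T f v j (f^[N - j] x)‖ ≤ H x) {j : ℕ} (hj : j ≤ N)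
    (x : X) : ‖iteratedBirkhoffSum T f v j x‖ ≤ 2 * H x + 2 * R x ^ 2 := by
  have h1 := hQ N le_rfl x
  have h2 := hQ (N - j) (by omega) x
  have h3 := hSR N le_rfl x
  have h4 := hSR (N - j) (by omega) x
  rw [Nat.sub_self, Function.iterate_zero, id] at h1 h3
  rw [Nat.sub_sub_self hj] at h2 h4
  have hR0 : 0 ≤ R x := (norm_nonneg _).trans h3
  have e1 := iteratedBirkhoffSum_add T f v j (N - j) x
  have e2 := birkhoffSum_add f v j (N - j) x
  rw [Nat.add_sub_cancel' hj] at e1 e2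
  have h5 : ‖birkhoffSum f v j x‖ ≤ 2 * R x := by
    rw [← add_sub_cancel_right (birkhoffSum f v j x) (birkhoffSum f v (N - j) (f^[j] x)), ← e2]
    have := norm_sub_le (birkhoffSum f v N x) (birkhoffSum f v (N - j) (f^[j] x))
    linarith
  have h6 := norm_bilin_le hT (birkhoffSum f v j x) (birkhoffSum f v (N - j) (f^[j] x))
  have h7 : ‖birkhoffSum f v j x‖ * ‖birkhoffSum f v (N - j) (f^[j] x)‖ ≤ 2 * R x * R x :=
    mul_le_mul h5 h4 (norm_nonneg _) (by positivity)
  have e3 : iteratedBirkhoffSum T f v j x = iteratedBirkhoffSum T f v N x -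
      iteratedBirkhoffSum T f v (N - j) (f^[j] x) -
      T (birkhoffSum f v j x) (birkhoffSum f v (N - j) (f^[j] x)) := by
    rw [e1]; abel
  rw [e3]
  have h8 := norm_sub_le (iteratedBirkhoffSum T f v N x -
    iteratedBirkhoffSum T f v (N - j) (f^[j] x))
    (T (birkhoffSum f v j x) (birkhoffSum f v (N - j) (f^[j] x)))
  have h9 := norm_sub_le (iteratedBirkhoffSum T f v N x)
    (iteratedBirkhoffSum T f v (N - j) (f^[j] x))
  nlinarith

theorem exists_majorant_iteratedBirkhoffSum (h : MartingaleCoboundary μ f q K N v m χ c χs)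
    (hf : MeasurePreserving f μ μ) (hq : 1 ≤ q) (hqQ : q ≤ Q) (hK : 1 ≤ K) (hN : 1 ≤ N)
    (T : E →L[ℝ] E →L[ℝ] E') (hT : ‖T‖ ≤ 1) {A : ℝ} (hA : 1 ≤ A) {R : X → ℝ}
    (hR : BddMeas R) (hR0 : ∀ x, 0 ≤ R x)
    (hSR : ∀ j ≤ N, ∀ x, ‖birkhoffSum f v j (f^[N - j] x)‖ ≤ R x)
    (hRA : eLpNorm R (ENNReal.ofReal (2 * q)) μ ≤ ENNReal.ofReal (A * Real.sqrt N)) :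
    ∃ H : X → ℝ, BddMeas H ∧ (∀ j ≤ N, ∀ x, ‖iteratedBirkhoffSum T f v j x‖ ≤ H x) ∧
      eLpNorm H (ENNReal.ofReal q) μ ≤ ENNReal.ofReal
        ((2 * (4 * rosenthalConst (2 * Q) * K * A + (K + A) ^ 2 + K ^ 2 + K * A) + 2 * A ^ 2)
          * N) := by
  have hN' : (1 : ℝ) ≤ N := by exact_mod_cast hN
  have hsN : 1 ≤ Real.sqrt N := by rwa [Real.one_le_sqrt]
  have hr2 : 2 ≤ max 2 q := le_max_left _ _
  obtain ⟨D, hD1, hD3, hD4⟩ := h.exists_majorant_transform hf hq hK hN hT hA hR hR0 hSR hRA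
  let L : X → ℝ := fun x => ∑ i ∈ Finset.range N, K * ‖χ (f^[i] x)‖
  have hLi : ∀ i, BddMeas (fun x => K * ‖χ (f^[i] x)‖) := fun i =>
    (BddMeas.const K).mul (h.bddMeas_χ.comp (hf.measurable.iterate i)).norm
  have hL : BddMeas L := BddMeas.sum _ fun i _ => hLi i
  let H₁ : X → ℝ := fun x => ((D x + (χs x + R x) ^ 2) + L x) + K * R x
  have hχs0 : ∀ x, 0 ≤ χs x := fun x => (norm_nonneg _).trans (h.χ_le 0 (by omega) x)
  have hχR := h.bddMeas_χs.add hR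
  have hH₁ : BddMeas H₁ := ((hD1.add (hχR.pow 2)).add hL).add ((BddMeas.const K).mul hR)
  have hQ : ∀ j ≤ N, ∀ x, ‖iteratedBirkhoffSum T f v j (f^[N - j] x)‖ ≤ H₁ x := by
    intro j hj x
    have h1 := hD3 j hj x
    have h2 := h.norm_iteratedBirkhoffSum_sub_transform_le (by linarith) hT hR0 hSR hj x
    have h3 := norm_add_le (iteratedBirkhoffSum T f v j (f^[N - j] x) -
      transform T f m v j (f^[N - j] x)) (transform T f m v j (f^[N - j] x))
    rw [sub_add_cancel] at h3
    simp only [H₁, L]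
    linarith
  refine ⟨fun x => 2 * H₁ x + 2 * R x ^ 2, ((BddMeas.const 2).mul hH₁).add
    ((BddMeas.const 2).mul (hR.pow 2)), fun j hj x =>
    norm_iteratedBirkhoffSum_le_of_reversed hT hSR hQ hj x, ?_⟩
  have hp : 1 ≤ ENNReal.ofReal q := by rwa [ENNReal.one_le_ofReal]
  have hp2 : 1 ≤ ENNReal.ofReal (2 * q) := by rw [ENNReal.one_le_ofReal]; linarith
  have hrc1 := one_le_rosenthalConst hr2
  have hrc2 := rosenthalConst_mono (r := max 2 q) (s := 2 * Q) (by linarith)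
    (max_le (by linarith) (by linarith))
  have sq : Real.sqrt N ^ 2 = N := Real.sq_sqrt (by linarith)
  have b1 : eLpNorm D (ENNReal.ofReal q) μ ≤
      ENNReal.ofReal (4 * rosenthalConst (2 * Q) * K * A * N) := by
    refine (eLpNorm_le_eLpNorm_of_exponent_le (ENNReal.ofReal_le_ofReal (le_max_right 2 q))
      hD1.1.aestronglyMeasurable).trans (hD4.trans (ENNReal.ofReal_le_ofReal ?_))
    gcongr
  have b2 : eLpNorm (fun x => (χs x + R x) ^ 2) (ENNReal.ofReal q) μ ≤
      ENNReal.ofReal ((K + A) ^ 2 * N) := by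
    have := eLpNorm_sq_le (μ := μ) (q := q) (A := K * Real.sqrt N + A * Real.sqrt N)
      hχR (fun x => add_nonneg (hχs0 x) (hR0 x)) (by linarith) (by positivity)
      (eLpNorm_add_le_ofReal h.bddMeas_χs hR hp2 (by positivity) (by positivity)
        h.eLpNorm_χs hRA)
    rwa [← add_mul, mul_pow, sq] at this
  -- By stationarity all N summands have the same L^q norm, so the triangle inequality gives K² N
  -- without a bound on the maximum of χ.
  have b3 : eLpNorm L (ENNReal.ofReal q) μ ≤ ENNReal.ofReal (K ^ 2 * N) := by
    have := eLpNorm_sum_le_ofReal (μ := μ) hp hLi (a := K * K) (by positivity) (fun i => by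
      refine eLpNorm_const_mul_le_ofReal (by linarith) ?_
      refine le_trans (le_of_eq ?_) h.eLpNorm_χ
      rw [← eLpNorm_norm χ]
      exact eLpNorm_comp_measurePreserving (g := fun x => ‖χ x‖)
        h.bddMeas_χ.norm.1.aestronglyMeasurable (hf.iterate i)) N
    rwa [← pow_two, mul_comm] at this
  have b4 : eLpNorm (fun x => K * R x) (ENNReal.ofReal q) μ ≤
      ENNReal.ofReal (K * A * N) := by
    refine (eLpNorm_const_mul_le_ofReal (by linarith)
      ((eLpNorm_le_eLpNorm_of_exponent_le (ENNReal.ofReal_le_ofReal (by linarith : q ≤ 2 * q))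
      hR.1.aestronglyMeasurable).trans hRA)).trans (ENNReal.ofReal_le_ofReal ?_)
    have : Real.sqrt N ≤ N := by nlinarith
    rw [← mul_assoc]
    gcongr
  have b5 : eLpNorm (fun x => R x ^ 2) (ENNReal.ofReal q) μ ≤ ENNReal.ofReal (A ^ 2 * N) := by
    have := eLpNorm_sq_le (μ := μ) (q := q) hR hR0 (by linarith) (by positivity) hRA
    rwa [mul_pow, sq] at this
  have hρ0 : 0 ≤ rosenthalConst (2 * Q) := by linarith
  have c1 := eLpNorm_add_le_ofReal hD1 (hχR.pow 2) hp (by positivity)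
    (by positivity) b1 b2
  have c2 := eLpNorm_add_le_ofReal (hD1.add (hχR.pow 2)) hL hp
    (by positivity) (by positivity) c1 b3
  have c3 : eLpNorm H₁ (ENNReal.ofReal q) μ ≤ _ := eLpNorm_add_le_ofReal
    ((hD1.add (hχR.pow 2)).add hL) ((BddMeas.const K).mul hR) hp
    (by positivity) (by positivity) c2 b4
  have c4 := eLpNorm_add_le_ofReal ((BddMeas.const 2).mul hH₁)
    ((BddMeas.const 2).mul (hR.pow 2)) hp (by positivity) (by positivity)
    (eLpNorm_const_mul_le_ofReal (by norm_num) c3)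
    (eLpNorm_const_mul_le_ofReal (by norm_num) b5)
  refine c4.trans (ENNReal.ofReal_le_ofReal (le_of_eq ?_))
  ring

end MartingaleCoboundary

end MartingaleCoboundary

/-! ### Removal of the truncation. -/

section MomentBound

variable {X : Type*} [MeasurableSpace X] {μ : Measure X} [IsProbabilityMeasure μ] {f : X → X}
  {E E' : Type*} [NormedAddCommGroup E] [InnerProductSpace ℝ E] [MeasurableSpace E]
  [BorelSpace E] [FiniteDimensional ℝ E] [NormedAddCommGroup E'] [InnerProductSpace ℝ E']
  [MeasurableSpace E'] [BorelSpace E'] [FiniteDimensional ℝ E']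

/-- The constant in the moment bounds for Birkhoff sums. -/
noncomputable def momentConst (Q K : ℝ) : ℝ :=
  let A := (4 * rosenthalConst (2 * Q) + 3) * K
  (2 * (4 * rosenthalConst (2 * Q) * K * A + (K + A) ^ 2 + K ^ 2 + K * A) + 2 * A ^ 2) + 2 * A +
    K ^ 3

theorem eLpNorm_indicator_const_le_ofReal {s : Set X} (hs : MeasurableSet s) {r a c b : ℝ}
    (hr : 0 < r) (ha : 0 ≤ a) (hc : 0 ≤ c) (hμ : μ s ≤ ENNReal.ofReal a)
    (h : c * a ^ (1 / r) ≤ b) :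
    eLpNorm (s.indicator fun _ => c) (ENNReal.ofReal r) μ ≤ ENNReal.ofReal b := by
  rw [eLpNorm_indicator_const hs (by simpa using hr) ENNReal.ofReal_ne_top,
    ENNReal.toReal_ofReal hr.le, Real.enorm_of_nonneg hc]
  calc ENNReal.ofReal c * μ s ^ (1 / r) ≤ ENNReal.ofReal c * ENNReal.ofReal a ^ (1 / r) := by
        gcongr
    _ = ENNReal.ofReal (c * a ^ (1 / r)) := by
        rw [ENNReal.ofReal_rpow_of_nonneg ha (by positivity), ENNReal.ofReal_mul hc]
    _ ≤ _ := ENNReal.ofReal_le_ofReal h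

variable {q K Q : ℝ} {N : ℕ} {v m χ c V : X → E} {χs : X → ℝ}

/-- Off the bad set the sums of V and v coincide up to time N. On it the trivial bounds NK and (NK)²
are used; as its measure is O(N^{-q}), their norms are O(N · N^{-1/2}) in L^{2q} and O(N² · N^{-1})
in L^q. -/
theorem MartingaleCoboundary.exists_majorants (h : MartingaleCoboundary μ f q K N v m χ c χs)
    (hf : MeasurePreserving f μ μ) (hq : 1 ≤ q) (hqQ : q ≤ Q) (hK : 1 ≤ K) (hN : 1 ≤ N)
    {bad : Set X} (hbad : MeasurableSet bad)
    (hμbad : μ bad ≤ ENNReal.ofReal (K * (N : ℝ) ^ (-q)))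
    (hV : ∀ x ∉ bad, ∀ k < N, V (f^[k] x) = v (f^[k] x)) (hVK : ∀ x, ‖V x‖ ≤ K)
    (T : E →L[ℝ] E →L[ℝ] E') (hT : ‖T‖ ≤ 1) :
    ∃ G H : X → ℝ, Measurable G ∧ Measurable H ∧
      (∀ j ≤ N, ∀ x, ‖birkhoffSum f V j x‖ ≤ G x) ∧
      (∀ j ≤ N, ∀ x, ‖iteratedBirkhoffSum T f V j x‖ ≤ H x) ∧
      eLpNorm G (ENNReal.ofReal (2 * q)) μ ≤ ENNReal.ofReal (momentConst Q K * Real.sqrt N) ∧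
      eLpNorm H (ENNReal.ofReal q) μ ≤ ENNReal.ofReal (momentConst Q K * N) := by
  have hN' : (1 : ℝ) ≤ N := by exact_mod_cast hN
  have hN0 : (0 : ℝ) < N := by linarith
  have hρ := one_le_rosenthalConst (r := 2 * Q) (by linarith)
  set A := (4 * rosenthalConst (2 * Q) + 3) * K with hA
  have hA1 : 1 ≤ A := by nlinarith
  obtain ⟨R, hR, hR0, hSR, hRA⟩ := h.exists_majorant_birkhoffSum hf hq hqQ hK hN
  obtain ⟨H, hH, hQH, hHA⟩ := h.exists_majorant_iteratedBirkhoffSum hf hq hqQ hK hN T hT hA1 hR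
    hR0 hSR hRA
  have hcomp : ∀ j ≤ N, ∀ x ∉ bad, birkhoffSum f V j x = birkhoffSum f v j x := by
    intro j hj x hx
    refine Finset.sum_congr rfl fun i hi => hV x hx i ?_
    have := Finset.mem_range.1 hi
    omega
  have hcomp2 : ∀ j ≤ N, ∀ x ∉ bad,
      iteratedBirkhoffSum T f V j x = iteratedBirkhoffSum T f v j x := by
    intro j hj x hx
    refine Finset.sum_congr rfl fun i hi => ?_
    have := Finset.mem_range.1 hi
    rw [hcomp i (by omega) x hx, hV x hx i (by omega)]
  have hmN : Measurable (bad.indicator fun _ : X => (N * K : ℝ)) :=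
    measurable_const.indicator hbad
  have hmN2 : Measurable (bad.indicator fun _ : X => ((N * K) ^ 2 : ℝ)) :=
    measurable_const.indicator hbad
  have hbN : BddMeas (bad.indicator fun _ : X => (N * K : ℝ)) :=
    ⟨hmN, N * K, fun x => (norm_indicator_le_norm_self _ _).trans (by
      rw [Real.norm_of_nonneg (by positivity)])⟩
  have hbN2 : BddMeas (bad.indicator fun _ : X => ((N * K) ^ 2 : ℝ)) :=
    ⟨hmN2, (N * K) ^ 2, fun x => (norm_indicator_le_norm_self _ _).trans (by
      rw [Real.norm_of_nonneg (by positivity)])⟩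
  have hqinv : ∀ r : ℝ, 1 ≤ r → K ^ (1 / r) ≤ K := fun r hr =>
    Real.rpow_le_self_of_one_le hK (by rw [div_le_one (by linarith)]; exact hr)
  have e1 : eLpNorm (bad.indicator fun _ : X => (N * K : ℝ)) (ENNReal.ofReal (2 * q)) μ ≤
      ENNReal.ofReal (K ^ 2 * Real.sqrt N) := by
    refine eLpNorm_indicator_const_le_ofReal hbad (by linarith) (by positivity)
      (by positivity) hμbad ?_
    rw [Real.mul_rpow (by linarith) (by positivity), ← Real.rpow_mul hN0.le]
    have e : -q * (1 / (2 * q)) = -(1 / 2) := by field_simp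
    have e2 : (N : ℝ) * (N : ℝ) ^ (-(1 / 2) : ℝ) = Real.sqrt N := by
      rw [Real.sqrt_eq_rpow, ← Real.rpow_one_add' hN0.le (by norm_num)]; norm_num
    rw [e]
    calc (N : ℝ) * K * (K ^ (1 / (2 * q)) * (N : ℝ) ^ (-(1 / 2) : ℝ))
        = K * K ^ (1 / (2 * q)) * (N * (N : ℝ) ^ (-(1 / 2) : ℝ)) := by ring
      _ ≤ K * K * (N * (N : ℝ) ^ (-(1 / 2) : ℝ)) := by
        gcongr
        exact hqinv _ (by linarith)
      _ = _ := by rw [e2]; ring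
  have e2 : eLpNorm (bad.indicator fun _ : X => ((N * K) ^ 2 : ℝ)) (ENNReal.ofReal q) μ ≤
      ENNReal.ofReal (K ^ 3 * N) := by
    refine eLpNorm_indicator_const_le_ofReal hbad (by linarith) (by positivity)
      (by positivity) hμbad ?_
    rw [Real.mul_rpow (by linarith) (by positivity), ← Real.rpow_mul hN0.le]
    have e : -q * (1 / q) = -1 := by field_simp
    rw [e, Real.rpow_neg_one]
    calc ((N : ℝ) * K) ^ 2 * (K ^ (1 / q) * (N : ℝ)⁻¹) = K ^ 2 * K ^ (1 / q) * N := by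
          field_simp
      _ ≤ K ^ 2 * K * N := by
        gcongr
        exact hqinv _ hq
      _ = _ := by ring
  have hpos : ∀ x ∈ bad, 0 ≤ H x := fun x _ => (norm_nonneg _).trans (hQH 0 (by omega) x)
  have hK2 : K ^ 2 ≤ K ^ 3 := pow_le_pow_right₀ hK (by norm_num)
  refine ⟨fun x => 2 * R x + bad.indicator (fun _ => (N * K : ℝ)) x,
    fun x => H x + bad.indicator (fun _ => ((N * K) ^ 2 : ℝ)) x,
    (hR.1.const_mul 2).add hmN, hH.1.add hmN2, fun j hj x => ?_, fun j hj x => ?_, ?_, ?_⟩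
  · by_cases hx : x ∈ bad
    · beta_reduce
      rw [indicator_of_mem hx]
      have h1 := norm_birkhoffSum_le hVK j x (f := f)
      have h2 : (j : ℝ) * K ≤ N * K := by gcongr
      have := hR0 x
      linarith
    · beta_reduce
      rw [indicator_of_notMem hx, hcomp j hj x hx, add_zero]
      have h3 := hSR N le_rfl x
      have h4 := hSR (N - j) (by omega) x
      rw [Nat.sub_self, Function.iterate_zero, id] at h3
      rw [Nat.sub_sub_self hj] at h4
      have e3 := birkhoffSum_add f v j (N - j) x
      rw [Nat.add_sub_cancel' hj] at e3
      rw [← add_sub_cancel_right (birkhoffSum f v j x) (birkhoffSum f v (N - j) (f^[j] x)), ← e3]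
      have := norm_sub_le (birkhoffSum f v N x) (birkhoffSum f v (N - j) (f^[j] x))
      linarith
  · by_cases hx : x ∈ bad
    · beta_reduce
      rw [indicator_of_mem hx]
      have h1 := norm_iteratedBirkhoffSum_le (f := f) T hT (by linarith) hVK hj x
      have := hpos x hx
      linarith
    · beta_reduce
      rw [indicator_of_notMem hx, hcomp2 j hj x hx, add_zero]
      exact hQH j hj x
  · have hp : 1 ≤ ENNReal.ofReal (2 * q) := by rw [ENNReal.one_le_ofReal]; linarith
    refine (eLpNorm_add_le_ofReal ((BddMeas.const 2).mul hR) hbN hp (by positivity)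
      (by positivity) (eLpNorm_const_mul_le_ofReal (by norm_num) hRA) e1).trans
      (ENNReal.ofReal_le_ofReal ?_)
    rw [← mul_assoc, ← add_mul]
    refine mul_le_mul_of_nonneg_right ?_ (Real.sqrt_nonneg _)
    simp only [momentConst, ← hA]
    have : 0 ≤ 2 * (4 * rosenthalConst (2 * Q) * K * A + (K + A) ^ 2 + K ^ 2 + K * A) +
      2 * A ^ 2 := by positivity
    linarith
  · have hp : 1 ≤ ENNReal.ofReal q := by rwa [ENNReal.one_le_ofReal]
    refine (eLpNorm_add_le_ofReal hH hbN2 hp (by positivity)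
      (by positivity) hHA e2).trans (ENNReal.ofReal_le_ofReal ?_)
    rw [← add_mul]
    refine mul_le_mul_of_nonneg_right ?_ hN0.le
    simp only [momentConst, ← hA]
    linarith

end MomentBound

/-! ### Maps with countably many full branches -/

/-- The exponential function with values in `[0, ∞]`. -/
noncomputable def eexp (t : ℝ) : ℝ≥0∞ := ENNReal.ofReal (Real.exp t)

theorem eexp_add (s t : ℝ) : eexp (s + t) = eexp s * eexp t := by
  rw [eexp, Real.exp_add, ENNReal.ofReal_mul (Real.exp_pos s).le]; rfl

theorem eexp_mono {s t : ℝ} (h : s ≤ t) : eexp s ≤ eexp t :=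
  ENNReal.ofReal_le_ofReal (Real.exp_le_exp.2 h)

theorem eexp_ne_top (t : ℝ) : eexp t ≠ ∞ := ENNReal.ofReal_ne_top

theorem one_le_eexp {t : ℝ} (h : 0 ≤ t) : 1 ≤ eexp t := by
  rw [eexp, ENNReal.one_le_ofReal]; exact Real.one_le_exp h

/-- `F` has countably many full branches on the full measure set `Z`, with inverse branches `g i`
and weights `w i` (the inverse Jacobians with respect to `lam`). The function `δ` plays the role of
the metric; the inverse branches contract it by the factor `γ` and the weights are log-Lipschitz. -/
structure FullBranchSystem {X ι : Type*} [MeasurableSpace X] (F : X → X) (lam : Measure X)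
    (Z : Set X) (g : ι → X → X) (w : ι → X → ℝ≥0∞) (δ : X → X → ℝ) (C γ D : ℝ) : Prop where
  isProbabilityMeasure : IsProbabilityMeasure lam
  measurable_F : Measurable F
  measurableSet_Z : MeasurableSet Z
  measure_compl_Z : lam Zᶜ = 0
  countable : Countable ι
  measurable_g : ∀ i, Measurable (g i)
  measurable_w : ∀ i, Measurable (w i)
  g_mem : ∀ i, ∀ y ∈ Z, g i y ∈ Z
  F_g : ∀ i, ∀ y ∈ Z, F (g i y) = y
  lintegral_eq : ∀ φ : X → ℝ≥0∞, Measurable φ →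
    ∫⁻ y, ∑' i, w i y * φ (g i y) ∂lam = ∫⁻ y, φ y ∂lam
  δ_nonneg : ∀ x y, 0 ≤ δ x y
  δ_le : ∀ x ∈ Z, ∀ y ∈ Z, δ x y ≤ D
  δ_g_le : ∀ i, ∀ x ∈ Z, ∀ y ∈ Z, δ (g i x) (g i y) ≤ γ * δ x y
  w_le : ∀ i, ∀ x ∈ Z, ∀ y ∈ Z, w i x ≤ eexp (C * δ x y) * w i y
  C_nonneg : 0 ≤ C
  γ_pos : 0 < γ
  γ_lt_one : γ < 1
  D_nonneg : 0 ≤ D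

/-- The transfer operator. -/
noncomputable def transferOp {X ι : Type*} (g : ι → X → X) (w : ι → X → ℝ≥0∞)
    (φ : X → ℝ≥0∞) (y : X) : ℝ≥0∞ := ∑' i, w i y * φ (g i y)

/-- Functions whose logarithm is `K`-Lipschitz on `Z` with respect to `δ`. -/
def LogLip {X : Type*} (Z : Set X) (δ : X → X → ℝ) (K : ℝ) (φ : X → ℝ≥0∞) : Prop :=
  ∀ x ∈ Z, ∀ y ∈ Z, φ x ≤ eexp (K * δ x y) * φ y

/-- A regularity constant preserved by the transfer operator. -/
noncomputable def regConst (C γ : ℝ) : ℝ := 2 * (C + 1) / (1 - γ)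

/-- The proportion of mass that can be coupled in one step. -/
noncomputable def couplingConst (C γ D : ℝ) : ℝ :=
  (1 - γ) / (1 + γ) * Real.exp (-(regConst C γ * D))

namespace FullBranchSystem

variable {X ι : Type*} [MeasurableSpace X] {F : X → X} {lam : Measure X}
  {Z : Set X} {g : ι → X → X} {w : ι → X → ℝ≥0∞} {δ : X → X → ℝ} {C γ D : ℝ}

theorem measurable_transferOp (S : FullBranchSystem F lam Z g w δ C γ D) {φ : X → ℝ≥0∞}
    (hφ : Measurable φ) : Measurable (transferOp g w φ) := by
  have := S.countable
  exact Measurable.tsum fun i => (S.measurable_w i).mul (hφ.comp (S.measurable_g i))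

theorem measurable_iterate (S : FullBranchSystem F lam Z g w δ C γ D) {φ : X → ℝ≥0∞}
    (hφ : Measurable φ) (n : ℕ) : Measurable ((transferOp g w)^[n] φ) := by
  induction n with
  | zero => exact hφ
  | succ n ih => rw [Function.iterate_succ_apply']; exact S.measurable_transferOp ih

theorem ae_mem (S : FullBranchSystem F lam Z g w δ C γ D) : ∀ᵐ x ∂lam, x ∈ Z :=
  mem_ae_iff.2 S.measure_compl_Z

theorem lintegral_transferOp_mul (S : FullBranchSystem F lam Z g w δ C γ D) {φ ψ : X → ℝ≥0∞}
    (hφ : Measurable φ) (hψ : Measurable ψ) :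
    ∫⁻ y, transferOp g w φ y * ψ y ∂lam = ∫⁻ y, φ y * ψ (F y) ∂lam := by
  rw [← S.lintegral_eq (fun y => φ y * ψ (F y)) (hφ.mul (hψ.comp S.measurable_F))]
  refine lintegral_congr_ae (S.ae_mem.mono fun y hy => ?_)
  simp only [transferOp]
  rw [← ENNReal.tsum_mul_right]
  exact tsum_congr fun i => by rw [S.F_g i y hy, mul_assoc]

theorem lintegral_iterate_mul (S : FullBranchSystem F lam Z g w δ C γ D) {φ ψ : X → ℝ≥0∞}
    (hφ : Measurable φ) (hψ : Measurable ψ) (n : ℕ) :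
    ∫⁻ y, (transferOp g w)^[n] φ y * ψ y ∂lam = ∫⁻ y, φ y * ψ (F^[n] y) ∂lam := by
  induction n generalizing ψ with
  | zero => rfl
  | succ n ih =>
    simp_rw [Function.iterate_succ_apply']
    rw [S.lintegral_transferOp_mul (S.measurable_iterate hφ n) hψ,
      ih (ψ := fun y => ψ (F y)) (hψ.comp S.measurable_F)]

theorem lintegral_iterate (S : FullBranchSystem F lam Z g w δ C γ D) {φ : X → ℝ≥0∞}
    (hφ : Measurable φ) (n : ℕ) :
    ∫⁻ y, (transferOp g w)^[n] φ y ∂lam = ∫⁻ y, φ y ∂lam := by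
  simpa using S.lintegral_iterate_mul hφ (ψ := fun _ => 1) measurable_const n

theorem lintegral_transferOp (S : FullBranchSystem F lam Z g w δ C γ D) {φ : X → ℝ≥0∞}
    (hφ : Measurable φ) : ∫⁻ y, transferOp g w φ y ∂lam = ∫⁻ y, φ y ∂lam :=
  S.lintegral_eq φ hφ

theorem transferOp_congr (S : FullBranchSystem F lam Z g w δ C γ D) {φ ψ : X → ℝ≥0∞}
    (h : ∀ y ∈ Z, φ y = ψ y) {y : X} (hy : y ∈ Z) : transferOp g w φ y = transferOp g w ψ y :=
  tsum_congr fun i => by rw [h _ (S.g_mem i y hy)]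

theorem transferOp_mono (S : FullBranchSystem F lam Z g w δ C γ D) {φ ψ : X → ℝ≥0∞}
    (h : ∀ y ∈ Z, φ y ≤ ψ y) {y : X} (hy : y ∈ Z) : transferOp g w φ y ≤ transferOp g w ψ y :=
  ENNReal.tsum_le_tsum fun i => by gcongr; exact h _ (S.g_mem i y hy)

theorem transferOp_add (φ ψ : X → ℝ≥0∞) (y : X) :
    transferOp g w (fun x => φ x + ψ x) y = transferOp g w φ y + transferOp g w ψ y := by
  simp only [transferOp, mul_add]
  exact ENNReal.tsum_add

theorem transferOp_const_mul (a : ℝ≥0∞) (φ : X → ℝ≥0∞) (y : X) :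
    transferOp g w (fun x => a * φ x) y = a * transferOp g w φ y := by
  simp only [transferOp, ← ENNReal.tsum_mul_left]
  exact tsum_congr fun i => by ring

theorem iterate_congr (S : FullBranchSystem F lam Z g w δ C γ D) {φ ψ : X → ℝ≥0∞}
    (h : ∀ y ∈ Z, φ y = ψ y) (n : ℕ) :
    ∀ y ∈ Z, (transferOp g w)^[n] φ y = (transferOp g w)^[n] ψ y := by
  induction n with
  | zero => exact h
  | succ n ih =>
    intro y hy
    simp_rw [Function.iterate_succ_apply']
    exact S.transferOp_congr ih hy

theorem iterate_add (S : FullBranchSystem F lam Z g w δ C γ D) (φ ψ : X → ℝ≥0∞) (n : ℕ) :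
    ∀ y ∈ Z, (transferOp g w)^[n] (fun x => φ x + ψ x) y =
      (transferOp g w)^[n] φ y + (transferOp g w)^[n] ψ y := by
  induction n with
  | zero => exact fun _ _ => rfl
  | succ n ih =>
    intro y hy
    simp_rw [Function.iterate_succ_apply']
    rw [S.transferOp_congr ih hy, transferOp_add]

theorem logLip_mono {K K' : ℝ} (S : FullBranchSystem F lam Z g w δ C γ D) (hK : K ≤ K')
    {φ : X → ℝ≥0∞} (h : LogLip Z δ K φ) : LogLip Z δ K' φ := fun x hx y hy =>
  (h x hx y hy).trans (by
    have := S.δ_nonneg x y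
    exact mul_le_mul_left (eexp_mono (by gcongr)) _)

/-- Inverse branches contract δ by γ, and the weights contribute C. This Lasota-Yorke type estimate
holds branch by branch, hence for the sum. -/
theorem logLip_transferOp {K : ℝ} (S : FullBranchSystem F lam Z g w δ C γ D) (hK : 0 ≤ K)
    {φ : X → ℝ≥0∞} (h : LogLip Z δ K φ) : LogLip Z δ (C + K * γ) (transferOp g w φ) := by
  intro x hx y hy
  simp only [transferOp, ← ENNReal.tsum_mul_left]
  refine ENNReal.tsum_le_tsum fun i => ?_
  have h1 := S.w_le i x hx y hy
  have h2 := h _ (S.g_mem i x hx) _ (S.g_mem i y hy)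
  have h3 : eexp (K * δ (g i x) (g i y)) ≤ eexp (K * (γ * δ x y)) :=
    eexp_mono (by have := S.δ_g_le i x hx y hy; gcongr)
  calc w i x * φ (g i x) ≤ (eexp (C * δ x y) * w i y) * (eexp (K * (γ * δ x y)) * φ (g i y)) := by
        gcongr
        exact h2.trans (by gcongr)
    _ = eexp ((C + K * γ) * δ x y) * (w i y * φ (g i y)) := by
        rw [add_mul, mul_assoc K, eexp_add]; ring

/-- A Harnack bound: on a set of diameter D a log-Lipschitz function is comparable to its mean. -/
theorem le_eexp_mul_lintegral {K : ℝ} (S : FullBranchSystem F lam Z g w δ C γ D) (hK : 0 ≤ K)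
    {φ : X → ℝ≥0∞} (h : LogLip Z δ K φ) {y : X} (hy : y ∈ Z) :
    φ y ≤ eexp (K * D) * ∫⁻ x, φ x ∂lam := by
  have := S.isProbabilityMeasure
  rw [← lintegral_const_mul' _ _ (eexp_ne_top _)]
  calc φ y = ∫⁻ _, φ y ∂lam := by simp
    _ ≤ _ := lintegral_mono_ae (S.ae_mem.mono fun x hx => (h y hy x hx).trans (by
        gcongr; exact eexp_mono (by have := S.δ_le y hy x hx; gcongr)))

theorem lintegral_le_eexp_mul {K : ℝ} (S : FullBranchSystem F lam Z g w δ C γ D) (hK : 0 ≤ K)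
    {φ : X → ℝ≥0∞} (h : LogLip Z δ K φ) {y : X} (hy : y ∈ Z) :
    ∫⁻ x, φ x ∂lam ≤ eexp (K * D) * φ y := by
  have := S.isProbabilityMeasure
  calc ∫⁻ x, φ x ∂lam ≤ ∫⁻ _, eexp (K * D) * φ y ∂lam :=
        lintegral_mono_ae (S.ae_mem.mono fun x hx => (h x hx y hy).trans (by
          gcongr; exact eexp_mono (by have := S.δ_le x hx y hy; gcongr)))
    _ = _ := by simp

/-- Subtracting at most the proportion s/(1+s) of a positive function worsens its logarithmic
Lipschitz constant only by the factor 1 + s. The reason is Bernoulli's inequality 1 + (1+s)(e^t - 1)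
≤ e^{(1+s)t}. -/
theorem sub_le_exp_mul_sub {a b c s t : ℝ} (hs : 0 < s) (ht : 0 ≤ t) (hc0 : 0 ≤ c)
    (hab : a ≤ Real.exp t * b) (hc : (1 + s) * c ≤ s * b) :
    a - c ≤ Real.exp ((1 + s) * t) * (b - c) := by
  have h1 : 1 + (1 + s) * (Real.exp t - 1) ≤ Real.exp ((1 + s) * t) := by
    have := one_add_mul_self_le_rpow_one_add (s := Real.exp t - 1) (p := 1 + s)
      (by have := Real.exp_pos t; linarith) (by linarith)
    rwa [add_sub_cancel, ← Real.exp_mul, mul_comm t] at this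
  have h3 : c ≤ s * (b - c) := by linarith
  have hbc : 0 ≤ b - c := by
    by_contra hneg
    push Not at hneg
    nlinarith
  have h4 : (1 + (1 + s) * (Real.exp t - 1)) * (b - c) ≤
    Real.exp ((1 + s) * t) * (b - c) := by gcongr
  have h5 : c * (Real.exp t - 1) ≤ s * (b - c) * (Real.exp t - 1) := by
    gcongr
    have := Real.one_le_exp ht
    linarith
  linarith

theorem logLip_sub_const {K s : ℝ} {φ : X → ℝ≥0∞} {c : ℝ≥0∞} (hs : 0 < s)
    (h : LogLip Z δ K φ) (hφ : ∀ y ∈ Z, φ y ≠ ∞) (hδ : ∀ x y, 0 ≤ δ x y) (hK : 0 ≤ K)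
    (hc : ∀ y ∈ Z, ENNReal.ofReal (1 + s) * c ≤ ENNReal.ofReal s * φ y) :
    LogLip Z δ ((1 + s) * K) (fun y => φ y - c) := by
  intro x hx y hy
  have h1 := h x hx y hy
  have h2 := hc y hy
  have hct : c ≠ ∞ := by
    rintro rfl
    rw [ENNReal.mul_top (by simp; linarith), top_le_iff] at h2
    exact ENNReal.mul_ne_top ENNReal.ofReal_ne_top (hφ y hy) h2
  lift c to NNReal using hct
  obtain ⟨a, ha⟩ : ∃ a : NNReal, φ x = a := ⟨_, (ENNReal.coe_toNNReal (hφ x hx)).symm⟩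
  obtain ⟨b, hb⟩ : ∃ b : NNReal, φ y = b := ⟨_, (ENNReal.coe_toNNReal (hφ y hy)).symm⟩
  simp only [ha, hb, eexp] at h1 h2 ⊢
  rw [← ENNReal.ofReal_coe_nnreal, ← ENNReal.ofReal_coe_nnreal,
    ← ENNReal.ofReal_mul (Real.exp_pos _).le,
    ENNReal.ofReal_le_ofReal_iff (by positivity)] at h1
  rw [← ENNReal.ofReal_coe_nnreal, ← ENNReal.ofReal_coe_nnreal,
    ← ENNReal.ofReal_mul hs.le, ← ENNReal.ofReal_mul (by linarith),
    ENNReal.ofReal_le_ofReal_iff (by positivity)] at h2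
  have h3 := sub_le_exp_mul_sub hs (mul_nonneg hK (hδ x y)) c.2 h1 h2
  rw [← ENNReal.ofReal_coe_nnreal, ← ENNReal.ofReal_coe_nnreal, ← ENNReal.ofReal_coe_nnreal,
    ← ENNReal.ofReal_sub (a : ℝ) c.coe_nonneg, ← ENNReal.ofReal_sub (b : ℝ) c.coe_nonneg,
    ← ENNReal.ofReal_mul (Real.exp_pos _).le, mul_assoc]
  exact ENNReal.ofReal_le_ofReal h3

theorem regConst_nonneg (S : FullBranchSystem F lam Z g w δ C γ D) : 0 ≤ regConst C γ := by
  have := S.C_nonneg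
  have := S.γ_lt_one
  exact div_nonneg (by linarith) (by linarith)

theorem couplingConst_pos (S : FullBranchSystem F lam Z g w δ C γ D) :
    0 < couplingConst C γ D := by
  have := S.γ_pos
  have := S.γ_lt_one
  exact mul_pos (div_pos (by linarith) (by linarith)) (Real.exp_pos _)

theorem couplingConst_lt_one (S : FullBranchSystem F lam Z g w δ C γ D) :
    couplingConst C γ D < 1 := by
  have h1 := S.γ_pos
  have h2 := S.γ_lt_one
  have h3 : (1 - γ) / (1 + γ) < 1 := by rw [div_lt_one (by linarith)]; linarith
  have h4 : Real.exp (-(regConst C γ * D)) ≤ 1 := by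
    rw [Real.exp_le_one_iff]
    have := mul_nonneg S.regConst_nonneg S.D_nonneg
    linarith
  have h5 : 0 < (1 - γ) / (1 + γ) := div_pos (by linarith) (by linarith)
  unfold couplingConst
  nlinarith [Real.exp_pos (-(regConst C γ * D))]

/-- With s = (1-γ)/(2γ) one has (1+s)γ = (1+γ)/2 < 1, so the contraction of the transfer operator
absorbs the loss caused by the subtraction, and the regularity constant is preserved by a coupling
step. -/
theorem regConst_step (S : FullBranchSystem F lam Z g w δ C γ D) :
    C + (1 + (1 - γ) / (2 * γ)) * regConst C γ * γ ≤ regConst C γ := by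
  have h1 := S.γ_pos
  have h2 := S.γ_lt_one
  have h4 : (0 : ℝ) < 1 - γ := by linarith
  have h3 : regConst C γ * (1 - γ) = 2 * (C + 1) := by
    unfold regConst; field_simp
  have h5 : (1 + (1 - γ) / (2 * γ)) * regConst C γ * γ = (1 + γ) / 2 * regConst C γ := by
    field_simp
    ring
  rw [h5]
  nlinarith

/-- One coupling step: after removal of a constant proportion of the mass, the remainder is
mapped by the transfer operator to a function that is again log-Lipschitz. -/
theorem exists_coupling (S : FullBranchSystem F lam Z g w δ C γ D) {φ : X → ℝ≥0∞}
    (hφ : Measurable φ) (h : LogLip Z δ (regConst C γ) φ) (hfin : ∫⁻ x, φ x ∂lam ≠ ∞) :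
    ∃ ψ : X → ℝ≥0∞, Measurable ψ ∧ LogLip Z δ (regConst C γ) (transferOp g w ψ) ∧
      ∫⁻ x, ψ x ∂lam = ENNReal.ofReal (1 - couplingConst C γ D) * ∫⁻ x, φ x ∂lam ∧
      ∀ y ∈ Z, φ y = ENNReal.ofReal (couplingConst C γ D) * ∫⁻ x, φ x ∂lam + ψ y := by
  have := S.isProbabilityMeasure
  have h1 := S.γ_pos
  have h2 := S.γ_lt_one
  have hK := S.regConst_nonneg
  have hε0 := S.couplingConst_pos
  have hε1 := S.couplingConst_lt_one
  set a := ∫⁻ x, φ x ∂lam with ha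
  set ε := couplingConst C γ D with hε
  set s := (1 - γ) / (2 * γ) with hs
  have hs0 : 0 < s := div_pos (by linarith) (by linarith)
  set c := ENNReal.ofReal ε * a with hc
  have hct : c ≠ ∞ := ENNReal.mul_ne_top ENNReal.ofReal_ne_top hfin
  -- The coupling constant is chosen for this identity: with the Harnack bound it says that the
  -- constant ε∫φ is at most the proportion s/(1+s) of φ at every point of Z.
  have hsε : (1 + s) * ε * Real.exp (regConst C γ * D) = s := by
    rw [hε, couplingConst, mul_assoc, mul_assoc, ← Real.exp_add, neg_add_cancel, Real.exp_zero,
      hs]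
    field_simp
    ring
  have hcs : ∀ y ∈ Z, ENNReal.ofReal (1 + s) * c ≤ ENNReal.ofReal s * φ y := by
    intro y hy
    calc ENNReal.ofReal (1 + s) * c
        ≤ ENNReal.ofReal (1 + s) * (ENNReal.ofReal ε * (eexp (regConst C γ * D) * φ y)) := by
          rw [hc]; gcongr; exact S.lintegral_le_eexp_mul hK h hy
      _ = ENNReal.ofReal ((1 + s) * ε * Real.exp (regConst C γ * D)) * φ y := by
          rw [eexp, ENNReal.ofReal_mul (by positivity), ENNReal.ofReal_mul (by positivity)]
          ring
      _ = _ := by rw [hsε]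
  have hcφ : ∀ y ∈ Z, c ≤ φ y := by
    intro y hy
    have h3 := hcs y hy
    have h4 : ENNReal.ofReal s * φ y ≤ ENNReal.ofReal (1 + s) * φ y := by gcongr; linarith
    exact (ENNReal.mul_le_mul_iff_right (by simp; linarith) ENNReal.ofReal_ne_top).1
      (h3.trans h4)
  have hφt : ∀ y ∈ Z, φ y ≠ ∞ := fun y hy => ne_top_of_le_ne_top
    (ENNReal.mul_ne_top (eexp_ne_top _) hfin) (S.le_eexp_mul_lintegral hK h hy)
  refine ⟨fun y => φ y - c, hφ.sub measurable_const, ?_, ?_, fun y hy => ?_⟩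
  · exact S.logLip_mono S.regConst_step (S.logLip_transferOp (by positivity)
      (logLip_sub_const hs0 h hφt S.δ_nonneg hK hcs))
  · have h5 : ∫⁻ x, (φ x - c) ∂lam + c = a := by
      rw [ha]
      calc ∫⁻ x, (φ x - c) ∂lam + c = ∫⁻ x, (φ x - c) ∂lam + ∫⁻ _, c ∂lam := by simp
        _ = ∫⁻ x, ((φ x - c) + c) ∂lam := (lintegral_add_right _ measurable_const).symm
        _ = _ := lintegral_congr_ae (S.ae_mem.mono fun x hx => tsub_add_cancel_of_le (hcφ x hx))
    have h6 : ENNReal.ofReal (1 - ε) * a + c = a := by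
      rw [hc, ← add_mul, ← ENNReal.ofReal_add (by linarith) hε0.le]
      simp
    exact (ENNReal.add_left_inj hct).1 (h5.trans h6.symm)
  · rw [add_tsub_cancel_of_le (hcφ y hy)]

/-- Two regular functions of equal mass share the same constant part, whose iterates cancel. The
remainders have mass smaller by the factor 1 - ε and become regular again after one application of
the operator, so induction gives an error that decays geometrically. -/
theorem iterate_le_add (S : FullBranchSystem F lam Z g w δ C γ D) (n : ℕ) {φ₁ φ₂ : X → ℝ≥0∞}
    (hφ₁ : Measurable φ₁) (hφ₂ : Measurable φ₂) (h₁ : LogLip Z δ (regConst C γ) φ₁)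
    (h₂ : LogLip Z δ (regConst C γ) φ₂) (hfin : ∫⁻ x, φ₁ x ∂lam ≠ ∞)
    (heq : ∫⁻ x, φ₁ x ∂lam = ∫⁻ x, φ₂ x ∂lam) :
    ∀ y ∈ Z, (transferOp g w)^[n] φ₁ y ≤ (transferOp g w)^[n] φ₂ y +
      ENNReal.ofReal (1 - couplingConst C γ D) ^ n * eexp (regConst C γ * D) *
        ∫⁻ x, φ₁ x ∂lam := by
  induction n generalizing φ₁ φ₂ with
  | zero =>
    intro y hy
    have := S.le_eexp_mul_lintegral S.regConst_nonneg h₁ hy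
    simp only [Function.iterate_zero, id, pow_zero, one_mul]
    exact this.trans le_add_self
  | succ n ih =>
    intro y hy
    obtain ⟨ψ₁, m1, l1, i1, e1⟩ := S.exists_coupling hφ₁ h₁ hfin
    obtain ⟨ψ₂, m2, l2, i2, e2⟩ := S.exists_coupling hφ₂ h₂ (heq ▸ hfin)
    set c := ENNReal.ofReal (couplingConst C γ D) * ∫⁻ x, φ₁ x ∂lam with hc
    rw [← heq] at e2 i2
    have j1 := S.lintegral_transferOp m1
    have j2 := S.lintegral_transferOp m2
    have h3 := ih (S.measurable_transferOp m1) (S.measurable_transferOp m2) l1 l2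
      (by rw [j1, i1]; exact ENNReal.mul_ne_top ENNReal.ofReal_ne_top hfin)
      (by rw [j1, j2, i1, i2]) y hy
    rw [j1, i1] at h3
    have e : ∀ (φ ψ : X → ℝ≥0∞), (∀ y ∈ Z, φ y = c + ψ y) → (transferOp g w)^[n + 1] φ y =
        (transferOp g w)^[n + 1] (fun _ => c) y + (transferOp g w)^[n] (transferOp g w ψ) y := by
      intro φ ψ h
      rw [S.iterate_congr h (n + 1) y hy, S.iterate_add (fun _ => c) ψ (n + 1) y hy,
        ← Function.iterate_succ_apply]
    rw [e _ _ e1, e _ _ e2, add_assoc]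
    gcongr
    refine h3.trans (le_of_eq ?_)
    ring

end FullBranchSystem

/-! ### The invariant density and its bounds. -/

/-- The error after `n` coupling steps. -/
noncomputable def couplingError (C γ D : ℝ) (n : ℕ) : ℝ≥0∞ :=
  ENNReal.ofReal (1 - couplingConst C γ D) ^ n * eexp (regConst C γ * D)

/-- The invariant density. -/
noncomputable def invariantDensity {X ι : Type*} (g : ι → X → X) (w : ι → X → ℝ≥0∞)
    (C γ D : ℝ) (y : X) : ℝ≥0∞ :=
  ⨅ n, ((transferOp g w)^[n] (fun _ => 1) y + couplingError C γ D n)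

namespace FullBranchSystem

variable {X ι : Type*} [MeasurableSpace X] {F : X → X} {lam : Measure X}
  {Z : Set X} {g : ι → X → X} {w : ι → X → ℝ≥0∞} {δ : X → X → ℝ} {C γ D : ℝ}

local notation "L" => transferOp g w
local notation "err" => couplingError C γ D
local notation "dens" => invariantDensity g w C γ D

theorem tendsto_couplingError (S : FullBranchSystem F lam Z g w δ C γ D) :
    Filter.Tendsto (err) Filter.atTop (nhds 0) := by
  have h : ENNReal.ofReal (1 - couplingConst C γ D) < 1 := by
    rw [ENNReal.ofReal_lt_one]; have := S.couplingConst_pos; linarith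
  have := ENNReal.Tendsto.mul_const (ENNReal.tendsto_pow_atTop_nhds_zero_of_lt_one h)
    (Or.inr (eexp_ne_top (regConst C γ * D)))
  rwa [zero_mul] at this

theorem div_le_regConst (S : FullBranchSystem F lam Z g w δ C γ D) :
    C / (1 - γ) + 1 ≤ regConst C γ := by
  have h1 := S.γ_pos
  have h2 := S.γ_lt_one
  have h3 := S.C_nonneg
  have h4 : 0 < 1 - γ := by linarith
  rw [regConst, div_add_one h4.ne']
  gcongr
  linarith

theorem logLip_one (S : FullBranchSystem F lam Z g w δ C γ D) {K : ℝ} (hK : 0 ≤ K) :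
    LogLip Z δ K (fun _ => 1) := fun x _ y _ => by
  rw [mul_one]; exact one_le_eexp (mul_nonneg hK (S.δ_nonneg x y))

theorem div_nonneg' (S : FullBranchSystem F lam Z g w δ C γ D) : 0 ≤ C / (1 - γ) :=
  div_nonneg S.C_nonneg (by have := S.γ_lt_one; linarith)

theorem div_step (S : FullBranchSystem F lam Z g w δ C γ D) :
    C + C / (1 - γ) * γ = C / (1 - γ) := by
  have h2 := S.γ_lt_one
  have h4 : 1 - γ ≠ 0 := by linarith
  field_simp
  ring

theorem logLip_iterate_one (S : FullBranchSystem F lam Z g w δ C γ D) (n : ℕ) :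
    LogLip Z δ (C / (1 - γ)) (L^[n] (fun _ => 1)) := by
  induction n with
  | zero => exact S.logLip_one S.div_nonneg'
  | succ n ih =>
    rw [Function.iterate_succ_apply']
    have := S.logLip_transferOp S.div_nonneg' ih
    rwa [S.div_step] at this

/-- The coupling estimate compares 1 with L^k 1, which has the same mass and the same regularity. -/
theorem iterate_one_le_add (S : FullBranchSystem F lam Z g w δ C γ D) (n k : ℕ) :
    ∀ y ∈ Z, L^[n + k] (fun _ => 1) y ≤ L^[n] (fun _ => 1) y + err n ∧
      L^[n] (fun _ => 1) y ≤ L^[n + k] (fun _ => 1) y + err n := by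
  intro y hy
  have := S.isProbabilityMeasure
  have hle : C / (1 - γ) ≤ regConst C γ := by have := S.div_le_regConst; linarith
  have h1 := S.logLip_mono hle (S.logLip_iterate_one k)
  have h2 := S.logLip_one S.regConst_nonneg
  have m1 := S.measurable_iterate (φ := fun _ => 1) measurable_const k
  have i1 := S.lintegral_iterate (φ := fun _ => 1) measurable_const k
  have h3 := S.iterate_le_add n m1 measurable_const h1 h2 (by rw [i1]; simp) i1 y hy
  have h4 := S.iterate_le_add n measurable_const m1 h2 h1 (by simp) i1.symm y hy
  rw [i1] at h3
  rw [Function.iterate_add_apply]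
  simp only [lintegral_const, measure_univ, mul_one] at h3 h4
  exact ⟨h3, h4⟩

theorem invariantDensity_le (n : ℕ) (y : X) : dens y ≤ L^[n] (fun _ => 1) y + err n :=
  iInf_le _ n

/-- The iterates of 1 are uniformly Cauchy on Z with modulus err, so the infimum of the upper
barriers L^m 1 + err m stays within err n of L^n 1. Defining the density as this infimum makes it
measurable and defined everywhere, also off Z. -/
theorem iterate_one_le (S : FullBranchSystem F lam Z g w δ C γ D) (n : ℕ) :
    ∀ y ∈ Z, L^[n] (fun _ => 1) y ≤ dens y + err n := by
  intro y hy
  rw [← tsub_le_iff_right]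
  refine le_iInf fun m => ?_
  rw [tsub_le_iff_right]
  rcases le_total m n with h | h
  · obtain ⟨k, rfl⟩ := Nat.exists_eq_add_of_le h
    exact (S.iterate_one_le_add m k y hy).1.trans le_self_add
  · obtain ⟨k, rfl⟩ := Nat.exists_eq_add_of_le h
    refine (S.iterate_one_le_add n k y hy).2.trans ?_
    gcongr
    exact le_self_add

theorem measurable_invariantDensity (S : FullBranchSystem F lam Z g w δ C γ D) :
    Measurable (dens) :=
  Measurable.iInf fun n => (S.measurable_iterate measurable_const n).add measurable_const

theorem tendsto_iterate_one (S : FullBranchSystem F lam Z g w δ C γ D) {y : X} (hy : y ∈ Z) :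
    Filter.Tendsto (fun n => L^[n] (fun _ => 1) y) Filter.atTop (nhds (dens y)) := by
  have h1 : Filter.Tendsto (fun n => dens y - err n) Filter.atTop (nhds (dens y)) := by
    have := ENNReal.Tendsto.sub (tendsto_const_nhds (x := dens y)) S.tendsto_couplingError
      (Or.inr ENNReal.zero_ne_top)
    rwa [tsub_zero] at this
  have h2 : Filter.Tendsto (fun n => dens y + err n) Filter.atTop (nhds (dens y)) := by
    have := (tendsto_const_nhds (x := dens y)).add S.tendsto_couplingError
    rwa [add_zero] at this
  exact tendsto_of_tendsto_of_tendsto_of_le_of_le h1 h2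
    (fun n => tsub_le_iff_right.2 (invariantDensity_le n y)) (fun n => S.iterate_one_le n y hy)

theorem logLip_invariantDensity (S : FullBranchSystem F lam Z g w δ C γ D) :
    LogLip Z δ (C / (1 - γ)) (dens) := fun _ hx _ hy =>
  le_of_tendsto_of_tendsto' (S.tendsto_iterate_one hx)
    (ENNReal.Tendsto.const_mul (S.tendsto_iterate_one hy) (Or.inr (eexp_ne_top _)))
    fun n => S.logLip_iterate_one n _ hx _ hy

/-- The limit is exchanged with the infinite sum over branches by means of the uniform error: the
operator applied to the density differs from L^{n+1} 1 by at most err n times L 1, which is finite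
on Z. -/
theorem transferOp_invariantDensity (S : FullBranchSystem F lam Z g w δ C γ D) :
    ∀ y ∈ Z, L (dens) y = dens y := by
  intro y hy
  have hb : L (fun _ => 1) y ≠ ∞ := by
    have := S.isProbabilityMeasure
    have h := S.le_eexp_mul_lintegral S.div_nonneg' (S.logLip_iterate_one 1) hy
    rw [S.lintegral_iterate measurable_const] at h
    exact ne_top_of_le_ne_top (by simp [eexp_ne_top]) h
  have he : Filter.Tendsto (fun n => err n * L (fun _ => 1) y) Filter.atTop (nhds 0) := by
    have := ENNReal.Tendsto.mul_const S.tendsto_couplingError (Or.inr hb)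
    rwa [zero_mul] at this
  have hL : ∀ n, L (fun x => err n * 1) y = err n * L (fun _ => 1) y := fun n =>
    transferOp_const_mul _ _ y
  have h0 := (S.tendsto_iterate_one hy).comp (Filter.tendsto_add_atTop_nat 1)
  have h1 : ∀ n, L (dens) y ≤ L^[n + 1] (fun _ => 1) y + err n * L (fun _ => 1) y := fun n => by
    rw [Function.iterate_succ_apply', ← hL, ← transferOp_add]
    refine S.transferOp_mono (fun z _ => ?_) hy
    rw [mul_one]; exact invariantDensity_le n z
  have h2 : ∀ n, L^[n + 1] (fun _ => 1) y ≤ L (dens) y + err n * L (fun _ => 1) y := fun n => by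
    rw [Function.iterate_succ_apply', ← hL, ← transferOp_add]
    refine S.transferOp_mono (fun z hz => ?_) hy
    rw [mul_one]; exact S.iterate_one_le n z hz
  refine le_antisymm ?_ ?_
  · refine ge_of_tendsto' (f := fun n => L^[n + 1] (fun _ => 1) y + err n * L (fun _ => 1) y)
      (x := Filter.atTop) ?_ h1
    have := h0.add he
    rwa [add_zero] at this
  · refine le_of_tendsto_of_tendsto' h0 ?_ h2
    have := (tendsto_const_nhds (x := L (dens) y)).add he
    rwa [add_zero] at this

theorem lintegral_invariantDensity (S : FullBranchSystem F lam Z g w δ C γ D) :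
    ∫⁻ y, dens y ∂lam = 1 := by
  have := S.isProbabilityMeasure
  have hi : ∀ n, ∫⁻ y, L^[n] (fun _ => 1) y ∂lam = 1 := fun n => by
    rw [S.lintegral_iterate measurable_const]; simp
  have h1 : ∀ n, ∫⁻ y, dens y ∂lam ≤ 1 + err n := fun n => by
    calc ∫⁻ y, dens y ∂lam ≤ ∫⁻ y, (L^[n] (fun _ => 1) y + err n) ∂lam :=
          lintegral_mono fun y => invariantDensity_le n y
      _ = _ := by rw [lintegral_add_right _ measurable_const, hi]; simp
  have h2 : ∀ n, 1 ≤ ∫⁻ y, dens y ∂lam + err n := fun n => by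
    calc 1 = ∫⁻ y, L^[n] (fun _ => 1) y ∂lam := (hi n).symm
      _ ≤ ∫⁻ y, (dens y + err n) ∂lam :=
          lintegral_mono_ae (S.ae_mem.mono fun y hy => S.iterate_one_le n y hy)
      _ = _ := by rw [lintegral_add_right _ measurable_const]; simp
  refine le_antisymm ?_ ?_
  · refine ge_of_tendsto' (x := Filter.atTop) ?_ h1
    have := (tendsto_const_nhds (x := (1 : ℝ≥0∞))).add S.tendsto_couplingError
    rwa [add_zero] at this
  · refine ge_of_tendsto' (x := Filter.atTop) ?_ h2
    have := (tendsto_const_nhds (x := ∫⁻ y, dens y ∂lam)).add S.tendsto_couplingError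
    rwa [add_zero] at this

theorem logLip_regConst_invariantDensity (S : FullBranchSystem F lam Z g w δ C γ D) :
    LogLip Z δ (regConst C γ) (dens) :=
  S.logLip_mono (by have := S.div_le_regConst; linarith) S.logLip_invariantDensity

theorem invariantDensity_le_eexp (S : FullBranchSystem F lam Z g w δ C γ D) {y : X}
    (hy : y ∈ Z) : dens y ≤ eexp (regConst C γ * D) := by
  have := S.le_eexp_mul_lintegral S.regConst_nonneg S.logLip_regConst_invariantDensity hy
  rwa [S.lintegral_invariantDensity, mul_one] at this

theorem one_le_eexp_mul_invariantDensity (S : FullBranchSystem F lam Z g w δ C γ D) {y : X}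
    (hy : y ∈ Z) : 1 ≤ eexp (regConst C γ * D) * dens y := by
  have := S.lintegral_le_eexp_mul S.regConst_nonneg S.logLip_regConst_invariantDensity hy
  rwa [S.lintegral_invariantDensity] at this

theorem invariantDensity_ne_top (S : FullBranchSystem F lam Z g w δ C γ D) {y : X}
    (hy : y ∈ Z) : dens y ≠ ∞ :=
  ne_top_of_le_ne_top (eexp_ne_top _) (S.invariantDensity_le_eexp hy)

theorem invariantDensity_ne_zero (S : FullBranchSystem F lam Z g w δ C γ D) {y : X}
    (hy : y ∈ Z) : dens y ≠ 0 := by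
  intro h
  have := S.one_le_eexp_mul_invariantDensity hy
  simp [h] at this

theorem iterate_invariantDensity (S : FullBranchSystem F lam Z g w δ C γ D) (n : ℕ) :
    ∀ y ∈ Z, L^[n] (dens) y = dens y := by
  induction n with
  | zero => exact fun _ _ => rfl
  | succ n ih =>
    intro y hy
    rw [Function.iterate_succ_apply', S.transferOp_congr ih hy,
      S.transferOp_invariantDensity y hy]

theorem iterate_const_mul (S : FullBranchSystem F lam Z g w δ C γ D) (a : ℝ≥0∞)
    (φ : X → ℝ≥0∞) (n : ℕ) : ∀ y ∈ Z, L^[n] (fun x => a * φ x) y = a * L^[n] φ y := by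
  induction n with
  | zero => exact fun _ _ => rfl
  | succ n ih =>
    intro y hy
    simp_rw [Function.iterate_succ_apply']
    rw [S.transferOp_congr ih hy, transferOp_const_mul]

/-- Coupling of φ with the multiple of the invariant density that has the same mass. -/
theorem iterate_sub_le (S : FullBranchSystem F lam Z g w δ C γ D) (n : ℕ) {φ : X → ℝ≥0∞}
    (hφ : Measurable φ) (h : LogLip Z δ (regConst C γ) φ) (hfin : ∫⁻ x, φ x ∂lam ≠ ∞) :
    ∀ y ∈ Z, L^[n] φ y ≤ (∫⁻ x, φ x ∂lam) * dens y + err n * ∫⁻ x, φ x ∂lam ∧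
      (∫⁻ x, φ x ∂lam) * dens y ≤ L^[n] φ y + err n * ∫⁻ x, φ x ∂lam := by
  intro y hy
  set a := ∫⁻ x, φ x ∂lam with ha
  have hm : Measurable fun x => a * dens x := S.measurable_invariantDensity.const_mul a
  have hl : LogLip Z δ (regConst C γ) fun x => a * dens x := fun x hx y hy => by
    rw [mul_left_comm]
    exact mul_le_mul_right (S.logLip_regConst_invariantDensity x hx y hy) a
  have hi : ∫⁻ x, a * dens x ∂lam = a := by
    rw [lintegral_const_mul _ S.measurable_invariantDensity, S.lintegral_invariantDensity,
      mul_one]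
  have hL : L^[n] (fun x => a * dens x) y = a * dens y := by
    rw [S.iterate_const_mul _ _ n y hy, S.iterate_invariantDensity n y hy]
  have h1 := S.iterate_le_add n hφ hm h hl hfin hi.symm y hy
  have h2 := S.iterate_le_add n hm hφ hl h (by rwa [hi]) hi y hy
  rw [hL] at h1 h2
  rw [hi] at h2
  exact ⟨h1, h2⟩

theorem isProbabilityMeasure_withDensity (S : FullBranchSystem F lam Z g w δ C γ D) :
    IsProbabilityMeasure (lam.withDensity (dens)) :=
  ⟨by rw [withDensity_apply _ MeasurableSet.univ, setLIntegral_univ,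
    S.lintegral_invariantDensity]⟩

theorem lintegral_withDensity (S : FullBranchSystem F lam Z g w δ C γ D) {φ : X → ℝ≥0∞}
    (hφ : Measurable φ) :
    ∫⁻ x, φ x ∂(lam.withDensity (dens)) = ∫⁻ x, dens x * φ x ∂lam :=
  lintegral_withDensity_eq_lintegral_mul _ S.measurable_invariantDensity hφ

theorem measurePreserving (S : FullBranchSystem F lam Z g w δ C γ D) :
    MeasurePreserving F (lam.withDensity (dens)) (lam.withDensity (dens)) := by
  refine ⟨S.measurable_F, Measure.ext fun s hs => ?_⟩
  rw [Measure.map_apply S.measurable_F hs, ← lintegral_indicator_one hs,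
    ← lintegral_indicator_one (S.measurable_F hs),
    S.lintegral_withDensity (measurable_one.indicator hs),
    S.lintegral_withDensity (measurable_one.indicator (S.measurable_F hs))]
  have h := S.lintegral_transferOp_mul S.measurable_invariantDensity
    (measurable_one.indicator hs : Measurable (s.indicator (1 : X → ℝ≥0∞)))
  rw [show (fun x => dens x * (F ⁻¹' s).indicator 1 x) =
    fun x => dens x * s.indicator (1 : X → ℝ≥0∞) (F x) from rfl, ← h]
  exact lintegral_congr_ae (S.ae_mem.mono fun y hy => by
    simp only; rw [S.transferOp_invariantDensity y hy])

theorem absolutelyContinuous (S : FullBranchSystem F lam Z g w δ C γ D) :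
    lam ≪ lam.withDensity (dens) :=
  withDensity_absolutelyContinuous' S.measurable_invariantDensity.aemeasurable
    (S.ae_mem.mono fun _ hy => S.invariantDensity_ne_zero hy)

/-- Quantitative mixing of a partition-measurable function and an arbitrary function. -/
theorem lintegral_mul_comp_le (S : FullBranchSystem F lam Z g w δ C γ D) {φ ψ : X → ℝ≥0∞}
    (hφ : Measurable φ) (hψ : Measurable ψ)
    (hconst : ∀ i, ∀ x ∈ Z, ∀ y ∈ Z, φ (g i x) = φ (g i y)) :
    ∫⁻ x, φ x * ψ (F x) ∂(lam.withDensity (dens)) ≤ eexp (2 * (regConst C γ * D)) *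
      (∫⁻ x, φ x ∂(lam.withDensity (dens))) * ∫⁻ x, ψ x ∂(lam.withDensity (dens)) := by
  have hd := S.measurable_invariantDensity
  rw [S.lintegral_withDensity (φ := fun x => φ x * ψ (F x)) (hφ.mul (hψ.comp S.measurable_F)), S.lintegral_withDensity hφ,
    S.lintegral_withDensity hψ]
  -- Since φ is constant on each branch image, it does not affect the regularity of the pushed
  -- density, whatever its size. The Harnack bound then replaces this density by its mean, up to the
  -- factor lost below.
  have hlip : LogLip Z δ (C / (1 - γ)) (L fun x => dens x * φ x) := by
    rw [← S.div_step]
    intro x hx y hy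
    simp only [transferOp, ← ENNReal.tsum_mul_left]
    refine ENNReal.tsum_le_tsum fun i => ?_
    have h1 := S.w_le i x hx y hy
    have h2 := S.logLip_invariantDensity _ (S.g_mem i x hx) _ (S.g_mem i y hy)
    have h3 : eexp (C / (1 - γ) * δ (g i x) (g i y)) ≤ eexp (C / (1 - γ) * (γ * δ x y)) :=
      eexp_mono (by have := S.δ_g_le i x hx y hy; have := S.div_nonneg'; gcongr)
    rw [hconst i x hx y hy]
    calc w i x * (dens (g i x) * φ (g i y))
        ≤ (eexp (C * δ x y) * w i y) *
          ((eexp (C / (1 - γ) * (γ * δ x y)) * dens (g i y)) * φ (g i y)) := by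
          gcongr
          exact h2.trans (by gcongr)
      _ = _ := by rw [add_mul, mul_assoc (C / (1 - γ)), eexp_add]; ring
  have hlip' := S.logLip_mono (K' := regConst C γ)
    (by have := S.div_le_regConst; linarith) hlip
  have hint : ∫⁻ x, L (fun x => dens x * φ x) x ∂lam = ∫⁻ x, dens x * φ x ∂lam :=
    S.lintegral_transferOp (hd.mul hφ)
  have h := S.lintegral_transferOp_mul (hd.mul hφ) hψ
  calc ∫⁻ x, dens x * (φ x * ψ (F x)) ∂lam
      = ∫⁻ x, L (fun x => dens x * φ x) x * ψ x ∂lam := by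
        rw [show (fun x => dens x * φ x) = (dens * φ) from rfl, h]
        simp [mul_assoc]
    _ ≤ ∫⁻ x, eexp (2 * (regConst C γ * D)) * (∫⁻ x, dens x * φ x ∂lam) *
          (dens x * ψ x) ∂lam := by
        refine lintegral_mono_ae (S.ae_mem.mono fun y hy => ?_)
        have h1 := S.le_eexp_mul_lintegral S.regConst_nonneg hlip' hy
        rw [hint] at h1
        calc L (fun x => dens x * φ x) y * ψ y
            ≤ (eexp (regConst C γ * D) * ∫⁻ x, dens x * φ x ∂lam) *
              (eexp (regConst C γ * D) * dens y) * ψ y := by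
              gcongr
              calc _ ≤ _ := h1
                _ ≤ _ := le_mul_of_one_le_right zero_le
                  (S.one_le_eexp_mul_invariantDensity hy)
          _ = _ := by rw [two_mul, eexp_add]; ring
    _ = _ := by
        exact lintegral_const_mul _ (hd.mul hψ)

end FullBranchSystem

/-! ### Independence of invariant sets and regular functions. -/

namespace FullBranchSystem

variable {X ι : Type*} [MeasurableSpace X] {F : X → X} {lam : Measure X}
  {Z : Set X} {g : ι → X → X} {w : ι → X → ℝ≥0∞} {δ : X → X → ℝ} {C γ D : ℝ}

local notation "L" => transferOp g w
local notation "err" => couplingError C γ D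
local notation "dens" => invariantDensity g w C γ D

theorem logLip_mul {K K' : ℝ} {φ ψ : X → ℝ≥0∞} (hφ : LogLip Z δ K φ) (hψ : LogLip Z δ K' ψ) :
    LogLip Z δ (K + K') (fun x => φ x * ψ x) := fun x hx y hy => by
  calc φ x * ψ x ≤ (eexp (K * δ x y) * φ y) * (eexp (K' * δ x y) * ψ y) :=
        mul_le_mul' (hφ x hx y hy) (hψ x hx y hy)
    _ = _ := by rw [add_mul, eexp_add]; ring

/-- The indicator of an invariant set is unchanged by F^n, so by duality the left side is the
integral over A of L^n(dens · ψ) for every n. These functions converge uniformly on Z to (∫ψ dμ) ·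
dens. -/
theorem setLIntegral_eq_of_preimage_eq (S : FullBranchSystem F lam Z g w δ C γ D)
    {A : Set X} (hA : MeasurableSet A) (hFA : F ⁻¹' A = A) {ψ : X → ℝ≥0∞} (hψ : Measurable ψ)
    (hlip : LogLip Z δ 1 ψ) (hfin : ∫⁻ x, ψ x ∂(lam.withDensity (dens)) ≠ ∞) :
    ∫⁻ x in A, ψ x ∂(lam.withDensity (dens)) =
      (∫⁻ x, ψ x ∂(lam.withDensity (dens))) * lam.withDensity (dens) A := by
  have hd := S.measurable_invariantDensity
  have := S.isProbabilityMeasure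
  have hφm : Measurable fun x => dens x * ψ x := hd.mul hψ
  have hφl : LogLip Z δ (regConst C γ) fun x => dens x * ψ x :=
    S.logLip_mono S.div_le_regConst (logLip_mul S.logLip_invariantDensity hlip)
  have h1m : Measurable (A.indicator (1 : X → ℝ≥0∞)) := measurable_one.indicator hA
  rw [← lintegral_indicator hA, S.lintegral_withDensity (hψ.indicator hA),
    ← lintegral_indicator_one hA, S.lintegral_withDensity h1m]
  rw [S.lintegral_withDensity hψ] at hfin ⊢
  set a := ∫⁻ x, dens x * ψ x ∂lam with ha
  have hiter : ∀ n : ℕ, ∀ x, A.indicator (1 : X → ℝ≥0∞) (F^[n] x) = A.indicator 1 x := by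
    intro n
    induction n with
    | zero => exact fun _ => rfl
    | succ n ih =>
      intro x
      rw [Function.iterate_succ_apply, ih]
      change (F ⁻¹' A).indicator 1 x = _
      rw [hFA]
  have e1 : ∀ n, ∫⁻ x, dens x * A.indicator ψ x ∂lam =
      ∫⁻ x, L^[n] (fun x => dens x * ψ x) x * A.indicator 1 x ∂lam := by
    intro n
    rw [S.lintegral_iterate_mul hφm h1m n]
    refine lintegral_congr fun x => ?_
    rw [hiter]
    by_cases hx : x ∈ A <;> simp [hx]
  set b := ∫⁻ x, dens x * A.indicator 1 x ∂lam with hb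
  have e2 : ∀ c : ℝ≥0∞, ∫⁻ x, (a * dens x) * A.indicator 1 x ∂lam = a * b := fun _ => by
    simp_rw [mul_assoc]
    exact lintegral_const_mul _ (hd.mul h1m)
  have hle : ∀ c : ℝ≥0∞, ∫⁻ x, c * A.indicator 1 x ∂lam ≤ c := fun c => by
    rw [lintegral_const_mul _ h1m, lintegral_indicator_one hA]
    exact mul_le_of_le_one_right zero_le prob_le_one
  have h1 : ∀ n, ∫⁻ x, dens x * A.indicator ψ x ∂lam ≤ a * b + err n * a := by
    intro n
    rw [e1 n, ← e2 0]
    calc _ ≤ ∫⁻ x, ((a * dens x) * A.indicator 1 x + (err n * a) * A.indicator 1 x) ∂lam := by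
          refine lintegral_mono_ae (S.ae_mem.mono fun x hx => ?_)
          rw [← add_mul]
          gcongr
          exact (S.iterate_sub_le n hφm hφl hfin x hx).1
      _ ≤ _ := by
          have hm : Measurable fun x => (a * dens x) * A.indicator (1 : X → ℝ≥0∞) x :=
            (hd.const_mul a).mul h1m
          rw [lintegral_add_left hm]
          gcongr
          exact hle _
  have h2 : ∀ n, a * b ≤ ∫⁻ x, dens x * A.indicator ψ x ∂lam + err n * a := by
    intro n
    rw [e1 n, ← e2 0]
    calc _ ≤ ∫⁻ x, (L^[n] (fun x => dens x * ψ x) x * A.indicator 1 x +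
            (err n * a) * A.indicator 1 x) ∂lam := by
          refine lintegral_mono_ae (S.ae_mem.mono fun x hx => ?_)
          rw [← add_mul]
          gcongr
          exact (S.iterate_sub_le n hφm hφl hfin x hx).2
      _ ≤ _ := by
          have hm : Measurable fun x => L^[n] (fun x => dens x * ψ x) x *
              A.indicator (1 : X → ℝ≥0∞) x := (S.measurable_iterate hφm n).mul h1m
          rw [lintegral_add_left hm]
          gcongr
          exact hle _
  have he : Filter.Tendsto (fun n => err n * a) Filter.atTop (nhds 0) := by
    have := ENNReal.Tendsto.mul_const S.tendsto_couplingError (Or.inr hfin)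
    rwa [zero_mul] at this
  refine le_antisymm (ge_of_tendsto' (x := Filter.atTop) ?_ h1)
    (ge_of_tendsto' (x := Filter.atTop) ?_ h2)
  · have := (tendsto_const_nhds (x := a * b)).add he
    rwa [add_zero] at this
  · have := (tendsto_const_nhds (x := ∫⁻ x, dens x * A.indicator ψ x ∂lam)).add he
    rwa [add_zero] at this

end FullBranchSystem

/-! ### Ergodicity and uniqueness of the invariant measure. -/

section Ergodicity

variable {X ι : Type*} [MetricSpace X] [MeasurableSpace X] [BorelSpace X] {F : X → X}
  {lam : Measure X} {Z : Set X} {g : ι → X → X} {w : ι → X → ℝ≥0∞} {C γ D η : ℝ}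

local notation "dens" => invariantDensity g w C γ D

/-- Adding 1 keeps the function away from zero. The factor min(1, r) compensates the Lipschitz
constant 1/r: at distance at most 1 one uses dist ≤ dist^η, and beyond that the oscillation, at most
1, is below dist^η. -/
theorem logLip_thickenedIndicator (hη0 : 0 < η) (hη1 : η ≤ 1) {r : ℝ} (hr : 0 < r) (B : Set X) :
    LogLip Z (fun x y => dist x y ^ η) 1
      (fun x => 1 + ENNReal.ofReal (min 1 r) * (thickenedIndicator hr B x : ℝ≥0∞)) := by
  intro x _ y _
  set θ : X → ℝ := fun x => (thickenedIndicator hr B x : ℝ) with hθ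
  have hconv : ∀ x, 1 + ENNReal.ofReal (min 1 r) * (thickenedIndicator hr B x : ℝ≥0∞) =
      ENNReal.ofReal (1 + min 1 r * θ x) := fun x => by
    rw [ENNReal.ofReal_add (by norm_num) (by positivity), ENNReal.ofReal_mul (by positivity)]
    simp [hθ]
  have h0 : ∀ x, 0 ≤ θ x := fun x => NNReal.coe_nonneg _
  have h1 : ∀ x, θ x ≤ 1 := fun x => by exact_mod_cast thickenedIndicator_le_one hr B x
  have hm0 : 0 < min 1 r := lt_min one_pos hr
  have hdist : min 1 r * θ x ≤ min 1 r * θ y + dist x y ^ η := by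
    rcases le_total (dist x y) 1 with h | h
    · have hl := (lipschitzWith_thickenedIndicator hr B).dist_le_mul x y
      rw [NNReal.dist_eq, NNReal.coe_inv, Real.coe_toNNReal _ hr.le] at hl
      have h2 : dist x y ≤ dist x y ^ η := by
        calc dist x y = dist x y ^ (1 : ℝ) := (Real.rpow_one _).symm
          _ ≤ _ := Real.rpow_le_rpow_of_exponent_ge_of_imp dist_nonneg h hη1 (fun _ h' => by linarith)
      have h3 : min 1 r * (r⁻¹ * dist x y) ≤ dist x y := by
        have : min 1 r * r⁻¹ ≤ 1 := by
          rw [← div_eq_mul_inv, div_le_one hr]; exact min_le_right _ _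
        rw [← mul_assoc]
        exact mul_le_of_le_one_left dist_nonneg this
      have h4 := (abs_le.1 hl).2
      have h5 : min 1 r * (θ x - θ y) ≤ min 1 r * (r⁻¹ * dist x y) := by gcongr
      linarith
    · have h2 : 1 ≤ dist x y ^ η := Real.one_le_rpow h hη0.le
      have h3 : min 1 r * θ x ≤ 1 * 1 :=
        mul_le_mul (min_le_left _ _) (h1 x) (h0 x) (by norm_num)
      have h4 : 0 ≤ min 1 r * θ y := mul_nonneg hm0.le (h0 y)
      linarith
  simp only [hconv, eexp, one_mul]
  rw [← ENNReal.ofReal_mul (Real.exp_pos _).le]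
  refine ENNReal.ofReal_le_ofReal ?_
  have h6 := Real.add_one_le_exp (dist x y ^ η)
  have h7 : 0 ≤ min 1 r * θ y := mul_nonneg hm0.le (h0 y)
  have h8 : 0 ≤ dist x y ^ η := by positivity
  nlinarith

/-- An invariant set A is independent of thickened indicators, hence of closed sets in the limit,
hence of all Borel sets because closed sets form a generating π-system. Independence of A from its
own complement gives μ(A) μ(Aᶜ) = 0. -/
theorem FullBranchSystem.ergodic (hη0 : 0 < η) (hη1 : η ≤ 1)
    (S : FullBranchSystem F lam Z g w (fun x y => dist x y ^ η) C γ D) :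
    Ergodic F (lam.withDensity (dens)) := by
  have := S.isProbabilityMeasure_withDensity
  set μ := lam.withDensity (dens) with hμ
  refine ⟨S.measurePreserving, ⟨fun A hA hFA => ?_⟩⟩
  have key : ∀ B : Set X, ∀ r : ℝ, ∀ hr : 0 < r,
      ∫⁻ x, (thickenedIndicator hr B x : ℝ≥0∞) ∂(μ.restrict A) =
        ∫⁻ x, (thickenedIndicator hr B x : ℝ≥0∞) ∂(μ A • μ) := by
    intro B r hr
    have hm : Measurable fun x => (thickenedIndicator hr B x : ℝ≥0∞) :=
      (thickenedIndicator hr B).continuous.measurable.coe_nnreal_ennreal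
    have hle : ∀ ν : Measure X, IsFiniteMeasure ν →
        ∫⁻ x, (thickenedIndicator hr B x : ℝ≥0∞) ∂ν ≠ ∞ := fun ν _ =>
      ne_top_of_le_ne_top (b := ν univ) (measure_ne_top _ _) (by
        calc _ ≤ ∫⁻ _, 1 ∂ν := lintegral_mono fun x => by
              exact ENNReal.coe_le_one_iff.2 (thickenedIndicator_le_one hr B x)
          _ = _ := by simp)
    have hε0 : ENNReal.ofReal (min 1 r) ≠ 0 := by simp [hr]
    have h := S.setLIntegral_eq_of_preimage_eq hA hFA ((hm.const_mul _).const_add 1)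
      (logLip_thickenedIndicator hη0 hη1 hr B) (by
        rw [lintegral_add_left measurable_const, lintegral_const_mul _ hm]
        simp only [lintegral_const, measure_univ, one_mul]
        exact ENNReal.add_ne_top.2 ⟨by simp,
          ENNReal.mul_ne_top ENNReal.ofReal_ne_top (hle μ inferInstance)⟩)
    rw [← hμ, lintegral_add_left measurable_const, lintegral_const_mul _ hm,
      lintegral_add_left measurable_const, lintegral_const_mul _ hm, add_mul] at h
    simp only [lintegral_const, one_mul, Measure.restrict_apply_univ, measure_univ] at h
    rw [ENNReal.add_right_inj (measure_ne_top _ _), mul_assoc,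
      ENNReal.mul_right_inj hε0 ENNReal.ofReal_ne_top] at h
    rw [h, lintegral_smul_measure, smul_eq_mul, mul_comm]
  have hclosed : ∀ B : Set X, IsClosed B → μ.restrict A B = (μ A • μ) B := by
    intro B hB
    have := Measure.smul_finite μ (measure_ne_top μ A)
    have hpos : ∀ n : ℕ, (0 : ℝ) < 1 / (n + 1) := fun n => by positivity
    have t1 := tendsto_lintegral_thickenedIndicator_of_isClosed (μ.restrict A) hB hpos
      tendsto_one_div_add_atTop_nhds_zero_nat
    have t2 := tendsto_lintegral_thickenedIndicator_of_isClosed (μ A • μ) hB hpos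
      tendsto_one_div_add_atTop_nhds_zero_nat
    simp_rw [key] at t1
    exact tendsto_nhds_unique t1 t2
  have hext : μ.restrict A = μ A • μ := by
    refine ext_of_generate_finite _ (BorelSpace.measurable_eq.trans borel_eq_generateFrom_isClosed)
      isPiSystem_isClosed (fun B hB => hclosed B hB) (hclosed _ isClosed_univ)
  have h0 : μ A * μ Aᶜ = 0 := by
    have := congrArg (fun ν : Measure X => ν Aᶜ) hext
    simp only [Measure.smul_apply, smul_eq_mul] at this
    rw [← this, Measure.restrict_apply hA.compl]
    simp
  rw [Filter.eventuallyConst_set']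
  rcases mul_eq_zero.1 h0 with h | h
  · exact Or.inl (ae_eq_empty.2 h)
  · exact Or.inr (ae_eq_univ.2 h)

/-- This identifies a given absolutely continuous invariant probability with the constructed one, so
that the quantitative estimates apply to it. Positivity of the density makes ν absolutely continuous
with respect to the ergodic measure. -/
theorem FullBranchSystem.eq_withDensity (hη0 : 0 < η) (hη1 : η ≤ 1)
    (S : FullBranchSystem F lam Z g w (fun x y => dist x y ^ η) C γ D) {ν : Measure X}
    [IsProbabilityMeasure ν] (hν : MeasurePreserving F ν ν) (hac : ν ≪ lam) :
    ν = lam.withDensity (dens) := by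
  have := S.isProbabilityMeasure_withDensity
  exact (S.ergodic hη0 hη1).eq_of_absolutelyContinuous hν (hac.trans S.absolutelyContinuous)

end Ergodicity

/-! ### Transfer operator series and the orthogonal decomposition. -/

/-- The bound for the coboundary obtained from an observable dominated by a function with
integral `t`. -/
noncomputable def coboundaryConst (C γ D t : ℝ) : ℝ :=
  2 * t * Real.exp (2 * (regConst C γ * D)) / couplingConst C γ D

namespace FullBranchSystem

variable {X ι : Type*} [MeasurableSpace X] {F : X → X} {lam : Measure X}
  {Z : Set X} {g : ι → X → X} {w : ι → X → ℝ≥0∞} {δ : X → X → ℝ} {C γ D : ℝ}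

local notation "L" => transferOp g w
local notation "dens" => invariantDensity g w C γ D

theorem map_iterate_withDensity (S : FullBranchSystem F lam Z g w δ C γ D) {φ : X → ℝ≥0∞}
    (hφ : Measurable φ) (n : ℕ) :
    (lam.withDensity φ).map F^[n] = lam.withDensity (L^[n] φ) := by
  refine Measure.ext fun s hs => ?_
  have hF := S.measurable_F.iterate n
  have h := S.lintegral_iterate_mul hφ (measurable_one.indicator hs) n
  rw [Measure.map_apply hF hs, withDensity_apply _ (hF hs), withDensity_apply _ hs,
    ← lintegral_indicator (hF hs), ← lintegral_indicator hs]
  calc _ = ∫⁻ y, φ y * s.indicator 1 (F^[n] y) ∂lam := lintegral_congr fun x => by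
        by_cases hx : F^[n] x ∈ s <;> simp [indicator, hx]
    _ = _ := h.symm
    _ = _ := lintegral_congr fun x => by by_cases hx : x ∈ s <;> simp [hx]

theorem integral_toReal_iterate_mul (S : FullBranchSystem F lam Z g w δ C γ D) {φ : X → ℝ≥0∞}
    (hφ : Measurable φ) (hfin : ∫⁻ x, φ x ∂lam ≠ ∞) {G : X → ℝ} (hG : BddMeas G) (n : ℕ) :
    ∫ x, (L^[n] φ x).toReal * G x ∂lam = ∫ x, (φ x).toReal * G (F^[n] x) ∂lam := by
  have hLm := S.measurable_iterate hφ n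
  have h1 := integral_withDensity_eq_integral_toReal_smul hLm
    (ae_lt_top hLm (by rwa [S.lintegral_iterate hφ])) G
  have h2 := integral_withDensity_eq_integral_toReal_smul hφ (ae_lt_top hφ hfin)
    (fun x => G (F^[n] x))
  simp only [smul_eq_mul] at h1 h2
  rw [← h1, ← h2, ← S.map_iterate_withDensity hφ,
    integral_map (S.measurable_F.iterate n).aemeasurable hG.1.aestronglyMeasurable]

theorem integral_withDensity (S : FullBranchSystem F lam Z g w δ C γ D) (G : X → ℝ) :
    ∫ x, G x ∂(lam.withDensity (dens)) = ∫ x, (dens x).toReal * G x ∂lam :=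
  integral_withDensity_eq_integral_toReal_smul S.measurable_invariantDensity
    (ae_lt_top S.measurable_invariantDensity (by rw [S.lintegral_invariantDensity]; simp)) G

theorem logLip_iterate (S : FullBranchSystem F lam Z g w δ C γ D) {φ : X → ℝ≥0∞}
    (hφ : LogLip Z δ (regConst C γ) φ) (n : ℕ) : LogLip Z δ (regConst C γ) (L^[n] φ) := by
  have hle : C + regConst C γ * γ ≤ regConst C γ := by
    have h1 := S.regConst_step
    have h2 : 0 ≤ (1 - γ) / (2 * γ) * (regConst C γ * γ) := by
      have := S.γ_pos
      have := S.γ_lt_one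
      exact mul_nonneg (div_nonneg (by linarith) (by linarith))
        (mul_nonneg S.regConst_nonneg (by linarith))
    nlinarith
  induction n with
  | zero => exact hφ
  | succ n ih =>
    rw [Function.iterate_succ_apply']
    exact S.logLip_mono hle (S.logLip_transferOp S.regConst_nonneg ih)

/-- Regularity is required only along each inverse branch. Excursion sums satisfy this, although
they may jump between partition elements. -/
theorem logLip_transferOp_of_branch (S : FullBranchSystem F lam Z g w δ C γ D) {K : ℝ}
    {φ : X → ℝ≥0∞}
    (h : ∀ i, ∀ x ∈ Z, ∀ y ∈ Z, φ (g i x) ≤ eexp (K * δ x y) * φ (g i y)) :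
    LogLip Z δ (C + K) (L φ) := by
  intro x hx y hy
  simp only [transferOp, ← ENNReal.tsum_mul_left]
  refine ENNReal.tsum_le_tsum fun i => ?_
  calc _ ≤ (eexp (C * δ x y) * w i y) * (eexp (K * δ x y) * φ (g i y)) :=
        mul_le_mul' (S.w_le i x hx y hy) (h i x hx y hy)
    _ = _ := by rw [add_mul, eexp_add]; ring

/-- Adding 2τ brings W into the cone of positive regular functions: on a branch τ is constant and 2τ
+ W ≥ τ, so an oscillation of at most τ δ is logarithmically 1-Lipschitz. -/
theorem logLip_transferOp_observable (S : FullBranchSystem F lam Z g w δ C γ D) {τ W : X → ℝ}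
    (hτ : ∀ i, ∀ x ∈ Z, ∀ y ∈ Z, τ (g i x) = τ (g i y)) (hW : ∀ x, |W x| ≤ τ x)
    (hWlip : ∀ i, ∀ x ∈ Z, ∀ y ∈ Z, |W (g i x) - W (g i y)| ≤ τ (g i y) * δ x y) :
    LogLip Z δ (regConst C γ) (L (fun x => dens x * ENNReal.ofReal (2 * τ x + W x))) := by
  have h1 := S.div_step
  have h2 := S.div_le_regConst
  refine S.logLip_mono (K := C + (C / (1 - γ) * γ + 1)) (by linarith)
    (S.logLip_transferOp_of_branch fun i x hx y hy => ?_)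
  have hδ := S.δ_nonneg x y
  have e1 : dens (g i x) ≤ eexp (C / (1 - γ) * γ * δ x y) * dens (g i y) :=
    (S.logLip_invariantDensity _ (S.g_mem i x hx) _ (S.g_mem i y hy)).trans (by
      gcongr
      refine eexp_mono ?_
      rw [mul_assoc]
      exact mul_le_mul_of_nonneg_left (S.δ_g_le i x hx y hy) S.div_nonneg')
  have e2 : ENNReal.ofReal (2 * τ (g i x) + W (g i x)) ≤
      eexp (1 * δ x y) * ENNReal.ofReal (2 * τ (g i y) + W (g i y)) := by
    rw [eexp, ← ENNReal.ofReal_mul (Real.exp_pos _).le, one_mul]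
    refine ENNReal.ofReal_le_ofReal ?_
    have h3 := (abs_le.1 (hWlip i x hx y hy)).2
    have h4 := (abs_le.1 (hW (g i y))).1
    have h5 := Real.add_one_le_exp (δ x y)
    have h6 := (abs_nonneg _).trans (hW (g i y))
    rw [hτ i x hx y hy]
    have h7 : τ (g i y) * δ x y ≤ (2 * τ (g i y) + W (g i y)) * δ x y :=
      mul_le_mul_of_nonneg_right (by linarith) hδ
    have h8 : (2 * τ (g i y) + W (g i y)) * (δ x y + 1) ≤
        (2 * τ (g i y) + W (g i y)) * Real.exp (δ x y) :=
      mul_le_mul_of_nonneg_left h5 (by linarith)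
    linarith
  calc _ ≤ (eexp (C / (1 - γ) * γ * δ x y) * dens (g i y)) *
        (eexp (1 * δ x y) * ENNReal.ofReal (2 * τ (g i y) + W (g i y))) := mul_le_mul' e1 e2
    _ = _ := by rw [add_mul, eexp_add]; ring

/-- χ is the sum over n of L^{n+1}(dens · W) / dens, the usual solution of the Poisson equation.
Since W has mean zero, 2τ + W and 2τ have equal mass, so their iterates couple and the terms decay
geometrically. The duality with G is recorded in place of a pointwise equation; it determines χ
almost everywhere. -/
theorem exists_hasSum_integral_mul_comp (S : FullBranchSystem F lam Z g w δ C γ D) {τ W : X → ℝ}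
    (hτm : Measurable τ) (hτi : Integrable τ (lam.withDensity (dens)))
    (hτ : ∀ i, ∀ x ∈ Z, ∀ y ∈ Z, τ (g i x) = τ (g i y)) (hW : ∀ x, |W x| ≤ τ x)
    (hWm : BddMeas W) (hW0 : ∫ x, W x ∂(lam.withDensity (dens)) = 0)
    (hWlip : ∀ i, ∀ x ∈ Z, ∀ y ∈ Z, |W (g i x) - W (g i y)| ≤ τ (g i y) * δ x y) :
    ∃ χ : X → ℝ, Measurable χ ∧
      (∀ x, |χ x| ≤ coboundaryConst C γ D (∫ x, τ x ∂(lam.withDensity (dens)))) ∧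
      ∀ G : X → ℝ, BddMeas G →
        HasSum (fun n => ∫ x, W x * G (F^[n + 1] x) ∂(lam.withDensity (dens)))
          (∫ x, χ x * G x ∂(lam.withDensity (dens))) := by
  have hμp := S.isProbabilityMeasure_withDensity
  have hlamp := S.isProbabilityMeasure
  have hdm := S.measurable_invariantDensity
  set μ := lam.withDensity (dens) with hμ
  set t := ∫ x, τ x ∂μ with ht
  have hτ0 : ∀ x, 0 ≤ τ x := fun x => (abs_nonneg _).trans (hW x)
  have ht0 : 0 ≤ t := integral_nonneg hτ0
  set r := 1 - couplingConst C γ D with hr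
  have hr0 : 0 ≤ r := by have := S.couplingConst_lt_one; linarith
  have hr1 : r < 1 := by have := S.couplingConst_pos; linarith
  set κ := regConst C γ * D with hκ
  -- the general statement for an admissible observable `V`
  have gen : ∀ V : X → ℝ, BddMeas V → ∫ x, V x ∂μ = 0 → (∀ x, |V x| ≤ τ x) →
      Measurable (fun x => dens x * ENNReal.ofReal (2 * τ x + V x)) ∧
      ∫⁻ x, dens x * ENNReal.ofReal (2 * τ x + V x) ∂lam = ENNReal.ofReal (2 * t) := by
    intro V hV hV0 hVτ
    have hm : Measurable fun x => ENNReal.ofReal (2 * τ x + V x) :=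
      ((hτm.const_mul 2).add hV.1).ennreal_ofReal
    refine ⟨hdm.mul hm, ?_⟩
    rw [← S.lintegral_withDensity hm, ← ofReal_integral_eq_lintegral_ofReal]
    · rw [integral_add (hτi.const_mul 2) (hV.integrable _), hV0, add_zero, integral_const_mul]
    · exact (hτi.const_mul 2).add (hV.integrable _)
    · refine Filter.Eventually.of_forall fun x => ?_
      have := (abs_le.1 (hVτ x)).1
      have := hτ0 x
      change 0 ≤ 2 * τ x + V x
      linarith
  obtain ⟨mW, iW⟩ := gen W hWm hW0 hW
  have h00 : ∀ x, |(0 : ℝ)| ≤ τ x := fun x => by simpa using hτ0 x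
  obtain ⟨m0, i0⟩ := gen (fun _ => 0) (BddMeas.const 0) (by simp) h00
  have lW := S.logLip_transferOp_observable hτ hW hWlip
  have l0 := S.logLip_transferOp_observable (W := fun _ => 0) hτ h00 (fun i x _ y _ => by
    simpa using mul_nonneg (hτ0 _) (S.δ_nonneg x y))
  set φW := fun x => dens x * ENNReal.ofReal (2 * τ x + W x) with hφW
  set φ0 := fun x => dens x * ENNReal.ofReal (2 * τ x + 0) with hφ0
  have fW : ∫⁻ x, φW x ∂lam ≠ ∞ := by rw [iW]; exact ENNReal.ofReal_ne_top
  have f0 : ∫⁻ x, φ0 x ∂lam ≠ ∞ := by rw [i0]; exact ENNReal.ofReal_ne_top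
  have jW : ∫⁻ x, L φW x ∂lam = ENNReal.ofReal (2 * t) := by rw [S.lintegral_transferOp mW, iW]
  have j0 : ∫⁻ x, L φ0 x ∂lam = ENNReal.ofReal (2 * t) := by rw [S.lintegral_transferOp m0, i0]
  have hsucc : ∀ (n : ℕ) (φ : X → ℝ≥0∞), L^[n + 1] φ = L^[n] (L φ) := fun n φ =>
    Function.iterate_succ_apply _ _ _
  have hfin : ∀ (φ : X → ℝ≥0∞), Measurable φ → LogLip Z δ (regConst C γ) (L φ) →
      ∫⁻ x, φ x ∂lam = ENNReal.ofReal (2 * t) → ∀ n, ∀ y ∈ Z, L^[n + 1] φ y ≠ ∞ := by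
    intro φ hφ hl hi n y hy
    have := S.le_eexp_mul_lintegral S.regConst_nonneg (S.logLip_iterate hl n) hy
    rw [← hsucc, S.lintegral_iterate hφ, hi] at this
    exact ne_top_of_le_ne_top (ENNReal.mul_ne_top (eexp_ne_top _) ENNReal.ofReal_ne_top) this
  -- The term L^{n+1}(dens · W), written as a difference of iterates of two positive functions of
  -- mass 2t.
  set E : ℕ → X → ℝ := fun n y => (L^[n + 1] φW y).toReal - (L^[n + 1] φ0 y).toReal with hE
  have hEm : ∀ n, Measurable (E n) := fun n =>
    (S.measurable_iterate mW _).ennreal_toReal.sub (S.measurable_iterate m0 _).ennreal_toReal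
  have hEb : ∀ n, ∀ y ∈ Z, |E n y| ≤ r ^ n * (Real.exp κ * (2 * t)) := by
    intro n y hy
    have hb : ENNReal.ofReal r ^ n * eexp κ * ENNReal.ofReal (2 * t) =
        ENNReal.ofReal (r ^ n * (Real.exp κ * (2 * t))) := by
      rw [eexp, ← ENNReal.ofReal_pow hr0, ← ENNReal.ofReal_mul (by positivity),
        ← ENNReal.ofReal_mul (by positivity), mul_assoc]
    have conv : ∀ a b : ℝ≥0∞, b ≠ ∞ →
        a ≤ b + ENNReal.ofReal (r ^ n * (Real.exp κ * (2 * t))) →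
        a.toReal ≤ b.toReal + r ^ n * (Real.exp κ * (2 * t)) := by
      intro a b hb' hab
      have := ENNReal.toReal_mono (ENNReal.add_ne_top.2 ⟨hb', ENNReal.ofReal_ne_top⟩) hab
      rwa [ENNReal.toReal_add hb' ENNReal.ofReal_ne_top, ENNReal.toReal_ofReal (by positivity)]
        at this
    have a1 := S.iterate_le_add n (S.measurable_transferOp mW) (S.measurable_transferOp m0) lW l0
      (by rw [jW]; exact ENNReal.ofReal_ne_top) (by rw [jW, j0]) y hy
    have a2 := S.iterate_le_add n (S.measurable_transferOp m0) (S.measurable_transferOp mW) l0 lW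
      (by rw [j0]; exact ENNReal.ofReal_ne_top) (by rw [jW, j0]) y hy
    rw [← hsucc, ← hsucc, jW, hb] at a1
    rw [← hsucc, ← hsucc, j0, hb] at a2
    have b1 := conv _ _ (hfin φ0 m0 l0 i0 n y hy) a1
    have b2 := conv _ _ (hfin φW mW lW iW n y hy) a2
    rw [abs_le]
    constructor <;> simp only [hE] <;> linarith
  -- Division by the density passes from the reference measure to the invariant one. The bounds are
  -- available only on Z, hence the indicator.
  set χ : ℕ → X → ℝ := fun n => Z.indicator fun y => E n y / (dens y).toReal with hχ
  have hχm : ∀ n, Measurable (χ n) := fun n =>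
    ((hEm n).div hdm.ennreal_toReal).indicator S.measurableSet_Z
  have hχb : ∀ n y, ‖χ n y‖ ≤ r ^ n * (Real.exp (2 * κ) * (2 * t)) := by
    intro n y
    by_cases hy : y ∈ Z
    · have hd : Real.exp (-κ) ≤ (dens y).toReal := by
        have := ENNReal.toReal_mono (ENNReal.mul_ne_top (eexp_ne_top _)
          (S.invariantDensity_ne_top hy)) (S.one_le_eexp_mul_invariantDensity hy)
        rw [ENNReal.toReal_mul, eexp, ENNReal.toReal_ofReal (Real.exp_pos _).le,
          ENNReal.toReal_one] at this
        rw [Real.exp_neg]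
        exact (inv_le_iff_one_le_mul₀' (Real.exp_pos _)).2 this
      simp only [hχ, indicator_of_mem hy, Real.norm_eq_abs, abs_div, abs_of_nonneg
        ENNReal.toReal_nonneg]
      calc |E n y| / (dens y).toReal ≤ (r ^ n * (Real.exp κ * (2 * t))) / Real.exp (-κ) := by
            gcongr
            exact hEb n y hy
        _ = _ := by rw [Real.exp_neg, div_inv_eq_mul, two_mul κ, Real.exp_add]; ring
    · simp only [hχ, indicator_of_notMem hy, norm_zero]
      positivity
  have hgeo : HasSum (fun n => r ^ n * (Real.exp (2 * κ) * (2 * t)))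
      (coboundaryConst C γ D t) := by
    have := (hasSum_geometric_of_lt_one hr0 hr1).mul_right (Real.exp (2 * κ) * (2 * t))
    have he : coboundaryConst C γ D t = (1 - r)⁻¹ * (Real.exp (2 * κ) * (2 * t)) := by
      unfold coboundaryConst
      rw [hr, sub_sub_cancel, div_eq_inv_mul]
      ring
    rw [he]
    exact this
  have hsum : ∀ y, Summable fun n => χ n y := fun y =>
    Summable.of_norm_bounded hgeo.summable fun n => hχb n y
  refine ⟨fun y => ∑' n, χ n y, ?_, fun y => tsum_of_norm_bounded hgeo fun n => hχb n y, ?_⟩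
  · refine measurable_of_tendsto_metrizable (f := fun n y => ∑ k ∈ Finset.range n, χ k y)
      (fun n => Finset.measurable_fun_sum _ fun k _ => hχm k) ?_
    exact tendsto_pi_nhds.2 fun y => (hsum y).hasSum.tendsto_sum_nat
  · intro G hG
    have hG' := hG
    obtain ⟨hGm, B, hB⟩ := hG'
    have hχB : ∀ n, BddMeas (χ n) := fun n => ⟨hχm n, _, hχb n⟩
    have hterm : ∀ n, ∫ x, χ n x * G x ∂μ = ∫ x, W x * G (F^[n + 1] x) ∂μ := by
      intro n
      have hI : ∀ φ : X → ℝ≥0∞, Measurable φ → ∫⁻ x, φ x ∂lam ≠ ∞ → ∀ H : X → ℝ, BddMeas H →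
          Integrable (fun x => (φ x).toReal * H x) lam := fun φ hφ hφi H hH => by
        obtain ⟨h1, c, hc⟩ := hH
        exact (integrable_toReal_of_lintegral_ne_top hφ.aemeasurable hφi).mul_bdd
          h1.aestronglyMeasurable (Filter.Eventually.of_forall hc)
      have hGF : BddMeas fun x => G (F^[n + 1] x) := hG.comp (S.measurable_F.iterate _)
      rw [hμ, S.integral_withDensity, S.integral_withDensity]
      calc ∫ x, (dens x).toReal * (χ n x * G x) ∂lam
          = ∫ x, ((L^[n + 1] φW x).toReal * G x - (L^[n + 1] φ0 x).toReal * G x) ∂lam := by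
            refine integral_congr_ae (S.ae_mem.mono fun y hy => ?_)
            have hd : (dens y).toReal ≠ 0 := (ENNReal.toReal_ne_zero).2
              ⟨S.invariantDensity_ne_zero hy, S.invariantDensity_ne_top hy⟩
            simp only [hχ, indicator_of_mem hy, hE]
            field_simp
        _ = ∫ x, ((φW x).toReal * G (F^[n + 1] x) - (φ0 x).toReal * G (F^[n + 1] x)) ∂lam := by
            rw [integral_sub, integral_sub, S.integral_toReal_iterate_mul mW fW hG,
              S.integral_toReal_iterate_mul m0 f0 hG]
            · exact hI _ mW fW _ hGF
            · exact hI _ m0 f0 _ hGF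
            · exact hI _ (S.measurable_iterate mW _) (by rwa [S.lintegral_iterate mW]) _ hG
            · exact hI _ (S.measurable_iterate m0 _) (by rwa [S.lintegral_iterate m0]) _ hG
        _ = _ := by
            refine integral_congr_ae (Filter.Eventually.of_forall fun y => ?_)
            have := (abs_le.1 (hW y)).1
            have := hτ0 y
            simp only [hφW, hφ0, ENNReal.toReal_mul]
            rw [ENNReal.toReal_ofReal (by linarith), ENNReal.toReal_ofReal (by linarith)]
            ring
    have := hasSum_integral_of_summable_integral_norm (μ := μ)
      (F := fun n x => χ n x * G x) (fun n => ((hχB n).mul hG).integrable μ) (by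
        refine Summable.of_nonneg_of_le (fun n => integral_nonneg fun _ => norm_nonneg _)
          (fun n => ?_) (hgeo.summable.mul_right B)
        have hbd : ∀ x, ‖χ n x * G x‖ ≤ r ^ n * (Real.exp (2 * κ) * (2 * t)) * B := fun x => by
          rw [norm_mul]
          exact mul_le_mul (hχb n x) (hB x) (norm_nonneg _) (by positivity)
        calc ∫ x, ‖χ n x * G x‖ ∂μ ≤ ∫ _, r ^ n * (Real.exp (2 * κ) * (2 * t)) * B ∂μ :=
              integral_mono (((hχB n).mul hG).norm.integrable μ) (integrable_const _) hbd
          _ = _ := by simp)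
    simp only [hterm, tsum_mul_right] at this
    exact this

variable {E : Type*} [NormedAddCommGroup E] [InnerProductSpace ℝ E] [FiniteDimensional ℝ E]
  [MeasurableSpace E] [BorelSpace E]

theorem coboundaryConst_nonneg (S : FullBranchSystem F lam Z g w δ C γ D) {t : ℝ} (ht : 0 ≤ t) :
    0 ≤ coboundaryConst C γ D t := by
  have := S.couplingConst_pos
  unfold coboundaryConst
  positivity

/-- Replacing G by G ∘ F shifts the dual series of χ by one index, so ∫⟨χ, G ∘ F⟩ = ∫⟨χ, G⟩ - ∫⟨W, G
∘ F⟩; with invariance this is the orthogonality. The bound on ‖χ‖ does not depend on the dimension: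
for every unit vector u the component ⟨u, χ⟩ is a.e. the scalar solution for ⟨u, W⟩, and that one
satisfies the scalar bound. -/
theorem exists_orthogonal_coboundary (S : FullBranchSystem F lam Z g w δ C γ D) {τ : X → ℝ}
    {W : X → E}
    (hτm : Measurable τ) (hτi : Integrable τ (lam.withDensity (dens)))
    (hτ : ∀ i, ∀ x ∈ Z, ∀ y ∈ Z, τ (g i x) = τ (g i y)) (hW : ∀ x, ‖W x‖ ≤ τ x)
    (hWm : BddMeas W) (hW0 : ∫ x, W x ∂(lam.withDensity (dens)) = 0)
    (hWlip : ∀ i, ∀ x ∈ Z, ∀ y ∈ Z, ‖W (g i x) - W (g i y)‖ ≤ τ (g i y) * δ x y) :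
    ∃ χ : X → E, Measurable χ ∧
      (∀ x, ‖χ x‖ ≤ coboundaryConst C γ D (∫ x, τ x ∂(lam.withDensity (dens)))) ∧
      ∀ G : X → E, BddMeas G →
        ∫ x, inner ℝ (W x + χ x - χ (F x)) (G (F x)) ∂(lam.withDensity (dens)) = 0 := by
  have hμp := S.isProbabilityMeasure_withDensity
  set μ := lam.withDensity (dens) with hμ
  have hτ0 : ∀ x, 0 ≤ τ x := fun x => (norm_nonneg _).trans (hW x)
  set K := coboundaryConst C γ D (∫ x, τ x ∂μ) with hK
  have hK0 : 0 ≤ K := S.coboundaryConst_nonneg (integral_nonneg hτ0)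
  -- scalar components
  have scal : ∀ u : E, ‖u‖ ≤ 1 → ∃ χ : X → ℝ, Measurable χ ∧ (∀ x, |χ x| ≤ K) ∧
      ∀ G : X → ℝ, BddMeas G → HasSum (fun n => ∫ x, inner ℝ u (W x) * G (F^[n + 1] x) ∂μ)
          (∫ x, χ x * G x ∂μ) := by
    intro u hu
    refine S.exists_hasSum_integral_mul_comp hτm hτi hτ (W := fun x => inner ℝ u (W x))
      (fun x => ?_) ((BddMeas.const u).inner hWm) ?_ fun i x hx y hy => ?_
    · exact (abs_real_inner_le_norm _ _).trans
        ((mul_le_of_le_one_left (norm_nonneg _) hu).trans (hW x))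
    · rw [integral_inner (hWm.integrable μ), hW0, inner_zero_right]
    · rw [← inner_sub_right]
      exact (abs_real_inner_le_norm _ _).trans
        ((mul_le_of_le_one_left (norm_nonneg _) hu).trans (hWlip i x hx y hy))
  set b := stdOrthonormalBasis ℝ E with hb
  choose ξ hξm hξb hξs using fun k => scal (b k) (b.orthonormal.1 k).le
  set χ₀ : X → E := fun x => ∑ k, ξ k x • b k with hχ₀
  have hχ₀m : Measurable χ₀ := Finset.measurable_fun_sum _ fun k _ => (hξm k).smul_const _
  have hχ₀B : BddMeas χ₀ := BddMeas.sum _ fun k _ =>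
    BddMeas.smul ⟨hξm k, K, hξb k⟩ (BddMeas.const _)
  have hFn : ∀ n, Measurable F^[n] := fun n => S.measurable_F.iterate n
  -- the vector valued duality
  have dual : ∀ G : X → E, BddMeas G → HasSum (fun n => ∫ x, inner ℝ (W x) (G (F^[n + 1] x)) ∂μ)
      (∫ x, inner ℝ (χ₀ x) (G x) ∂μ) := by
    intro G hG
    have hGk : ∀ k, BddMeas fun x => (inner ℝ (b k) (G x) : ℝ) := fun k =>
      (BddMeas.const (b k)).inner hG
    have h := hasSum_sum (s := Finset.univ) fun k _ => hξs k _ (hGk k)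
    have e1 : ∀ n, ∑ k, ∫ x, inner ℝ (b k) (W x) * inner ℝ (b k) (G (F^[n + 1] x)) ∂μ =
        ∫ x, inner ℝ (W x) (G (F^[n + 1] x)) ∂μ := by
      intro n
      rw [← integral_finsetSum]
      · refine integral_congr_ae (Filter.Eventually.of_forall fun x => ?_)
        simp only
        rw [← b.sum_inner_mul_inner (W x)]
        exact Finset.sum_congr rfl fun k _ => by rw [real_inner_comm]
      · intro k _
        exact (((BddMeas.const (b k)).inner hWm).mul ((hGk k).comp (hFn _))).integrable μ
    have e2 : ∑ k, ∫ x, ξ k x * inner ℝ (b k) (G x) ∂μ = ∫ x, inner ℝ (χ₀ x) (G x) ∂μ := by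
      rw [← integral_finsetSum]
      · refine integral_congr_ae (Filter.Eventually.of_forall fun x => ?_)
        simp only [hχ₀, sum_inner, real_inner_smul_left]
      · intro k _
        exact (BddMeas.mul ⟨hξm k, K, hξb k⟩ (hGk k)).integrable μ
    simp only [e1] at h
    rwa [e2] at h
  -- the norm bound
  have comp : ∀ u : E, ∀ᵐ x ∂μ, inner ℝ u (χ₀ x) ≤ K * ‖u‖ := by
    intro u
    rcases eq_or_ne u 0 with rfl | hu
    · simp
    have hu' : 0 < ‖u‖ := norm_pos_iff.2 hu
    obtain ⟨ξu, hm, hbd, hs⟩ := scal (‖u‖⁻¹ • u) (by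
      rw [norm_smul, norm_inv, norm_norm, inv_mul_cancel₀ hu'.ne'])
    have hae : (fun x => (inner ℝ u (χ₀ x) : ℝ)) =ᵐ[μ] fun x => ‖u‖ * ξu x := by
      have hi1 : Integrable (fun x => (inner ℝ u (χ₀ x) : ℝ)) μ :=
        ((BddMeas.const u).inner hχ₀B).integrable μ
      have hi2 : Integrable (fun x => ‖u‖ * ξu x) μ :=
        ((BddMeas.const ‖u‖).mul ⟨hm, K, hbd⟩).integrable μ
      refine hi1.ae_eq_of_forall_setIntegral_eq _ _ hi2 fun s hsm _ => ?_
      have hind : BddMeas (s.indicator (1 : X → ℝ)) :=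
        ⟨measurable_one.indicator hsm, 1, fun x => by
          by_cases hx : x ∈ s <;> simp [hx]⟩
      have h1 := dual (fun x => s.indicator (1 : X → ℝ) x • u) (hind.smul (BddMeas.const u))
      have h2 := (hs _ hind).mul_left ‖u‖
      simp only [← integral_const_mul] at h2
      have h3 : ∀ n, ∫ x, inner ℝ (W x) (s.indicator (1 : X → ℝ) (F^[n + 1] x) • u) ∂μ =
          ∫ x, ‖u‖ * (inner ℝ (‖u‖⁻¹ • u) (W x) * s.indicator (1 : X → ℝ) (F^[n + 1] x)) ∂μ := by
        intro n
        refine integral_congr_ae (Filter.Eventually.of_forall fun x => ?_)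
        simp only [real_inner_smul_left, real_inner_smul_right]
        rw [real_inner_comm]
        field_simp
      simp only [h3] at h1
      have h4 := h1.unique h2
      rw [← integral_indicator hsm, ← integral_indicator hsm]
      calc _ = ∫ x, inner ℝ (χ₀ x) (s.indicator (1 : X → ℝ) x • u) ∂μ := by
            refine integral_congr_ae (Filter.Eventually.of_forall fun x => ?_)
            by_cases hx : x ∈ s
            · simp [hx, real_inner_comm]
            · simp [hx]
        _ = _ := h4
        _ = _ := by
            refine integral_congr_ae (Filter.Eventually.of_forall fun x => ?_)
            by_cases hx : x ∈ s <;> simp [hx]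
    filter_upwards [hae] with x hx
    rw [hx, mul_comm K]
    exact mul_le_mul_of_nonneg_left ((le_abs_self _).trans (hbd x)) hu'.le
  -- A countable dense set of directions gives one null set for all of them; testing with u = χ₀ x
  -- itself then bounds the norm.
  have hnorm : ∀ᵐ x ∂μ, ‖χ₀ x‖ ≤ K := by
    have := ae_all_iff.2 fun n => comp (TopologicalSpace.denseSeq E n)
    filter_upwards [this] with x hx
    have hcl : IsClosed {u : E | inner ℝ u (χ₀ x) ≤ K * ‖u‖} :=
      isClosed_le (by fun_prop) (by fun_prop)
    have huniv : closure (range (TopologicalSpace.denseSeq E)) ⊆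
        {u : E | inner ℝ u (χ₀ x) ≤ K * ‖u‖} :=
      closure_minimal (range_subset_iff.2 hx) hcl
    have h1 : inner ℝ (χ₀ x) (χ₀ x) ≤ K * ‖χ₀ x‖ :=
      huniv ((TopologicalSpace.denseRange_denseSeq E) _)
    rw [real_inner_self_eq_norm_mul_norm] at h1
    rcases (norm_nonneg (χ₀ x)).eq_or_lt with h | h
    · rw [← h]; exact hK0
    · exact le_of_mul_le_mul_right h1 h
  have hset : MeasurableSet {x | ‖χ₀ x‖ ≤ K} := measurableSet_le hχ₀m.norm measurable_const
  -- Setting χ₀ to zero on the null set where the bound fails makes the bound hold everywhere.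
  set χ : X → E := {x | ‖χ₀ x‖ ≤ K}.indicator χ₀ with hχ
  have hχm : Measurable χ := hχ₀m.indicator hset
  have hχb : ∀ x, ‖χ x‖ ≤ K := fun x => by
    by_cases hx : ‖χ₀ x‖ ≤ K
    · rw [hχ, indicator_of_mem (by exact hx)]; exact hx
    · rw [hχ, indicator_of_notMem (by exact hx), norm_zero]; exact hK0
  have hχae : ∀ᵐ x ∂μ, χ x = χ₀ x := hnorm.mono fun x hx =>
    indicator_of_mem (s := {x | ‖χ₀ x‖ ≤ K}) hx χ₀
  have hχB : BddMeas χ := ⟨hχm, K, hχb⟩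
  have dual' : ∀ G : X → E, BddMeas G →
      HasSum (fun n => ∫ x, inner ℝ (W x) (G (F^[n + 1] x)) ∂μ)
      (∫ x, inner ℝ (χ x) (G x) ∂μ) := fun G hG => by
    have h := dual G hG
    rwa [integral_congr_ae (hχae.mono fun x hx => by simp only [hx] :
      (fun x => (inner ℝ (χ₀ x) (G x) : ℝ)) =ᵐ[μ] fun x => inner ℝ (χ x) (G x))] at h
  refine ⟨χ, hχm, hχb, fun G hG => ?_⟩
  have hF : Measurable F := S.measurable_F
  have hGF : BddMeas fun x => G (F x) := hG.comp hF
  have a1 := dual' G hG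
  have a2 := dual' _ hGF
  have e1 : ∫ x, inner ℝ (χ (F x)) (G (F x)) ∂μ = ∫ x, inner ℝ (χ x) (G x) ∂μ := by
    have h := S.measurePreserving
    rw [← hμ] at h
    conv_rhs => rw [← h.map_eq]
    rw [integral_map hF.aemeasurable]
    exact (hχB.inner hG).1.aestronglyMeasurable
  have e2 : ∀ n x, F (F^[n + 1] x) = F^[n + 1 + 1] x := fun n x =>
    (Function.iterate_succ_apply' F (n + 1) x).symm
  simp only [e2] at a2
  -- The series for G without its first term is the series for G ∘ F.
  have a3 := (hasSum_nat_add_iff' (f := fun n => ∫ x, inner ℝ (W x) (G (F^[n + 1] x)) ∂μ) 1).2 a1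
  have a4 := a2.unique a3
  rw [Finset.sum_range_one] at a4
  simp only [zero_add, Function.iterate_one] at a4
  simp only [inner_sub_left, inner_add_left]
  rw [integral_sub, integral_add, e1, a4]
  · ring
  · exact (hWm.inner hGF).integrable μ
  · exact (hχB.inner hGF).integrable μ
  · exact ((hWm.inner hGF).add (hχB.inner hGF)).integrable μ
  · exact ((hχB.comp hF).inner hGF).integrable μ

end FullBranchSystem

namespace ExpandingSemiflow

/-! ### The induced map has full branches -/

variable {Λ : Type*} [MetricSpace Λ] [MeasurableSpace Λ] [BorelSpace Λ]
  {T : Λ → Λ} {ρ : Measure Λ} {Y : Set Λ} {α : Set (Set Λ)} {τ : Λ → ℕ} {C₁ β η : ℝ}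
  {μY : Measure Λ}

theorem measurable_inducedMap (hT : Measurable T) (hτ : Measurable τ) :
    Measurable (inducedMap T τ) := by
  intro s hs
  have : inducedMap T τ ⁻¹' s = ⋃ n : ℕ, τ ⁻¹' {n} ∩ T^[n] ⁻¹' s := by
    ext x; simp [inducedMap]
  rw [this]
  exact .iUnion fun n => (hτ (measurableSet_singleton n)).inter (hT.iterate n hs)

/-- The return time, set to `1` off `Y`. -/
noncomputable def extendedTime (Y : Set Λ) (τ : Λ → ℕ) (x : Λ) : ℕ :=
  open Classical in if x ∈ Y then τ x else 1

theorem extendedTime_of_mem {x : Λ} (hx : x ∈ Y) : extendedTime Y τ x = τ x := if_pos hx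

theorem inducedMap_extendedTime {x : Λ} (hx : x ∈ Y) :
    inducedMap T (extendedTime Y τ) x = inducedMap T τ x := by
  simp only [inducedMap, extendedTime_of_mem hx]

theorem tower_extendedTime : tower Y (extendedTime Y τ) = tower Y τ := by
  ext q
  simp only [tower, mem_ofPred_eq]
  exact and_congr_right fun h => by rw [extendedTime_of_mem h]

namespace IsNonuniformlyExpanding

theorem subset_Y (H : IsNonuniformlyExpanding T ρ Y α τ C₁ β η) {a : Set Λ} (ha : a ∈ α) :
    a ⊆ Y := H.sUnion_eq ▸ subset_sUnion_of_mem ha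

theorem one_le_extendedTime (H : IsNonuniformlyExpanding T ρ Y α τ C₁ β η) (x : Λ) :
    1 ≤ extendedTime Y τ x := by
  by_cases hx : x ∈ Y
  · rw [extendedTime_of_mem hx]; exact H.one_le_τ x hx
  · rw [extendedTime, if_neg hx]

theorem measurable_extendedTime (H : IsNonuniformlyExpanding T ρ Y α τ C₁ β η) :
    Measurable (extendedTime Y τ) := by
  refine measurable_to_countable' fun n => ?_
  have : extendedTime Y τ ⁻¹' {n} =
      (⋃ a ∈ {a ∈ α | ∃ x ∈ a, τ x = n}, a) ∪ (Yᶜ ∩ {_x | n = 1}) := by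
    ext x
    simp only [mem_preimage, mem_singleton_iff, mem_union, mem_iUnion, mem_inter_iff,
      mem_compl_iff, mem_ofPred_eq]
    by_cases hx : x ∈ Y
    · rw [extendedTime_of_mem hx]
      obtain ⟨a, ha, hxa⟩ : ∃ a ∈ α, x ∈ a := by rwa [← H.sUnion_eq] at hx
      constructor
      · exact fun h => Or.inl ⟨a, ⟨ha, x, hxa, h⟩, hxa⟩
      · rintro (⟨b, ⟨hb, y, hy, h⟩, hxb⟩ | h)
        · rw [H.τ_const b hb x hxb y hy, h]
        · exact absurd hx h.1
    · rw [extendedTime, if_neg hx]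
      constructor
      · exact fun h => Or.inr ⟨hx, h.symm⟩
      · rintro (⟨b, ⟨hb, -⟩, hxb⟩ | h)
        · exact absurd (H.subset_Y hb hxb) hx
        · exact h.2.symm
  rw [this]
  exact (MeasurableSet.biUnion (H.countable.mono (sep_subset _ _))
    fun a ha => H.measurableSet a ha.1).union (H.measurableSet_Y.compl.inter (.const _))

theorem extendedTime (H : IsNonuniformlyExpanding T ρ Y α τ C₁ β η) :
    IsNonuniformlyExpanding T ρ Y α (extendedTime Y τ) C₁ β η := by
  have hF : ∀ a ∈ α, EqOn (inducedMap T (ExpandingSemiflow.extendedTime Y τ)) (inducedMap T τ) a :=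
    fun a ha x hx => inducedMap_extendedTime (H.subset_Y ha hx)
  obtain ⟨ζ, h1, h2, h3, h4⟩ := H.distortion
  exact {
    bounded := H.bounded
    finite := H.finite
    nonsingular := H.nonsingular
    measurableSet_Y := H.measurableSet_Y
    measure_Y_pos := H.measure_Y_pos
    one_le_C₁ := H.one_le_C₁
    one_lt_β := H.one_lt_β
    η_pos := H.η_pos
    η_le_one := H.η_le_one
    countable := H.countable
    measurableSet := H.measurableSet
    pairwiseDisjoint := H.pairwiseDisjoint
    sUnion_eq := H.sUnion_eq
    one_le_τ := fun x _ => H.one_le_extendedTime x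
    τ_const := fun a ha x hx y hy => by
      rw [extendedTime_of_mem (H.subset_Y ha hx), extendedTime_of_mem (H.subset_Y ha hy)]
      exact H.τ_const a ha x hx y hy
    τ_integrable := H.τ_integrable.congr_fun
      (fun x hx => by simp only [extendedTime_of_mem hx]) H.measurableSet_Y
    injOn := fun a ha => (H.injOn a ha).congr (hF a ha).symm
    image_ae_eq := fun a ha => by rw [(hF a ha).image_eq]; exact H.image_ae_eq a ha
    expansion := fun a ha x hx y hy => by
      rw [hF a ha hx, hF a ha hy]; exact H.expansion a ha x hx y hy
    intermediate := fun a ha x hx y hy l hl => by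
      rw [extendedTime_of_mem (H.subset_Y ha hx)] at hl
      rw [hF a ha hx, hF a ha hy]; exact H.intermediate a ha x hx y hy l hl
    distortion := ⟨ζ, h1, h2, fun a ha B hB hBm => by
      rw [((hF a ha).mono hB).image_eq]; exact h3 a ha B hB hBm,
      fun a ha x hx y hy => by
        rw [hF a ha hx, hF a ha hy]; exact h4 a ha x hx y hy⟩ }

/-- Weakening of the constants. -/
theorem weaken (H : IsNonuniformlyExpanding T ρ Y α τ C₁ β η) {C₁' β' η' D : ℝ} (hD1 : 1 ≤ D)
    (hD : ∀ x y : Λ, dist x y ≤ D) (hC : C₁ * D ≤ C₁') (hβ1 : 1 < β') (hβ : β' ≤ β)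
    (hη0 : 0 < η') (hη : η' ≤ η) :
    IsNonuniformlyExpanding T ρ Y α τ C₁' β' η' := by
  have h1 := H.one_le_C₁
  have hC' : C₁ ≤ C₁' := (le_mul_of_one_le_right (by linarith) hD1).trans hC
  obtain ⟨ζ, z1, z2, z3, z4⟩ := H.distortion
  exact {
    bounded := H.bounded
    finite := H.finite
    nonsingular := H.nonsingular
    measurableSet_Y := H.measurableSet_Y
    measure_Y_pos := H.measure_Y_pos
    one_le_C₁ := h1.trans hC'
    one_lt_β := hβ1
    η_pos := hη0
    η_le_one := hη.trans H.η_le_one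
    countable := H.countable
    measurableSet := H.measurableSet
    pairwiseDisjoint := H.pairwiseDisjoint
    sUnion_eq := H.sUnion_eq
    one_le_τ := H.one_le_τ
    τ_const := H.τ_const
    τ_integrable := H.τ_integrable
    injOn := H.injOn
    image_ae_eq := H.image_ae_eq
    expansion := fun a ha x hx y hy =>
      (mul_le_mul_of_nonneg_right hβ dist_nonneg).trans (H.expansion a ha x hx y hy)
    intermediate := fun a ha x hx y hy l hl =>
      (H.intermediate a ha x hx y hy l hl).trans (mul_le_mul_of_nonneg_right hC' dist_nonneg)
    distortion := ⟨ζ, z1, z2, z3, fun a ha x hx y hy => by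
      refine (z4 a ha x hx y hy).trans ?_
      set t := dist (inducedMap T τ x) (inducedMap T τ y) with ht
      have ht0 : 0 ≤ t := dist_nonneg
      -- Since t ≤ D and η - η' ≤ 1, lowering the exponent costs a factor D; hence the assumption C₁
      -- * D ≤ C₁'.
      have h2 : t ^ η ≤ D * t ^ η' := by
        rcases ht0.eq_or_lt with h0 | h0
        · rw [← h0, Real.zero_rpow (by linarith), Real.zero_rpow hη0.ne', mul_zero]
        · have h3 : t ^ (η - η') ≤ D := by
            calc t ^ (η - η') ≤ D ^ (η - η') :=
                  Real.rpow_le_rpow ht0 (hD _ _) (by linarith)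
              _ ≤ D ^ (1 : ℝ) := Real.rpow_le_rpow_of_exponent_le hD1
                  (by have := H.η_le_one; linarith)
              _ = D := Real.rpow_one D
          calc t ^ η = t ^ (η - η') * t ^ η' := by rw [← Real.rpow_add h0]; ring_nf
            _ ≤ _ := by gcongr
      calc C₁ * t ^ η ≤ C₁ * (D * t ^ η') := by gcongr
        _ = (C₁ * D) * t ^ η' := by ring
        _ ≤ _ := by gcongr⟩ }

/-- The Jacobian formula is available only for measurable sets, so the null set is first enlarged to
its measurable hull. -/
theorem measure_image_eq_zero (H : IsNonuniformlyExpanding T ρ Y α τ C₁ β η)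
    {N : Set Λ} (hN : ρ N = 0) {a : Set Λ} (ha : a ∈ α) :
    ρ (inducedMap T τ '' (a ∩ N)) = 0 := by
  obtain ⟨ζ, -, -, h3, -⟩ := H.distortion
  refine measure_mono_null (image_mono (inter_subset_inter_right a (subset_toMeasurable ρ N))) ?_
  rw [h3 a ha _ inter_subset_left ((H.measurableSet a ha).inter (measurableSet_toMeasurable ρ N)),
    Measure.restrict_zero_set, lintegral_zero_measure]
  exact measure_mono_null inter_subset_right (by rw [measure_toMeasurable, hN])

/-- There is a set of full measure in `Y` on which all inverse branches are defined and which is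
invariant under them. -/
theorem exists_full_set (H : IsNonuniformlyExpanding T ρ Y α τ C₁ β η) :
    ∃ Z ⊆ Y, MeasurableSet Z ∧ ρ (Y \ Z) = 0 ∧
    ∀ a ∈ α, ∀ y ∈ Z, ∃ x ∈ a, x ∈ Z ∧ inducedMap T τ x = y := by
  set F := inducedMap T τ with hF
  set next : Set Λ → Set Λ := fun N => toMeasurable ρ (⋃ a ∈ α, F '' (a ∩ N)) with hnext
  -- The first bad set contains the points of Y missed by some branch, the next ones the images of
  -- the previous bad set. Removing all of them leaves a set in which every preimage of a good point
  -- is good.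
  set B : ℕ → Set Λ := fun n => next^[n] (toMeasurable ρ (⋃ a ∈ α, Y \ F '' a)) with hB
  have h0 : ∀ n, ρ (B n) = 0 := by
    intro n
    induction n with
    | zero =>
      simp only [hB, Function.iterate_zero, id_eq, measure_toMeasurable]
      exact (measure_biUnion_null_iff H.countable).2 fun a ha =>
        (ae_le_set.1 (H.image_ae_eq a ha).symm.le)
    | succ n ih =>
      simp only [hB, Function.iterate_succ_apply'] at ih ⊢
      rw [hnext]
      simp only [measure_toMeasurable]
      exact (measure_biUnion_null_iff H.countable).2 fun a ha => H.measure_image_eq_zero ih ha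
  have hm : ∀ n, MeasurableSet (B n) := by
    intro n
    cases n with
    | zero => exact measurableSet_toMeasurable _ _
    | succ n =>
      simp only [hB, Function.iterate_succ_apply']
      exact measurableSet_toMeasurable _ _
  refine ⟨Y \ ⋃ n, B n, sdiff_subset, H.measurableSet_Y.diff (.iUnion hm), ?_, ?_⟩
  · exact measure_mono_null (t := ⋃ n, B n) (fun x hx => by
      by_contra h; exact hx.2 ⟨hx.1, h⟩) (measure_iUnion_null h0)
  · intro a ha y hy
    have hy1 : y ∈ F '' a := by
      by_contra h
      exact hy.2 (mem_iUnion.2 ⟨0, subset_toMeasurable _ _ (mem_iUnion₂.2 ⟨a, ha, hy.1, h⟩)⟩)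
    obtain ⟨x, hx, hxy⟩ := hy1
    refine ⟨x, hx, ⟨H.subset_Y ha hx, fun h => ?_⟩, hxy⟩
    obtain ⟨n, hn⟩ := mem_iUnion.1 h
    refine hy.2 (mem_iUnion.2 ⟨n + 1, ?_⟩)
    simp only [hB, Function.iterate_succ_apply']
    exact subset_toMeasurable _ _ (mem_iUnion₂.2 ⟨a, ha, x, ⟨hx, hn⟩, hxy⟩)

/-- Change of variables on a partition element. -/
theorem lintegral_branch (H : IsNonuniformlyExpanding T ρ Y α τ C₁ β η)
    (hτ : Measurable τ) {ζ : Λ → ℝ} (hζ : Measurable ζ)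
    (h3 : ∀ a ∈ α, ∀ B ⊆ a, MeasurableSet B →
      ρ (inducedMap T τ '' B) = ∫⁻ x in B, ENNReal.ofReal (ζ x)⁻¹ ∂ρ)
    {a : Set Λ} (ha : a ∈ α) {ψ : Λ → ℝ≥0∞} (hψ : Measurable ψ) :
    ∫⁻ x in a, ENNReal.ofReal (ζ x)⁻¹ * ψ (inducedMap T τ x) ∂ρ = ∫⁻ y in Y, ψ y ∂ρ := by
  have hF := measurable_inducedMap H.nonsingular.measurable hτ
  set F := inducedMap T τ with hFd
  have hz : Measurable fun x => ENNReal.ofReal (ζ x)⁻¹ := hζ.inv.ennreal_ofReal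
  have key : ((ρ.restrict a).withDensity fun x => ENNReal.ofReal (ζ x)⁻¹).map F =
      ρ.restrict Y := by
    refine Measure.ext fun s hs => ?_
    rw [Measure.map_apply hF hs, withDensity_apply _ (hF hs), Measure.restrict_restrict (hF hs),
      Measure.restrict_apply hs, ← h3 a ha _ inter_subset_right
        ((hF hs).inter (H.measurableSet a ha)), inter_comm, image_inter_preimage, inter_comm]
    exact measure_congr ((ae_eq_refl s).inter (H.image_ae_eq a ha))
  rw [← key, lintegral_map hψ hF, lintegral_withDensity_eq_lintegral_mul _ hz
    (show Measurable fun x => ψ (F x) from hψ.comp hF)]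
  rfl

theorem exists_fullBranchSystem (H : IsNonuniformlyExpanding T ρ Y α τ C₁ β η)
    (hτ : Measurable τ) {D : ℝ} (hD1 : 1 ≤ D)
    (hD : ∀ x y : Λ, dist x y ≤ D) :
    ∃ (Z : Set Λ) (g : α → Λ → Λ) (w : α → Λ → ℝ≥0∞), Z ⊆ Y ∧
      (∀ a : α, ∀ y ∈ Z, g a y ∈ (a : Set Λ)) ∧
      FullBranchSystem (inducedMap T τ) ((ρ Y)⁻¹ • ρ.restrict Y) Z g w
        (fun x y => dist x y ^ η) C₁ (β ^ (-η)) D := by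
  classical
  have hF := measurable_inducedMap H.nonsingular.measurable hτ
  have := H.finite
  obtain ⟨Z, hZY, hZm, hZ0, hZ⟩ := H.exists_full_set
  obtain ⟨ζ, z1, z2, z3, z4⟩ := H.distortion
  set F := inducedMap T τ with hFd
  choose! g₀ g1 g2 g3 using hZ
  -- The identity off Z is a filler. On Z the branch is Lipschitz by the expansion property, which
  -- gives measurability.
  set g : α → Λ → Λ := fun a => Z.piecewise (g₀ a) id with hg
  have hgZ : ∀ (a : α) {y}, y ∈ Z → g a y = g₀ a y := fun a y hy => piecewise_eq_of_mem _ _ _ hy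
  have hgF : ∀ (a : α) {x}, x ∈ (a : Set Λ) → F x ∈ Z → g a (F x) = x := fun a x hx hFx => by
    rw [hgZ a hFx]
    exact H.injOn a a.2 (g1 a a.2 _ hFx) hx (g3 a a.2 _ hFx)
  have hβ0 : 0 < β := by have := H.one_lt_β; linarith
  have hη0 := H.η_pos
  have hdist : ∀ (a : α), ∀ x ∈ Z, ∀ y ∈ Z, β * dist (g a x) (g a y) ≤ dist x y := by
    intro a x hx y hy
    rw [hgZ a hx, hgZ a hy]
    have h := H.expansion a a.2 _ (g1 a a.2 x hx) _ (g1 a a.2 y hy)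
    rwa [← hFd, g3 a a.2 x hx, g3 a a.2 y hy] at h
  have hgm : ∀ a, Measurable (g a) := by
    intro a
    refine ContinuousOn.measurable_piecewise ?_ continuous_id.continuousOn hZm
    have : LipschitzOnWith (Real.toNNReal β⁻¹) (g₀ a) Z := by
      refine LipschitzOnWith.of_dist_le_mul fun x hx y hy => ?_
      have h := hdist a x hx y hy
      rw [hgZ a hx, hgZ a hy] at h
      rw [Real.coe_toNNReal _ (by positivity), ← div_eq_inv_mul, le_div_iff₀' hβ0]
      exact h
    exact this.continuousOn
  set w : α → Λ → ℝ≥0∞ := fun a => Z.indicator fun y => ENNReal.ofReal (ζ (g a y)) with hw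
  have hwm : ∀ a, Measurable (w a) := fun a =>
    ((z1.comp (hgm a)).ennreal_ofReal).indicator hZm
  have hzpos : ∀ a ∈ α, ∀ x ∈ a, 0 < ζ x := fun a ha x hx => z2 x (H.subset_Y ha hx)
  have hbr : ∀ (a : α) (φ : Λ → ℝ≥0∞), Measurable φ →
      ∫⁻ y in Y, w a y * φ (g a y) ∂ρ = ∫⁻ x in a, φ x ∂ρ := by
    intro a φ hφ
    rw [← H.lintegral_branch hτ z1 z3 a.2 (show Measurable fun y => w a y * φ (g a y) from
      (hwm a).mul (hφ.comp (hgm a)))]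
    have hnull : ∀ᵐ x ∂(ρ.restrict a), F x ∈ Z := by
      have h0 : ∫⁻ x in a, ENNReal.ofReal (ζ x)⁻¹ * Zᶜ.indicator 1 (F x) ∂ρ = 0 := by
        rw [H.lintegral_branch hτ z1 z3 a.2 (measurable_one.indicator hZm.compl),
          lintegral_indicator_one hZm.compl, Measure.restrict_apply hZm.compl, inter_comm]
        exact hZ0
      rw [lintegral_eq_zero_iff (show Measurable fun x => ENNReal.ofReal (ζ x)⁻¹ *
        Zᶜ.indicator 1 (F x) from z1.inv.ennreal_ofReal.mul
        ((measurable_one.indicator hZm.compl).comp hF))] at h0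
      filter_upwards [h0, ae_restrict_mem (H.measurableSet a a.2)] with x hx hxa
      by_contra hxZ
      have hp := hzpos a a.2 x hxa
      simp [indicator_of_mem (show F x ∈ Zᶜ from hxZ), hp.not_ge] at hx
    refine lintegral_congr_ae ?_
    filter_upwards [hnull, ae_restrict_mem (H.measurableSet a a.2)] with x hx hxa
    have hp := hzpos a a.2 x hxa
    change ENNReal.ofReal (ζ x)⁻¹ * (w a (F x) * φ (g a (F x))) = φ x
    simp only [hw, indicator_of_mem hx]
    rw [hgF a hxa hx, ← mul_assoc, ← ENNReal.ofReal_mul (by positivity), inv_mul_cancel₀ hp.ne']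
    simp
  refine ⟨Z, g, w, hZY, fun a y hy => by rw [hgZ a hy]; exact g1 a a.2 y hy, ?_⟩
  have hY0 := H.measure_Y_pos.ne'
  have hcount : Countable α := H.countable
  exact {
    isProbabilityMeasure := ⟨by
      rw [Measure.smul_apply, Measure.restrict_apply_univ, smul_eq_mul,
        ENNReal.inv_mul_cancel hY0 (measure_ne_top _ _)]⟩
    measurable_F := hF
    measurableSet_Z := hZm
    measure_compl_Z := by
      rw [Measure.smul_apply, Measure.restrict_apply hZm.compl, inter_comm]
      change _ • ρ (Y \ Z) = 0
      rw [hZ0, smul_zero]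
    countable := hcount
    measurable_g := hgm
    measurable_w := hwm
    g_mem := fun a y hy => by rw [hgZ a hy]; exact g2 a a.2 y hy
    F_g := fun a y hy => by rw [hgZ a hy]; exact g3 a a.2 y hy
    lintegral_eq := fun φ hφ => by
      rw [lintegral_smul_measure, lintegral_smul_measure, lintegral_tsum fun a =>
        (show Measurable fun y => w a y * φ (g a y) from
          (hwm a).mul (hφ.comp (hgm a))).aemeasurable]
      congr 1
      simp_rw [hbr _ φ hφ]
      rw [← H.sUnion_eq, sUnion_eq_biUnion, lintegral_biUnion H.countable H.measurableSet]
      exact H.pairwiseDisjoint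
    δ_nonneg := fun x y => by positivity
    δ_le := fun x _ y _ => by
      calc dist x y ^ η ≤ D ^ η := Real.rpow_le_rpow dist_nonneg (hD x y) hη0.le
        _ ≤ D ^ (1 : ℝ) := Real.rpow_le_rpow_of_exponent_le hD1 H.η_le_one
        _ = D := Real.rpow_one D
    δ_g_le := fun a x hx y hy => by
      rw [Real.rpow_neg hβ0.le, ← div_eq_inv_mul, le_div_iff₀' (by positivity),
        ← Real.mul_rpow hβ0.le dist_nonneg]
      exact Real.rpow_le_rpow (by positivity) (hdist a x hx y hy) hη0.le
    w_le := fun a x hx y hy => by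
      have m1 := g1 a a.2 x hx
      have m2 := g1 a a.2 y hy
      have h := (abs_le.1 (z4 a a.2 _ m1 _ m2)).2
      rw [g3 a a.2 x hx, g3 a a.2 y hy] at h
      simp only [hw, indicator_of_mem hx, indicator_of_mem hy, hgZ a hx, hgZ a hy, eexp]
      rw [← ENNReal.ofReal_mul (Real.exp_pos _).le]
      refine ENNReal.ofReal_le_ofReal ?_
      rw [← Real.exp_log (hzpos a a.2 _ m1), ← Real.exp_log (hzpos a a.2 _ m2), ← Real.exp_add]
      exact Real.exp_le_exp.2 (by linarith)
    C_nonneg := by have := H.one_le_C₁; linarith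
    γ_pos := by positivity
    γ_lt_one := Real.rpow_lt_one_of_one_lt_of_neg H.one_lt_β (by linarith)
    D_nonneg := by linarith }

end IsNonuniformlyExpanding

theorem IsInducedMeasure.ae_mem (hY : MeasurableSet Y) (hμ : IsInducedMeasure T ρ Y τ μY) :
    ∀ᵐ y ∂μY, y ∈ Y := hμ.absolutelyContinuous.ae_le (ae_restrict_mem hY)

theorem IsInducedMeasure.extendedTime (hY : MeasurableSet Y)
    (hμ : IsInducedMeasure T ρ Y τ μY) : IsInducedMeasure T ρ Y (extendedTime Y τ) μY :=
  ⟨hμ.isProbabilityMeasure, hμ.absolutelyContinuous, by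
    conv_rhs => rw [← hμ.invariant]
    exact Measure.map_congr ((hμ.ae_mem hY).mono fun y hy => inducedMap_extendedTime hy)⟩

theorem towerMeasure_extendedTime (hY : MeasurableSet Y) :
    towerMeasure Y (extendedTime Y τ) μY = towerMeasure Y τ μY := by
  rw [towerMeasure, towerMeasure, tower_extendedTime,
    setLIntegral_congr_fun hY (g := fun y => (τ y : ℝ≥0∞)) fun y hy => by
      simp only [extendedTime_of_mem hy]]

/-- The invariant measure of the full branch system is the given one. -/
theorem IsInducedMeasure.eq_withDensity (hμ : IsInducedMeasure T ρ Y τ μY)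
    (hη0 : 0 < η) (hη1 : η ≤ 1) {ι : Type*} {Z : Set Λ} {g : ι → Λ → Λ} {w : ι → Λ → ℝ≥0∞}
    {C γ D : ℝ} (hρ : (ρ Y)⁻¹ ≠ 0)
    (S : FullBranchSystem (inducedMap T τ) ((ρ Y)⁻¹ • ρ.restrict Y) Z g w
      (fun x y => dist x y ^ η) C γ D) :
    μY = ((ρ Y)⁻¹ • ρ.restrict Y).withDensity (invariantDensity g w C γ D) := by
  have := hμ.isProbabilityMeasure
  exact S.eq_withDensity hη0 hη1 ⟨S.measurable_F, hμ.invariant⟩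
    (hμ.absolutelyContinuous.trans (Measure.absolutelyContinuous_smul hρ))

end ExpandingSemiflow

namespace ExpandingSemiflow

/-! ### The tower map -/

section Tower

variable {Λ : Type*} [MeasurableSpace Λ] {T : Λ → Λ} {Y : Set Λ} {τ : Λ → ℕ} {μY : Measure Λ}

/-- The data needed to build a tower with finite measure. -/
structure IsTowerSystem (T : Λ → Λ) (Y : Set Λ) (τ : Λ → ℕ) (μY : Measure Λ) : Prop where
  measurable_T : Measurable T
  measurableSet_Y : MeasurableSet Y
  measurable_τ : Measurable τ
  one_le_τ : ∀ x, 1 ≤ τ x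
  isProbabilityMeasure : IsProbabilityMeasure μY
  ae_mem : ∀ᵐ y ∂μY, y ∈ Y
  measurePreserving : MeasurePreserving (inducedMap T τ) μY μY
  lintegral_τ_ne_top : ∫⁻ y, (τ y : ℝ≥0∞) ∂μY ≠ ∞

/-- The tower map. -/
def towerMap (T : Λ → Λ) (τ : Λ → ℕ) (q : Λ × ℕ) : Λ × ℕ :=
  if q.2 + 1 < τ q.1 then (q.1, q.2 + 1) else (inducedMap T τ q.1, 0)

theorem towerMap_of_lt {q : Λ × ℕ} (h : q.2 + 1 < τ q.1) : towerMap T τ q = (q.1, q.2 + 1) :=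
  if_pos h

theorem towerMap_of_not_lt {q : Λ × ℕ} (h : ¬ q.2 + 1 < τ q.1) :
    towerMap T τ q = (inducedMap T τ q.1, 0) := if_neg h

namespace IsTowerSystem

theorem snd_towerMap_lt (S : IsTowerSystem T Y τ μY) (q : Λ × ℕ) :
    (towerMap T τ q).2 < τ (towerMap T τ q).1 := by
  by_cases h : q.2 + 1 < τ q.1
  · rw [towerMap_of_lt h]; exact h
  · rw [towerMap_of_not_lt h]; exact S.one_le_τ _

theorem snd_iterate_lt (S : IsTowerSystem T Y τ μY) {q : Λ × ℕ} (hq : q.2 < τ q.1) (n : ℕ) :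
    ((towerMap T τ)^[n] q).2 < τ ((towerMap T τ)^[n] q).1 := by
  cases n with
  | zero => exact hq
  | succ n => rw [Function.iterate_succ_apply']; exact S.snd_towerMap_lt _

theorem towerProj_towerMap {q : Λ × ℕ} (hq : q.2 < τ q.1) :
    towerProj T (towerMap T τ q) = T (towerProj T q) := by
  by_cases h : q.2 + 1 < τ q.1
  · rw [towerMap_of_lt h]; exact Function.iterate_succ_apply' T _ _
  · have h1 : τ q.1 = q.2 + 1 := by omega
    rw [towerMap_of_not_lt h]
    simp only [towerProj, inducedMap, h1, Function.iterate_zero, id_eq]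
    exact Function.iterate_succ_apply' T _ _

theorem towerProj_iterate (S : IsTowerSystem T Y τ μY) {q : Λ × ℕ} (hq : q.2 < τ q.1) (n : ℕ) :
    towerProj T ((towerMap T τ)^[n] q) = T^[n] (towerProj T q) := by
  induction n with
  | zero => rfl
  | succ n ih =>
    rw [Function.iterate_succ_apply', Function.iterate_succ_apply',
      towerProj_towerMap (S.snd_iterate_lt hq n), ih]

theorem measurable_towerProj (S : IsTowerSystem T Y τ μY) : Measurable (towerProj T) :=
  measurable_from_prod_countable_left fun n => S.measurable_T.iterate n

theorem measurable_inducedMap (S : IsTowerSystem T Y τ μY) : Measurable (inducedMap T τ) :=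
  S.measurePreserving.measurable

theorem measurableSet_lt_τ (S : IsTowerSystem T Y τ μY) (k : ℕ) :
    MeasurableSet {q : Λ × ℕ | q.2 + k < τ q.1} :=
  measurableSet_lt (measurable_snd.add_const k) (S.measurable_τ.comp measurable_fst)

theorem measurable_towerMap (S : IsTowerSystem T Y τ μY) : Measurable (towerMap T τ) :=
  Measurable.ite (S.measurableSet_lt_τ 1)
    (measurable_fst.prodMk (measurable_snd.add_const 1))
    ((S.measurable_inducedMap.comp measurable_fst).prodMk measurable_const)

theorem measurableSet_tower (S : IsTowerSystem T Y τ μY) : MeasurableSet (tower Y τ) :=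
  (measurable_fst S.measurableSet_Y).inter (S.measurableSet_lt_τ 0)

theorem sum_range_eq_tsum (φ : Λ × ℕ → ℝ≥0∞) (y : Λ) :
    ∑ l ∈ Finset.range (τ y), φ (y, l) =
      ∑' l, {q : Λ × ℕ | q.2 + 0 < τ q.1}.indicator φ (y, l) := by
  rw [tsum_eq_sum (s := Finset.range (τ y))]
  · refine Finset.sum_congr rfl fun l hl => ?_
    rw [indicator_of_mem]
    exact Finset.mem_range.1 hl
  · intro l hl
    rw [indicator_of_notMem]
    simpa using hl

theorem measurable_sum (S : IsTowerSystem T Y τ μY) {φ : Λ × ℕ → ℝ≥0∞} (hφ : Measurable φ) :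
    Measurable fun y => ∑ l ∈ Finset.range (τ y), φ (y, l) := by
  simp only [sum_range_eq_tsum (τ := τ) φ]
  exact Measurable.tsum fun l =>
    (hφ.indicator (S.measurableSet_lt_τ 0)).comp (measurable_id.prodMk measurable_const)

theorem lintegral_tower (S : IsTowerSystem T Y τ μY) {φ : Λ × ℕ → ℝ≥0∞} (hφ : Measurable φ) :
    ∫⁻ q, φ q ∂(towerMeasure Y τ μY) =
      (∫⁻ y, (τ y : ℝ≥0∞) ∂μY)⁻¹ * ∫⁻ y, ∑ l ∈ Finset.range (τ y), φ (y, l) ∂μY := by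
  have := S.isProbabilityMeasure
  have hY : μY.restrict Y = μY := Measure.restrict_eq_self_of_ae_mem S.ae_mem
  rw [towerMeasure, lintegral_smul_measure, smul_eq_mul, hY,
    ← lintegral_indicator S.measurableSet_tower,
    lintegral_prod _ (hφ.indicator S.measurableSet_tower).aemeasurable]
  congr 1
  refine lintegral_congr_ae (S.ae_mem.mono fun y hy => ?_)
  simp only [lintegral_count]
  rw [sum_range_eq_tsum]
  refine tsum_congr fun l => ?_
  by_cases hl : l < τ y
  · rw [indicator_of_mem (show (y, l) ∈ tower Y τ from ⟨hy, hl⟩),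
      indicator_of_mem (show (y, l) ∈ {q : Λ × ℕ | q.2 + 0 < τ q.1} from hl)]
  · rw [indicator_of_notMem (show (y, l) ∉ tower Y τ from fun h => hl h.2),
      indicator_of_notMem (show (y, l) ∉ {q : Λ × ℕ | q.2 + 0 < τ q.1} from hl)]

theorem one_le_lintegral_τ (S : IsTowerSystem T Y τ μY) : 1 ≤ ∫⁻ y, (τ y : ℝ≥0∞) ∂μY := by
  have := S.isProbabilityMeasure
  calc (1 : ℝ≥0∞) = ∫⁻ _, 1 ∂μY := by simp
    _ ≤ _ := lintegral_mono fun y => by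
        change (1 : ℝ≥0∞) ≤ (τ y : ℝ≥0∞)
        exact_mod_cast S.one_le_τ y

theorem inv_lintegral_τ_le_one (S : IsTowerSystem T Y τ μY) :
    (∫⁻ y, (τ y : ℝ≥0∞) ∂μY)⁻¹ ≤ 1 :=
  ENNReal.inv_le_one.2 S.one_le_lintegral_τ

theorem isProbabilityMeasure_tower (S : IsTowerSystem T Y τ μY) :
    IsProbabilityMeasure (towerMeasure Y τ μY) := ⟨by
  have h := S.lintegral_tower (φ := fun _ => 1) measurable_const
  simp only [lintegral_const, one_mul, Finset.sum_const, Finset.card_range, nsmul_eq_mul,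
    mul_one] at h
  rw [h, ENNReal.inv_mul_cancel _ S.lintegral_τ_ne_top]
  exact (zero_lt_one.trans_le S.one_le_lintegral_τ).ne'⟩

theorem ae_mem_tower (S : IsTowerSystem T Y τ μY) :
    ∀ᵐ q ∂(towerMeasure Y τ μY), q ∈ tower Y τ :=
  (Measure.smul_absolutelyContinuous.ae_le : _ ≤ _) (ae_restrict_mem S.measurableSet_tower)

/-- In each column the map shifts the sum over the floors by one: the base value at y is lost and
the base value at F y is gained. The two have the same integral because F preserves μY. -/
theorem measurePreserving_towerMap (S : IsTowerSystem T Y τ μY) :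
    MeasurePreserving (towerMap T τ) (towerMeasure Y τ μY) (towerMeasure Y τ μY) := by
  refine ⟨S.measurable_towerMap, Measure.ext fun s hs => ?_⟩
  have hf := S.measurable_towerMap
  have h1 : Measurable (s.indicator (1 : Λ × ℕ → ℝ≥0∞)) := measurable_one.indicator hs
  rw [← lintegral_indicator_one hs, lintegral_map h1 hf, S.lintegral_tower
      (show Measurable fun q => s.indicator (1 : Λ × ℕ → ℝ≥0∞) (towerMap T τ q) from h1.comp hf),
    ← lintegral_indicator_one hs, S.lintegral_tower h1]
  set φ := s.indicator (1 : Λ × ℕ → ℝ≥0∞) with hφ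
  congr 1
  have hφ0 : Measurable fun y => φ (y, 0) := h1.comp (measurable_id.prodMk measurable_const)
  have hsum : Measurable fun y => ∑ l ∈ Finset.range (τ y), φ (towerMap T τ (y, l)) :=
    S.measurable_sum (φ := fun q => φ (towerMap T τ q)) (h1.comp hf)
  have key : ∀ y, (∑ l ∈ Finset.range (τ y), φ (towerMap T τ (y, l))) + φ (y, 0) =
      (∑ l ∈ Finset.range (τ y), φ (y, l)) + φ (inducedMap T τ y, 0) := by
    intro y
    obtain ⟨n, hn⟩ : ∃ n, τ y = n + 1 := ⟨τ y - 1, by have := S.one_le_τ y; omega⟩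
    rw [hn, Finset.sum_range_succ, Finset.sum_range_succ',
      towerMap_of_not_lt (by simp [hn])]
    have : ∑ l ∈ Finset.range n, φ (towerMap T τ (y, l)) =
        ∑ l ∈ Finset.range n, φ (y, l + 1) := Finset.sum_congr rfl fun l hl => by
      have := Finset.mem_range.1 hl
      rw [towerMap_of_lt (by simp only; omega)]
    rw [this]
    simp only
    ring
  have e1 : ∫⁻ y, φ (inducedMap T τ y, 0) ∂μY = ∫⁻ y, φ (y, 0) ∂μY :=
    S.measurePreserving.lintegral_comp hφ0
  have e2 := lintegral_congr (μ := μY) key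
  rw [lintegral_add_left hsum, lintegral_add_left (S.measurable_sum h1), e1] at e2
  have := S.isProbabilityMeasure
  refine (ENNReal.add_left_inj (ne_top_of_le_ne_top ENNReal.one_ne_top ?_)).1 e2
  calc ∫⁻ y, φ (y, 0) ∂μY ≤ ∫⁻ _, 1 ∂μY := lintegral_mono fun y => by
        by_cases h : (y, 0) ∈ s <;> simp [hφ, h]
    _ = 1 := by simp

theorem lintegral_fst (S : IsTowerSystem T Y τ μY) {φ : Λ → ℝ≥0∞} (hφ : Measurable φ) :
    ∫⁻ q, φ q.1 ∂(towerMeasure Y τ μY) =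
      (∫⁻ y, (τ y : ℝ≥0∞) ∂μY)⁻¹ * ∫⁻ y, τ y * φ y ∂μY := by
  rw [S.lintegral_tower (φ := fun q => φ q.1) (hφ.comp measurable_fst)]
  simp

theorem measurableSet_snd_zero : MeasurableSet {q : Λ × ℕ | q.2 = 0} :=
  measurable_snd (measurableSet_singleton 0)

theorem measurableSet_top (S : IsTowerSystem T Y τ μY) :
    MeasurableSet {q : Λ × ℕ | q.2 + 1 = τ q.1} :=
  measurableSet_eq_fun (measurable_snd.add_const 1) (S.measurable_τ.comp measurable_fst)

theorem lintegral_base (S : IsTowerSystem T Y τ μY) {φ : Λ × ℕ → ℝ≥0∞} (hφ : Measurable φ) :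
    ∫⁻ q in {q : Λ × ℕ | q.2 = 0}, φ q ∂(towerMeasure Y τ μY) =
      (∫⁻ y, (τ y : ℝ≥0∞) ∂μY)⁻¹ * ∫⁻ y, φ (y, 0) ∂μY := by
  rw [← lintegral_indicator measurableSet_snd_zero,
    S.lintegral_tower (hφ.indicator measurableSet_snd_zero)]
  congr 1
  refine lintegral_congr fun y => ?_
  rw [Finset.sum_eq_single 0]
  · simp
  · intro l _ hl; simp [hl]
  · intro h; have := S.one_le_τ y; simp at h; omega

theorem lintegral_top (S : IsTowerSystem T Y τ μY) {φ : Λ → ℝ≥0∞} (hφ : Measurable φ) :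
    ∫⁻ q in {q : Λ × ℕ | q.2 + 1 = τ q.1}, φ q.1 ∂(towerMeasure Y τ μY) =
      (∫⁻ y, (τ y : ℝ≥0∞) ∂μY)⁻¹ * ∫⁻ y, φ y ∂μY := by
  rw [← lintegral_indicator S.measurableSet_top,
    S.lintegral_tower (Measurable.indicator
      (show Measurable fun q : Λ × ℕ => φ q.1 from hφ.comp measurable_fst) S.measurableSet_top)]
  congr 1
  refine lintegral_congr fun y => ?_
  have := S.one_le_τ y
  rw [Finset.sum_eq_single (τ y - 1)]
  · rw [indicator_of_mem (show (y, τ y - 1) ∈ {q : Λ × ℕ | q.2 + 1 = τ q.1} from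
      Nat.sub_add_cancel this)]
  · intro l _ hl
    rw [indicator_of_notMem (show (y, l) ∉ {q : Λ × ℕ | q.2 + 1 = τ q.1} from fun h => hl (by
      have h' : l + 1 = τ y := h
      omega))]
  · intro h; simp at h; omega

theorem map_fst_top (S : IsTowerSystem T Y τ μY) :
    ((towerMeasure Y τ μY).restrict {q : Λ × ℕ | q.2 + 1 = τ q.1}).map Prod.fst =
      (∫⁻ y, (τ y : ℝ≥0∞) ∂μY)⁻¹ • μY := by
  refine Measure.ext fun s hs => ?_
  have h1 : Measurable (s.indicator (1 : Λ → ℝ≥0∞)) := measurable_one.indicator hs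
  rw [← lintegral_indicator_one hs, lintegral_map h1 measurable_fst, S.lintegral_top h1,
    lintegral_indicator_one hs, Measure.smul_apply, smul_eq_mul]

/-- A bound for `φ (τ ·)` along an orbit segment of the tower map. -/
noncomputable def orbitBound (T : Λ → Λ) (τ : Λ → ℕ) (φ : ℕ → ℝ≥0∞) (n : ℕ) (q : Λ × ℕ) : ℝ≥0∞ :=
  φ (τ q.1) + ∑ k ∈ Finset.range n,
    {q : Λ × ℕ | q.2 = 0}.indicator (fun q => φ (τ q.1)) ((towerMap T τ)^[k + 1] q)

/-- The column changes only when the orbit visits the base, so the return time seen at time k is the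
initial one or one met at a base visit up to time k. -/
theorem le_orbitBound (φ : ℕ → ℝ≥0∞) {n k : ℕ} (hk : k ≤ n) (q : Λ × ℕ) :
    φ (τ ((towerMap T τ)^[k] q).1) ≤ orbitBound T τ φ n q := by
  have h : φ (τ ((towerMap T τ)^[k] q).1) ≤ orbitBound T τ φ k q := by
    clear hk
    induction k with
    | zero => simp [orbitBound]
    | succ k ih =>
      by_cases h : ((towerMap T τ)^[k] q).2 + 1 < τ ((towerMap T τ)^[k] q).1
      · rw [Function.iterate_succ_apply', towerMap_of_lt h]
        refine ih.trans ?_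
        rw [orbitBound, orbitBound, Finset.sum_range_succ, ← add_assoc]
        exact le_self_add
      · have h0 : ((towerMap T τ)^[k + 1] q).2 = 0 := by
          rw [Function.iterate_succ_apply', towerMap_of_not_lt h]
        rw [orbitBound, Finset.sum_range_succ, ← add_assoc,
          indicator_of_mem (show (towerMap T τ)^[k + 1] q ∈ {q : Λ × ℕ | q.2 = 0} from h0)]
        exact le_add_self
  refine h.trans ?_
  rw [orbitBound, orbitBound]
  gcongr

theorem measurable_orbitBound (S : IsTowerSystem T Y τ μY) (φ : ℕ → ℝ≥0∞) (n : ℕ) :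
    Measurable (orbitBound T τ φ n) := by
  have h : Measurable fun q : Λ × ℕ => φ (τ q.1) :=
    (Measurable.of_discrete (f := φ)).comp (S.measurable_τ.comp measurable_fst)
  exact h.add (Finset.measurable_fun_sum _ fun k _ =>
    (h.indicator measurableSet_snd_zero).comp (S.measurable_towerMap.iterate _))

/-- The initial column is size biased, which costs an additional factor τ. By stationarity every
later term is an integral over the base, with no such factor. -/
theorem lintegral_orbitBound_le (S : IsTowerSystem T Y τ μY) (φ : ℕ → ℝ≥0∞) (n : ℕ) :
    ∫⁻ q, orbitBound T τ φ n q ∂(towerMeasure Y τ μY) ≤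
      ∫⁻ y, τ y * φ (τ y) ∂μY + n * ∫⁻ y, φ (τ y) ∂μY := by
  have h0 : Measurable fun y => φ (τ y) :=
    (Measurable.of_discrete (f := φ)).comp S.measurable_τ
  have h : Measurable fun q : Λ × ℕ => φ (τ q.1) := h0.comp measurable_fst
  have hi := h.indicator (measurableSet_snd_zero (Λ := Λ))
  unfold orbitBound
  rw [lintegral_add_left h, lintegral_finsetSum _ fun k _ =>
    (show Measurable fun q => {q : Λ × ℕ | q.2 = 0}.indicator (fun q => φ (τ q.1))
      ((towerMap T τ)^[k + 1] q) from hi.comp (S.measurable_towerMap.iterate _))]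
  have e : ∀ k, ∫⁻ q, {q : Λ × ℕ | q.2 = 0}.indicator (fun q => φ (τ q.1))
      ((towerMap T τ)^[k + 1] q) ∂(towerMeasure Y τ μY) ≤ ∫⁻ y, φ (τ y) ∂μY := fun k => by
    rw [(S.measurePreserving_towerMap.iterate (k + 1)).lintegral_comp hi,
      lintegral_indicator measurableSet_snd_zero, S.lintegral_base h]
    exact mul_le_of_le_one_left zero_le S.inv_lintegral_τ_le_one
  refine add_le_add ?_ ?_
  · rw [S.lintegral_fst h0]
    exact mul_le_of_le_one_left zero_le S.inv_lintegral_τ_le_one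
  · calc _ ≤ ∑ k ∈ Finset.range n, ∫⁻ y, φ (τ y) ∂μY := Finset.sum_le_sum fun k _ => e k
      _ = _ := by simp

end IsTowerSystem

end Tower

end ExpandingSemiflow

/-! ### Decomposition of an observable on the tower. -/

namespace ExpandingSemiflow

section TowerDecomposition

variable {Λ : Type*} [MeasurableSpace Λ] {T : Λ → Λ} {Y : Set Λ} {τ : Λ → ℕ} {μY : Measure Λ}
  {E : Type*} [NormedAddCommGroup E] [InnerProductSpace ℝ E] [FiniteDimensional ℝ E]
  [MeasurableSpace E] [BorelSpace E] {N : ℕ} {v χ' : Λ → E} {w : E} {q R B C' : ℝ}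

/-- Partial sums of `v` along an excursion, set to zero on excursions longer than `N`. -/
noncomputable def truncSum (T : Λ → Λ) (τ : Λ → ℕ) (v : Λ → E) (N : ℕ) (y : Λ) (k : ℕ) : E :=
  if τ y ≤ N then ∑ l ∈ Finset.range k, v (T^[l] y) else 0

/-- The observable `v` on the tower, set to zero on excursions longer than `N`. -/
noncomputable def towerObs (T : Λ → Λ) (τ : Λ → ℕ) (v : Λ → E) (N : ℕ) (p : Λ × ℕ) : E :=
  if p.2 < τ p.1 ∧ τ p.1 ≤ N then v (towerProj T p) else 0

/-- The martingale part of `towerObs`. -/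
noncomputable def towerMart (T : Λ → Λ) (τ : Λ → ℕ) (v : Λ → E) (N : ℕ) (w : E) (χ' : Λ → E)
    (p : Λ × ℕ) : E :=
  if p.2 + 1 = τ p.1 then
    truncSum T τ v N p.1 (τ p.1) - w + χ' p.1 - χ' (inducedMap T τ p.1) else 0

/-- The coboundary part of `towerObs`. -/
noncomputable def towerCob (T : Λ → Λ) (τ : Λ → ℕ) (v : Λ → E) (N : ℕ) (w : E) (χ' : Λ → E)
    (p : Λ × ℕ) : E :=
  if p.2 < τ p.1 then χ' p.1 + truncSum T τ v N p.1 p.2 - (if p.2 = 0 then 0 else w)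
  else χ' (inducedMap T τ p.1)

/-- The drift part of `towerObs`. -/
noncomputable def towerDrift (w : E) (p : Λ × ℕ) : E := if p.2 = 0 then w else 0

/-- Inside a column the coboundary accumulates v floor by floor, and on the top floor the martingale
part replaces the whole excursion sum by an orthogonal increment of F. The mean w of the excursion
sums enters as drift on the base floor, is subtracted in the coboundary above it, and is removed
from the martingale at the top. Values off the tower are chosen so that the identity holds
everywhere. -/
theorem towerObs_eq_add (S : IsTowerSystem T Y τ μY) (w : E) (p : Λ × ℕ) :
    towerObs T τ v N p = towerMart T τ v N w χ' p + towerCob T τ v N w χ' (towerMap T τ p) -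
      towerCob T τ v N w χ' p + towerDrift w p := by
  obtain ⟨y, l⟩ := p
  have h1 := S.one_le_τ y
  have h2 := S.one_le_τ (inducedMap T τ y)
  have hsucc : truncSum T τ v N y (l + 1) =
      truncSum T τ v N y l + if τ y ≤ N then v (T^[l] y) else 0 := by
    by_cases h : τ y ≤ N
    · simp [truncSum, h, Finset.sum_range_succ]
    · simp [truncSum, h]
  have hzero : truncSum T τ v N (inducedMap T τ y) 0 = 0 := by simp [truncSum]
  rcases lt_trichotomy (l + 1) (τ y) with h | h | h
  · rw [towerMap_of_lt h]
    have h3 : l < τ y := by omega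
    simp only [towerObs, towerMart, towerCob, towerDrift, h3, h, h.ne, true_and, if_true,
      if_false, hsucc, Nat.succ_ne_zero, towerProj]
    rcases eq_or_ne l 0 with rfl | hl
    · simp only [if_true, Function.iterate_zero, id_eq]; abel
    · simp only [hl, if_false]; abel
  · rw [towerMap_of_not_lt (by simp [h])]
    simp only [towerObs, towerMart, towerCob, towerDrift, true_and, if_true, ← h, hsucc,
      hzero, towerProj, zero_lt_one.trans_le h2, lt_add_one]
    by_cases hl : l = 0 <;> simp [hl] <;> abel
  · rw [towerMap_of_not_lt (by simp; omega)]
    have h3 : ¬ l < τ y := by omega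
    have h4 : l ≠ 0 := by omega
    simp only [towerObs, towerMart, towerCob, towerDrift, h3, false_and, if_true, if_false, h4,
      h.ne', hzero, zero_lt_one.trans_le h2]
    simp

theorem measurable_truncSum (S : IsTowerSystem T Y τ μY) (hv : Measurable v) :
    Measurable fun p : Λ × ℕ => truncSum T τ v N p.1 p.2 := by
  refine measurable_from_prod_countable_left fun k => ?_
  exact Measurable.ite (p := fun y => τ y ≤ N) (S.measurable_τ measurableSet_Iic)
    (f := fun y => ∑ l ∈ Finset.range k, v (T^[l] y))
    (Finset.measurable_fun_sum _ fun l _ => hv.comp (S.measurable_T.iterate l)) measurable_const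

theorem measurable_truncSum_self (S : IsTowerSystem T Y τ μY) (hv : Measurable v) :
    Measurable fun y : Λ => truncSum T τ v N y (τ y) :=
  (measurable_truncSum S hv).comp (measurable_id.prodMk S.measurable_τ)

theorem norm_truncSum_le (hv : ∀ x, ‖v x‖ ≤ 1) {y : Λ} {k : ℕ} (hk : k ≤ τ y) :
    ‖truncSum T τ v N y k‖ ≤ (min (τ y) N : ℕ) := by
  by_cases h : τ y ≤ N
  · rw [truncSum, if_pos h, min_eq_left h]
    calc _ ≤ ∑ l ∈ Finset.range k, ‖v (T^[l] y)‖ := norm_sum_le _ _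
      _ ≤ ∑ l ∈ Finset.range k, (1 : ℝ) := Finset.sum_le_sum fun l _ => hv _
      _ = k := by simp
      _ ≤ _ := by exact_mod_cast hk
  · rw [truncSum, if_neg h, norm_zero]; positivity

theorem measurable_towerObs (S : IsTowerSystem T Y τ μY) (hv : Measurable v) :
    Measurable (towerObs T τ v N) :=
  Measurable.ite ((S.measurableSet_lt_τ 0).inter
    ((S.measurable_τ.comp measurable_fst) measurableSet_Iic))
    (hv.comp S.measurable_towerProj) measurable_const

theorem measurable_towerDrift : Measurable (towerDrift w : Λ × ℕ → E) :=
  Measurable.ite IsTowerSystem.measurableSet_snd_zero measurable_const measurable_const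

theorem measurable_towerMart (S : IsTowerSystem T Y τ μY) (hv : Measurable v)
    (hχ : Measurable χ') : Measurable (towerMart T τ v N w χ') :=
  Measurable.ite S.measurableSet_top
    (((((measurable_truncSum_self S hv).comp measurable_fst).sub_const w).add
      (hχ.comp measurable_fst)).sub (hχ.comp (S.measurable_inducedMap.comp measurable_fst)))
    measurable_const

theorem measurable_towerCob (S : IsTowerSystem T Y τ μY) (hv : Measurable v)
    (hχ : Measurable χ') : Measurable (towerCob T τ v N w χ') :=
  Measurable.ite (S.measurableSet_lt_τ 0)
    (((hχ.comp measurable_fst).add (measurable_truncSum S hv)).sub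
      (Measurable.ite IsTowerSystem.measurableSet_snd_zero measurable_const measurable_const))
    (hχ.comp (S.measurable_inducedMap.comp measurable_fst))

theorem integral_indicator_top (S : IsTowerSystem T Y τ μY) {G : Type*} [NormedAddCommGroup G]
    [NormedSpace ℝ G] {H : Λ → G} (hH : StronglyMeasurable H) :
    ∫ p in {p : Λ × ℕ | p.2 + 1 = τ p.1}, H p.1 ∂(towerMeasure Y τ μY) =
      (∫⁻ y, (τ y : ℝ≥0∞) ∂μY)⁻¹.toReal • ∫ y, H y ∂μY := by
  rw [← integral_smul_measure, ← S.map_fst_top,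
    integral_map measurable_fst.aemeasurable hH.aestronglyMeasurable]

theorem towerMart_eq_indicator : towerMart T τ v N w χ' =
    {p : Λ × ℕ | p.2 + 1 = τ p.1}.indicator fun p =>
      truncSum T τ v N p.1 (τ p.1) - w + χ' p.1 - χ' (inducedMap T τ p.1) := by
  ext p
  by_cases h : p.2 + 1 = τ p.1
  · rw [indicator_of_mem (by exact h), towerMart, if_pos h]
  · rw [indicator_of_notMem (by exact h), towerMart, if_neg h]

/-- The mean of the truncated excursion sums is small. -/
theorem norm_integral_truncSum_le (S : IsTowerSystem T Y τ μY) (hv : Measurable v)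
    (hv1 : ∀ x, ‖v x‖ ≤ 1) (hv0 : ∫ p, v (towerProj T p) ∂(towerMeasure Y τ μY) = 0) {r : ℝ}
    (hr : 0 ≤ r)
    (htail : ∫⁻ y, τ y * {n : ℕ | N < n}.indicator 1 (τ y) ∂μY ≤ ENNReal.ofReal r) :
    ‖∫ y, truncSum T τ v N y (τ y) ∂μY‖ ≤ r := by
  have := S.isProbabilityMeasure
  have := S.isProbabilityMeasure_tower
  set μ := towerMeasure Y τ μY with hμ
  set w := ∫ y, truncSum T τ v N y (τ y) ∂μY with hw
  set s := ∫⁻ y, (τ y : ℝ≥0∞) ∂μY with hs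
  have hs0 : 0 < s⁻¹.toReal :=
    ENNReal.toReal_pos (ENNReal.inv_ne_zero.2 S.lintegral_τ_ne_top)
      (ne_top_of_le_ne_top ENNReal.one_ne_top S.inv_lintegral_τ_le_one)
  have hW : BddMeas fun y => truncSum T τ v N y (τ y) :=
    ⟨measurable_truncSum_self S hv, N, fun y => (norm_truncSum_le hv1 le_rfl).trans (by
      exact_mod_cast min_le_right _ _)⟩
  -- The decomposition is used with χ' = 0, where no orthogonality is needed: the top floor term is
  -- already centred by the choice of w.
  have hχ : BddMeas (towerCob T τ v N w 0) := by
    refine ⟨measurable_towerCob S hv measurable_zero, N + ‖w‖, fun p => ?_⟩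
    unfold towerCob
    split_ifs with h1 h2
    · simp only [Pi.zero_apply, zero_add, sub_zero]
      exact ((norm_truncSum_le hv1 h1.le).trans (by exact_mod_cast min_le_right _ _)).trans
        (le_add_of_nonneg_right (norm_nonneg w))
    · simp only [Pi.zero_apply, zero_add]
      exact (norm_sub_le _ _).trans (by
        gcongr
        exact (norm_truncSum_le hv1 h1.le).trans (by exact_mod_cast min_le_right _ _))
    · simp only [Pi.zero_apply, norm_zero]; positivity
  have hm0 : ∫ p, towerMart T τ v N w 0 p ∂μ = 0 := by
    rw [towerMart_eq_indicator, integral_indicator S.measurableSet_top]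
    simp only [Pi.zero_apply, add_zero, sub_zero]
    rw [integral_indicator_top (G := E) (H := fun y => truncSum T τ v N y (τ y) - w) S
      (hW.1.sub_const w).stronglyMeasurable, integral_sub (hW.integrable _) (integrable_const _)]
    simp [hw]
  have hc : ∫ p, towerDrift w p ∂μ = s⁻¹.toReal • w := by
    have h1 : (towerDrift w : Λ × ℕ → E) = {p : Λ × ℕ | p.2 = 0}.indicator fun _ => w := by
      ext p; by_cases h : p.2 = 0 <;> simp [towerDrift, h]
    have h2 : μ {p : Λ × ℕ | p.2 = 0} = s⁻¹ := by
      have := S.lintegral_base (φ := fun _ => 1) measurable_const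
      simpa using this
    rw [h1, integral_indicator IsTowerSystem.measurableSet_snd_zero, setIntegral_const,
      Measure.real, h2]
  have hD : BddMeas (towerDrift w : Λ × ℕ → E) :=
    ⟨measurable_towerDrift, ‖w‖, fun p => by unfold towerDrift; split_ifs <;> simp⟩
  have hO : BddMeas (towerObs T τ v N) := ⟨measurable_towerObs S hv, 1, fun p => by
    unfold towerObs; split_ifs <;> simp [hv1]⟩
  have hf := S.measurable_towerMap
  have hχf : ∫ p, towerCob T τ v N w 0 (towerMap T τ p) ∂μ = ∫ p, towerCob T τ v N w 0 p ∂μ := by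
    have h := S.measurePreserving_towerMap
    rw [← hμ] at h
    conv_rhs => rw [← h.map_eq]
    rw [integral_map hf.aemeasurable hχ.1.aestronglyMeasurable]
  have hM : BddMeas (towerMart T τ v N w 0) := by
    have : towerMart T τ v N w 0 = fun p => (towerObs T τ v N p -
        towerCob T τ v N w 0 (towerMap T τ p)) + towerCob T τ v N w 0 p - towerDrift w p := by
      ext p; rw [towerObs_eq_add S w p (χ' := 0)]; abel
    rw [this]
    exact ((hO.sub (hχ.comp hf)).add hχ).sub hD
  -- Martingale and coboundary parts have mean zero, so the mean of the truncated observable is the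
  -- mass of the base times w. The untruncated observable has mean zero, so w measures exactly the
  -- mass in long excursions.
  have hint : ∫ p, towerObs T τ v N p ∂μ = s⁻¹.toReal • w := by
    simp_rw [towerObs_eq_add S w _ (χ' := 0)]
    have i1 := hM.integrable μ
    have i2 := (hχ.comp hf).integrable μ
    have i3 := hχ.integrable μ
    have i4 := hD.integrable μ
    have e1 := integral_add i1 i2
    have e2 := integral_sub (i1.add i2) i3
    have e3 := integral_add ((i1.add i2).sub i3) i4
    simp only [Pi.add_apply, Pi.sub_apply] at e2 e3
    rw [e3, e2, e1, hm0, hχf, hc]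
    simp
  have hV : BddMeas fun p => v (towerProj T p) :=
    ⟨hv.comp S.measurable_towerProj, 1, fun p => hv1 _⟩
  have hbound : ‖∫ p, towerObs T τ v N p ∂μ‖ ≤ s⁻¹.toReal * r := by
    rw [← sub_zero (∫ p, towerObs T τ v N p ∂μ), ← hv0,
      ← integral_sub (hO.integrable _) (hV.integrable _)]
    have hi : Measurable fun y : Λ => ({n : ℕ | N < n}.indicator 1 (τ y) : ℝ≥0∞) :=
      (Measurable.of_discrete (f := {n : ℕ | N < n}.indicator (1 : ℕ → ℝ≥0∞))).comp S.measurable_τ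
    have h1 : ∫⁻ p, ‖towerObs T τ v N p - v (towerProj T p)‖ₑ ∂μ ≤
        ENNReal.ofReal (s⁻¹.toReal * r) := by
      calc _ ≤ ∫⁻ p, {n : ℕ | N < n}.indicator 1 (τ p.1) ∂μ := by
            refine lintegral_mono_ae (S.ae_mem_tower.mono fun p hp => ?_)
            by_cases h : τ p.1 ≤ N
            · have : towerObs T τ v N p = v (towerProj T p) := if_pos ⟨hp.2, h⟩
              rw [this, sub_self, enorm_zero]; exact zero_le
            · have : towerObs T τ v N p = 0 := if_neg fun h' => h h'.2
              rw [this, zero_sub, enorm_neg, indicator_of_mem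
                (show τ p.1 ∈ {n : ℕ | N < n} from not_le.1 h)]
              rw [← ofReal_norm]
              exact ENNReal.ofReal_le_one.2 (hv1 _)
        _ ≤ s⁻¹ * ENNReal.ofReal r := by
            rw [hμ, S.lintegral_fst hi]
            gcongr
        _ = _ := by
            rw [ENNReal.ofReal_mul hs0.le, ENNReal.ofReal_toReal]
            exact ne_top_of_le_ne_top ENNReal.one_ne_top S.inv_lintegral_τ_le_one
    rw [← ENNReal.ofReal_le_ofReal_iff (by positivity), ofReal_norm]
    exact (enorm_integral_le_lintegral_enorm _).trans h1
  rw [hint, norm_smul, Real.norm_of_nonneg hs0.le] at hbound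
  exact le_of_mul_le_mul_left hbound hs0

end TowerDecomposition

end ExpandingSemiflow

/-! ### Moment estimates on the tower. -/

namespace ExpandingSemiflow

section TowerMoments

variable {Λ : Type*} [MeasurableSpace Λ] {T : Λ → Λ} {Y : Set Λ} {τ : Λ → ℕ} {μY : Measure Λ}
  {E : Type*} [NormedAddCommGroup E] [InnerProductSpace ℝ E] [FiniteDimensional ℝ E]
  [MeasurableSpace E] [BorelSpace E] {N : ℕ} {v χ' : Λ → E} {w : E} {q R B C' : ℝ}

/-- A tower system with a moment bound for the return time and a decorrelation estimate. -/
structure IsMixingTower (T : Λ → Λ) (Y : Set Λ) (τ : Λ → ℕ) (μY : Measure Λ) (q R B : ℝ) :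
    Prop extends IsTowerSystem T Y τ μY where
  one_le_q : 1 ≤ q
  one_le_R : 1 ≤ R
  one_le_B : 1 ≤ B
  lintegral_rpow_le : ∫⁻ y, ENNReal.ofReal ((τ y : ℝ) ^ (q + 1)) ∂μY ≤ ENNReal.ofReal R
  mixing : ∀ (φ : ℕ → ℝ≥0∞) (ψ : Λ → ℝ≥0∞), Measurable ψ →
    ∫⁻ y, φ (τ y) * ψ (inducedMap T τ y) ∂μY ≤
      ENNReal.ofReal B * (∫⁻ y, φ (τ y) ∂μY) * ∫⁻ y, ψ y ∂μY

namespace IsMixingTower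

open IsTowerSystem

theorem lintegral_comp_le (S : IsMixingTower T Y τ μY q R B) {φ : ℕ → ℝ≥0∞} {c : ℝ} (hc : 0 ≤ c)
    (h : ∀ t : ℕ, 1 ≤ t → φ t ≤ ENNReal.ofReal (c * (t : ℝ) ^ (q + 1))) :
    ∫⁻ y, φ (τ y) ∂μY ≤ ENNReal.ofReal (c * R) := by
  calc ∫⁻ y, φ (τ y) ∂μY ≤ ∫⁻ y, ENNReal.ofReal c * ENNReal.ofReal ((τ y : ℝ) ^ (q + 1)) ∂μY :=
        lintegral_mono fun y => by
          rw [← ENNReal.ofReal_mul hc]; exact h _ (S.one_le_τ y)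
    _ = ENNReal.ofReal c * ∫⁻ y, ENNReal.ofReal ((τ y : ℝ) ^ (q + 1)) ∂μY :=
        lintegral_const_mul' _ _ ENNReal.ofReal_ne_top
    _ ≤ ENNReal.ofReal c * ENNReal.ofReal R := by gcongr; exact S.lintegral_rpow_le
    _ = _ := (ENNReal.ofReal_mul hc).symm

theorem rpow_le_rpow_add_one {q s : ℝ} {t : ℕ} (ht : 1 ≤ t) (hs : s ≤ q + 1) (N : ℕ)
    (hs0 : 0 ≤ s) : ((min t N : ℕ) : ℝ) ^ s ≤ (t : ℝ) ^ (q + 1) := by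
  have ht' : (1 : ℝ) ≤ t := by exact_mod_cast ht
  calc ((min t N : ℕ) : ℝ) ^ s ≤ (t : ℝ) ^ s := by
        gcongr; exact min_le_left _ _
    _ ≤ _ := Real.rpow_le_rpow_of_exponent_le ht' hs

/-- This interpolation is the source of the exponent 2q = 2(p-1): of the 2q powers, q + 1 are paid
by the moments of τ and the other q - 1 by the truncation level. -/
theorem min_rpow_two_mul_le {q : ℝ} (hq : 1 ≤ q) {t : ℕ} (ht : 1 ≤ t) {N : ℕ} (hN : 1 ≤ N) :
    ((min t N : ℕ) : ℝ) ^ (2 * q) ≤ (N : ℝ) ^ (q - 1) * (t : ℝ) ^ (q + 1) := by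
  have h0 : (0 : ℝ) < (min t N : ℕ) := by
    exact_mod_cast lt_min (by omega : 0 < t) (by omega : 0 < N)
  rw [show 2 * q = (q - 1) + (q + 1) by ring, Real.rpow_add h0]
  gcongr
  · exact min_le_right _ _
  · exact min_le_left _ _

/-- The size biased version for the initial column: the additional factor τ costs one more power of
N. -/
theorem mul_min_rpow_two_mul_le {q : ℝ} (hq : 1 ≤ q) {t : ℕ} (ht : 1 ≤ t) {N : ℕ} (hN : 1 ≤ N) :
    (t : ℝ) * ((min t N : ℕ) : ℝ) ^ (2 * q) ≤ (N : ℝ) ^ q * (t : ℝ) ^ (q + 1) := by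
  have h0 : (0 : ℝ) < (min t N : ℕ) := by
    exact_mod_cast lt_min (by omega : 0 < t) (by omega : 0 < N)
  have ht' : (0 : ℝ) < t := by exact_mod_cast ht
  rw [show 2 * q = q + q by ring, Real.rpow_add h0, Real.rpow_add ht', Real.rpow_one]
  have h1 : ((min t N : ℕ) : ℝ) ^ q ≤ (N : ℝ) ^ q := by gcongr; exact min_le_right _ _
  have h2 : ((min t N : ℕ) : ℝ) ^ q ≤ (t : ℝ) ^ q := by gcongr; exact min_le_left _ _
  calc (t : ℝ) * (((min t N : ℕ) : ℝ) ^ q * ((min t N : ℕ) : ℝ) ^ q)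
      ≤ t * ((N : ℝ) ^ q * (t : ℝ) ^ q) := by gcongr
    _ = _ := by ring

theorem one_le_mul_rpow_of_lt {s : ℝ} (hs : 0 ≤ s) {t N : ℕ} (hN : 1 ≤ N) (h : N < t) :
    1 ≤ (N : ℝ) ^ (-s) * (t : ℝ) ^ s := by
  have hN' : (0 : ℝ) < N := by exact_mod_cast hN
  rw [Real.rpow_neg hN'.le, ← div_eq_inv_mul, one_le_div (by positivity)]
  gcongr

theorem lintegral_tail_le (S : IsMixingTower T Y τ μY q R B) (hN : 1 ≤ N) :
    ∫⁻ y, τ y * {n : ℕ | N < n}.indicator 1 (τ y) ∂μY ≤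
      ENNReal.ofReal ((N : ℝ) ^ (-q) * R) := by
  refine S.lintegral_comp_le (φ := fun t => t * {n : ℕ | N < n}.indicator 1 t) (by positivity)
    fun t ht => ?_
  by_cases h : N < t
  · rw [indicator_of_mem (show t ∈ {n : ℕ | N < n} from h), Pi.one_apply, mul_one,
      ← ENNReal.ofReal_natCast]
    refine ENNReal.ofReal_le_ofReal ?_
    have h1 := one_le_mul_rpow_of_lt (s := q) (by linarith [S.one_le_q]) hN h
    have ht' : (0 : ℝ) < t := by exact_mod_cast ht
    rw [Real.rpow_add ht', Real.rpow_one, ← mul_assoc]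
    exact le_mul_of_one_le_left ht'.le h1
  · rw [indicator_of_notMem (show t ∉ {n : ℕ | N < n} from h), mul_zero]
    exact zero_le

/-- Markov's inequality for the orbit bound of the indicator of long excursions. The size biased
initial column costs N^{-q}, and each of the N later base visits costs N^{-(q+1)}. -/
theorem measure_exists_lt_le (S : IsMixingTower T Y τ μY q R B) (hN : 1 ≤ N) :
    towerMeasure Y τ μY {p | ∃ k < N, N < τ ((towerMap T τ)^[k] p).1} ≤
      ENNReal.ofReal (2 * R * (N : ℝ) ^ (-q)) := by
  set φ : ℕ → ℝ≥0∞ := {n : ℕ | N < n}.indicator 1 with hφ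
  have hN' : (0 : ℝ) < N := by exact_mod_cast hN
  have hR := S.one_le_R
  have h2 : ∫⁻ y, φ (τ y) ∂μY ≤ ENNReal.ofReal ((N : ℝ) ^ (-(q + 1)) * R) := by
    refine S.lintegral_comp_le (by positivity) fun t ht => ?_
    by_cases h : N < t
    · rw [hφ, indicator_of_mem (show t ∈ {n : ℕ | N < n} from h), Pi.one_apply,
        ENNReal.one_le_ofReal]
      exact one_le_mul_rpow_of_lt (by linarith [S.one_le_q]) hN h
    · rw [hφ, indicator_of_notMem (show t ∉ {n : ℕ | N < n} from h)]; exact zero_le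
  calc _ ≤ towerMeasure Y τ μY {p | 1 ≤ orbitBound T τ φ N p} := by
        refine measure_mono fun p hp => ?_
        obtain ⟨k, hk, h⟩ := hp
        refine le_trans ?_ (IsTowerSystem.le_orbitBound φ hk.le p)
        rw [hφ, indicator_of_mem (show τ ((towerMap T τ)^[k] p).1 ∈ {n : ℕ | N < n} from h)]
        rfl
    _ ≤ ∫⁻ p, orbitBound T τ φ N p ∂(towerMeasure Y τ μY) := by
        have := mul_meas_ge_le_lintegral (μ := towerMeasure Y τ μY)
          (S.measurable_orbitBound φ N) 1
        rwa [one_mul] at this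
    _ ≤ _ := S.lintegral_orbitBound_le φ N
    _ ≤ ENNReal.ofReal ((N : ℝ) ^ (-q) * R) +
          ENNReal.ofReal N * ENNReal.ofReal ((N : ℝ) ^ (-(q + 1)) * R) := by
        rw [ENNReal.ofReal_natCast]
        exact add_le_add (S.lintegral_tail_le hN) (mul_le_mul_right h2 _)
    _ = _ := by
        rw [← ENNReal.ofReal_mul hN'.le, ← ENNReal.ofReal_add (by positivity) (by positivity)]
        congr 1
        rw [neg_add, Real.rpow_add hN', Real.rpow_neg_one]
        field_simp
        ring

theorem integral_le_of_lintegral_le {X : Type*} [MeasurableSpace X] {μ : Measure X}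
    [IsFiniteMeasure μ] {f g : X → ℝ} (hf : BddMeas f) (hg : BddMeas g) (hf0 : ∀ x, 0 ≤ f x)
    (hg0 : ∀ x, 0 ≤ g x) {c : ℝ} (hc : 0 ≤ c)
    (h : ∫⁻ x, ENNReal.ofReal (f x) ∂μ ≤ ENNReal.ofReal c * ∫⁻ x, ENNReal.ofReal (g x) ∂μ) :
    ∫ x, f x ∂μ ≤ c * ∫ x, g x ∂μ := by
  rw [← ofReal_integral_eq_lintegral_ofReal (hf.integrable μ) (Filter.Eventually.of_forall hf0),
    ← ofReal_integral_eq_lintegral_ofReal (hg.integrable μ) (Filter.Eventually.of_forall hg0),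
    ← ENNReal.ofReal_mul hc] at h
  exact (ENNReal.ofReal_le_ofReal_iff (mul_nonneg hc (integral_nonneg hg0))).1 h

theorem norm_towerMart_le (S : IsMixingTower T Y τ μY q R B) (hv1 : ∀ x, ‖v x‖ ≤ 1)
    (hχ1 : ∀ x, ‖χ' x‖ ≤ C') (hw : ‖w‖ ≤ R) (hC : 0 ≤ C') (hN : 1 ≤ N) (p : Λ × ℕ) :
    ‖towerMart T τ v N w χ' p‖ ≤ (1 + R + 2 * C') * (min (τ p.1) N : ℕ) := by
  have h1 : (1 : ℝ) ≤ (min (τ p.1) N : ℕ) := by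
    exact_mod_cast le_min (S.one_le_τ p.1) hN
  have hR := S.one_le_R
  unfold towerMart
  split_ifs with h
  · have h2 := norm_truncSum_le (T := T) (N := N) hv1 (le_refl (τ p.1))
    calc _ ≤ ‖truncSum T τ v N p.1 (τ p.1)‖ + ‖w‖ + ‖χ' p.1‖ + ‖χ' (inducedMap T τ p.1)‖ :=
          (norm_sub_le _ _).trans (by gcongr; exact (norm_add_le _ _).trans (by
            gcongr; exact norm_sub_le _ _))
      _ ≤ (min (τ p.1) N : ℕ) + R + C' + C' := by gcongr <;> apply hχ1
      _ ≤ _ := by nlinarith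
  · rw [norm_zero]; positivity

theorem norm_towerCob_le (S : IsMixingTower T Y τ μY q R B) (hv1 : ∀ x, ‖v x‖ ≤ 1)
    (hχ1 : ∀ x, ‖χ' x‖ ≤ C') (hw : ‖w‖ ≤ R) (hC : 0 ≤ C') (hN : 1 ≤ N) (p : Λ × ℕ) :
    ‖towerCob T τ v N w χ' p‖ ≤ (1 + R + 2 * C') * (min (τ p.1) N : ℕ) := by
  have h1 : (1 : ℝ) ≤ (min (τ p.1) N : ℕ) := by
    exact_mod_cast le_min (S.one_le_τ p.1) hN
  have hR := S.one_le_R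
  unfold towerCob
  split_ifs with h h0
  · have h2 := norm_truncSum_le (T := T) (N := N) hv1 h.le
    rw [sub_zero]
    calc _ ≤ C' + (min (τ p.1) N : ℕ) := (norm_add_le _ _).trans (add_le_add (hχ1 _) h2)
      _ ≤ _ := by nlinarith
  · have h2 := norm_truncSum_le (T := T) (N := N) hv1 h.le
    calc _ ≤ (C' + (min (τ p.1) N : ℕ)) + R := (norm_sub_le _ _).trans
          (add_le_add ((norm_add_le _ _).trans (add_le_add (hχ1 _) h2)) hw)
      _ ≤ _ := by nlinarith
  · calc _ ≤ C' := hχ1 _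
      _ ≤ _ := by nlinarith

/-- On the top floor, where m lives, the tower map sends a point over y to the base point F y, and
‖m‖^s is dominated by a function of τ. The decorrelation estimate separates this function from g at
F y, and its mean is finite because s ≤ q + 1. -/
theorem lintegral_towerMap_mul_le (S : IsMixingTower T Y τ μY q R B) {s K₀ : ℝ} (hs0 : 0 ≤ s)
    (hs : s ≤ q + 1) (hK : 0 ≤ K₀) {m : Λ × ℕ → E}
    (hm0 : ∀ p : Λ × ℕ, p.2 + 1 ≠ τ p.1 → m p = 0)
    (hm : ∀ p, ‖m p‖ ≤ K₀ * (min (τ p.1) N : ℕ)) {g : Λ × ℕ → ℝ} (hg : BddMeas g)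
    (hg0 : ∀ p, 0 ≤ g p) (hmB : BddMeas m) (hs' : 0 < s) :
    ∫ p, g (towerMap T τ p) * ‖m p‖ ^ s ∂(towerMeasure Y τ μY) ≤
      (K₀ ^ s * (B * R)) * ∫ p, g p ∂(towerMeasure Y τ μY) := by
  have := S.isProbabilityMeasure_tower
  have hR := S.one_le_R
  have hB := S.one_le_B
  set μ := towerMeasure Y τ μY with hμ
  set φ : ℕ → ℝ≥0∞ := fun t => ENNReal.ofReal ((K₀ * (min t N : ℕ)) ^ s) with hφ
  have hφm : Measurable fun y => φ (τ y) := (Measurable.of_discrete (f := φ)).comp S.measurable_τ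
  have hg' : Measurable fun p => ENNReal.ofReal (g p) := hg.1.ennreal_ofReal
  have hg'' : Measurable fun y : Λ => ENNReal.ofReal (g (y, 0)) :=
    hg'.comp (measurable_id.prodMk measurable_const)
  refine integral_le_of_lintegral_le
    ((hg.comp S.measurable_towerMap).mul (hmB.norm.rpow (fun _ => norm_nonneg _) hs0)) hg
    (fun p => mul_nonneg (hg0 _) (by positivity)) hg0 (by positivity) ?_
  have hφi : ∫⁻ y, φ (τ y) ∂μY ≤ ENNReal.ofReal (K₀ ^ s * R) := by
    refine S.lintegral_comp_le (by positivity) fun t ht => ENNReal.ofReal_le_ofReal ?_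
    rw [Real.mul_rpow hK (by positivity)]
    gcongr
    exact rpow_le_rpow_add_one ht hs N hs0
  calc ∫⁻ p, ENNReal.ofReal (g (towerMap T τ p) * ‖m p‖ ^ s) ∂μ
      ≤ ∫⁻ p in {p : Λ × ℕ | p.2 + 1 = τ p.1},
          φ (τ p.1) * ENNReal.ofReal (g (inducedMap T τ p.1, 0)) ∂μ := by
        rw [← lintegral_indicator S.measurableSet_top]
        refine lintegral_mono fun p => ?_
        by_cases h : p.2 + 1 = τ p.1
        · rw [indicator_of_mem (show p ∈ {p : Λ × ℕ | p.2 + 1 = τ p.1} from h),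
            towerMap_of_not_lt (by omega), mul_comm, ENNReal.ofReal_mul (by positivity)]
          gcongr
          exact ENNReal.ofReal_le_ofReal (by gcongr; exact hm p)
        · simp only [hm0 p h, norm_zero, Real.zero_rpow hs'.ne', mul_zero, ENNReal.ofReal_zero]
          exact zero_le
    _ = (∫⁻ y, (τ y : ℝ≥0∞) ∂μY)⁻¹ *
          ∫⁻ y, φ (τ y) * ENNReal.ofReal (g (inducedMap T τ y, 0)) ∂μY :=
        S.lintegral_top (φ := fun y => φ (τ y) * ENNReal.ofReal (g (inducedMap T τ y, 0)))
          (hφm.mul (hg''.comp S.measurable_inducedMap))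
    _ ≤ (∫⁻ y, (τ y : ℝ≥0∞) ∂μY)⁻¹ * (ENNReal.ofReal B * (∫⁻ y, φ (τ y) ∂μY) *
          ∫⁻ y, ENNReal.ofReal (g (y, 0)) ∂μY) := by
        gcongr
        exact S.mixing φ _ hg''
    _ ≤ (∫⁻ y, (τ y : ℝ≥0∞) ∂μY)⁻¹ * (ENNReal.ofReal B * ENNReal.ofReal (K₀ ^ s * R) *
          ∫⁻ y, ENNReal.ofReal (g (y, 0)) ∂μY) := by gcongr
    _ = ENNReal.ofReal (K₀ ^ s * (B * R)) * ((∫⁻ y, (τ y : ℝ≥0∞) ∂μY)⁻¹ *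
          ∫⁻ y, ENNReal.ofReal (g (y, 0)) ∂μY) := by
        rw [← ENNReal.ofReal_mul (by positivity), show B * (K₀ ^ s * R) = K₀ ^ s * (B * R) by ring]
        ring
    _ = ENNReal.ofReal (K₀ ^ s * (B * R)) *
          ∫⁻ p in {p : Λ × ℕ | p.2 = 0}, ENNReal.ofReal (g p) ∂μ := by rw [S.lintegral_base hg']
    _ ≤ _ := by gcongr; exact Measure.restrict_le_self

/-- The constant for the martingale-coboundary decomposition on the tower. -/
noncomputable def towerConst (R B C' : ℝ) : ℝ := 2 * B * R * (1 + R + 2 * C')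

theorem one_le_towerConst (S : IsMixingTower T Y τ μY q R B) (hC : 0 ≤ C') :
    1 ≤ towerConst R B C' := by
  have hR := S.one_le_R
  have hB := S.one_le_B
  unfold towerConst
  have h1 : 1 ≤ B * R := by nlinarith
  have h2 : 1 ≤ 1 + R + 2 * C' := by linarith
  nlinarith

theorem rpow_mul_le_towerConst_rpow (S : IsMixingTower T Y τ μY q R B) (hC : 0 ≤ C') {s : ℝ}
    (hs : 1 ≤ s) : (1 + R + 2 * C') ^ s * (2 * B * R) ≤ towerConst R B C' ^ s := by
  have hR := S.one_le_R
  have hB := S.one_le_B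
  have h1 : 1 ≤ 2 * B * R := by nlinarith
  rw [towerConst, mul_comm (2 * B * R), Real.mul_rpow (by linarith) (by linarith)]
  gcongr
  exact Real.self_le_rpow_of_one_le h1 hs

/-- Both m and χ are at most a constant times min(τ, N), so every bound reduces to moments of min(τ,
N) along the orbit. The maximal function χs is the 2q-th root of the orbit bound of the 2q-th power.
-/
theorem martingaleCoboundary (S : IsMixingTower T Y τ μY q R B) (hv : Measurable v)
    (hv1 : ∀ x, ‖v x‖ ≤ 1) (hχ : Measurable χ') (hχ1 : ∀ x, ‖χ' x‖ ≤ C') (hw : ‖w‖ ≤ R / N)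
    (hC : 0 ≤ C') (hN : 1 ≤ N)
    (horth : ∀ G : Λ → E, BddMeas G → ∫ y, inner ℝ (truncSum T τ v N y (τ y) - w + χ' y -
      χ' (inducedMap T τ y)) (G (inducedMap T τ y)) ∂μY = 0) :
    ∃ χs, MartingaleCoboundary (towerMeasure Y τ μY) (towerMap T τ) q (towerConst R B C') N
      (towerObs T τ v N) (towerMart T τ v N w χ') (towerCob T τ v N w χ') (towerDrift w) χs := by
  have := S.isProbabilityMeasure_tower
  have := S.isProbabilityMeasure
  have hR := S.one_le_R
  have hB := S.one_le_B
  have hq := S.one_le_q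
  have hN' : (1 : ℝ) ≤ N := by exact_mod_cast hN
  have hwR : ‖w‖ ≤ R := hw.trans (div_le_self (by linarith) hN')
  have hK1 := S.one_le_towerConst hC
  set K := towerConst R B C' with hK
  set K₀ := 1 + R + 2 * C' with hK₀
  have hK₀1 : 1 ≤ K₀ := by linarith
  set μ := towerMeasure Y τ μY with hμ
  have hm := S.norm_towerMart_le (N := N) hv1 hχ1 hwR hC hN
  have hc := S.norm_towerCob_le (N := N) hv1 hχ1 hwR hC hN
  have hmin : ∀ p : Λ × ℕ, K₀ * (min (τ p.1) N : ℕ) ≤ K₀ * N := fun p => by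
    gcongr; exact min_le_right _ _
  have hmB : BddMeas (towerMart T τ v N w χ') :=
    ⟨measurable_towerMart S.toIsTowerSystem hv hχ, K₀ * N, fun p => (hm p).trans (hmin p)⟩
  have hcB : BddMeas (towerCob T τ v N w χ') :=
    ⟨measurable_towerCob S.toIsTowerSystem hv hχ, K₀ * N, fun p => (hc p).trans (hmin p)⟩
  have hm0 : ∀ p : Λ × ℕ, p.2 + 1 ≠ τ p.1 → towerMart T τ v N w χ' p = 0 := fun p h => if_neg h
  have hKs : ∀ s : ℝ, 1 ≤ s → K₀ ^ s * (B * R) ≤ K ^ s := fun s hs => by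
    refine le_trans ?_ (S.rpow_mul_le_towerConst_rpow hC hs)
    gcongr
    nlinarith
  have hKs2 : ∀ s : ℝ, 1 ≤ s → K₀ ^ s * (2 * R) ≤ K ^ s := fun s hs => by
    refine le_trans ?_ (S.rpow_mul_le_towerConst_rpow hC hs)
    gcongr
    nlinarith
  have hKs1 : ∀ s : ℝ, 1 ≤ s → K₀ ^ s * R ≤ K ^ s := fun s hs => by
    refine le_trans ?_ (hKs2 s hs)
    gcongr
    linarith
  -- This serves s = 2 and s = max(2, q); both are at most q + 1 because q ≥ 1.
  have hmom : ∀ s : ℝ, 1 ≤ s → s ≤ q + 1 → ∀ g : Λ × ℕ → ℝ, BddMeas g → (∀ p, 0 ≤ g p) →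
      ∫ p, g (towerMap T τ p) * ‖towerMart T τ v N w χ' p‖ ^ s ∂μ ≤ K ^ s * ∫ p, g p ∂μ := by
    intro s hs1 hs g hg hg0
    refine (S.lintegral_towerMap_mul_le (by linarith) hs (by linarith) hm0 hm hg hg0 hmB
      (by linarith)).trans ?_
    exact mul_le_mul_of_nonneg_right (hKs s hs1) (integral_nonneg hg0)
  -- the maximal function of the coboundary
  set φ : ℕ → ℝ≥0∞ := fun t => ENNReal.ofReal ((K₀ * (min t N : ℕ)) ^ (2 * q)) with hφ
  have hφle : ∀ t, φ t ≤ ENNReal.ofReal ((K₀ * N) ^ (2 * q)) := fun t =>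
    ENNReal.ofReal_le_ofReal (by gcongr; exact min_le_right _ _)
  have hob : ∀ p, orbitBound T τ φ N p ≤ (N + 1) * ENNReal.ofReal ((K₀ * N) ^ (2 * q)) := by
    intro p
    rw [add_mul, one_mul, add_comm, orbitBound]
    refine add_le_add (hφle _) ?_
    refine (Finset.sum_le_card_nsmul _ _ (ENNReal.ofReal ((K₀ * N) ^ (2 * q))) fun k _ => ?_).trans
      (by simp)
    exact (indicator_le_self {q : Λ × ℕ | q.2 = 0} (fun q => φ (τ q.1)) _).trans (hφle _)
  have hfin : ((N : ℝ≥0∞) + 1) * ENNReal.ofReal ((K₀ * N) ^ (2 * q)) ≠ ∞ :=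
    ENNReal.mul_ne_top (by simp) ENNReal.ofReal_ne_top
  have hobB : BddMeas fun p => (orbitBound T τ φ N p).toReal :=
    ⟨(S.measurable_orbitBound φ N).ennreal_toReal, _, fun p => by
      rw [Real.norm_of_nonneg ENNReal.toReal_nonneg]; exact ENNReal.toReal_mono hfin (hob p)⟩
  have hob0 : ∀ p, 0 ≤ (orbitBound T τ φ N p).toReal := fun p => ENNReal.toReal_nonneg
  have hχsB := hobB.rpow hob0 (r := 1 / (2 * q)) (by positivity)
  refine ⟨fun p => (orbitBound T τ φ N p).toReal ^ (1 / (2 * q)), {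
    bddMeas_m := hmB
    bddMeas_χ := hcB
    bddMeas_c := ⟨measurable_towerDrift, ‖w‖, fun p => by unfold towerDrift; split_ifs <;> simp⟩
    eq_add := towerObs_eq_add S.toIsTowerSystem w
    orthogonal := fun G hG => ?_
    variance := fun g hg hg0 => by
      simpa using hmom 2 (by norm_num) (by linarith) g hg hg0
    moment := hmom (max 2 q) (by simp) (max_le (by linarith) (by linarith))
    moment_two_mul := ?_
    bddMeas_χs := hχsB
    χ_le := fun k hk p => ?_
    eLpNorm_χs := ?_
    norm_le := fun p => by
      unfold towerObs
      split_ifs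
      · exact (hv1 _).trans hK1
      · rw [norm_zero]; linarith
    eLpNorm_χ := ?_
    norm_c_le := fun p => by
      have h1 : R / N ≤ K / N := by
        gcongr
        have := hKs1 1 le_rfl
        rw [Real.rpow_one, Real.rpow_one] at this
        nlinarith
      unfold towerDrift
      split_ifs
      · exact hw.trans h1
      · rw [norm_zero]; positivity }⟩
  -- Only the top floor contributes, and there G is evaluated at (F y, 0); orthogonality on the
  -- tower is thus orthogonality for the induced map.
  · have hG0 : BddMeas fun y : Λ => G (y, 0) := hG.comp (measurable_id.prodMk measurable_const)
    have hH : Measurable fun y => (inner ℝ (truncSum T τ v N y (τ y) - w + χ' y -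
        χ' (inducedMap T τ y)) (G (inducedMap T τ y, 0)) : ℝ) :=
      ((((measurable_truncSum_self S.toIsTowerSystem hv).sub_const w).add hχ).sub
        (hχ.comp S.measurable_inducedMap)).inner (hG0.1.comp S.measurable_inducedMap)
    have h := integral_indicator_top S.toIsTowerSystem hH.stronglyMeasurable
    rw [horth _ hG0, smul_zero, ← integral_indicator S.measurableSet_top] at h
    rw [← h]
    refine integral_congr_ae (Filter.Eventually.of_forall fun p => ?_)
    by_cases hp : p.2 + 1 = τ p.1
    · simp only [indicator_of_mem (show p ∈ {p : Λ × ℕ | p.2 + 1 = τ p.1} from hp)]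
      rw [towerMap_of_not_lt (by omega), towerMart, if_pos hp]
    · simp only [indicator_of_notMem (show p ∉ {p : Λ × ℕ | p.2 + 1 = τ p.1} from hp)]
      rw [hm0 p hp, inner_zero_left]
  · have h := integral_le_of_lintegral_le (μ := μ)
      (hmB.norm.rpow (fun _ => norm_nonneg _) (r := 2 * q) (by linarith)) (BddMeas.const 1)
      (fun p => by positivity) (fun _ => zero_le_one)
      (c := K₀ ^ (2 * q) * ((N : ℝ) ^ (q - 1) * R)) (by positivity) ?_
    · simp only [integral_const, probReal_univ, smul_eq_mul, mul_one] at h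
      refine h.trans ?_
      calc _ = K₀ ^ (2 * q) * R * (N : ℝ) ^ (q - 1) := by ring
        _ ≤ _ := by gcongr; exact hKs1 _ (by linarith)
    · simp only [ENNReal.ofReal_one, lintegral_one, measure_univ, mul_one]
      calc ∫⁻ p, ENNReal.ofReal (‖towerMart T τ v N w χ' p‖ ^ (2 * q)) ∂μ
          ≤ ∫⁻ p in {p : Λ × ℕ | p.2 + 1 = τ p.1}, φ (τ p.1) ∂μ := by
            rw [← lintegral_indicator S.measurableSet_top]
            refine lintegral_mono fun p => ?_
            by_cases hp : p.2 + 1 = τ p.1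
            · rw [indicator_of_mem (show p ∈ {p : Λ × ℕ | p.2 + 1 = τ p.1} from hp)]
              exact ENNReal.ofReal_le_ofReal (by gcongr; exact hm p)
            · simp only [hm0 p hp, norm_zero, Real.zero_rpow (by linarith : 2 * q ≠ 0),
                ENNReal.ofReal_zero]
              exact zero_le
        _ ≤ ∫⁻ y, φ (τ y) ∂μY := by
            rw [S.lintegral_top (φ := fun y => φ (τ y))
              ((Measurable.of_discrete (f := φ)).comp S.measurable_τ)]
            exact mul_le_of_le_one_left zero_le S.inv_lintegral_τ_le_one
        _ ≤ ENNReal.ofReal (K₀ ^ (2 * q) * (N : ℝ) ^ (q - 1) * R) := by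
            refine S.lintegral_comp_le (by positivity) fun t ht => ENNReal.ofReal_le_ofReal ?_
            rw [Real.mul_rpow (by linarith) (by positivity), mul_assoc]
            gcongr
            exact min_rpow_two_mul_le hq ht hN
        _ = _ := by rw [mul_assoc]
  · have h1 := IsTowerSystem.le_orbitBound (T := T) (τ := τ) φ hk p
    have h2 := ENNReal.toReal_mono (ne_top_of_le_ne_top hfin (hob p)) h1
    rw [hφ] at h2
    simp only at h2
    rw [ENNReal.toReal_ofReal (by positivity)] at h2
    refine (hc _).trans ?_
    calc K₀ * (min (τ ((towerMap T τ)^[k] p).1) N : ℕ)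
        = ((K₀ * (min (τ ((towerMap T τ)^[k] p).1) N : ℕ)) ^ (2 * q)) ^ (1 / (2 * q)) := by
          rw [← Real.rpow_mul (by positivity), mul_one_div_cancel (by linarith), Real.rpow_one]
      _ ≤ _ := by gcongr
  · rw [hχsB.eLpNorm_le_ofReal_iff (fun p => by positivity) (by linarith) (by positivity)]
    have e : ∀ p, ((orbitBound T τ φ N p).toReal ^ (1 / (2 * q))) ^ (2 * q) =
        (orbitBound T τ φ N p).toReal := fun p => by
      rw [← Real.rpow_mul ENNReal.toReal_nonneg, one_div_mul_cancel (by linarith), Real.rpow_one]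
    simp_rw [e]
    have hsq : (K * Real.sqrt N) ^ (2 * q) = K ^ (2 * q) * (N : ℝ) ^ q := by
      rw [Real.mul_rpow (by linarith) (Real.sqrt_nonneg _), Real.sqrt_eq_rpow,
        ← Real.rpow_mul (by positivity)]
      congr 2
      ring
    rw [hsq]
    have h := integral_le_of_lintegral_le (μ := μ) hobB (BddMeas.const 1) hob0
      (fun _ => zero_le_one) (c := K₀ ^ (2 * q) * (2 * R) * (N : ℝ) ^ q) (by positivity) ?_
    · simp only [integral_const, probReal_univ, smul_eq_mul, mul_one] at h
      refine h.trans ?_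
      gcongr
      exact hKs2 _ (by linarith)
    · simp only [ENNReal.ofReal_one, lintegral_one, measure_univ, mul_one]
      -- The initial column contributes N^q by size bias and the N base visits contribute N ·
      -- N^{q-1}, so the total is of order N^q, the 2q-th power of √N.
      calc ∫⁻ p, ENNReal.ofReal (orbitBound T τ φ N p).toReal ∂μ
          = ∫⁻ p, orbitBound T τ φ N p ∂μ := lintegral_congr fun p =>
            ENNReal.ofReal_toReal (ne_top_of_le_ne_top hfin (hob p))
        _ ≤ _ := S.lintegral_orbitBound_le φ N
        _ ≤ ENNReal.ofReal (K₀ ^ (2 * q) * (N : ℝ) ^ q * R) +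
            ENNReal.ofReal N * ENNReal.ofReal (K₀ ^ (2 * q) * (N : ℝ) ^ (q - 1) * R) := by
            rw [ENNReal.ofReal_natCast]
            refine add_le_add ?_ (mul_le_mul_right ?_ _)
            · refine S.lintegral_comp_le (φ := fun t => t * φ t) (by positivity) fun t ht => ?_
              rw [hφ]
              simp only
              rw [← ENNReal.ofReal_natCast, ← ENNReal.ofReal_mul (by positivity)]
              refine ENNReal.ofReal_le_ofReal ?_
              have := mul_min_rpow_two_mul_le hq ht hN
              rw [Real.mul_rpow (by linarith) (by positivity)]
              calc _ = K₀ ^ (2 * q) * (t * ((min t N : ℕ) : ℝ) ^ (2 * q)) := by ring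
                _ ≤ K₀ ^ (2 * q) * ((N : ℝ) ^ q * (t : ℝ) ^ (q + 1)) := by gcongr
                _ = _ := by ring
            · refine S.lintegral_comp_le (by positivity) fun t ht => ENNReal.ofReal_le_ofReal ?_
              rw [Real.mul_rpow (by linarith) (by positivity), mul_assoc]
              gcongr
              exact min_rpow_two_mul_le hq ht hN
        _ = _ := by
            rw [← ENNReal.ofReal_mul (by positivity),
              ← ENNReal.ofReal_add (by positivity) (by positivity)]
            congr 1
            rw [Real.rpow_sub (by linarith), Real.rpow_one]
            field_simp
            ring
  · rw [← eLpNorm_norm, hcB.norm.eLpNorm_le_ofReal_iff (fun p => norm_nonneg _) (by linarith)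
      (by linarith)]
    set ψ : ℕ → ℝ≥0∞ := fun t => ENNReal.ofReal ((K₀ * (min t N : ℕ)) ^ q) with hψ
    have h := integral_le_of_lintegral_le (μ := μ)
      (hcB.norm.rpow (fun _ => norm_nonneg _) (r := q) (by linarith)) (BddMeas.const 1)
      (fun p => by positivity) (fun _ => zero_le_one) (c := K₀ ^ q * R) (by positivity) ?_
    · simp only [integral_const, probReal_univ, smul_eq_mul, mul_one] at h
      exact h.trans (hKs1 q hq)
    · simp only [ENNReal.ofReal_one, lintegral_one, measure_univ, mul_one]
      calc ∫⁻ p, ENNReal.ofReal (‖towerCob T τ v N w χ' p‖ ^ q) ∂μ ≤ ∫⁻ p, ψ (τ p.1) ∂μ :=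
            lintegral_mono fun p => ENNReal.ofReal_le_ofReal (by gcongr; exact hc p)
        _ ≤ ∫⁻ y, τ y * ψ (τ y) ∂μY := by
            rw [S.lintegral_fst (φ := fun y => ψ (τ y))
              ((Measurable.of_discrete (f := ψ)).comp S.measurable_τ)]
            exact mul_le_of_le_one_left zero_le S.inv_lintegral_τ_le_one
        _ ≤ _ := by
            refine S.lintegral_comp_le (φ := fun t => t * ψ t) (by positivity) fun t ht => ?_
            rw [hψ]
            simp only
            rw [← ENNReal.ofReal_natCast, ← ENNReal.ofReal_mul (by positivity)]
            refine ENNReal.ofReal_le_ofReal ?_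
            have ht' : (0 : ℝ) < t := by exact_mod_cast ht
            have : ((min t N : ℕ) : ℝ) ^ q ≤ (t : ℝ) ^ q := by
              gcongr; exact min_le_left _ _
            rw [Real.mul_rpow (by linarith) (by positivity), Real.rpow_add ht', Real.rpow_one]
            calc _ = K₀ ^ q * (((min t N : ℕ) : ℝ) ^ q * t) := by ring
              _ ≤ _ := by gcongr

end IsMixingTower

end TowerMoments

end ExpandingSemiflow

namespace ExpandingSemiflow

/-! ### Iterated moments for the nonuniformly expanding map -/

section BaseMoments

variable {Λ : Type*} [MetricSpace Λ] [MeasurableSpace Λ] [BorelSpace Λ]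
  {T : Λ → Λ} {ρ : Measure Λ} {Y : Set Λ} {α : Set (Set Λ)} {τ : Λ → ℕ} {C₁ β η : ℝ}
  {μY : Measure Λ} {E E' : Type*} [NormedAddCommGroup E] [InnerProductSpace ℝ E]
  [FiniteDimensional ℝ E] [MeasurableSpace E] [BorelSpace E] [NormedAddCommGroup E']
  [InnerProductSpace ℝ E'] [FiniteDimensional ℝ E'] [MeasurableSpace E'] [BorelSpace E']
  {N : ℕ} {v : Λ → E} {q Q R D : ℝ}

/-- The decorrelation constant. -/
noncomputable def mixingConst (C₁ β η D : ℝ) : ℝ :=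
  Real.exp (2 * (regConst C₁ (β ^ (-η)) * D))

/-- The constant in the moment bounds for Birkhoff sums of nonuniformly expanding maps. -/
noncomputable def baseConst (C₁ β η D R Q : ℝ) : ℝ :=
  momentConst Q (IsMixingTower.towerConst R (mixingConst C₁ β η D)
    (coboundaryConst C₁ (β ^ (-η)) D ((C₁ + R) * R)))

/-- The coboundary theorem is applied to the centred truncated excursion sums, dominated by (C₁ + R)
τ, and the resulting decomposition is lifted to the tower. The mixing structure of the tower is part
of the conclusion because later bounds use it independently of v. -/
theorem IsNonuniformlyExpanding.exists_tower_decomposition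
    (H : IsNonuniformlyExpanding T ρ Y α τ C₁ β η) (hμ : IsInducedMeasure T ρ Y τ μY)
    (hτ : Measurable τ) (hτ1 : ∀ x, 1 ≤ τ x) (hD1 : 1 ≤ D) (hD : ∀ x y : Λ, dist x y ≤ D)
    (hq : 1 ≤ q) (hR : 1 ≤ R)
    (hRτ : ∫⁻ y, ENNReal.ofReal ((τ y : ℝ) ^ (q + 1)) ∂μY ≤ ENNReal.ofReal R)
    (hv : Measurable v) (hv1 : ∀ x, ‖v x‖ ≤ 1) (hvh : ∀ x y, ‖v x - v y‖ ≤ dist x y ^ η)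
    (hv0 : ∫ x, v x ∂(baseMeasure T Y τ μY) = 0) (hN : 1 ≤ N) :
    IsMixingTower T Y τ μY q R (mixingConst C₁ β η D) ∧
    0 ≤ coboundaryConst C₁ (β ^ (-η)) D ((C₁ + R) * R) ∧
    ∃ m χ c χs, MartingaleCoboundary (towerMeasure Y τ μY) (towerMap T τ) q
      (IsMixingTower.towerConst R (mixingConst C₁ β η D)
        (coboundaryConst C₁ (β ^ (-η)) D ((C₁ + R) * R))) N (towerObs T τ v N) m χ c χs := by
  obtain ⟨Z, g, w, hZY, hg, S⟩ := H.exists_fullBranchSystem hτ hD1 hD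
  have hfin := H.finite
  have hC1 := H.one_le_C₁
  have hη0 := H.η_pos
  have hμY := hμ.eq_withDensity H.η_pos H.η_le_one
    (ENNReal.inv_ne_zero.2 (measure_ne_top ρ Y)) S
  have hprob := hμ.isProbabilityMeasure
  have hτconst : ∀ i, ∀ x ∈ Z, ∀ y ∈ Z, τ (g i x) = τ (g i y) := fun i x hx y hy =>
    H.τ_const i i.2 _ (hg i x hx) _ (hg i y hy)
  have hτle : ∀ y, (τ y : ℝ≥0∞) ≤ ENNReal.ofReal ((τ y : ℝ) ^ (q + 1)) := fun y => by
    rw [← ENNReal.ofReal_natCast]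
    exact ENNReal.ofReal_le_ofReal
      (Real.self_le_rpow_of_one_le (by exact_mod_cast hτ1 y) (by linarith))
  have hτR : ∫⁻ y, (τ y : ℝ≥0∞) ∂μY ≤ ENNReal.ofReal R := (lintegral_mono hτle).trans hRτ
  have hTower : IsTowerSystem T Y τ μY :=
    { measurable_T := H.nonsingular.measurable
      measurableSet_Y := H.measurableSet_Y
      measurable_τ := hτ
      one_le_τ := hτ1
      isProbabilityMeasure := hprob
      ae_mem := hμ.ae_mem H.measurableSet_Y
      measurePreserving := ⟨S.measurable_F, hμ.invariant⟩
      lintegral_τ_ne_top := ne_top_of_le_ne_top ENNReal.ofReal_ne_top hτR }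
  have hMix : IsMixingTower T Y τ μY q R (mixingConst C₁ β η D) :=
    { hTower with
      one_le_q := hq
      one_le_R := hR
      one_le_B := Real.one_le_exp (by
        have := S.regConst_nonneg
        positivity)
      lintegral_rpow_le := hRτ
      mixing := fun φ ψ hψ => by
        have h := S.lintegral_mul_comp_le (φ := fun y => φ (τ y))
          ((Measurable.of_discrete (f := φ)).comp hτ) hψ
          (fun i x hx y hy => by simp only [hτconst i x hx y hy])
        rw [← hμY] at h
        exact h }
  have hcob0 : 0 ≤ coboundaryConst C₁ (β ^ (-η)) D ((C₁ + R) * R) :=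
    S.coboundaryConst_nonneg (by positivity)
  refine ⟨hMix, hcob0, ?_⟩
  set e := ∫ y, truncSum T τ v N y (τ y) ∂μY with he
  have hN' : (1 : ℝ) ≤ N := by exact_mod_cast hN
  -- The mass in long excursions is at most R N^{-q}, and q ≥ 1.
  have heR : ‖e‖ ≤ R / N := by
    have h0 : ∫ p, v (towerProj T p) ∂(towerMeasure Y τ μY) = 0 := by
      rw [← hv0, baseMeasure, integral_map hTower.measurable_towerProj.aemeasurable
        hv.aestronglyMeasurable]
    refine (norm_integral_truncSum_le hTower hv hv1 h0 (by positivity)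
      (hMix.lintegral_tail_le hN)).trans ?_
    rw [div_eq_inv_mul, ← Real.rpow_neg_one]
    gcongr
  have heR' : ‖e‖ ≤ R := heR.trans (div_le_self (by linarith) hN')
  -- One factor for both requirements: the size τ + R of the centred sum and its Hölder oscillation
  -- C₁ τ along a branch.
  set κ := C₁ + R with hκ
  have hτr : ∀ y, (1 : ℝ) ≤ τ y := fun y => by exact_mod_cast hτ1 y
  have hτm : Measurable fun y => κ * (τ y : ℝ) :=
    ((measurable_from_top (f := fun n : ℕ => (n : ℝ))).comp hτ).const_mul κ
  have hτint : ∫⁻ y, ENNReal.ofReal (κ * (τ y : ℝ)) ∂μY ≤ ENNReal.ofReal (κ * R) := by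
    have : ∀ y, ENNReal.ofReal (κ * (τ y : ℝ)) = ENNReal.ofReal κ * (τ y : ℝ≥0∞) := fun y => by
      rw [ENNReal.ofReal_mul (by positivity), ENNReal.ofReal_natCast]
    simp_rw [this]
    rw [lintegral_const_mul' _ _ ENNReal.ofReal_ne_top, ENNReal.ofReal_mul (by positivity)]
    gcongr
  have hτi : Integrable (fun y => κ * (τ y : ℝ)) μY := by
    refine ⟨hτm.aestronglyMeasurable, ?_⟩
    rw [hasFiniteIntegral_iff_ofReal (Filter.Eventually.of_forall fun y => by
      have := hτr y
      positivity)]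
    exact hτint.trans_lt ENNReal.ofReal_lt_top
  have hτint' : ∫ y, κ * (τ y : ℝ) ∂μY ≤ κ * R := by
    rw [← ofReal_integral_eq_lintegral_ofReal hτi (Filter.Eventually.of_forall fun y => by
      have := hτr y
      change 0 ≤ κ * (τ y : ℝ)
      positivity)] at hτint
    exact (ENNReal.ofReal_le_ofReal_iff (by positivity)).1 hτint
  have hWm : BddMeas fun y => truncSum T τ v N y (τ y) - e :=
    BddMeas.sub ⟨measurable_truncSum_self hTower hv, N, fun y =>
      (norm_truncSum_le hv1 le_rfl).trans (by exact_mod_cast min_le_right _ _)⟩ (BddMeas.const e)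
  have hWint : BddMeas fun y => truncSum T τ v N y (τ y) :=
    ⟨measurable_truncSum_self hTower hv, N, fun y =>
      (norm_truncSum_le hv1 le_rfl).trans (by exact_mod_cast min_le_right _ _)⟩
  have hco := S.exists_orthogonal_coboundary (E := E) (τ := fun y => κ * (τ y : ℝ))
    (W := fun y => truncSum T τ v N y (τ y) - e) hτm (by rw [← hμY]; exact hτi)
    (fun i x hx y hy => by simp only [hτconst i x hx y hy])
    (fun y => by
      have h1 : ‖truncSum T τ v N y (τ y)‖ ≤ τ y := (norm_truncSum_le hv1 le_rfl).trans (by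
        exact_mod_cast min_le_left _ _)
      have := hτr y
      calc _ ≤ (τ y : ℝ) + R := (norm_sub_le _ _).trans (add_le_add h1 heR')
        _ ≤ _ := by rw [hκ]; nlinarith)
    hWm (by
      rw [← hμY, integral_sub (hWint.integrable _) (integrable_const _)]
      simp [he])
    (fun i x hx y hy => by
      rw [sub_sub_sub_cancel_right]
      have ht := hτconst i x hx y hy
      -- As τ is constant on a partition element, truncation keeps or kills the excursion sum on the
      -- whole element and does not spoil its regularity.
      by_cases hle : τ (g i y) ≤ N
      · rw [truncSum, truncSum, if_pos hle, if_pos (ht ▸ hle), ht, ← Finset.sum_sub_distrib]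
        have hterm : ∀ l ∈ Finset.range (τ (g i y)),
            ‖v (T^[l] (g i x)) - v (T^[l] (g i y))‖ ≤ C₁ * dist x y ^ η := by
          intro l hl
          have h := H.intermediate i i.2 _ (hg i x hx) _ (hg i y hy) l
            (by rw [ht]; exact Finset.mem_range.1 hl)
          rw [S.F_g i x hx, S.F_g i y hy] at h
          calc _ ≤ dist (T^[l] (g i x)) (T^[l] (g i y)) ^ η := hvh _ _
            _ ≤ (C₁ * dist x y) ^ η := Real.rpow_le_rpow dist_nonneg h hη0.le
            _ = C₁ ^ η * dist x y ^ η := Real.mul_rpow (by linarith) dist_nonneg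
            _ ≤ C₁ ^ (1 : ℝ) * dist x y ^ η := by
                gcongr
                exact H.η_le_one
            _ = _ := by rw [Real.rpow_one]
        calc _ ≤ ∑ l ∈ Finset.range (τ (g i y)), C₁ * dist x y ^ η :=
              norm_sum_le_of_le _ hterm
          _ = C₁ * (τ (g i y) : ℝ) * dist x y ^ η := by
              rw [Finset.sum_const, Finset.card_range, nsmul_eq_mul]; ring
          _ ≤ _ := by
              gcongr
              linarith
      · rw [truncSum, truncSum, if_neg hle, if_neg (ht ▸ hle), sub_zero, norm_zero]
        positivity)
  rw [← hμY] at hco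
  obtain ⟨χ', hχm, hχb, horth⟩ := hco
  have hmono : coboundaryConst C₁ (β ^ (-η)) D (∫ y, κ * (τ y : ℝ) ∂μY) ≤
      coboundaryConst C₁ (β ^ (-η)) D (κ * R) := by
    have := S.couplingConst_pos
    unfold coboundaryConst
    gcongr
  obtain ⟨χs, h⟩ := hMix.martingaleCoboundary hv hv1 hχm (fun x => (hχb x).trans hmono) heR hcob0
    hN horth
  exact ⟨_, _, _, χs, h⟩

/-- The tower map is semiconjugate to T, so sums along the tower project to sums along T. Points off
the tower are put into the bad set at no cost, as they have measure zero. -/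
theorem IsNonuniformlyExpanding.exists_majorants
    (H : IsNonuniformlyExpanding T ρ Y α τ C₁ β η) (hμ : IsInducedMeasure T ρ Y τ μY)
    (hτ : Measurable τ) (hτ1 : ∀ x, 1 ≤ τ x) (hD1 : 1 ≤ D) (hD : ∀ x y : Λ, dist x y ≤ D)
    (hq : 1 ≤ q) (hqQ : q ≤ Q) (hR : 1 ≤ R)
    (hRτ : ∫⁻ y, ENNReal.ofReal ((τ y : ℝ) ^ (q + 1)) ∂μY ≤ ENNReal.ofReal R)
    (hv : Measurable v) (hv1 : ∀ x, ‖v x‖ ≤ 1) (hvh : ∀ x y, ‖v x - v y‖ ≤ dist x y ^ η)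
    (hv0 : ∫ x, v x ∂(baseMeasure T Y τ μY) = 0) (hN : 1 ≤ N)
    (B : E →L[ℝ] E →L[ℝ] E') (hB : ‖B‖ ≤ 1) :
    ∃ G I : Λ → ℝ, Measurable G ∧ Measurable I ∧
      (∀ j ≤ N, ∀ x, ‖birkhoffSum T v j x‖ ≤ G x) ∧
      (∀ j ≤ N, ∀ x, ‖iteratedBirkhoffSum B T v j x‖ ≤ I x) ∧
      eLpNorm G (ENNReal.ofReal (2 * q)) (baseMeasure T Y τ μY) ≤
        ENNReal.ofReal (baseConst C₁ β η D R Q * Real.sqrt N) ∧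
      eLpNorm I (ENNReal.ofReal q) (baseMeasure T Y τ μY) ≤
        ENNReal.ofReal (baseConst C₁ β η D R Q * N) := by
  obtain ⟨S, hC0, m, χ, c, χs, hM⟩ := H.exists_tower_decomposition hμ hτ hτ1 hD1 hD hq hR hRτ hv
    hv1 hvh hv0 hN
  have hprob := S.isProbabilityMeasure_tower
  have hK1 := S.one_le_towerConst hC0
  have hBd := S.one_le_B
  have hN' : (0 : ℝ) < N := by exact_mod_cast hN
  have hKR : 2 * R ≤ IsMixingTower.towerConst R (mixingConst C₁ β η D)
      (coboundaryConst C₁ (β ^ (-η)) D ((C₁ + R) * R)) := by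
    unfold IsMixingTower.towerConst
    have h1 : 2 * R ≤ 2 * mixingConst C₁ β η D * R := by nlinarith
    exact h1.trans (le_mul_of_one_le_right (by linarith) (by linarith))
  set bad : Set (Λ × ℕ) := {p | ∃ k < N, N < τ ((towerMap T τ)^[k] p).1} ∪
    {p | p.2 < τ p.1}ᶜ with hbad
  have hlt : MeasurableSet {p : Λ × ℕ | p.2 < τ p.1} := S.measurableSet_lt_τ 0
  have hbadm : MeasurableSet bad := by
    have : {p : Λ × ℕ | ∃ k < N, N < τ ((towerMap T τ)^[k] p).1} =
        ⋃ k ∈ Finset.range N, {p | N < τ ((towerMap T τ)^[k] p).1} := by ext p; simp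
    refine MeasurableSet.union ?_ hlt.compl
    rw [this]
    exact Finset.measurableSet_biUnion _ fun k _ => measurableSet_lt measurable_const
      (hτ.comp (measurable_fst.comp (S.measurable_towerMap.iterate k)))
  have hμbad : towerMeasure Y τ μY bad ≤ ENNReal.ofReal (IsMixingTower.towerConst R
      (mixingConst C₁ β η D) (coboundaryConst C₁ (β ^ (-η)) D ((C₁ + R) * R)) *
        (N : ℝ) ^ (-q)) := by
    have h0 : towerMeasure Y τ μY {p : Λ × ℕ | p.2 < τ p.1}ᶜ = 0 :=
      mem_ae_iff.1 (S.ae_mem_tower.mono fun p hp => hp.2)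
    refine (measure_union_le _ _).trans ?_
    rw [h0, add_zero]
    exact (S.measure_exists_lt_le hN).trans (ENNReal.ofReal_le_ofReal (by gcongr))
  obtain ⟨G, I, hG, hI, hG1, hI1, hG2, hI2⟩ := hM.exists_majorants
    S.measurePreserving_towerMap hq hqQ hK1 hN hbadm hμbad (V := fun p => v (towerProj T p))
    (fun p hp k hk => by
      have h1 : p.2 < τ p.1 := by
        by_contra h; exact hp (Or.inr h)
      have h2 : τ ((towerMap T τ)^[k] p).1 ≤ N := by
        by_contra h; exact hp (Or.inl ⟨k, hk, not_le.1 h⟩)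
      exact (if_pos ⟨S.snd_iterate_lt h1 k, h2⟩).symm)
    (fun p => (hv1 _).trans hK1) B hB
  have hsum : ∀ p : Λ × ℕ, p.2 < τ p.1 → ∀ j,
      birkhoffSum (towerMap T τ) (fun p => v (towerProj T p)) j p =
        birkhoffSum T v j (towerProj T p) := fun p hp j =>
    Finset.sum_congr rfl fun k _ => by
      simp only [S.towerProj_iterate hp]
  have hiter : ∀ p : Λ × ℕ, p.2 < τ p.1 → ∀ j,
      iteratedBirkhoffSum B (towerMap T τ) (fun p => v (towerProj T p)) j p =
        iteratedBirkhoffSum B T v j (towerProj T p) := fun p hp j =>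
    Finset.sum_congr rfl fun k _ => by
      simp only [S.towerProj_iterate hp, hsum p hp]
  have hTm := S.measurable_T
  have hbm : ∀ j, Measurable fun x => birkhoffSum T v j x := fun j =>
    Finset.measurable_fun_sum _ fun k _ => hv.comp (hTm.iterate k)
  have him : ∀ j, Measurable fun x => iteratedBirkhoffSum B T v j x := fun j =>
    Finset.measurable_fun_sum _ fun k _ => by
      have : Continuous fun z : E × E => B z.1 z.2 := by fun_prop
      exact this.measurable.comp ((hbm k).prodMk (hv.comp (hTm.iterate k)))
  have hne : (Finset.range (N + 1)).Nonempty := ⟨0, by simp⟩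
  have hmem : ∀ {j}, j ≤ N → j ∈ Finset.range (N + 1) := fun h =>
    Finset.mem_range.2 (by omega)
  -- The majorants found on the tower need not be functions of the projection to Λ; the actual
  -- maxima are, and they are smaller.
  set G' : Λ → ℝ := fun x => (Finset.range (N + 1)).sup' hne fun j => ‖birkhoffSum T v j x‖
    with hG'
  set I' : Λ → ℝ := fun x => (Finset.range (N + 1)).sup' hne fun j =>
    ‖iteratedBirkhoffSum B T v j x‖ with hI'
  have hG'm : Measurable G' := Finset.measurable_range_sup'' fun j _ => (hbm j).norm
  have hI'm : Measurable I' := Finset.measurable_range_sup'' fun j _ => (him j).norm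
  have hGl : ∀ j ≤ N, ∀ x, ‖birkhoffSum T v j x‖ ≤ G' x := fun j hj x =>
    Finset.le_sup' (fun j => ‖birkhoffSum T v j x‖) (hmem hj)
  have hIl : ∀ j ≤ N, ∀ x, ‖iteratedBirkhoffSum B T v j x‖ ≤ I' x := fun j hj x =>
    Finset.le_sup' (fun j => ‖iteratedBirkhoffSum B T v j x‖) (hmem hj)
  refine ⟨G', I', hG'm, hI'm, hGl, hIl, ?_, ?_⟩
  · rw [baseMeasure, eLpNorm_map_measure hG'm.aestronglyMeasurable
      S.measurable_towerProj.aemeasurable]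
    refine (eLpNorm_mono_ae_real (S.ae_mem_tower.mono fun p hp => ?_)).trans hG2
    rw [Function.comp_apply, Real.norm_of_nonneg ((norm_nonneg _).trans (hGl 0 (zero_le) _))]
    refine Finset.sup'_le _ _ fun j hj => ?_
    rw [← hsum p hp.2]
    exact hG1 j (by have := Finset.mem_range.1 hj; omega) p
  · rw [baseMeasure, eLpNorm_map_measure hI'm.aestronglyMeasurable
      S.measurable_towerProj.aemeasurable]
    refine (eLpNorm_mono_ae_real (S.ae_mem_tower.mono fun p hp => ?_)).trans hI2
    rw [Function.comp_apply, Real.norm_of_nonneg ((norm_nonneg _).trans (hIl 0 (zero_le) _))]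
    refine Finset.sup'_le _ _ fun j hj => ?_
    rw [← hiter p hp.2]
    exact hI1 j (by have := Finset.mem_range.1 hj; omega) p

end BaseMoments

end ExpandingSemiflow

/-! ### Iterated integrals of bounded paths -/

section Paths

variable {E E' : Type*} [NormedAddCommGroup E] [InnerProductSpace ℝ E]
  [FiniteDimensional ℝ E] [MeasurableSpace E] [BorelSpace E] [NormedAddCommGroup E']
  [InnerProductSpace ℝ E'] [FiniteDimensional ℝ E'] {γ : ℝ → E} {A : ℝ}
  {B : E →L[ℝ] E →L[ℝ] E'}

/-- The primitive of a path. -/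
noncomputable def pathIntegral (γ : ℝ → E) (s : ℝ) : E := ∫ r in (0 : ℝ)..s, γ r

/-- The iterated integral of a path. -/
noncomputable def iteratedPathIntegral (B : E →L[ℝ] E →L[ℝ] E') (γ : ℝ → E) (s : ℝ) : E' :=
  ∫ r in (0 : ℝ)..s, B (pathIntegral γ r) (γ r)

theorem BddMeas.intervalIntegrable (hγ : BddMeas γ) (s t : ℝ) :
    IntervalIntegrable γ volume s t := by
  obtain ⟨h1, C, hC⟩ := hγ
  exact (intervalIntegrable_const (c := C)).mono_fun h1.aestronglyMeasurable
    (Filter.Eventually.of_forall fun x => (hC x).trans (le_abs_self C))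

theorem pathIntegral_sub (hγ : BddMeas γ) (s t : ℝ) :
    pathIntegral γ t - pathIntegral γ s = ∫ r in s..t, γ r :=
  intervalIntegral.integral_interval_sub_left (hγ.intervalIntegrable _ _)
    (hγ.intervalIntegrable _ _)

theorem norm_pathIntegral_sub_le (hγ : BddMeas γ) (hA : ∀ s, ‖γ s‖ ≤ A) (s t : ℝ) :
    ‖pathIntegral γ t - pathIntegral γ s‖ ≤ A * |t - s| := by
  rw [pathIntegral_sub hγ]
  exact intervalIntegral.norm_integral_le_of_norm_le_const fun r _ => hA r

theorem continuous_pathIntegral (hγ : BddMeas γ) : Continuous (pathIntegral γ) :=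
  intervalIntegral.continuous_primitive (fun a b => hγ.intervalIntegrable a b) 0

theorem measurable_bilin_pathIntegral (hγ : BddMeas γ) (c : E) :
    StronglyMeasurable fun r => B (pathIntegral γ r - c) (γ r) := by
  have : Continuous fun z : E × E => B z.1 z.2 := by fun_prop
  exact this.comp_stronglyMeasurable
    (((continuous_pathIntegral hγ).stronglyMeasurable.sub stronglyMeasurable_const).prodMk
      hγ.1.stronglyMeasurable)

theorem intervalIntegrable_bilin_pathIntegral (hγ : BddMeas γ) (c : E) (s t : ℝ) :
    IntervalIntegrable (fun r => B (pathIntegral γ r - c) (γ r)) volume s t := by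
  obtain ⟨A, hA⟩ := hγ.2
  have hc : Continuous fun r => ‖B‖ * ‖pathIntegral γ r - c‖ * A :=
    ((((continuous_pathIntegral hγ).sub continuous_const).norm).const_mul _).mul_const _
  refine (hc.intervalIntegrable s t).mono_fun
    (measurable_bilin_pathIntegral hγ c).aestronglyMeasurable
    (Filter.Eventually.of_forall fun r => ?_)
  refine (B.le_opNorm₂ _ _).trans (le_trans ?_ (le_abs_self _))
  gcongr
  exact hA r

/-- What remains of the increment after the cross term is the iterated integral of the path
restarted at s, which is quadratically small in t - s. -/
theorem iteratedPathIntegral_sub (hγ : BddMeas γ) (s t : ℝ) :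
    iteratedPathIntegral B γ t - iteratedPathIntegral B γ s -
      B (pathIntegral γ s) (pathIntegral γ t - pathIntegral γ s) =
    ∫ r in s..t, B (pathIntegral γ r - pathIntegral γ s) (γ r) := by
  have h0 : ∀ s t, IntervalIntegrable (fun r => B (pathIntegral γ r) (γ r)) volume s t :=
    fun s t => by simpa using intervalIntegrable_bilin_pathIntegral (B := B) hγ 0 s t
  have h1 : iteratedPathIntegral B γ t - iteratedPathIntegral B γ s =
      ∫ r in s..t, B (pathIntegral γ r) (γ r) :=
    intervalIntegral.integral_interval_sub_left (h0 _ _) (h0 _ _)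
  have h2 : B (pathIntegral γ s) (∫ r in s..t, γ r) = ∫ r in s..t, B (pathIntegral γ s) (γ r) :=
    ((B (pathIntegral γ s)).intervalIntegral_comp_comm (hγ.intervalIntegrable s t)).symm
  rw [h1, pathIntegral_sub hγ, h2, ← intervalIntegral.integral_sub (h0 s t)]
  · simp only [map_sub, sub_apply]
  · have := intervalIntegrable_bilin_pathIntegral (B := B) hγ (pathIntegral γ s) s t
    have := (h0 s t).sub this
    simpa only [map_sub, sub_apply, sub_sub_cancel] using this

theorem norm_iteratedPathIntegral_sub_le (hγ : BddMeas γ) (hA : ∀ s, ‖γ s‖ ≤ A) (hB : ‖B‖ ≤ 1)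
    {s t : ℝ} (hst : s ≤ t) :
    ‖iteratedPathIntegral B γ t - iteratedPathIntegral B γ s -
      B (pathIntegral γ s) (pathIntegral γ t - pathIntegral γ s)‖ ≤ (A * (t - s)) ^ 2 := by
  have hA0 : 0 ≤ A := (norm_nonneg _).trans (hA 0)
  rw [iteratedPathIntegral_sub hγ]
  have : ∀ r ∈ uIoc s t, ‖B (pathIntegral γ r - pathIntegral γ s) (γ r)‖ ≤
      (A * (t - s)) * A := by
    intro r hr
    rw [uIoc_of_le hst] at hr
    have h1 := norm_pathIntegral_sub_le hγ hA s r
    rw [abs_of_nonneg (by linarith [hr.1])] at h1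
    calc _ ≤ ‖B‖ * ‖pathIntegral γ r - pathIntegral γ s‖ * ‖γ r‖ := B.le_opNorm₂ _ _
      _ ≤ 1 * (A * (t - s)) * A := by
          gcongr
          · exact h1.trans (by gcongr; exact hr.2)
          · exact hA r
      _ = _ := by ring
  refine (intervalIntegral.norm_integral_le_of_norm_le_const this).trans (le_of_eq ?_)
  rw [abs_of_nonneg (by linarith)]
  ring

/-- Chen's relation. -/
theorem integral_shift_eq (hγ : BddMeas γ) (u t : ℝ) :
    ∫ s in (0 : ℝ)..t, B (∫ r in (0 : ℝ)..s, γ (u + r)) (γ (u + s)) =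
      iteratedPathIntegral B γ (u + t) - iteratedPathIntegral B γ u -
        B (pathIntegral γ u) (pathIntegral γ (u + t) - pathIntegral γ u) := by
  rw [iteratedPathIntegral_sub hγ]
  have h1 : ∀ s, ∫ r in (0 : ℝ)..s, γ (u + r) = pathIntegral γ (u + s) - pathIntegral γ u := by
    intro s
    rw [pathIntegral_sub hγ, intervalIntegral.integral_comp_add_left, add_zero]
  simp only [h1]
  rw [intervalIntegral.integral_comp_add_left
    (fun r => B (pathIntegral γ r - pathIntegral γ u) (γ r)), add_zero]

end Paths

/-! ### Orbits of the semiflow and sums of fibre integrals. -/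

namespace ExpandingSemiflow

section FlowPath

variable {Λ : Type*} {T : Λ → Λ} {h : Λ → ℝ} {E E' : Type*} [NormedAddCommGroup E]
  [InnerProductSpace ℝ E] [FiniteDimensional ℝ E] [MeasurableSpace E] [BorelSpace E]
  [NormedAddCommGroup E'] [InnerProductSpace ℝ E'] [FiniteDimensional ℝ E'] {v : Λ × ℝ → E}
  {A b M : ℝ} {B : E →L[ℝ] E →L[ℝ] E'}

/-- The observable along the orbit of `(x, 0)`. -/
noncomputable def flowPath (T : Λ → Λ) (h : Λ → ℝ) (v : Λ × ℝ → E) (x : Λ) (s : ℝ) : E :=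
  if 0 ≤ s then v (semiflow T h s (x, 0)) else 0

/-- The integral of the observable over one fibre. -/
noncomputable def fibreIntegral (h : Λ → ℝ) (v : Λ × ℝ → E) (x : Λ) : E :=
  ∫ u in (0 : ℝ)..h x, v (x, u)

theorem semiflow_eq_semiflow_zero (t : ℝ) (x : Λ) (u : ℝ) :
    semiflow T h t (x, u) = semiflow T h (u + t) (x, 0) := by
  simp only [semiflow, lapNumber, zero_add]

theorem apply_semiflow_eq {u t : ℝ} (ht : 0 ≤ u + t) (x : Λ) :
    v (semiflow T h t (x, u)) = flowPath T h v x (u + t) := by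
  rw [flowPath, if_pos ht, semiflow_eq_semiflow_zero]

theorem mul_le_birkhoffSum (hb : ∀ x, b ≤ h x) (n : ℕ) (x : Λ) : n * b ≤ birkhoffSum T h n x := by
  calc (n : ℝ) * b = ∑ _k ∈ Finset.range n, b := by simp
    _ ≤ _ := Finset.sum_le_sum fun k _ => hb _

theorem strictMono_birkhoffSum (hb0 : 0 < b) (hb : ∀ x, b ≤ h x) (x : Λ) :
    StrictMono fun n => birkhoffSum T h n x :=
  strictMono_nat_of_lt_succ fun n => by
    rw [birkhoffSum_succ]
    have := hb (T^[n] x)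
    linarith

/-- The lower bound on the roof makes the set of admissible lap counts bounded, so its supremum is
attained. -/
theorem lapNumber_spec (hb0 : 0 < b) (hb : ∀ x, b ≤ h x) {s : ℝ} (hs : 0 ≤ s) (x : Λ) :
    birkhoffSum T h (lapNumber T h s (x, 0)) x ≤ s ∧
      s < birkhoffSum T h (lapNumber T h s (x, 0) + 1) x := by
  set N : Set ℕ := {n | ∑ j ∈ Finset.range n, h (T^[j] x) ≤ 0 + s} with hN
  have hbdd : BddAbove N := ⟨⌈s / b⌉₊, fun n hn => by
    have h1 := mul_le_birkhoffSum (T := T) hb n x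
    have h2 : birkhoffSum T h n x ≤ 0 + s := hn
    have h3 : (n : ℝ) ≤ s / b := by rw [le_div_iff₀ hb0]; linarith
    exact_mod_cast h3.trans (Nat.le_ceil _)⟩
  have hmem := Nat.sSup_mem (s := N) ⟨0, by simpa [hN] using hs⟩ hbdd
  refine ⟨by
    have h' : birkhoffSum T h (sSup N) x ≤ 0 + s := hmem
    rw [zero_add] at h'
    exact h', ?_⟩
  by_contra hcon
  have h4 : sSup N + 1 ∈ N := by
    change birkhoffSum T h (sSup N + 1) x ≤ 0 + s
    rw [zero_add]
    exact not_lt.1 hcon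
  have := le_csSup hbdd h4
  omega

theorem flowPath_eq (hb0 : 0 < b) (hb : ∀ x, b ≤ h x) {x : Λ} {n : ℕ} {s : ℝ}
    (h1 : birkhoffSum T h n x ≤ s) (h2 : s < birkhoffSum T h (n + 1) x) :
    flowPath T h v x s = v (T^[n] x, s - birkhoffSum T h n x) := by
  have h0 : 0 ≤ s := le_trans (le_trans (by positivity) (mul_le_birkhoffSum (T := T) hb n x)) h1
  obtain ⟨h3, h4⟩ := lapNumber_spec (T := T) hb0 hb h0 x
  have hm := strictMono_birkhoffSum (T := T) hb0 hb x
  have h5 : lapNumber T h s (x, 0) = n := by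
    have h6 := hm.lt_iff_lt.1 (h3.trans_lt h2)
    have h7 := hm.lt_iff_lt.1 (h1.trans_lt h4)
    omega
  rw [flowPath, if_pos h0, semiflow, h5]
  simp only [zero_add]
  rfl

theorem exists_lap (hb0 : 0 < b) (hb : ∀ x, b ≤ h x) {s : ℝ} (hs : 0 ≤ s) (x : Λ) :
    ∃ n : ℕ, birkhoffSum T h n x ≤ s ∧ s < birkhoffSum T h (n + 1) x :=
  ⟨_, lapNumber_spec hb0 hb hs x⟩

theorem norm_flowPath_le (hb0 : 0 < b) (hb : ∀ x, b ≤ h x) (hA0 : 0 ≤ A)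
    (hA : ∀ p ∈ suspension h, ‖v p‖ ≤ A) (x : Λ) (s : ℝ) : ‖flowPath T h v x s‖ ≤ A := by
  by_cases hs : 0 ≤ s
  · obtain ⟨n, h1, h2⟩ := exists_lap (T := T) hb0 hb hs x
    rw [flowPath_eq hb0 hb h1 h2]
    rw [birkhoffSum_succ] at h2
    exact hA _ ⟨by simpa using h1, by simp only; linarith⟩
  · rw [flowPath, if_neg hs, norm_zero]; exact hA0

variable [MeasurableSpace Λ]

/-- Between consecutive lap times the path is v along a fixed fibre, so preimages are countable
unions of pieces. -/
theorem measurable_flowPath (hb0 : 0 < b) (hb : ∀ x, b ≤ h x) (hv : Measurable v) (x : Λ) :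
    Measurable (flowPath T h v x) := by
  intro U hU
  have hpre : flowPath T h v x ⁻¹' U =
      (⋃ n : ℕ, Ico (birkhoffSum T h n x) (birkhoffSum T h (n + 1) x) ∩
        (fun s => v (T^[n] x, s - birkhoffSum T h n x)) ⁻¹' U) ∪
      (Iio 0 ∩ (fun _ : ℝ => (0 : E)) ⁻¹' U) := by
    ext s
    simp only [mem_preimage, mem_union, mem_iUnion, mem_inter_iff, mem_Ico, mem_Iio]
    constructor
    · intro hs
      by_cases h0 : 0 ≤ s
      · obtain ⟨n, h1, h2⟩ := exists_lap (T := T) hb0 hb h0 x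
        exact Or.inl ⟨n, ⟨h1, h2⟩, by
          rwa [flowPath_eq hb0 hb h1 h2] at hs⟩
      · exact Or.inr ⟨not_le.1 h0, by rwa [flowPath, if_neg h0] at hs⟩
    · rintro (⟨n, ⟨h1, h2⟩, h3⟩ | ⟨h1, h2⟩)
      · rwa [flowPath_eq hb0 hb h1 h2]
      · rwa [flowPath, if_neg (not_le.2 h1)]
  rw [hpre]
  refine (MeasurableSet.iUnion fun n => measurableSet_Ico.inter ?_).union
    (measurableSet_Iio.inter (measurable_const hU))
  exact (hv.comp (measurable_const.prodMk (measurable_id.sub_const _))) hU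

theorem bddMeas_flowPath (hb0 : 0 < b) (hb : ∀ x, b ≤ h x) (hv : Measurable v) (hA0 : 0 ≤ A)
    (hA : ∀ p ∈ suspension h, ‖v p‖ ≤ A) (x : Λ) : BddMeas (flowPath T h v x) :=
  ⟨measurable_flowPath hb0 hb hv x, A, norm_flowPath_le hb0 hb hA0 hA x⟩

theorem integral_flowPath_fibre (hb0 : 0 < b) (hb : ∀ x, b ≤ h x) (x : Λ) (n : ℕ) :
    ∫ s in (birkhoffSum T h n x)..(birkhoffSum T h (n + 1) x), flowPath T h v x s =
      fibreIntegral h v (T^[n] x) := by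
  have hle : birkhoffSum T h n x ≤ birkhoffSum T h (n + 1) x :=
    (strictMono_birkhoffSum (T := T) hb0 hb x).monotone (Nat.le_succ n)
  have h1 : ∫ s in (birkhoffSum T h n x)..(birkhoffSum T h (n + 1) x), flowPath T h v x s =
      ∫ s in (birkhoffSum T h n x)..(birkhoffSum T h (n + 1) x),
        v (T^[n] x, s - birkhoffSum T h n x) := by
    rw [intervalIntegral.integral_of_le hle, intervalIntegral.integral_of_le hle,
      integral_Ioc_eq_integral_Ioo, integral_Ioc_eq_integral_Ioo]
    exact setIntegral_congr_fun measurableSet_Ioo fun s hs => flowPath_eq hb0 hb hs.1.le hs.2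
  rw [h1, intervalIntegral.integral_comp_sub_right (fun s => v (T^[n] x, s)), sub_self,
    birkhoffSum_succ, add_sub_cancel_left]
  rfl

theorem pathIntegral_birkhoffSum (hb0 : 0 < b) (hb : ∀ x, b ≤ h x) (hv : Measurable v)
    (hA0 : 0 ≤ A) (hA : ∀ p ∈ suspension h, ‖v p‖ ≤ A) (x : Λ) (n : ℕ) :
    pathIntegral (flowPath T h v x) (birkhoffSum T h n x) =
      birkhoffSum T (fibreIntegral h v) n x := by
  have hγ := bddMeas_flowPath (T := T) hb0 hb hv hA0 hA x
  induction n with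
  | zero => simp [pathIntegral]
  | succ n ih =>
    have h1 := pathIntegral_sub hγ (birkhoffSum T h n x) (birkhoffSum T h (n + 1) x)
    rw [integral_flowPath_fibre hb0 hb] at h1
    rw [birkhoffSum_succ T (fibreIntegral h v), ← ih, ← h1]
    abel

/-- At lap times the path integral is a Birkhoff sum, so Chen's relation reproduces the discrete
recursion up to the iterated integral inside one fibre, which is at most (A M)² for each lap. -/
theorem norm_iteratedPathIntegral_birkhoffSum_sub_le (hb0 : 0 < b) (hb : ∀ x, b ≤ h x)
    (hM : ∀ x, h x ≤ M) (hv : Measurable v) (hA0 : 0 ≤ A)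
    (hA : ∀ p ∈ suspension h, ‖v p‖ ≤ A) (hB : ‖B‖ ≤ 1) (x : Λ) (n : ℕ) :
    ‖iteratedPathIntegral B (flowPath T h v x) (birkhoffSum T h n x) -
      iteratedBirkhoffSum B T (fibreIntegral h v) n x‖ ≤ n * (A * M) ^ 2 := by
  have hγ := bddMeas_flowPath (T := T) hb0 hb hv hA0 hA x
  have hγA := norm_flowPath_le (T := T) hb0 hb hA0 hA x
  have hpath := pathIntegral_birkhoffSum (T := T) hb0 hb hv hA0 hA x
  induction n with
  | zero => simp [iteratedPathIntegral, iteratedBirkhoffSum]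
  | succ n ih =>
    have hle : birkhoffSum T h n x ≤ birkhoffSum T h (n + 1) x :=
      (strictMono_birkhoffSum (T := T) hb0 hb x).monotone (Nat.le_succ n)
    have h1 := norm_iteratedPathIntegral_sub_le hγ hγA hB hle
    rw [hpath, hpath, birkhoffSum_succ T (fibreIntegral h v), add_sub_cancel_left] at h1
    have h2 : A * (birkhoffSum T h (n + 1) x - birkhoffSum T h n x) ≤ A * M := by
      rw [birkhoffSum_succ, add_sub_cancel_left]
      exact mul_le_mul_of_nonneg_left (hM _) hA0
    have h3 : 0 ≤ A * (birkhoffSum T h (n + 1) x - birkhoffSum T h n x) :=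
      mul_nonneg hA0 (by linarith)
    have h4 : iteratedBirkhoffSum B T (fibreIntegral h v) (n + 1) x =
        iteratedBirkhoffSum B T (fibreIntegral h v) n x +
          B (birkhoffSum T (fibreIntegral h v) n x) (fibreIntegral h v (T^[n] x)) :=
      Finset.sum_range_succ _ _
    set P := iteratedPathIntegral B (flowPath T h v x) (birkhoffSum T h n x)
    set P' := iteratedPathIntegral B (flowPath T h v x) (birkhoffSum T h (n + 1) x)
    rw [h4]
    calc _ = ‖(P' - P - B (birkhoffSum T (fibreIntegral h v) n x) (fibreIntegral h v (T^[n] x))) +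
          (P - iteratedBirkhoffSum B T (fibreIntegral h v) n x)‖ := by congr 1; abel
      _ ≤ (A * M) ^ 2 + n * (A * M) ^ 2 :=
          (norm_add_le _ _).trans (add_le_add (h1.trans (by gcongr)) ih)
      _ = _ := by push_cast; ring

/-- Pathwise bounds for the flow in terms of bounds for the Birkhoff sums of the fibre
integrals. -/
theorem norm_path_le (hb0 : 0 < b) (hb : ∀ x, b ≤ h x) (hM : ∀ x, h x ≤ M) (hv : Measurable v)
    (hA0 : 0 ≤ A) (hA : ∀ p ∈ suspension h, ‖v p‖ ≤ A) (hB : ‖B‖ ≤ 1) (x : Λ) {N : ℕ} {g i : ℝ}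
    (hg : ∀ j ≤ N, ‖birkhoffSum T (fibreIntegral h v) j x‖ ≤ g)
    (hi : ∀ j ≤ N, ‖iteratedBirkhoffSum B T (fibreIntegral h v) j x‖ ≤ i)
    {s : ℝ} (hs : 0 ≤ s) (hsN : s ≤ N * b) :
    ‖pathIntegral (flowPath T h v x) s‖ ≤ g + A * M ∧
      ‖iteratedPathIntegral B (flowPath T h v x) s‖ ≤
        i + N * (A * M) ^ 2 + g * (A * M) + (A * M) ^ 2 := by
  have hγ := bddMeas_flowPath (T := T) hb0 hb hv hA0 hA x
  have hγA := norm_flowPath_le (T := T) hb0 hb hA0 hA x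
  obtain ⟨n, h1, h2⟩ := exists_lap (T := T) hb0 hb hs x
  have hnN : n ≤ N := by
    have h3 := (mul_le_birkhoffSum (T := T) hb n x).trans (h1.trans hsN)
    exact_mod_cast le_of_mul_le_mul_right h3 hb0
  have h4 : A * (s - birkhoffSum T h n x) ≤ A * M := by
    rw [birkhoffSum_succ] at h2
    exact mul_le_mul_of_nonneg_left (by linarith [hM (T^[n] x)]) hA0
  have h5 := norm_pathIntegral_sub_le hγ hγA (birkhoffSum T h n x) s
  rw [abs_of_nonneg (by linarith)] at h5
  have hpath := pathIntegral_birkhoffSum (T := T) hb0 hb hv hA0 hA x n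
  have h6 := norm_iteratedPathIntegral_sub_le hγ hγA hB h1
  have h7 := norm_iteratedPathIntegral_birkhoffSum_sub_le (T := T) (B := B) hb0 hb hM hv hA0 hA
    hB x n
  rw [hpath] at h5 h6
  have hgn := hg n hnN
  have hin := hi n hnN
  have hAM : 0 ≤ A * M := le_trans (mul_nonneg hA0 (by linarith)) h4
  have hg0 : 0 ≤ g := (norm_nonneg _).trans hgn
  set a := pathIntegral (flowPath T h v x) s
  set S := birkhoffSum T (fibreIntegral h v) n x
  set P := iteratedPathIntegral B (flowPath T h v x) s
  set P' := iteratedPathIntegral B (flowPath T h v x) (birkhoffSum T h n x)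
  set I := iteratedBirkhoffSum B T (fibreIntegral h v) n x
  constructor
  · calc ‖a‖ = ‖S + (a - S)‖ := by rw [add_sub_cancel]
      _ ≤ _ := (norm_add_le _ _).trans (add_le_add hgn (h5.trans h4))
  · have h8 : ‖B S (a - S)‖ ≤ g * (A * M) := by
      calc _ ≤ ‖B‖ * ‖S‖ * ‖a - S‖ := B.le_opNorm₂ _ _
        _ ≤ 1 * g * (A * M) := by
            gcongr
            exact h5.trans h4
        _ = _ := by ring
    have h9 : (A * (s - birkhoffSum T h n x)) ^ 2 ≤ (A * M) ^ 2 := by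
      have : 0 ≤ A * (s - birkhoffSum T h n x) := mul_nonneg hA0 (by linarith)
      gcongr
    have h10 : (n : ℝ) * (A * M) ^ 2 ≤ N * (A * M) ^ 2 := by gcongr
    calc ‖P‖ = ‖I + (P' - I) + B S (a - S) + (P - P' - B S (a - S))‖ := by congr 1; abel
      _ ≤ ‖I‖ + ‖P' - I‖ + ‖B S (a - S)‖ + ‖P - P' - B S (a - S)‖ :=
          (norm_add_le _ _).trans (by gcongr; exact (norm_add_le _ _).trans (by
            gcongr; exact norm_add_le _ _))
      _ ≤ _ := by linarith

end FlowPath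

end ExpandingSemiflow

/-! ### The outer product, flow integrals and the suspension measure. -/

namespace ExpandingSemiflow

section OuterProduct

variable {d : ℕ}

/-- The outer product `a ⊗ b = a bᵀ` with values in the Euclidean space of matrices. -/
noncomputable def outerProduct (d : ℕ) : EuclideanSpace ℝ (Fin d) →L[ℝ]
    EuclideanSpace ℝ (Fin d) →L[ℝ] EuclideanSpace ℝ (Fin d × Fin d) :=
  LinearMap.mkContinuous₂ (LinearMap.mk₂ ℝ
    (fun a b => WithLp.toLp 2 fun ij : Fin d × Fin d => a ij.1 * b ij.2)
    (fun a a' b => by ext ij; simp [add_mul]) (fun c a b => by ext ij; simp [mul_assoc])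
    (fun a b b' => by ext ij; simp [mul_add]) (fun c a b => by ext ij; simp [mul_left_comm])) 1
    fun a b => by
      rw [one_mul, EuclideanSpace.norm_eq, EuclideanSpace.norm_eq, EuclideanSpace.norm_eq,
        ← Real.sqrt_mul (by positivity), Finset.sum_mul_sum, ← Finset.sum_product']
      refine le_of_eq (congrArg Real.sqrt (Finset.sum_congr rfl fun ij _ => ?_))
      simp [mul_pow]

theorem norm_outerProduct_le : ‖outerProduct d‖ ≤ 1 :=
  LinearMap.mkContinuous₂_norm_le _ zero_le_one _

theorem matrixNorm_eq (J : Matrix (Fin d) (Fin d) ℝ) (z : EuclideanSpace ℝ (Fin d × Fin d))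
    (hz : ∀ i j, J i j = z (i, j)) : matrixNorm J = ‖z‖ := by
  rw [matrixNorm, EuclideanSpace.norm_eq]
  congr 1
  rw [← Finset.univ_product_univ, Finset.sum_product]
  refine Finset.sum_congr rfl fun i _ => Finset.sum_congr rfl fun j _ => ?_
  rw [hz, Real.norm_eq_abs, sq_abs]

end OuterProduct

section FlowIntegrals

variable {Λ : Type*} [MeasurableSpace Λ] {T : Λ → Λ} {h : Λ → ℝ} {d : ℕ}
  {v : Λ × ℝ → EuclideanSpace ℝ (Fin d)} {A b M : ℝ}

theorem singleIntegral_eq {x : Λ} {u t : ℝ} (hγ : BddMeas (flowPath T h v x)) (hu : 0 ≤ u)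
    (ht : 0 ≤ t) : singleIntegral T h v t (x, u) =
      pathIntegral (flowPath T h v x) (u + t) - pathIntegral (flowPath T h v x) u := by
  have h1 := intervalIntegral.integral_comp_add_left (a := 0) (b := t) (flowPath T h v x) u
  rw [add_zero] at h1
  rw [pathIntegral_sub hγ, singleIntegral, ← h1]
  refine intervalIntegral.integral_congr fun s hs => ?_
  rw [uIcc_of_le ht] at hs
  exact apply_semiflow_eq (add_nonneg hu hs.1) x

/-- The orbit of (x, u) is the orbit of (x, 0) delayed by u. Chen's relation expresses its double
integral through primitives that start at time 0 on the base. -/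
theorem matrixNorm_doubleIntegral {x : Λ} {u t : ℝ} (hγ : BddMeas (flowPath T h v x))
    (hu : 0 ≤ u) (ht : 0 ≤ t) : matrixNorm (doubleIntegral T h v t (x, u)) =
      ‖iteratedPathIntegral (outerProduct d) (flowPath T h v x) (u + t) -
        iteratedPathIntegral (outerProduct d) (flowPath T h v x) u -
        outerProduct d (pathIntegral (flowPath T h v x) u)
          (pathIntegral (flowPath T h v x) (u + t) - pathIntegral (flowPath T h v x) u)‖ := by
  set γ := flowPath T h v x with hγd
  rw [← integral_shift_eq hγ]
  refine matrixNorm_eq _ _ fun i j => ?_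
  have hγu : BddMeas fun s => γ (u + s) := hγ.comp (measurable_const_add u)
  have hint := intervalIntegrable_bilin_pathIntegral (B := outerProduct d) hγu 0 0 t
  simp only [sub_zero, pathIntegral] at hint
  have h1 := (EuclideanSpace.proj (i, j) :
    EuclideanSpace ℝ (Fin d × Fin d) →L[ℝ] ℝ).intervalIntegral_comp_comm hint
  refine Eq.trans ?_ h1
  change ∫ s in (0 : ℝ)..t, ∫ r in (0 : ℝ)..s, v (semiflow T h r (x, u)) i *
    v (semiflow T h s (x, u)) j = _
  refine intervalIntegral.integral_congr fun s hs => ?_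
  rw [uIcc_of_le ht] at hs
  change ∫ r in (0 : ℝ)..s, v (semiflow T h r (x, u)) i * v (semiflow T h s (x, u)) j =
    (∫ r in (0 : ℝ)..s, γ (u + r)) i * γ (u + s) j
  rw [intervalIntegral.integral_mul_const, apply_semiflow_eq (v := v) (add_nonneg hu hs.1)]
  congr 1
  have h2 := (EuclideanSpace.proj i : EuclideanSpace ℝ (Fin d) →L[ℝ] ℝ).intervalIntegral_comp_comm (hγu.intervalIntegrable 0 s)
  refine Eq.trans ?_ h2
  refine intervalIntegral.integral_congr fun r hr => ?_
  rw [uIcc_of_le hs.1] at hr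
  change v (semiflow T h r (x, u)) i = γ (u + r) i
  rw [apply_semiflow_eq (v := v) (add_nonneg hu hr.1)]

/-- An orbit started at height u ≤ M runs on the base path up to time at most M + t₁, and N laps of
length at least b cover this. The initial piece of length u costs a few multiples of A M. -/
theorem norm_integrals_le (hb0 : 0 < b) (hb : ∀ x, b ≤ h x) (hM : ∀ x, h x ≤ M)
    (hv : Measurable v) (hA0 : 0 ≤ A) (hA : ∀ p ∈ suspension h, ‖v p‖ ≤ A) {p : Λ × ℝ}
    (hp : p ∈ suspension h) {N : ℕ} {g i t₁ t : ℝ}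
    (hg : ∀ j ≤ N, ‖birkhoffSum T (fibreIntegral h v) j p.1‖ ≤ g)
    (hi : ∀ j ≤ N, ‖iteratedBirkhoffSum (outerProduct d) T (fibreIntegral h v) j p.1‖ ≤ i)
    (hN : M + t₁ ≤ N * b) (ht : t ∈ Icc 0 t₁) :
    ‖singleIntegral T h v t p‖ ≤ g + 2 * (A * M) ∧
      matrixNorm (doubleIntegral T h v t p) ≤ i + 2 * g * (A * M) + (N + 4) * (A * M) ^ 2 := by
  obtain ⟨x, u⟩ := p
  obtain ⟨hu0, huh⟩ := hp
  simp only at hu0 huh hg hi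
  have huM : u ≤ M := huh.le.trans (hM x)
  have hM0 : 0 ≤ M := hu0.trans huM
  have hγ := bddMeas_flowPath (T := T) hb0 hb hv hA0 hA x
  have hγA := norm_flowPath_le (T := T) hb0 hb hA0 hA x
  rw [singleIntegral_eq hγ hu0 ht.1, matrixNorm_doubleIntegral hγ hu0 ht.1]
  obtain ⟨h1, h2⟩ := norm_path_le (T := T) hb0 hb hM hv hA0 hA norm_outerProduct_le x hg hi
    (add_nonneg hu0 ht.1) (by linarith [ht.2])
  have hAu : A * u ≤ A * M := by gcongr
  have h3 := norm_pathIntegral_sub_le hγ hγA 0 u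
  have h4 := norm_iteratedPathIntegral_sub_le (B := outerProduct d) hγ hγA norm_outerProduct_le
    hu0
  have e1 : pathIntegral (flowPath T h v x) 0 = 0 := intervalIntegral.integral_same
  have e2 : iteratedPathIntegral (outerProduct d) (flowPath T h v x) 0 = 0 :=
    intervalIntegral.integral_same
  rw [e1, sub_zero, sub_zero, abs_of_nonneg hu0] at h3
  rw [e1, e2, map_zero, zero_apply, sub_zero, sub_zero, sub_zero] at h4
  have h5 : (A * u) ^ 2 ≤ (A * M) ^ 2 := by gcongr
  have h6 : ‖pathIntegral (flowPath T h v x) (u + t) - pathIntegral (flowPath T h v x) u‖ ≤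
      g + 2 * (A * M) := (norm_sub_le _ _).trans (by linarith)
  refine ⟨h6, ?_⟩
  have h7 : ‖outerProduct d (pathIntegral (flowPath T h v x) u)
      (pathIntegral (flowPath T h v x) (u + t) - pathIntegral (flowPath T h v x) u)‖ ≤
      (A * M) * (g + 2 * (A * M)) := by
    calc _ ≤ ‖outerProduct d‖ * ‖pathIntegral (flowPath T h v x) u‖ * _ :=
          (outerProduct d).le_opNorm₂ _ _
      _ ≤ 1 * (A * M) * (g + 2 * (A * M)) := by
          gcongr
          · exact norm_outerProduct_le
          · exact h3.trans hAu
      _ = _ := by ring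
  refine (norm_sub_le _ _).trans ((add_le_add ((norm_sub_le _ _).trans
    (add_le_add h2 (h4.trans h5))) h7).trans (le_of_eq ?_))
  ring

theorem norm_integrals_le_of_short (hb0 : 0 < b) (hb : ∀ x, b ≤ h x)
    (hv : Measurable v) (hA0 : 0 ≤ A) (hA : ∀ p ∈ suspension h, ‖v p‖ ≤ A) {p : Λ × ℝ}
    (hp : p ∈ suspension h) {t₁ t : ℝ} (ht : t ∈ Icc 0 t₁) :
    ‖singleIntegral T h v t p‖ ≤ A * t₁ ∧
      matrixNorm (doubleIntegral T h v t p) ≤ (A * t₁) ^ 2 := by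
  obtain ⟨x, u⟩ := p
  have hu0 : 0 ≤ u := hp.1
  have hγ := bddMeas_flowPath (T := T) hb0 hb hv hA0 hA x
  have hγA := norm_flowPath_le (T := T) hb0 hb hA0 hA x
  rw [singleIntegral_eq hγ hu0 ht.1, matrixNorm_doubleIntegral hγ hu0 ht.1]
  have h1 := norm_pathIntegral_sub_le hγ hγA u (u + t)
  have h2 := norm_iteratedPathIntegral_sub_le (B := outerProduct d) hγ hγA norm_outerProduct_le
    (le_add_of_nonneg_right ht.1 : u ≤ u + t)
  rw [add_sub_cancel_left, abs_of_nonneg ht.1] at h1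
  rw [add_sub_cancel_left] at h2
  have h3 : A * t ≤ A * t₁ := by gcongr; exact ht.2
  have h4 : 0 ≤ A * t := mul_nonneg hA0 ht.1
  exact ⟨h1.trans h3, h2.trans (by gcongr)⟩

end FlowIntegrals

section SuspensionMeasure

variable {Λ : Type*} [MeasurableSpace Λ] {h : Λ → ℝ} {μ : Measure Λ} [IsProbabilityMeasure μ]
  {b M : ℝ} {E : Type*} [NormedAddCommGroup E] [NormedSpace ℝ E] {v : Λ × ℝ → E} {A : ℝ}

theorem measurableSet_suspension (hh : Measurable h) : MeasurableSet (suspension h) :=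
  (measurableSet_le measurable_const measurable_snd).inter
    (measurableSet_lt measurable_snd (hh.comp measurable_fst))

theorem ae_mem_suspension (hh : Measurable h) :
    ∀ᵐ p ∂(suspensionMeasure μ h), p ∈ suspension h :=
  (Measure.smul_absolutelyContinuous.ae_le : _ ≤ _) (ae_restrict_mem (measurableSet_suspension hh))

theorem le_integral (hh : Measurable h) (hb : ∀ x, b ≤ h x) (hM : ∀ x, h x ≤ M) :
    b ≤ ∫ x, h x ∂μ := by
  have hi : Integrable h μ := Integrable.of_bound (C := max |b| |M|) hh.aestronglyMeasurable
    (Filter.Eventually.of_forall fun x => abs_le_max_abs_abs (hb x) (hM x))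
  calc b = ∫ _, b ∂μ := by simp
    _ ≤ _ := integral_mono (integrable_const b) hi hb

/-- Fibres have length at most M, and the normalising integral is at least b. -/
theorem map_fst_suspensionMeasure_le (hh : Measurable h) (hb0 : 0 < b) (hb : ∀ x, b ≤ h x)
    (hM : ∀ x, h x ≤ M) :
    (suspensionMeasure μ h).map Prod.fst ≤ ENNReal.ofReal (M / b) • μ := by
  refine Measure.le_iff.2 fun s hs => ?_
  have hint := le_integral (μ := μ) hh hb hM
  rw [Measure.map_apply measurable_fst hs, suspensionMeasure, Measure.smul_apply,
    Measure.restrict_apply (measurable_fst hs), Measure.smul_apply, smul_eq_mul, smul_eq_mul]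
  have h1 : (Prod.fst ⁻¹' s ∩ suspension h : Set (Λ × ℝ)) ⊆ s ×ˢ Icc 0 M := fun p hp =>
    ⟨hp.1, hp.2.1, hp.2.2.le.trans (hM _)⟩
  calc (ENNReal.ofReal (∫ x, h x ∂μ))⁻¹ * (μ.prod volume) (Prod.fst ⁻¹' s ∩ suspension h)
      ≤ (ENNReal.ofReal b)⁻¹ * (μ.prod volume) (s ×ˢ Icc 0 M) := by gcongr
    _ = ENNReal.ofReal (M / b) * μ s := by
        rw [Measure.prod_prod, Real.volume_Icc, sub_zero, div_eq_mul_inv,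
          ENNReal.ofReal_mul' (by positivity), ENNReal.ofReal_inv_of_pos hb0]
        ring

theorem eLpNorm_suspension_le (hh : Measurable h) (hb0 : 0 < b) (hb : ∀ x, b ≤ h x)
    (hM : ∀ x, h x ≤ M) {Φ : Λ × ℝ → ℝ≥0∞} {φ : Λ → ℝ} (hφ : Measurable φ)
    (hΦ : ∀ p ∈ suspension h, Φ p ≤ ENNReal.ofReal (φ p.1)) {r c : ℝ} (hr : 1 ≤ r) (hbM : b ≤ M)
    (hc : eLpNorm φ (ENNReal.ofReal r) μ ≤ ENNReal.ofReal c) :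
    eLpNorm Φ (ENNReal.ofReal r) (suspensionMeasure μ h) ≤ ENNReal.ofReal (M / b * c) := by
  have h0 : ENNReal.ofReal (M / b) ≠ 0 := by
    have : 0 < M / b := div_pos (hb0.trans_le hbM) hb0
    simpa using this
  have h1 : 1 ≤ ENNReal.ofReal (M / b) := by
    rw [ENNReal.one_le_ofReal, one_le_div hb0]; exact hbM
  calc eLpNorm Φ (ENNReal.ofReal r) (suspensionMeasure μ h)
      ≤ eLpNorm (fun p : Λ × ℝ => φ p.1) (ENNReal.ofReal r) (suspensionMeasure μ h) := by
        refine eLpNorm_mono_enorm_ae ((ae_mem_suspension hh).mono fun p hp => ?_)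
        exact (hΦ p hp).trans (Real.ofReal_le_enorm _)
    _ = eLpNorm φ (ENNReal.ofReal r) ((suspensionMeasure μ h).map Prod.fst) :=
        (eLpNorm_map_measure hφ.aestronglyMeasurable measurable_fst.aemeasurable).symm
    _ ≤ eLpNorm φ (ENNReal.ofReal r) (ENNReal.ofReal (M / b) • μ) :=
        eLpNorm_mono_measure _ (map_fst_suspensionMeasure_le hh hb0 hb hM)
    _ = ENNReal.ofReal (M / b) ^ (1 / ENNReal.ofReal r).toReal •
          eLpNorm φ (ENNReal.ofReal r) μ := eLpNorm_smul_measure_of_ne_zero h0 _ _ _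
    _ ≤ ENNReal.ofReal (M / b) * ENNReal.ofReal c := by
        rw [smul_eq_mul]
        gcongr
        calc _ ≤ ENNReal.ofReal (M / b) ^ (1 : ℝ) := by
              refine ENNReal.rpow_le_rpow_of_exponent_le h1 ?_
              rw [one_div, ENNReal.toReal_inv, ENNReal.toReal_ofReal (by linarith)]
              exact inv_le_one_of_one_le₀ hr
          _ = _ := ENNReal.rpow_one _
    _ = _ := (ENNReal.ofReal_mul (by
        have := hb0.trans_le hbM
        positivity)).symm

/-- By Fubini the mean of v over the suspension is a positive multiple of the mean of the fibre
integrals. -/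
theorem integral_fibreIntegral [FiniteDimensional ℝ E] [MeasurableSpace E] [BorelSpace E]
    (hh : Measurable h) (hb0 : 0 < b)
    (hb : ∀ x, b ≤ h x) (hM : ∀ x, h x ≤ M) (hv : Measurable v)
    (hA : ∀ p ∈ suspension h, ‖v p‖ ≤ A)
    (h0 : ∫ p, v p ∂(suspensionMeasure μ h) = 0) :
    ∫ x, (∫ u in (0 : ℝ)..h x, v (x, u)) ∂μ = 0 := by
  have hint := le_integral (μ := μ) hh hb hM
  have hms := measurableSet_suspension hh
  have hfin : (μ.prod volume) (suspension h) ≠ ∞ := by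
    refine ne_top_of_le_ne_top (b := (μ.prod volume) (univ ×ˢ Icc 0 M)) ?_
      (measure_mono fun p hp => ⟨mem_univ _, hp.1, hp.2.le.trans (hM _)⟩)
    rw [Measure.prod_prod, Real.volume_Icc]
    exact ENNReal.mul_ne_top (measure_ne_top _ _) ENNReal.ofReal_ne_top
  have hi : IntegrableOn v (suspension h) (μ.prod volume) :=
    IntegrableOn.of_bound hfin.lt_top hv.aestronglyMeasurable A
      ((ae_restrict_mem hms).mono fun p hp => hA p hp)
  rw [suspensionMeasure, integral_smul_measure, smul_eq_zero] at h0
  rcases h0 with h0 | h0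
  · exfalso
    rw [ENNReal.toReal_inv, ENNReal.toReal_ofReal (by linarith), inv_eq_zero] at h0
    linarith
  · rw [← integral_indicator hms, integral_prod _ (hi.integrable_indicator hms)] at h0
    rw [← h0]
    refine integral_congr_ae (Filter.Eventually.of_forall fun x => ?_)
    simp only
    have hx : (fun u => (suspension h).indicator v (x, u)) =
        (Ico 0 (h x)).indicator fun u => v (x, u) := by
      ext u
      by_cases hu : u ∈ Ico 0 (h x)
      · rw [indicator_of_mem hu, indicator_of_mem (show (x, u) ∈ suspension h from hu)]
      · rw [indicator_of_notMem hu, indicator_of_notMem (show (x, u) ∉ suspension h from hu)]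
    rw [hx, integral_indicator measurableSet_Ico, integral_Ico_eq_integral_Ioc,
      intervalIntegral.integral_of_le (by linarith [hb x])]

end SuspensionMeasure

end ExpandingSemiflow

/-! ### Hölder regularity of fibre integrals and moments of the semiflow. -/

namespace ExpandingSemiflow

section FibreIntegral

variable {Λ : Type*} [MetricSpace Λ] [MeasurableSpace Λ] {T : Λ → Λ} {h : Λ → ℝ} {E E' : Type*}
  [NormedAddCommGroup E] [InnerProductSpace ℝ E] [FiniteDimensional ℝ E] [MeasurableSpace E]
  [BorelSpace E] [NormedAddCommGroup E'] [NormedSpace ℝ E'] {v : Λ × ℝ → E} {A b M η : ℝ}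

theorem birkhoffSum_const_smul (σ : ℝ) (w : Λ → E) (n : ℕ) (x : Λ) :
    birkhoffSum T (fun y => σ • w y) n x = σ • birkhoffSum T w n x := by
  simp only [birkhoffSum, Finset.smul_sum]

theorem iteratedBirkhoffSum_const_smul (B : E →L[ℝ] E →L[ℝ] E') (σ : ℝ) (w : Λ → E) (n : ℕ)
    (x : Λ) : iteratedBirkhoffSum B T (fun y => σ • w y) n x =
      σ ^ 2 • iteratedBirkhoffSum B T w n x := by
  simp only [iteratedBirkhoffSum, Finset.smul_sum, birkhoffSum_const_smul, map_smul,
    smul_apply, smul_smul, sq]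

/-- The top endpoint of a fibre is outside the half open fundamental domain, where nothing is
assumed about v; it is discarded as a null set. -/
theorem ae_mem_suspension_of_le {x y : Λ} (hxy : h x ≤ h y) :
    ∀ᵐ u : ℝ, u ∈ Ioc 0 (h x) → (x, u) ∈ suspension h ∧ (y, u) ∈ suspension h := by
  filter_upwards [compl_mem_ae_iff.2 (measure_singleton (h x))] with u hu hm
  have h1 : u < h x := lt_of_le_of_ne hm.2 hu
  exact ⟨⟨hm.1.le, h1⟩, ⟨hm.1.le, h1.trans_le hxy⟩⟩

theorem intervalIntegrable_fibre (hv : Measurable v) (hA : ∀ p ∈ suspension h, ‖v p‖ ≤ A) {x : Λ}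
    {s t : ℝ} (hs : 0 ≤ s) (hst : s ≤ t) (ht : t ≤ h x) :
    IntervalIntegrable (fun u => v (x, u)) volume s t := by
  rw [intervalIntegrable_iff_integrableOn_Ico_of_le hst]
  exact IntegrableOn.of_bound measure_Ico_lt_top
    (hv.comp measurable_prodMk_left).aestronglyMeasurable A
    ((ae_restrict_mem measurableSet_Ico).mono fun u hu =>
      hA (x, u) ⟨hs.trans hu.1, hu.2.trans_le ht⟩)

theorem norm_fibreIntegral_le (hb0 : 0 < b) (hb : ∀ x, b ≤ h x) (hM : ∀ x, h x ≤ M)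
    (hA0 : 0 ≤ A) (hA : ∀ p ∈ suspension h, ‖v p‖ ≤ A) (x : Λ) :
    ‖fibreIntegral h v x‖ ≤ A * M := by
  have hx : 0 ≤ h x := hb0.le.trans (hb x)
  refine (intervalIntegral.norm_integral_le_of_norm_le_const_ae (C := A) ?_).trans ?_
  · filter_upwards [ae_mem_suspension_of_le (le_refl (h x))] with u hu hm
    rw [uIoc_of_le hx] at hm
    exact hA _ (hu hm).1
  · rw [sub_zero, abs_of_nonneg hx]
    exact mul_le_mul_of_nonneg_left (hM x) hA0

/-- Two sources of variation: v changes between the common parts of the fibres, and the fibre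
lengths differ by the Hölder variation of h. Each contributes M A. -/
theorem norm_fibreIntegral_sub_le (hb0 : 0 < b) (hb : ∀ x, b ≤ h x) (hM : ∀ x, h x ≤ M)
    (hh : ∀ x y, |h x - h y| ≤ M * dist x y ^ η) (hv : Measurable v)
    (hA0 : 0 ≤ A) (hA : ∀ p ∈ suspension h, ‖v p‖ ≤ A)
    (hvh : ∀ x y u, (x, u) ∈ suspension h → (y, u) ∈ suspension h →
      ‖v (x, u) - v (y, u)‖ ≤ A * dist x y ^ η) (x y : Λ) :
    ‖fibreIntegral h v x - fibreIntegral h v y‖ ≤ 2 * M * A * dist x y ^ η := by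
  wlog hxy : h x ≤ h y generalizing x y
  · rw [norm_sub_rev, dist_comm]; exact this y x (le_of_not_ge hxy)
  have hx : 0 ≤ h x := hb0.le.trans (hb x)
  have hd : 0 ≤ dist x y ^ η := Real.rpow_nonneg dist_nonneg _
  have i1 := intervalIntegrable_fibre hv hA (x := x) le_rfl hx le_rfl
  have i2 := intervalIntegrable_fibre hv hA (x := y) le_rfl hx hxy
  have i3 := intervalIntegrable_fibre hv hA (x := y) hx hxy le_rfl
  have e : fibreIntegral h v x - fibreIntegral h v y =
      (∫ u in (0 : ℝ)..h x, (v (x, u) - v (y, u))) - ∫ u in h x..h y, v (y, u) := by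
    rw [intervalIntegral.integral_sub i1 i2, fibreIntegral, fibreIntegral,
      ← intervalIntegral.integral_add_adjacent_intervals i2 i3]
    abel
  have b1 : ‖∫ u in (0 : ℝ)..h x, (v (x, u) - v (y, u))‖ ≤ A * dist x y ^ η * |h x - 0| := by
    refine intervalIntegral.norm_integral_le_of_norm_le_const_ae ?_
    filter_upwards [ae_mem_suspension_of_le hxy] with u hu hm
    rw [uIoc_of_le hx] at hm
    exact hvh x y u (hu hm).1 (hu hm).2
  have b2 : ‖∫ u in h x..h y, v (y, u)‖ ≤ A * |h y - h x| := by
    refine intervalIntegral.norm_integral_le_of_norm_le_const_ae ?_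
    filter_upwards [ae_mem_suspension_of_le (le_refl (h y))] with u hu hm
    rw [uIoc_of_le hxy] at hm
    exact hA _ (hu ⟨hx.trans_lt hm.1, hm.2⟩).1
  rw [sub_zero, abs_of_nonneg hx] at b1
  rw [abs_sub_comm] at b2
  rw [e]
  refine (norm_sub_le _ _).trans ((add_le_add (b1.trans (mul_le_mul_of_nonneg_left (hM x)
    (mul_nonneg hA0 hd))) (b2.trans (mul_le_mul_of_nonneg_left (hh x y) hA0))).trans
    (le_of_eq ?_))
  ring

/-- A function with a Hölder bound is continuous. -/
theorem continuous_of_norm_sub_le {f : Λ → E} {K : ℝ} (hη : 0 < η)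
    (hf : ∀ x y, ‖f x - f y‖ ≤ K * dist x y ^ η) : Continuous f := by
  rw [continuous_iff_continuousAt]
  intro x
  rw [ContinuousAt, tendsto_iff_norm_sub_tendsto_zero]
  have h1 : Filter.Tendsto (fun y => K * dist y x ^ η) (nhds x) (nhds (K * dist x x ^ η)) := by
    have : Continuous fun y => K * dist y x ^ η :=
      continuous_const.mul ((continuous_id.dist continuous_const).rpow_const
        fun _ => Or.inr hη.le)
    exact this.tendsto x
  rw [dist_self, Real.zero_rpow hη.ne', mul_zero] at h1
  exact squeeze_zero (fun _ => norm_nonneg _) (fun y => hf y x) h1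

end FibreIntegral

section FlowMoments

variable {Λ : Type*} [MetricSpace Λ] [MeasurableSpace Λ] [BorelSpace Λ]
  {T : Λ → Λ} {ρ : Measure Λ} {Y : Set Λ} {α : Set (Set Λ)} {τ : Λ → ℕ} {C₁ β η : ℝ}
  {μY : Measure Λ} {h : Λ → ℝ} {d : ℕ} {v : Λ × ℝ → EuclideanSpace ℝ (Fin d)}
  {q Q R D A b M t₁ : ℝ}

/-- The constant in the moment bounds for suspension semiflows, in terms of the constant `K` for
the base map and of bounds `b ≤ h ≤ M` on the roof function. -/
noncomputable def flowConst (K b M : ℝ) : ℝ :=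
  M / b * (4 * M ^ 2 * (2 * K * ((M + 1) / b + 1) + ((M + 1) / b + 1) + 4) +
    2 * M * (K * ((M + 1) / b + 1) + 1) + 1)

theorem IsNonuniformlyExpanding.isProbabilityMeasure_baseMeasure
    (H : IsNonuniformlyExpanding T ρ Y α τ C₁ β η) (hμ : IsInducedMeasure T ρ Y τ μY)
    (hτ : Measurable τ) (hτ1 : ∀ x, 1 ≤ τ x) (hD1 : 1 ≤ D) (hD : ∀ x y : Λ, dist x y ≤ D)
    (hq : 1 ≤ q) (hR : 1 ≤ R)
    (hRτ : ∫⁻ y, ENNReal.ofReal ((τ y : ℝ) ^ (q + 1)) ∂μY ≤ ENNReal.ofReal R) :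
    IsProbabilityMeasure (baseMeasure T Y τ μY) := by
  -- The zero observable with N = 1 is used just to extract the tower structure.
  obtain ⟨S, -⟩ := H.exists_tower_decomposition hμ hτ hτ1 hD1 hD hq hR hRτ
    (v := fun _ => (0 : ℝ)) (N := 1) measurable_const (by simp)
    (fun x y => by simpa using Real.rpow_nonneg dist_nonneg _) (by simp) le_rfl
  have := S.isProbabilityMeasure_tower
  exact Measure.isProbabilityMeasure_map S.measurable_towerProj.aemeasurable

theorem IsNonuniformlyExpanding.flow_moments_of_one_le
    (H : IsNonuniformlyExpanding T ρ Y α τ C₁ β η) (hμ : IsInducedMeasure T ρ Y τ μY)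
    (hτ : Measurable τ) (hτ1 : ∀ x, 1 ≤ τ x) (hD1 : 1 ≤ D) (hD : ∀ x y : Λ, dist x y ≤ D)
    (hq : 1 ≤ q) (hqQ : q ≤ Q) (hR : 1 ≤ R)
    (hRτ : ∫⁻ y, ENNReal.ofReal ((τ y : ℝ) ^ (q + 1)) ∂μY ≤ ENNReal.ofReal R)
    (hb0 : 0 < b) (hb : ∀ x, b ≤ h x) (hM : ∀ x, h x ≤ M) (hbM : b ≤ M)
    (hh : ∀ x y, |h x - h y| ≤ M * dist x y ^ η) (hv : Measurable v) (hA0 : 0 < A)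
    (hA : ∀ p ∈ suspension h, ‖v p‖ ≤ A)
    (hvh : ∀ x y u, (x, u) ∈ suspension h → (y, u) ∈ suspension h →
      ‖v (x, u) - v (y, u)‖ ≤ A * dist x y ^ η)
    (hv0 : ∫ p, v p ∂(suspensionMeasure (baseMeasure T Y τ μY) h) = 0) (ht₁ : 1 ≤ t₁) :
    eLpNorm (fun p => ⨆ t ∈ Icc (0 : ℝ) t₁, ‖singleIntegral T h v t p‖ₑ)
        (ENNReal.ofReal (2 * q)) (suspensionMeasure (baseMeasure T Y τ μY) h) ≤
      ENNReal.ofReal (M / b * (2 * M * (|baseConst C₁ β η D R Q| * ((M + 1) / b + 1) + 1)) *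
        Real.sqrt t₁ * A) ∧
    eLpNorm (fun p => ⨆ t ∈ Icc (0 : ℝ) t₁,
        ENNReal.ofReal (matrixNorm (doubleIntegral T h v t p)))
        (ENNReal.ofReal q) (suspensionMeasure (baseMeasure T Y τ μY) h) ≤
      ENNReal.ofReal (M / b * (4 * M ^ 2 * (2 * |baseConst C₁ β η D R Q| * ((M + 1) / b + 1) +
        ((M + 1) / b + 1) + 4)) * t₁ * A ^ 2) := by
  have hprob := H.isProbabilityMeasure_baseMeasure hμ hτ hτ1 hD1 hD hq hR hRτ
  set μ := baseMeasure T Y τ μY with hμd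
  set K := |baseConst C₁ β η D R Q| with hK
  have hK0 : 0 ≤ K := abs_nonneg _
  set κ := (M + 1) / b + 1 with hκ
  have hM0 : 0 < M := hb0.trans_le hbM
  have hκ1 : 1 ≤ κ := by
    have : 0 < (M + 1) / b := by positivity
    linarith
  -- The normalisation that makes both the sup norm and the Hölder constant of the fibre integrals
  -- at most 1.
  set σ := 2 * M * A with hσd
  have hσ : 0 < σ := by positivity
  -- Enough laps to cover time t₁ from any height. Because t₁ ≥ 1, the number N is at most a
  -- constant times t₁.
  set N := ⌈(M + t₁) / b⌉₊ with hNd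
  have hNle : (M + t₁) / b ≤ N := Nat.le_ceil _
  have hN : 1 ≤ N := Nat.one_le_ceil_iff.2 (by positivity)
  have hNb : M + t₁ ≤ N * b := (div_le_iff₀ hb0).1 hNle
  have hNκ : (N : ℝ) ≤ κ * t₁ := by
    have h1 : (N : ℝ) < (M + t₁) / b + 1 := Nat.ceil_lt_add_one (by positivity)
    have h2 : (M + t₁) / b ≤ (M + 1) / b * t₁ := by
      rw [div_mul_eq_mul_div]
      gcongr
      nlinarith
    rw [hκ]; nlinarith
  have hN1 : (1 : ℝ) ≤ N := by exact_mod_cast hN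
  have hsN : Real.sqrt N ≤ κ * Real.sqrt t₁ := by
    calc Real.sqrt N ≤ Real.sqrt (κ * t₁) := Real.sqrt_le_sqrt hNκ
      _ = Real.sqrt κ * Real.sqrt t₁ := Real.sqrt_mul (by linarith) _
      _ ≤ κ * Real.sqrt t₁ := by
          gcongr
          exact Real.sqrt_le_iff.2 ⟨by linarith, by nlinarith⟩
  have hst1 : 1 ≤ Real.sqrt t₁ := Real.one_le_sqrt.2 ht₁
  have hsNN : Real.sqrt N ≤ N := Real.sqrt_le_iff.2 ⟨by linarith, by nlinarith⟩
  have hhm : Measurable h := (continuous_of_norm_sub_le H.η_pos hh).measurable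
  have hfh := norm_fibreIntegral_sub_le hb0 hb hM hh hv hA0.le hA hvh
  have hfm : Measurable (fibreIntegral h v) := (continuous_of_norm_sub_le H.η_pos hfh).measurable
  set w : Λ → EuclideanSpace ℝ (Fin d) := fun x => σ⁻¹ • fibreIntegral h v x with hw
  have hfw : fibreIntegral h v = fun x => σ • w x := by
    ext1 x; rw [hw]; simp only; rw [smul_inv_smul₀ hσ.ne']
  have hAM : 0 < A * M := mul_pos hA0 hM0
  obtain ⟨G, I, hG, hI, hGb, hIb, hGn, hIn⟩ := H.exists_majorants hμ hτ hτ1 hD1 hD hq hqQ hR hRτ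
    (v := w) (hfm.const_smul σ⁻¹)
    (fun x => by
      rw [hw]; simp only
      rw [norm_smul, norm_inv, Real.norm_of_nonneg hσ.le, inv_mul_le_iff₀ hσ, mul_one]
      refine (norm_fibreIntegral_le hb0 hb hM hA0.le hA x).trans ?_
      rw [hσd]; nlinarith)
    (fun x y => by
      rw [hw]; simp only
      rw [← smul_sub, norm_smul, norm_inv, Real.norm_of_nonneg hσ.le, inv_mul_le_iff₀ hσ]
      exact hfh x y)
    (by
      rw [hw, integral_smul]
      have := integral_fibreIntegral (μ := μ) hhm hb0 hb hM hv hA hv0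
      rw [show ∫ x, fibreIntegral h v x ∂μ = 0 from this, smul_zero])
    hN (outerProduct d) norm_outerProduct_le
  replace hGn : eLpNorm G (ENNReal.ofReal (2 * q)) μ ≤ ENNReal.ofReal (K * Real.sqrt N) :=
    hGn.trans (ENNReal.ofReal_le_ofReal (by gcongr; exact le_abs_self _))
  replace hIn : eLpNorm I (ENNReal.ofReal q) μ ≤ ENNReal.ofReal (K * N) :=
    hIn.trans (ENNReal.ofReal_le_ofReal (by gcongr; exact le_abs_self _))
  have hq1 : 1 ≤ ENNReal.ofReal q := ENNReal.one_le_ofReal.2 hq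
  have h2q1 : 1 ≤ ENNReal.ofReal (2 * q) := ENNReal.one_le_ofReal.2 (by linarith)
  have hGq : eLpNorm G (ENNReal.ofReal q) μ ≤ ENNReal.ofReal (K * N) :=
    (eLpNorm_le_eLpNorm_of_exponent_le (ENNReal.ofReal_le_ofReal (by linarith))
      hG.aestronglyMeasurable).trans (hGn.trans (ENNReal.ofReal_le_ofReal (by gcongr)))
  have hbound : ∀ p ∈ suspension h, ∀ t ∈ Icc 0 t₁,
      ‖singleIntegral T h v t p‖ ≤ σ * (G p.1 + 1) ∧
        matrixNorm (doubleIntegral T h v t p) ≤ σ ^ 2 * (I p.1 + (G p.1 + (N + 4))) := by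
    intro p hp t ht
    obtain ⟨h1, h2⟩ := norm_integrals_le (T := T) hb0 hb hM hv hA0.le hA hp
      (g := σ * G p.1) (i := σ ^ 2 * I p.1)
      (fun j hj => by
        rw [hfw, birkhoffSum_const_smul, norm_smul, Real.norm_of_nonneg hσ.le]
        gcongr; exact hGb j hj _)
      (fun j hj => by
        rw [hfw, iteratedBirkhoffSum_const_smul, norm_smul, Real.norm_of_nonneg (by positivity)]
        gcongr; exact hIb j hj _) hNb ht
    refine ⟨h1.trans (le_of_eq (by rw [hσd]; ring)), h2.trans ?_⟩
    have h3 : σ ^ 2 * I p.1 + 2 * (σ * G p.1) * (A * M) + (N + 4) * (A * M) ^ 2 =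
      σ ^ 2 * (I p.1 + (G p.1 + (N + 4))) - 3 * ((N + 4) * (A * M) ^ 2) := by rw [hσd]; ring
    rw [h3]
    have : 0 ≤ ((N : ℝ) + 4) * (A * M) ^ 2 := by positivity
    linarith
  have hadd : ∀ {f g : Λ → ℝ} {r : ℝ≥0∞} {a c : ℝ}, Measurable f → Measurable g → 1 ≤ r → 0 ≤ a →
      0 ≤ c → eLpNorm f r μ ≤ ENNReal.ofReal a → eLpNorm g r μ ≤ ENNReal.ofReal c →
      eLpNorm (fun x => f x + g x) r μ ≤ ENNReal.ofReal (a + c) :=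
    fun hf hg hr ha hc h1 h2 => by
      rw [ENNReal.ofReal_add ha hc]
      exact (eLpNorm_add_le hf.aestronglyMeasurable hg.aestronglyMeasurable hr).trans
        (add_le_add h1 h2)
  constructor
  · refine (eLpNorm_suspension_le hhm hb0 hb hM (φ := fun x => σ * (G x + 1))
      ((hG.add_const _).const_mul _)
      (fun p hp => iSup₂_le fun t ht => ?_) (by linarith) hbM
      (eLpNorm_const_mul_le_ofReal hσ.le (hadd hG measurable_const h2q1 (by positivity) zero_le_one
        hGn (eLpNorm_const_le_ofReal zero_le_one)))).trans (ENNReal.ofReal_le_ofReal ?_)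
    · rw [← ofReal_norm]
      exact ENNReal.ofReal_le_ofReal (hbound p hp t ht).1
    · have h1 : K * Real.sqrt N + 1 ≤ (K * κ + 1) * Real.sqrt t₁ := by
        nlinarith [mul_le_mul_of_nonneg_left hsN hK0]
      calc M / b * (σ * (K * Real.sqrt N + 1)) ≤ M / b * (σ * ((K * κ + 1) * Real.sqrt t₁)) := by
            gcongr
        _ = _ := by rw [hσd]; ring
  · refine (eLpNorm_suspension_le hhm hb0 hb hM
      (φ := fun x => σ ^ 2 * (I x + (G x + (N + 4))))
      ((hI.add (hG.add_const _)).const_mul _)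
      (fun p hp => iSup₂_le fun t ht => ?_) hq hbM
      (eLpNorm_const_mul_le_ofReal (by positivity) (hadd hI (hG.add_const _) hq1 (by positivity)
        (by positivity) hIn (hadd hG measurable_const hq1 (by positivity) (by positivity) hGq
          (eLpNorm_const_le_ofReal (by positivity)))))).trans (ENNReal.ofReal_le_ofReal ?_)
    · exact ENNReal.ofReal_le_ofReal (hbound p hp t ht).2
    · have h1 : K * N + (K * N + (N + 4)) ≤ (2 * K * κ + κ + 4) * t₁ := by
        nlinarith [mul_le_mul_of_nonneg_left hNκ hK0]
      calc M / b * (σ ^ 2 * (K * N + (K * N + (N + 4)))) ≤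
            M / b * (σ ^ 2 * ((2 * K * κ + κ + 4) * t₁)) := by gcongr
        _ = _ := by rw [hσd]; ring

/-- For t₁ ≤ 1 the trivial bounds A t₁ and (A t₁)² are below the claimed orders √t₁ and t₁; the
summand 1 in `flowConst` is there for this case. -/
theorem IsNonuniformlyExpanding.flow_moments
    (H : IsNonuniformlyExpanding T ρ Y α τ C₁ β η) (hμ : IsInducedMeasure T ρ Y τ μY)
    (hτ : Measurable τ) (hτ1 : ∀ x, 1 ≤ τ x) (hD1 : 1 ≤ D) (hD : ∀ x y : Λ, dist x y ≤ D)
    (hq : 1 ≤ q) (hqQ : q ≤ Q) (hR : 1 ≤ R)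
    (hRτ : ∫⁻ y, ENNReal.ofReal ((τ y : ℝ) ^ (q + 1)) ∂μY ≤ ENNReal.ofReal R)
    (hb0 : 0 < b) (hb : ∀ x, b ≤ h x) (hM : ∀ x, h x ≤ M) (hbM : b ≤ M)
    (hh : ∀ x y, |h x - h y| ≤ M * dist x y ^ η) (hv : Measurable v) (hA0 : 0 < A)
    (hA : ∀ p ∈ suspension h, ‖v p‖ ≤ A)
    (hvh : ∀ x y u, (x, u) ∈ suspension h → (y, u) ∈ suspension h →
      ‖v (x, u) - v (y, u)‖ ≤ A * dist x y ^ η)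
    (hv0 : ∫ p, v p ∂(suspensionMeasure (baseMeasure T Y τ μY) h) = 0) (ht₁ : 0 ≤ t₁) :
    eLpNorm (fun p => ⨆ t ∈ Icc (0 : ℝ) t₁, ‖singleIntegral T h v t p‖ₑ)
        (ENNReal.ofReal (2 * q)) (suspensionMeasure (baseMeasure T Y τ μY) h) ≤
      ENNReal.ofReal (flowConst |baseConst C₁ β η D R Q| b M * Real.sqrt t₁ * A) ∧
    eLpNorm (fun p => ⨆ t ∈ Icc (0 : ℝ) t₁,
        ENNReal.ofReal (matrixNorm (doubleIntegral T h v t p)))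
        (ENNReal.ofReal q) (suspensionMeasure (baseMeasure T Y τ μY) h) ≤
      ENNReal.ofReal (flowConst |baseConst C₁ β η D R Q| b M * t₁ * A ^ 2) := by
  have hM0 : 0 < M := hb0.trans_le hbM
  have hK0 : 0 ≤ |baseConst C₁ β η D R Q| := abs_nonneg _
  set K := |baseConst C₁ β η D R Q|
  have hκ : 0 < (M + 1) / b + 1 := by positivity
  set κ := (M + 1) / b + 1 with hκd
  have p1 : 0 ≤ 4 * M ^ 2 * (2 * K * κ + κ + 4) := by positivity
  have p2 : 0 ≤ 2 * M * (K * κ + 1) := by positivity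
  rcases le_total 1 t₁ with h1 | h1
  · obtain ⟨r1, r2⟩ := H.flow_moments_of_one_le hμ hτ hτ1 hD1 hD hq hqQ hR hRτ hb0 hb hM hbM hh hv
      hA0 hA hvh hv0 h1
    refine ⟨r1.trans (ENNReal.ofReal_le_ofReal ?_), r2.trans (ENNReal.ofReal_le_ofReal ?_)⟩
    · rw [flowConst]
      gcongr
      linarith
    · rw [flowConst]
      gcongr
      linarith
  · have hprob := H.isProbabilityMeasure_baseMeasure hμ hτ hτ1 hD1 hD hq hR hRτ
    have hhm : Measurable h := (continuous_of_norm_sub_le H.η_pos hh).measurable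
    have hb' := fun p hp t ht => norm_integrals_le_of_short (T := T) hb0 hb hv hA0.le hA
      (p := p) hp (t₁ := t₁) (t := t) ht
    have hC : M / b * 1 ≤ flowConst K b M := by
      rw [flowConst]
      gcongr
      linarith
    have hC0 : 0 ≤ M / b * 1 := by positivity
    constructor
    · refine (eLpNorm_suspension_le hhm hb0 hb hM (φ := fun x => A * t₁) measurable_const
        (fun p hp => iSup₂_le fun t ht => ?_) (by linarith) hbM
        (eLpNorm_const_le_ofReal (by positivity))).trans (ENNReal.ofReal_le_ofReal ?_)
      · rw [← ofReal_norm]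
        exact ENNReal.ofReal_le_ofReal (hb' p hp t ht).1
      · have h2 : t₁ ≤ Real.sqrt t₁ := Real.le_sqrt_of_sq_le (by nlinarith)
        calc M / b * (A * t₁) = M / b * 1 * t₁ * A := by ring
          _ ≤ _ := by gcongr; exact hC0.trans hC
    · refine (eLpNorm_suspension_le hhm hb0 hb hM (φ := fun x => (A * t₁) ^ 2) measurable_const
        (fun p hp => iSup₂_le fun t ht => ?_) hq hbM
        (eLpNorm_const_le_ofReal (by positivity))).trans (ENNReal.ofReal_le_ofReal ?_)
      · exact ENNReal.ofReal_le_ofReal (hb' p hp t ht).2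
      · have h2 : t₁ ^ 2 ≤ t₁ := by nlinarith
        calc M / b * (A * t₁) ^ 2 = M / b * 1 * t₁ ^ 2 * A ^ 2 := by ring
          _ ≤ _ := by gcongr; exact hC0.trans hC

end FlowMoments

end ExpandingSemiflow

/-! ### From extended norms to pointwise bounds. -/

namespace ExpandingSemiflow

section Norms

variable {Λ : Type*} [MetricSpace Λ] {h : Λ → ℝ} {d : ℕ} {v : Λ × ℝ → EuclideanSpace ℝ (Fin d)}
  {η η' D : ℝ}

theorem dist_rpow_le (hD1 : 1 ≤ D) (hD : ∀ x y : Λ, dist x y ≤ D) (hη0 : 0 < η') (hη : η' ≤ η)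
    (hη1 : η ≤ 1) (x y : Λ) : dist x y ^ η ≤ D * dist x y ^ η' := by
  rcases (dist_nonneg (x := x) (y := y)).eq_or_lt with h0 | h0
  · rw [← h0, Real.zero_rpow (by linarith), Real.zero_rpow hη0.ne', mul_zero]
  · rw [← sub_add_cancel η η', Real.rpow_add h0]
    gcongr
    calc dist x y ^ (η - η') ≤ D ^ (η - η') :=
          Real.rpow_le_rpow h0.le (hD x y) (by linarith)
      _ ≤ D ^ (1 : ℝ) := Real.rpow_le_rpow_of_exponent_le hD1 (by linarith)
      _ = D := Real.rpow_one D

theorem norm_le_of_enorm_div_le {E : Type*} [NormedAddCommGroup E] {z : E} {x y : Λ} {L : ℝ≥0∞}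
    (hη : 0 < η) (hL : L ≠ ⊤) (hxy : x ≠ y) (hz : ‖z‖ₑ / edist x y ^ η ≤ L) :
    ‖z‖ ≤ L.toReal * dist x y ^ η := by
  have h0 : edist x y ^ η ≠ 0 := by
    rw [Ne, ENNReal.rpow_eq_zero_iff_of_pos hη]
    exact (edist_pos.2 hxy).ne'
  have h1 : edist x y ^ η ≠ ⊤ := ENNReal.rpow_ne_top_of_nonneg hη.le (edist_ne_top _ _)
  rw [ENNReal.div_le_iff h0 h1] at hz
  have h2 := ENNReal.toReal_mono (ENNReal.mul_ne_top hL h1) hz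
  rwa [toReal_enorm, ENNReal.toReal_mul, ← ENNReal.toReal_rpow, ← dist_edist] at h2

theorem abs_le_holderNorm (hh : holderNorm η h ≠ ⊤) (x : Λ) :
    |h x| ≤ (holderNorm η h).toReal := by
  have h1 : ‖h x‖ₑ ≤ holderNorm η h := (le_iSup (fun x => ‖h x‖ₑ) x).trans le_self_add
  have h2 := ENNReal.toReal_mono hh h1
  rwa [toReal_enorm, Real.norm_eq_abs] at h2

theorem abs_sub_le_holderNorm (hη : 0 < η) (hh : holderNorm η h ≠ ⊤) (x y : Λ) :
    |h x - h y| ≤ (holderNorm η h).toReal * dist x y ^ η := by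
  by_cases hxy : x = y
  · subst hxy; simpa using mul_nonneg ENNReal.toReal_nonneg (Real.rpow_nonneg le_rfl _)
  · refine norm_le_of_enorm_div_le (z := h x - h y) hη hh hxy (le_trans ?_ le_add_self)
    exact le_iSup₂_of_le x y (le_iSup_of_le hxy le_rfl)

theorem norm_le_flowHolderNorm (hv : flowHolderNorm h η v ≠ ⊤) {p : Λ × ℝ}
    (hp : p ∈ suspension h) : ‖v p‖ ≤ (flowHolderNorm h η v).toReal := by
  have h1 : ‖v p‖ₑ ≤ flowHolderNorm h η v :=
    (le_iSup₂ (f := fun p (_ : p ∈ suspension h) => ‖v p‖ₑ) p hp).trans le_self_add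
  have h2 := ENNReal.toReal_mono hv h1
  rwa [toReal_enorm] at h2

theorem norm_sub_le_flowHolderNorm (hη : 0 < η) (hv : flowHolderNorm h η v ≠ ⊤) {x y : Λ} {u : ℝ}
    (hx : (x, u) ∈ suspension h) (hy : (y, u) ∈ suspension h) :
    ‖v (x, u) - v (y, u)‖ ≤ (flowHolderNorm h η v).toReal * dist x y ^ η := by
  by_cases hxy : x = y
  · subst hxy; simpa using mul_nonneg ENNReal.toReal_nonneg (Real.rpow_nonneg le_rfl _)
  · refine norm_le_of_enorm_div_le hη hv hxy (le_trans ?_ le_add_self)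
    exact le_iSup₂_of_le x y (le_iSup₂_of_le u hx (le_iSup₂_of_le hy hxy le_rfl))

end Norms

theorem flowConst_nonneg {K b M : ℝ} (hK : 0 ≤ K) (hb : 0 < b) (hM : 0 < M) :
    0 ≤ flowConst K b M := by
  unfold flowConst; positivity

/-! ### Bounds uniform over nearby data. -/

section UniformBound

variable {Λ : Type*} [MetricSpace Λ] [MeasurableSpace Λ] [BorelSpace Λ]
  {T : Λ → Λ} {ρ : Measure Λ} {Y : Set Λ} {α : Set (Set Λ)} {τ : Λ → ℕ} {C₁ β η p : ℝ}
  {μY : Measure Λ} {h : Λ → ℝ} {d : ℕ} {v : Λ × ℝ → EuclideanSpace ℝ (Fin d)}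
  {D C₁' β' η' P R M b t₁ : ℝ}

theorem baseMeasure_extendedTime (hY : MeasurableSet Y) :
    baseMeasure T Y (extendedTime Y τ) μY = baseMeasure T Y τ μY := by
  unfold baseMeasure
  rw [towerMeasure_extendedTime hY]

theorem lintegral_extendedTime_rpow_le (hY : MeasurableSet Y) (hμ : IsInducedMeasure T ρ Y τ μY)
    (hp : 0 < p) (hpP : p ≤ P) (hτ : eLpNorm (fun y => (τ y : ℝ)) (ENNReal.ofReal p) μY ≠ ⊤)
    (hR : (eLpNorm (fun y => (τ y : ℝ)) (ENNReal.ofReal p) μY).toReal ≤ R) (hR1 : 1 ≤ R) :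
    ∫⁻ y, ENNReal.ofReal ((extendedTime Y τ y : ℝ) ^ p) ∂μY ≤ ENNReal.ofReal (R ^ P) := by
  have h1 : ∫⁻ y, ENNReal.ofReal ((extendedTime Y τ y : ℝ) ^ p) ∂μY =
      ∫⁻ y, ‖(τ y : ℝ)‖ₑ ^ p ∂μY := by
    refine lintegral_congr_ae ((hμ.ae_mem hY).mono fun y hy => ?_)
    simp only
    rw [extendedTime_of_mem hy, Real.enorm_of_nonneg (Nat.cast_nonneg _),
      ENNReal.ofReal_rpow_of_nonneg (Nat.cast_nonneg _) hp.le]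
  have h2 := eLpNorm_eq_lintegral_rpow_enorm_toReal (f := fun y => (τ y : ℝ)) (μ := μY)
    (p := ENNReal.ofReal p) (by simpa using hp) ENNReal.ofReal_ne_top
  rw [ENNReal.toReal_ofReal hp.le] at h2
  have h3 : ∫⁻ y, ‖(τ y : ℝ)‖ₑ ^ p ∂μY =
      eLpNorm (fun y => (τ y : ℝ)) (ENNReal.ofReal p) μY ^ p := by
    rw [h2, ← ENNReal.rpow_mul, one_div, inv_mul_cancel₀ hp.ne', ENNReal.rpow_one]
  rw [h1, h3]
  calc _ ≤ ENNReal.ofReal R ^ p := by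
        gcongr
        exact (ENNReal.le_ofReal_iff_toReal_le hτ (by linarith)).2 hR
    _ = ENNReal.ofReal (R ^ p) := ENNReal.ofReal_rpow_of_nonneg (by linarith) hp.le
    _ ≤ _ := ENNReal.ofReal_le_ofReal (Real.rpow_le_rpow_of_exponent_le hR1 hpP)

/-- Needed to place the actual data in the domain, where the component for |τ|_p is at least 1. -/
theorem one_le_eLpNorm_returnTime (H : IsNonuniformlyExpanding T ρ Y α τ C₁ β η)
    (hμ : IsInducedMeasure T ρ Y τ μY) (hp : 0 < p) :
    1 ≤ eLpNorm (fun y => (τ y : ℝ)) (ENNReal.ofReal p) μY := by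
  have := hμ.isProbabilityMeasure
  have h1 : eLpNorm (fun _ : Λ => (1 : ℝ)) (ENNReal.ofReal p) μY = 1 := by
    rw [eLpNorm_const _ (by simpa using hp) (IsProbabilityMeasure.ne_zero _)]
    simp
  rw [← h1]
  refine eLpNorm_mono_ae ((hμ.ae_mem H.measurableSet_Y).mono fun y hy => ?_)
  have := H.one_le_τ y hy
  simpa using this

theorem IsNonuniformlyExpanding.nonempty (H : IsNonuniformlyExpanding T ρ Y α τ C₁ β η) :
    Nonempty Λ := (nonempty_of_measure_ne_zero H.measure_Y_pos.ne').to_type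

theorem le_of_le_iInf (hh : holderNorm η h ≠ ⊤) (hb : b ≤ ⨅ x, h x) (x : Λ) : b ≤ h x :=
  hb.trans (ciInf_le ⟨-(holderNorm η h).toReal, by
    rintro _ ⟨x, rfl⟩; exact neg_le_of_abs_le (abs_le_holderNorm hh x)⟩ x)

/-- The moment bounds with a constant that is uniform over boxes of data. -/
theorem IsNonuniformlyExpanding.flow_moments_uniform
    (H : IsNonuniformlyExpanding T ρ Y α τ C₁ β η) (hμ : IsInducedMeasure T ρ Y τ μY)
    (hp : 2 ≤ p) (hpP : p ≤ P) (hD1 : 1 ≤ D) (hD : Metric.diam (univ : Set Λ) ≤ D)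
    (hC : C₁ * D ≤ C₁') (hβ1 : 1 < β') (hβ : β' ≤ β) (hη0 : 0 < η') (hη : η' ≤ η)
    (hτ : eLpNorm (fun y => (τ y : ℝ)) (ENNReal.ofReal p) μY ≠ ⊤)
    (hR : (eLpNorm (fun y => (τ y : ℝ)) (ENNReal.ofReal p) μY).toReal ≤ R) (hR1 : 1 ≤ R)
    (hh : holderNorm η h ≠ ⊤) (hM : (holderNorm η h).toReal ≤ M) (hb0 : 0 < b)
    (hb : b ≤ ⨅ x, h x) (hv : Measurable v) (hvh : flowHolderNorm h η v ≠ ⊤)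
    (hv0 : ∫ q, v q ∂(suspensionMeasure (baseMeasure T Y τ μY) h) = 0) (ht₁ : 0 ≤ t₁) :
    eLpNorm (fun q => ⨆ t ∈ Icc (0 : ℝ) t₁, ‖singleIntegral T h v t q‖ₑ)
        (ENNReal.ofReal (2 * (p - 1))) (suspensionMeasure (baseMeasure T Y τ μY) h) ≤
      ENNReal.ofReal (flowConst |baseConst C₁' β' η' D (R ^ P) (P - 1)| b (M * D) * D ^ 2 *
        t₁ ^ (1 / 2 : ℝ)) * flowHolderNorm h η v ∧
    eLpNorm (fun q => ⨆ t ∈ Icc (0 : ℝ) t₁,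
        ENNReal.ofReal (matrixNorm (doubleIntegral T h v t q)))
        (ENNReal.ofReal (p - 1)) (suspensionMeasure (baseMeasure T Y τ μY) h) ≤
      ENNReal.ofReal (flowConst |baseConst C₁' β' η' D (R ^ P) (P - 1)| b (M * D) * D ^ 2 *
        t₁) * flowHolderNorm h η v ^ 2 := by
  have hY := H.measurableSet_Y
  have hdist : ∀ x y : Λ, dist x y ≤ D := fun x y =>
    (Metric.dist_le_diam_of_mem H.bounded (mem_univ _) (mem_univ _)).trans hD
  obtain ⟨x₀⟩ := H.nonempty
  have hbh := le_of_le_iInf hh hb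
  have hhM : ∀ x, h x ≤ M := fun x => (le_abs_self _).trans ((abs_le_holderNorm hh x).trans hM)
  have hM0 : 0 < M := hb0.trans_le ((hbh x₀).trans (hhM x₀))
  have hMD : M ≤ M * D := le_mul_of_one_le_right hM0.le hD1
  have hF := flowConst_nonneg (abs_nonneg (baseConst C₁' β' η' D (R ^ P) (P - 1))) hb0
    (hM0.trans_le hMD)
  set F := flowConst |baseConst C₁' β' η' D (R ^ P) (P - 1)| b (M * D)
  set A := (flowHolderNorm h η v).toReal with hAd
  have hA0 : 0 ≤ A := ENNReal.toReal_nonneg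
  have hD0 : 0 < D := by linarith
  -- The previous bounds need a strictly positive bound on v, so ‖v‖ + ε is used and ε tends to 0
  -- afterwards. The factors D pay for lowering the Hölder exponent from η to η'. Replacing the
  -- return time by 1 off Y makes it measurable everywhere and changes none of the measures.
  have key := fun (ε : ℝ) (hε : 0 < ε) =>
    (H.weaken hD1 hdist hC hβ1 hβ hη0 hη).extendedTime.flow_moments (hμ.extendedTime hY)
      (h := h) (v := v) (A := (A + ε) * D) (t₁ := t₁) (b := b) (M := M * D) (q := p - 1)
      (Q := P - 1) (R := R ^ P)
      H.measurable_extendedTime H.one_le_extendedTime hD1 hdist (by linarith) (by linarith)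
      (Real.one_le_rpow hR1 (by linarith))
      (by
        rw [sub_add_cancel]
        exact lintegral_extendedTime_rpow_le hY hμ (by linarith) hpP hτ hR hR1)
      hb0 hbh (fun x => (hhM x).trans hMD) (((hbh x₀).trans (hhM x₀)).trans hMD)
      (fun x y => by
        refine (abs_sub_le_holderNorm H.η_pos hh x y).trans ?_
        rw [mul_assoc]
        gcongr
        exact dist_rpow_le hD1 hdist hη0 hη H.η_le_one x y)
      hv (by positivity)
      (fun p hp => (norm_le_flowHolderNorm hvh hp).trans (by nlinarith))
      (fun x y u hx hy => by
        refine (norm_sub_le_flowHolderNorm H.η_pos hvh hx hy).trans ?_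
        rw [mul_assoc]
        gcongr
        · linarith
        · exact dist_rpow_le hD1 hdist hη0 hη H.η_le_one x y)
      (by rwa [baseMeasure_extendedTime hY]) ht₁
  simp only [baseMeasure_extendedTime hY] at key
  have lim : ∀ {a : ℝ≥0∞} {f : ℝ → ℝ}, Continuous f → (∀ ε > 0, a ≤ ENNReal.ofReal (f ε)) →
      a ≤ ENNReal.ofReal (f 0) := fun {a f} hf hle => by
    have h1 : Filter.Tendsto (fun ε => ENNReal.ofReal (f ε)) (nhdsWithin 0 (Ioi 0))
        (nhds (ENNReal.ofReal (f 0))) :=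
      ((ENNReal.continuous_ofReal.comp hf).tendsto 0).mono_left nhdsWithin_le_nhds
    exact ge_of_tendsto h1 (Filter.mem_of_superset self_mem_nhdsWithin hle)
  have k1 := lim (f := fun ε => F * Real.sqrt t₁ * ((A + ε) * D)) (by fun_prop)
    fun ε hε => (key ε hε).1
  have k2 := lim (f := fun ε => F * t₁ * ((A + ε) * D) ^ 2) (by fun_prop)
    fun ε hε => (key ε hε).2
  simp only [add_zero] at k1 k2
  rw [← ENNReal.ofReal_toReal hvh, ← hAd, ← Real.sqrt_eq_rpow,
    ← ENNReal.ofReal_mul (by positivity), ← ENNReal.ofReal_pow hA0,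
    ← ENNReal.ofReal_mul (by positivity)]
  refine ⟨k1.trans (ENNReal.ofReal_le_ofReal ?_), k2.trans (ENNReal.ofReal_le_ofReal ?_)⟩
  · have h1 : D ≤ D ^ 2 := by nlinarith
    calc F * Real.sqrt t₁ * (A * D) = F * D * Real.sqrt t₁ * A := by ring
      _ ≤ _ := by gcongr
  · exact le_of_eq (by ring)

end UniformBound

/-! ### Continuous choice of the constant. -/

/-- `c` is a valid constant for all systems with data
`P = (diam Λ, C₁, β, η, p, |τ|_p, ‖h‖_η, inf h)`. -/
def IsFlowMomentBound.{u} (P : ℝ × ℝ × ℝ × ℝ × ℝ × ℝ × ℝ × ℝ) (c : ℝ) : Prop :=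
  ∀ (Λ : Type u) [MetricSpace Λ] [MeasurableSpace Λ] [BorelSpace Λ]
    (T : Λ → Λ) (ρ : Measure Λ) (Y : Set Λ) (α : Set (Set Λ)) (τ : Λ → ℕ)
    (C₁ β η p : ℝ) (μY : Measure Λ) (h : Λ → ℝ)
    (d : ℕ) (v : Λ × ℝ → EuclideanSpace ℝ (Fin d)),
    IsNonuniformlyExpanding T ρ Y α τ C₁ β η →
    IsInducedMeasure T ρ Y τ μY →
    2 ≤ p →
    eLpNorm (fun y => (τ y : ℝ)) (ENNReal.ofReal p) μY ≠ ⊤ →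
    holderNorm η h ≠ ⊤ →
    0 < ⨅ x, h x →
    Measurable v →
    flowHolderNorm h η v ≠ ⊤ →
    ∫ q, v q ∂(suspensionMeasure (baseMeasure T Y τ μY) h) = 0 →
    (Metric.diam (univ : Set Λ), C₁, β, η, p,
      (eLpNorm (fun y => (τ y : ℝ)) (ENNReal.ofReal p) μY).toReal,
      (holderNorm η h).toReal, ⨅ x, h x) = P →
    ∀ t₁ : ℝ, 0 ≤ t₁ →
      eLpNorm (fun q => ⨆ t ∈ Icc (0 : ℝ) t₁, ‖singleIntegral T h v t q‖ₑ)
          (ENNReal.ofReal (2 * (p - 1))) (suspensionMeasure (baseMeasure T Y τ μY) h) ≤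
        ENNReal.ofReal (c * t₁ ^ (1 / 2 : ℝ)) * flowHolderNorm h η v ∧
      eLpNorm (fun q => ⨆ t ∈ Icc (0 : ℝ) t₁,
          ENNReal.ofReal (matrixNorm (doubleIntegral T h v t q)))
          (ENNReal.ofReal (p - 1)) (suspensionMeasure (baseMeasure T Y τ μY) h) ≤
        ENNReal.ofReal (c * t₁) * flowHolderNorm h η v ^ 2

theorem IsFlowMomentBound.mono.{u} {P : ℝ × ℝ × ℝ × ℝ × ℝ × ℝ × ℝ × ℝ} {c c' : ℝ} (hcc : c ≤ c')
    (hc : IsFlowMomentBound.{u} P c) : IsFlowMomentBound.{u} P c' := by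
  intro Λ _ _ _ T ρ Y α τ C₁ β η p μY h d v a1 a2 a3 a4 a5 a6 a7 a8 a9 a10 t₁ ht₁
  obtain ⟨h1, h2⟩ := hc Λ T ρ Y α τ C₁ β η p μY h d v a1 a2 a3 a4 a5 a6 a7 a8 a9 a10 t₁ ht₁
  refine ⟨h1.trans ?_, h2.trans ?_⟩ <;> gcongr

/-- Any constant larger than a valid one is valid, and upper sets of ℝ are convex; this is what
allows averaging with a partition of unity. -/
theorem convex_isFlowMomentBound.{u} (P : ℝ × ℝ × ℝ × ℝ × ℝ × ℝ × ℝ × ℝ) :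
    Convex ℝ {c | IsFlowMomentBound.{u} P c} :=
  (show IsUpperSet {c | IsFlowMomentBound.{u} P c} from
    fun _ _ hcc hc => IsFlowMomentBound.mono hcc hc).ordConnected.convex

/-- Nearby data satisfy the weakened hypotheses of one box: the upper bounds are raised by 1, and β,
η, inf h are bounded below by (1 + β)/2, η/2, b/2. The constant computed from the worst values in
the box serves for all of them. -/
theorem exists_eventually_isFlowMomentBound.{u} {P : ℝ × ℝ × ℝ × ℝ × ℝ × ℝ × ℝ × ℝ}
    (hP : P ∈ dataDomain) : ∃ c, ∀ᶠ P' in nhds P, IsFlowMomentBound.{u} P' c := by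
  obtain ⟨D, C₁, β, η, p, R, M, b⟩ := P
  obtain ⟨hD, hC₁, hβ, hη, -, hp, hR, hM, hb⟩ := hP
  refine ⟨flowConst |baseConst ((C₁ + 1) * (D + 1)) ((1 + β) / 2) (η / 2) (D + 1)
    ((R + 1) ^ (p + 1)) ((p + 1) - 1)| (b / 2) ((M + 1) * (D + 1)) * (D + 1) ^ 2, ?_⟩
  have lt : ∀ {f : ℝ × ℝ × ℝ × ℝ × ℝ × ℝ × ℝ × ℝ → ℝ} {a : ℝ}, Continuous f →
      f (D, C₁, β, η, p, R, M, b) < a →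
      ∀ᶠ P' in nhds (D, C₁, β, η, p, R, M, b), f P' < a :=
    fun hf h => (hf.tendsto _).eventually (gt_mem_nhds h)
  have gt : ∀ {f : ℝ × ℝ × ℝ × ℝ × ℝ × ℝ × ℝ × ℝ → ℝ} {a : ℝ}, Continuous f →
      a < f (D, C₁, β, η, p, R, M, b) →
      ∀ᶠ P' in nhds (D, C₁, β, η, p, R, M, b), a < f P' :=
    fun hf h => (hf.tendsto _).eventually (lt_mem_nhds h)
  filter_upwards [lt (f := fun P => P.1) (a := D + 1) (by fun_prop) (by simp),
    lt (f := fun P => P.2.1) (a := C₁ + 1) (by fun_prop) (by simp),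
    gt (f := fun P => P.2.2.1) (a := (1 + β) / 2) (by fun_prop) (by simp only; linarith),
    gt (f := fun P => P.2.2.2.1) (a := η / 2) (by fun_prop) (by simp only; linarith),
    lt (f := fun P => P.2.2.2.2.1) (a := p + 1) (by fun_prop) (by simp),
    lt (f := fun P => P.2.2.2.2.2.1) (a := R + 1) (by fun_prop) (by simp),
    lt (f := fun P => P.2.2.2.2.2.2.1) (a := M + 1) (by fun_prop) (by simp),
    gt (f := fun P => P.2.2.2.2.2.2.2) (a := b / 2) (by fun_prop) (by simp only; linarith)]
    with P' e1 e2 e3 e4 e5 e6 e7 e8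
  intro Λ _ _ _ T ρ Y α τ C₁' β' η' p' μY h d v H hμ hp' hτ hh _ hv hvh hv0 hP' t₁ ht₁
  subst hP'
  exact H.flow_moments_uniform hμ hp' e5.le (by linarith) e1.le
    (mul_le_mul_of_nonneg_right e2.le (by linarith)) (by linarith) e3.le (by linarith) e4.le hτ
    e6.le (by linarith) hh e7.le (by linarith) e8.le hv hvh hv0 ht₁

/-- Locally valid constants are glued by a partition of unity on the data domain; convexity keeps
the glued value valid. Outside the domain the value 0 is a filler. -/
theorem exists_continuousOn_isFlowMomentBound.{u} :
    ∃ C : ℝ × ℝ × ℝ × ℝ × ℝ × ℝ × ℝ × ℝ → ℝ, ContinuousOn C dataDomain ∧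
      ∀ P ∈ dataDomain, IsFlowMomentBound.{u} P (C P) := by
  classical
  obtain ⟨g, hg⟩ := exists_continuous_forall_mem_convex_of_local_const (X := dataDomain) (E := ℝ)
    (t := fun P => {c | IsFlowMomentBound.{u} P c}) (fun P => convex_isFlowMomentBound P)
    fun P => by
      obtain ⟨c, hc⟩ := exists_eventually_isFlowMomentBound P.2
      exact ⟨c, continuous_subtype_val.continuousAt.eventually hc⟩
  refine ⟨fun P => if hP : P ∈ dataDomain then g ⟨P, hP⟩ else 0, ?_, fun P hP => ?_⟩
  · rw [continuousOn_iff_continuous_domRestrict]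
    convert g.continuous using 1
    ext P
    simp [P.2]
  · simp only [dif_pos hP]
    exact hg ⟨P, hP⟩

theorem IsNonuniformlyExpanding.mem_dataDomain {Λ : Type*} [MetricSpace Λ] [MeasurableSpace Λ]
    [BorelSpace Λ] {T : Λ → Λ} {ρ : Measure Λ} {Y : Set Λ} {α : Set (Set Λ)}
    {τ : Λ → ℕ} {C₁ β η p : ℝ} {μY : Measure Λ} {h : Λ → ℝ}
    (H : IsNonuniformlyExpanding T ρ Y α τ C₁ β η) (hμ : IsInducedMeasure T ρ Y τ μY) (hp : 2 ≤ p)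
    (hτ : eLpNorm (fun y => (τ y : ℝ)) (ENNReal.ofReal p) μY ≠ ⊤) (hh : holderNorm η h ≠ ⊤)
    (hb : 0 < ⨅ x, h x) :
    (Metric.diam (univ : Set Λ), C₁, β, η, p,
      (eLpNorm (fun y => (τ y : ℝ)) (ENNReal.ofReal p) μY).toReal,
      (holderNorm η h).toReal, ⨅ x, h x) ∈ dataDomain := by
  obtain ⟨x₀⟩ := H.nonempty
  have h1 := ENNReal.toReal_mono hτ (one_le_eLpNorm_returnTime H hμ (by linarith : 0 < p))
  rw [ENNReal.toReal_one] at h1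
  exact ⟨Metric.diam_nonneg, H.one_le_C₁, H.one_lt_β, H.η_pos, H.η_le_one, hp, h1,
    (hb.trans_le (le_of_le_iInf hh le_rfl x₀)).trans_le
      ((le_abs_self _).trans (abs_le_holderNorm hh x₀)), hb⟩

end ExpandingSemiflow

theorem mainTheorem4 :
    ∃ C : ℝ × ℝ × ℝ × ℝ × ℝ × ℝ × ℝ × ℝ → ℝ, ContinuousOn C dataDomain ∧
      ∀ (Λ : Type*) [MetricSpace Λ] [MeasurableSpace Λ] [BorelSpace Λ]
        (T : Λ → Λ) (ρ : Measure Λ) (Y : Set Λ) (α : Set (Set Λ)) (τ : Λ → ℕ)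
        (C₁ β η p : ℝ) (μY : Measure Λ) (h : Λ → ℝ)
        (d : ℕ) (v : Λ × ℝ → EuclideanSpace ℝ (Fin d)),
        IsNonuniformlyExpanding T ρ Y α τ C₁ β η →
        IsInducedMeasure T ρ Y τ μY →
        2 ≤ p →
        eLpNorm (fun y => (τ y : ℝ)) (ENNReal.ofReal p) μY ≠ ⊤ →
        holderNorm η h ≠ ⊤ →
        0 < ⨅ x, h x →
        Measurable v →
        flowHolderNorm h η v ≠ ⊤ →
        ∫ q, v q ∂(suspensionMeasure (baseMeasure T Y τ μY) h) = 0 →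
        ∀ t₁ : ℝ, 0 ≤ t₁ →
          eLpNorm (fun q => ⨆ t ∈ Icc (0 : ℝ) t₁, ‖singleIntegral T h v t q‖ₑ)
              (ENNReal.ofReal (2 * (p - 1)))
              (suspensionMeasure (baseMeasure T Y τ μY) h) ≤
            ENNReal.ofReal
                (C (Metric.diam (univ : Set Λ), C₁, β, η, p,
                  (eLpNorm (fun y => (τ y : ℝ)) (ENNReal.ofReal p) μY).toReal,
                  (holderNorm η h).toReal, ⨅ x, h x) * t₁ ^ (1 / 2 : ℝ)) *
              flowHolderNorm h η v ∧
          eLpNorm (fun q => ⨆ t ∈ Icc (0 : ℝ) t₁,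
                ENNReal.ofReal (matrixNorm (doubleIntegral T h v t q)))
              (ENNReal.ofReal (p - 1))
              (suspensionMeasure (baseMeasure T Y τ μY) h) ≤
            ENNReal.ofReal
                (C (Metric.diam (univ : Set Λ), C₁, β, η, p,
                  (eLpNorm (fun y => (τ y : ℝ)) (ENNReal.ofReal p) μY).toReal,
                  (holderNorm η h).toReal, ⨅ x, h x) * t₁) *
              flowHolderNorm h η v ^ 2 := by
  obtain ⟨C, hC, hb⟩ := exists_continuousOn_isFlowMomentBound
  refine ⟨C, hC, ?_⟩
  intro Λ _ _ _ T ρ Y α τ C₁ β η p μY h d v H hμ hp hτ hh hh0 hv hvh hv0 t₁ ht₁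
  exact hb _ (H.mem_dataDomain hμ hp hτ hh hh0) Λ T ρ Y α τ C₁ β η p μY h d v H hμ hp hτ hh hh0
    hv hvh hv0 rfl t₁ ht₁
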